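/- **Setting.** Let $d\ge 1$, $z=(x,v)\in\mathbb R^{2d}$, $\boldsymbol a=(3,1)$, $|z|_{\boldsymbol a}=|x|^{1/3}+|v|$, and for $\boldsymbol p=(p_x,p_v)$ put $\boldsymbol a\cdot\frac d{\boldsymbol p}=\frac{3d}{p_x}+\frac d{p_v}$ and $\|g\|_{\boldsymbol p}=\big\|v\mapsto\|g(\cdot,v)\|_{L^{p_x}(\mathbb R^d)}\big\|_{L^{p_v}(\mathbb R^d)}$. Fix an even function $\chi\in C^\infty(\mathbb R^{2d})$ with $\chi=1$ on $\{|\xi|_{\boldsymbol a}\le 1\}$ and $\chi=0$ on $\{|\xi|_{\boldsymbol a}>2\}$, and set $\phi^{\boldsymbol a}_0=\chi$, $\phi^{\boldsymbol a}_j(\xi)=\chi(2^{-j\boldsymbol a}\xi)-\chi(2^{-(j-1)\boldsymbol a}\xi)$ for $j\ge1$, where $2^{s\boldsymbol a}(\xi_1,\xi_2)=(2^{3s}\xi_1,2^s\xi_2)$. Let $\mathcal R^{\boldsymbol a}_jf$ be the inverse Fourier transform of $\phi^{\boldsymbol a}_j\hat f$ (Fourier kernel $e^{-i\xi\cdot z}$).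 Let $\mathcal R^x_k$, $k\ge 0$, be the dyadic blocks in the variable $x$ only, built in the same way from an even smooth function on $\mathbb R^d$ that equals $1$ on $\{|\xi|\le1\}$ and $0$ on $\{|\xi|>2\}$, with the dilations $2^{-k}\xi$. For tempered distributions $f$ define $$\|f\|_{\mathbb B^s_{\boldsymbol p;\boldsymbol a}}=\sup_{j\ge0}2^{js}\|\mathcal R^{\boldsymbol a}_jf\|_{\boldsymbol p},\qquad \|f\|_{\mathbb B^{s_0,s_1}_{\boldsymbol p;x,\boldsymbol a}}=\sup_{k,j\ge0}2^{ks_0/3}2^{js_1}\|\mathcal R^x_k\mathcal R^{\boldsymbol a}_jf\|_{\boldsymbol p},$$ and let $L^\infty_T(\cdot)$ be the essential supremum of these norms over $t\in[0,T]$. For $\lambda\ge0$ consider $$\partial_tu=\Delta_vu+v\cdot\nabla_xu-\lambda u+b\cdot\nabla_vu+f,\qquad u_0=0, \tag{1}$$ where $b:\mathbb R\times\mathbb R^{2d}\to\mathbb R^d$ is a Borel function and $f=(f_t)$ is a measurable family of real tempered distributions ($t\mapsto\langle f_t,\varphi\rangle$ is measurable for each Schwartz function $\varphi$). A weak solution of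 (1) on $[0,T]$ is a measurable real function $u$ with a weak gradient $\nabla_vu$ such that for every compactly supported smooth $\varphi$ and every $t\in[0,T]$ $$\int u_t\varphi=\int_0^t\Big(\int u_s(\Delta_v\varphi-v\cdot\nabla_x\varphi-\lambda\varphi)+\int (b_s\cdot\nabla_vu_s)\varphi+\langle f_s,\varphi\rangle\Big)ds,$$ with all integrals absolutely convergent. **Theorem.** Let $T>0$, $\beta>0$, $\boldsymbol p\in(1,\infty)^2$ with $\boldsymbol a\cdot\frac d{\boldsymbol p}<1$, and $\delta\in(-1+\boldsymbol a\cdot\frac d{\boldsymbol p},\beta]$. (i) If $b\in L^\infty_T(\mathbb B^\beta_{\boldsymbol p;\boldsymbol a})$ and $f\in L^\infty_T(\mathbb B^\delta_{\boldsymbol p;\boldsymbol a})$, then for every $\lambda\ge0$ equation (1) has a weak solution $u\in L^\infty_T(\mathbb B^{2+\delta}_{\boldsymbol p;\boldsymbol a})$, and it is unique in this class (for every $t\in[0,T]$, $u_t$ is determined almost everywhere). For every $\theta\in[0,2]$ and $K\geq 0$ there is a constant $C>0$, depending only on $T,d,\beta,\delta,\boldsymbol p,\theta,K$ and the fixed cutoff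 functions, such that, if $\|b\|_{L^\infty_T(\mathbb B^\beta_{\boldsymbol p;\boldsymbol a})}\le K$, then for all $\lambda\ge1$ $$\sup_{t\in[0,T]}\|u_t\|_{\mathbb B^{\theta+\delta}_{\boldsymbol p;\boldsymbol a}}\le C\,\lambda^{\frac{\theta-2}2}\,\|f\|_{L^\infty_T(\mathbb B^\delta_{\boldsymbol p;\boldsymbol a})}.$$ (ii) Let in addition $\gamma>0$. If $b\in L^\infty_T(\mathbb B^{\gamma,\beta}_{\boldsymbol p;x,\boldsymbol a})$ and $f\in L^\infty_T(\mathbb B^{\gamma,\delta}_{\boldsymbol p;x,\boldsymbol a})$, then for every $\lambda\ge0$ equation (1) has a unique weak solution $u$ in $L^\infty_T(\mathbb B^{2+\delta}_{\boldsymbol p;\boldsymbol a})$. For every $\theta\in[0,2]$ and $K\geq 0$ there is a constant $C>0$, depending only on $T,d,\beta,\gamma,\delta,\boldsymbol p,\theta,K$ and the fixed cutoff functions, such that, if $\|b\|_{L^\infty_T(\mathbb B^{\gamma,\beta}_{\boldsymbol p;x,\boldsymbol a})}\le K$, then for all $\lambda\ge1$ $$\sup_{t\in[0,T]}\|u_t\|_{\mathbb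 B^{\gamma,\theta+\delta}_{\boldsymbol p;x,\boldsymbol a}}\le C\,\lambda^{\frac{\theta-2}2}\,\|f\|_{L^\infty_T(\mathbb B^{\gamma,\delta}_{\boldsymbol p;x,\boldsymbol a})}.$$ -/

import Mathlib

open MeasureTheory Set
open scoped ENNReal NNReal ContDiff

noncomputable section

namespace Kinetic

/-- The space `ℝᵈ` with its Euclidean norm. -/
abbrev Vec (d : ℕ) : Type := EuclideanSpace ℝ (Fin d)

/-- The phase space `ℝ²ᵈ` of points `z = (x, v)` with its Euclidean norm; the coordinates of `x`
are indexed by the left copy of `Fin d`, those of `v` by the right one. -/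
abbrev Phase (d : ℕ) : Type := EuclideanSpace ℝ (Fin d ⊕ Fin d)

/-- The position `x` of `z = (x, v)`. -/
def posn {d : ℕ} (z : Phase d) : Vec d := WithLp.toLp 2 (fun i => z (Sum.inl i))

/-- The velocity `v` of `z = (x, v)`. -/
def velo {d : ℕ} (z : Phase d) : Vec d := WithLp.toLp 2 (fun i => z (Sum.inr i))

/-- The point `(x, v)`. -/
def pt {d : ℕ} (x v : Vec d) : Phase d := WithLp.toLp 2 (Sum.elim (fun i => x i) (fun i => v i))

/-- Complex Schwartz functions on phase space. -/
abbrev Test (d : ℕ) : Type := SchwartzMap (Phase d) ℂ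

/-- Tempered distributions on phase space with values in `F`. -/
abbrev Temp (d : ℕ) (F : Type) [NormedAddCommGroup F] [NormedSpace ℂ F] : Type :=
  TemperedDistribution (Phase d) F

/-! ### Littlewood-Paley blocks -/

/-- `χ` is an even smooth cutoff for the gauge `N`: it equals `1` where `N ≤ 1` and
vanishes where `N > 2`. -/
structure IsCutoff {V : Type} [NormedAddCommGroup V] [NormedSpace ℝ V]
    (N : V → ℝ) (χ : V → ℝ) : Prop where
  smooth : ContDiff ℝ ∞ χ
  even : ∀ ξ, χ (-ξ) = χ ξ
  eq_one : ∀ ξ, N ξ ≤ 1 → χ ξ = 1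
  eq_zero : ∀ ξ, 2 < N ξ → χ ξ = 0

/-- The anisotropic gauge `|(x, v)|ₐ = |x|^{1/3} + |v|`, for `a = (3, 1)`. -/
def anisoNorm {d : ℕ} (z : Phase d) : ℝ := ‖posn z‖ ^ (1 / 3 : ℝ) + ‖velo z‖

/-- The contraction `2^{-j a} ξ = (2^{-3j} ξ₁, 2^{-j} ξ₂)`. -/
def anisoShrink {d : ℕ} (j : ℕ) (ξ : Phase d) : Phase d :=
  pt (((2 : ℝ) ^ (3 * j))⁻¹ • posn ξ) (((2 : ℝ) ^ j)⁻¹ • velo ξ)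

/-- The anisotropic dyadic partition of unity `φᵃ_j` generated by `χ`. -/
def anisoPart {d : ℕ} (χ : Phase d → ℝ) : ℕ → Phase d → ℝ
  | 0, ξ => χ ξ
  | j + 1, ξ => χ (anisoShrink (j + 1) ξ) - χ (anisoShrink j ξ)

/-- The isotropic dyadic partition of unity `φ_k` on `ℝᵈ` generated by `χ`. -/
def isoPart {d : ℕ} (χ : Vec d → ℝ) : ℕ → Vec d → ℝ
  | 0, ξ => χ ξ
  | k + 1, ξ => χ (((2 : ℝ) ^ (k + 1))⁻¹ • ξ) - χ (((2 : ℝ) ^ k)⁻¹ • ξ)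

variable {d : ℕ} {F : Type} [NormedAddCommGroup F] [NormedSpace ℂ F]

/-- The block `Rᵃ_j`. The frequency variable of the Fourier transform with kernel
`exp(-i ξ · z)` is `2π` times that of the kernel `exp(-2πi η · z)` used by the library, hence the
rescaling of the symbol. -/
def blockA (χ : Phase d → ℝ) (j : ℕ) (Φ : Temp d F) : Temp d F :=
  TemperedDistribution.fourierMultiplierCLM F
    (fun η : Phase d => (anisoPart χ j ((2 * Real.pi) • η) : ℂ)) Φ

/-- The block `Rˣ_k`, the isotropic block acting in the variable `x` only. -/
def blockX (χ : Vec d → ℝ) (k : ℕ) (Φ : Temp d F) : Temp d F :=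
  TemperedDistribution.fourierMultiplierCLM F
    (fun η : Phase d => (isoPart χ k ((2 * Real.pi) • posn η) : ℂ)) Φ

/-! ### Mixed Lebesgue norms and Besov norms -/

/-- The function `g` is the density of the tempered distribution `Φ`. -/
def Represents (g : Phase d → F) (Φ : Temp d F) : Prop :=
  ∀ φ : Test d, Integrable (fun z => φ z • g z) ∧ Φ φ = ∫ z, φ z • g z

/-- The mixed norm `‖g‖_p = ‖ v ↦ ‖g(·, v)‖_{L^{p_x}} ‖_{L^{p_v}}`, for `p = (p_x, p_v)`. -/
def mixedNorm (p : ℝ≥0∞ × ℝ≥0∞) (g : Phase d → F) : ℝ≥0∞ :=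
  eLpNorm (fun v : Vec d => eLpNorm (fun x : Vec d => g (pt x v)) p.1 volume) p.2 volume

/-- The mixed norm of a tempered distribution: that of its density, which is unique up to null
sets, and `∞` if there is no density. -/
def distNorm (p : ℝ≥0∞ × ℝ≥0∞) (Φ : Temp d F) : ℝ≥0∞ :=
  ⨅ (g : Phase d → F) (_ : Represents g Φ), mixedNorm p g

/-- The norm of the anisotropic Besov space `B^s_{p;a} = B^{s,∞}_{p;a}`. -/
def besov (χ : Phase d → ℝ) (p : ℝ≥0∞ × ℝ≥0∞) (s : ℝ) (Φ : Temp d F) : ℝ≥0∞ :=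
  ⨆ j : ℕ, (2 : ℝ≥0∞) ^ ((j : ℝ) * s) * distNorm p (blockA χ j Φ)

/-- The norm of the mixed Besov space `B^{s₀,s₁}_{p;x,a}`. -/
def besovMixed (χ : Phase d → ℝ) (χx : Vec d → ℝ) (p : ℝ≥0∞ × ℝ≥0∞) (s₀ s₁ : ℝ)
    (Φ : Temp d F) : ℝ≥0∞ :=
  ⨆ (k : ℕ) (j : ℕ), (2 : ℝ≥0∞) ^ ((k : ℝ) * s₀ / 3) * (2 : ℝ≥0∞) ^ ((j : ℝ) * s₁) *
    distNorm p (blockX χx k (blockA χ j Φ))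

/-- A norm on tempered distributions, evaluated at a function; it is `∞` if the function is not
the density of a tempered distribution. -/
def ofFun (N : Temp d F → ℝ≥0∞) (g : Phase d → F) : ℝ≥0∞ :=
  ⨅ (Φ : Temp d F) (_ : Represents g Φ), N Φ

/-- A real function, seen as a complex one. -/
def cplx (g : Phase d → ℝ) : Phase d → ℂ := fun z => (g z : ℂ)

/-- A real vector field, seen as a complex one with the same Euclidean length. -/
def cplxVec (g : Phase d → Vec d) : Phase d → EuclideanSpace ℂ (Fin d) :=
  fun z => WithLp.toLp 2 (fun i => (g z i : ℂ))

/-- The `L^∞_T` norm, the essential supremum over `[0, T]`, of a time-dependent norm. -/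
def supT (T : ℝ) (n : ℝ → ℝ≥0∞) : ℝ≥0∞ := essSup n (volume.restrict (Icc 0 T))

/-! ### The kinetic equation -/

/-- `Φ` is a real tempered distribution. -/
def IsRealDist (Φ : Temp d ℂ) : Prop :=
  ∀ φ : Test d, (∀ z, (φ z).im = 0) → (Φ φ).im = 0

/-- `f` is a measurable family of real tempered distributions on the time interval `[0, T]`. -/
def IsForcing (T : ℝ) (f : ℝ → Temp d ℂ) : Prop :=
  (∀ φ : Test d, AEMeasurable (fun t => f t φ) (volume.restrict (Icc 0 T))) ∧
    ∀ᵐ t ∂(volume.restrict (Icc 0 T)), IsRealDist (f t)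

/-- The unit vector in the direction of `v_i`. -/
def eV (i : Fin d) : Phase d := pt 0 (EuclideanSpace.single i 1)

/-- `Δ_v φ - v · ∇_x φ - lam φ`, the formal adjoint of `Δ_v + v · ∇_x - lam` applied to `φ`. -/
def adjointOp (lam : ℝ) (φ : Test d) (z : Phase d) : ℂ :=
  (∑ i : Fin d, LineDeriv.lineDerivOp (eV i) (LineDeriv.lineDerivOp (eV i) φ) z)
    - fderiv ℝ (φ : Phase d → ℂ) z (pt (velo z) 0) - (lam : ℂ) * φ z

/-- `G` is the weak gradient of `u` in the variable `v`. -/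
def IsWeakGradV (u : Phase d → ℝ) (G : Phase d → Vec d) : Prop :=
  LocallyIntegrable u ∧ LocallyIntegrable G ∧
    ∀ φ : Test d, HasCompactSupport φ → ∀ i : Fin d,
      ∫ z, (u z : ℂ) * LineDeriv.lineDerivOp (eV i) φ z = -∫ z, (G z i : ℂ) * φ z

/-- `u` is a weak solution on `[0, T]` of
`∂_t u = Δ_v u + v · ∇_x u - lam u + b · ∇_v u + f`, `u_0 = 0`: it has a weak gradient `G` in `v`,
and the equation, integrated over `[0, t]`, holds against every compactly supported smooth
function for every `t ∈ [0, T]`. -/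
def IsWeakSolution (T lam : ℝ) (b : ℝ → Phase d → Vec d) (f : ℝ → Temp d ℂ)
    (u : ℝ → Phase d → ℝ) : Prop :=
  Measurable (fun q : ℝ × Phase d => u q.1 q.2) ∧
  ∃ G : ℝ → Phase d → Vec d, Measurable (fun q : ℝ × Phase d => G q.1 q.2) ∧
    (∀ᵐ s ∂(volume.restrict (Icc 0 T)), IsWeakGradV (u s) (G s)) ∧
    ∀ φ : Test d, HasCompactSupport φ →
      Integrable (fun q : ℝ × Phase d => (u q.1 q.2 : ℂ) * adjointOp lam φ q.2)
        ((volume.restrict (Icc 0 T)).prod volume) ∧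
      Integrable (fun q : ℝ × Phase d =>
          ((inner ℝ (b q.1 q.2) (G q.1 q.2) : ℝ) : ℂ) * φ q.2)
        ((volume.restrict (Icc 0 T)).prod volume) ∧
      IntervalIntegrable (fun s => f s φ) volume 0 T ∧
      ∀ t ∈ Icc 0 T, Integrable (fun z => (u t z : ℂ) * φ z) ∧
        ∫ z, (u t z : ℂ) * φ z =
          ∫ s in (0 : ℝ)..t, ((∫ z, (u s z : ℂ) * adjointOp lam φ z)
            + (∫ z, ((inner ℝ (b s z) (G s z) : ℝ) : ℂ) * φ z) + f s φ)

/-- `u` is a weak solution in the class `L^∞_T(B^{2+δ}_{p;a})`. -/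
def IsRegularSolution (χ : Phase d → ℝ) (p : ℝ≥0∞ × ℝ≥0∞) (δ T lam : ℝ)
    (b : ℝ → Phase d → Vec d) (f : ℝ → Temp d ℂ) (u : ℝ → Phase d → ℝ) : Prop :=
  IsWeakSolution T lam b f u ∧
    supT T (fun t => ofFun (besov χ p (2 + δ)) (cplx (u t))) < ⊤

/-- Existence and uniqueness on `[0, T]` of a weak solution in `L^∞_T(B^{2+δ}_{p;a})`. -/
def UniquelySolvable (χ : Phase d → ℝ) (p : ℝ≥0∞ × ℝ≥0∞) (δ T lam : ℝ)
    (b : ℝ → Phase d → Vec d) (f : ℝ → Temp d ℂ) : Prop :=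
  ∃ u, IsRegularSolution χ p δ T lam b f u ∧
    ∀ u₁, IsRegularSolution χ p δ T lam b f u₁ → ∀ t ∈ Icc 0 T, u₁ t =ᵐ[volume] u t

end Kinetic

end

open Kinetic

/-!
The solution is constructed from the Duhamel formula for the kinetic semigroup, and the drift term
is treated as a perturbation.

*The semigroup.* In Fourier variables the flow of `∂ₜ = Δ_v + v · ∇ₓ` is the multiplication by
`exp (-4π² ∫₀ʳ |ξ_v + ρ ξ_x|² dρ)` followed by a shear, and the exponent is a definite form which,
up to the anisotropic dilation by `√r`, does not depend on `r`. Blocks are convolutions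
with Schwartz kernels, and the mixed norm of such a convolution is controlled by the `L¹` norm of
the kernel (`wiener`, `mx_T_le`). The central estimate `LP.wiener_sig_le` bounds this norm for the
semigroup between the annuli of ranks `l` and `j` by `C 2^(-N |j - l|) (1 + r 4^l)^(-2)`. The decay
in `r` comes from the heat factor. The shear moves frequencies from one annulus to another, but only
when `r 4^l` or `r 4^j` is large, so the heat factor pays for this as well. Shears preserve the
mixed norm and the position frequency, so the blocks in `x` are carried along unchanged. Integration
in time gives `Src.exists_bnorm_mild_le`: the Duhamel integral of a source of regularity `δ` which
grows at most like `exp (μ t)` has regularity `θ + δ`, `θ ∈ [0, 2]`, with the same growth and the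
factor `(lam + μ) ^ ((θ - 2) / 2)`.

*The drift.* By Bernstein's inequality a function of regularity `κ + δ > 1 + a · d / p` has a bounded
velocity gradient, given by the sum of its blocks. The product of `b`, of regularity `β`, with it has
regularity `δ` (`exists_bn_mul_gradF_le`), because the output frequency of a product is at most
comparable to the larger input frequency. Here `κ < 2` can be chosen because
`-1 + a · d / p < δ` and `a · d / p < 1` (`exists_par`). For a large weight `μ`, depending only on
the norm of `b`, the map `u ↦ ∫ semigroup (b · ∇_v u)` is then a contraction
(`Par.exists_contraction`), uniformly in `lam ≥ 0`. Its Neumann series `sol` satisfies the smoothing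
estimate (`Par.exists_bn_sol_le`); as `lam + μ ≥ lam`, this is the claimed power of `lam`. The
Duhamel integral solves the equation weakly, because the semigroup can be moved to the test
function (`duh_weak`, `Src.mild_weak`, `Par.sol_weak`).

*From distributions to functions.* The drift and the forcing are given by norms of the blocks of
tempered distributions. A block of finite norm is a function (`exists_bnorm_dens_le`), and on a set
of times of full measure all of them can be chosen jointly measurable and bounded (`exists_drift`,
`exists_source`); a null set of times does not affect the equation.

*Uniqueness.* The difference `w` of two solutions solves the equation without forcing. Subtracting
from `w` the mild solution with source `b · ∇_v w` leaves a bounded weak solution of the equation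
without drift and source. It vanishes, as one sees by testing with the dual semigroup
(`integral_pairing_eq_zero`), so `w` is a fixed point of the contraction (`Par.ae_eq_mild`,
`Par.ae_eq_zero`, `Par.unique`).

Both parts are instances of `Par.wellPosed`: for the trivial cutoff `1` in the position frequencies
the mixed norm is the anisotropic Besov norm (`besovMixed_triv_eq`). The same device reduces
uniqueness in the mixed case, which is claimed in an anisotropic class, to that case.
-/

noncomputable section

namespace Kinetic

open FourierTransform Filter LineDeriv
open scoped Real
open ENNReal (mul_ne_top coe_ne_top ofReal_ne_top coe_toNNReal ofReal_le_ofReal coe_lt_top mul_lt_top)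
open SchwartzMap (compCLMOfContinuousLinearEquiv smulLeftCLM smulLeftCLM_apply_apply)

variable {d : ℕ} {p : ℝ≥0∞ × ℝ≥0∞} {F : Type} [NormedAddCommGroup F] [NormedSpace ℂ F]

/-! ### Phase space -/

@[simp] lemma posn_pt (x v : Vec d) : posn (pt x v) = x := by
  ext i; simp [posn, pt]

@[simp] lemma velo_pt (x v : Vec d) : velo (pt x v) = v := by
  ext i; simp [velo, pt]

@[simp] lemma pt_posn_velo (z : Phase d) : pt (posn z) (velo z) = z := by
  ext i; cases i <;> simp [posn, velo, pt]

lemma phase_ext {z w : Phase d} (h₁ : posn z = posn w) (h₂ : velo z = velo w) : z = w := by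
  rw [← pt_posn_velo z, ← pt_posn_velo w, h₁, h₂]

/-- The position as a continuous linear map. -/
def posnL : Phase d →L[ℝ] Vec d :=
  LinearMap.toContinuousLinearMap
    { toFun := posn, map_add' := fun _ _ => by ext; simp [posn],
      map_smul' := fun _ _ => by ext; simp [posn] }

/-- The velocity as a continuous linear map. -/
def veloL : Phase d →L[ℝ] Vec d :=
  LinearMap.toContinuousLinearMap
    { toFun := velo, map_add' := fun _ _ => by ext; simp [velo],
      map_smul' := fun _ _ => by ext; simp [velo] }

/-- The map `(x, v) ↦ (x, v)` from the product to phase space, as a continuous linear map. -/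
def ptL : Vec d × Vec d →L[ℝ] Phase d :=
  LinearMap.toContinuousLinearMap
    { toFun := fun q => pt q.1 q.2,
      map_add' := fun _ _ => by ext i; cases i <;> simp [pt],
      map_smul' := fun _ _ => by ext i; cases i <;> simp [pt] }

@[simp] lemma posnL_apply (z : Phase d) : posnL z = posn z := rfl
@[simp] lemma veloL_apply (z : Phase d) : veloL z = velo z := rfl
@[fun_prop] lemma continuous_posn : Continuous (posn : Phase d → Vec d) := posnL.continuous
@[fun_prop] lemma continuous_velo : Continuous (velo : Phase d → Vec d) := veloL.continuous
@[fun_prop] lemma continuous_pt {X : Type*} [TopologicalSpace X] {f g : X → Vec d}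
    (hf : Continuous f) (hg : Continuous g) : Continuous fun a => pt (f a) (g a) :=
  ptL.continuous.comp (hf.prodMk hg)
@[fun_prop] lemma measurable_pt {X : Type*} [MeasurableSpace X] {f g : X → Vec d}
    (hf : Measurable f) (hg : Measurable g) : Measurable fun a => pt (f a) (g a) :=
  ptL.continuous.measurable.comp (hf.prodMk hg)

@[simp] lemma posn_add (z w : Phase d) : posn (z + w) = posn z + posn w := posnL.map_add z w
@[simp] lemma velo_add (z w : Phase d) : velo (z + w) = velo z + velo w := veloL.map_add z w
@[simp] lemma posn_sub (z w : Phase d) : posn (z - w) = posn z - posn w := posnL.map_sub z w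
@[simp] lemma velo_sub (z w : Phase d) : velo (z - w) = velo z - velo w := veloL.map_sub z w
@[simp] lemma posn_neg (z : Phase d) : posn (-z) = -posn z := posnL.map_neg z
@[simp] lemma velo_neg (z : Phase d) : velo (-z) = -velo z := veloL.map_neg z
@[simp] lemma posn_smul (c : ℝ) (z : Phase d) : posn (c • z) = c • posn z := posnL.map_smul c z
@[simp] lemma velo_smul (c : ℝ) (z : Phase d) : velo (c • z) = c • velo z := veloL.map_smul c z
@[simp] lemma posn_zero : posn (0 : Phase d) = 0 := posnL.map_zero
@[simp] lemma velo_zero : velo (0 : Phase d) = 0 := veloL.map_zero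

lemma inner_phase (z w : Phase d) :
    inner ℝ z w = inner ℝ (posn z) (posn w) + inner ℝ (velo z) (velo w) := by
  simp [PiLp.inner_apply, posn, velo]

lemma norm_sq_phase (z : Phase d) : ‖z‖ ^ 2 = ‖posn z‖ ^ 2 + ‖velo z‖ ^ 2 := by
  rw [← real_inner_self_eq_norm_sq, inner_phase, real_inner_self_eq_norm_sq,
    real_inner_self_eq_norm_sq]

lemma norm_posn_le (z : Phase d) : ‖posn z‖ ≤ ‖z‖ :=
  abs_le_of_sq_le_sq' (by nlinarith [norm_sq_phase z, sq_nonneg ‖velo z‖]) (norm_nonneg _) |>.2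

lemma norm_velo_le (z : Phase d) : ‖velo z‖ ≤ ‖z‖ :=
  abs_le_of_sq_le_sq' (by nlinarith [norm_sq_phase z, sq_nonneg ‖posn z‖]) (norm_nonneg _) |>.2

lemma norm_le_posn_add_velo (z : Phase d) : ‖z‖ ≤ ‖posn z‖ + ‖velo z‖ :=
  abs_le_of_sq_le_sq' (by nlinarith [norm_sq_phase z, norm_nonneg (posn z), norm_nonneg (velo z)])
    (by positivity) |>.2

lemma measurePreserving_pt :
    MeasurePreserving (fun q : Vec d × Vec d => pt q.1 q.2)
      ((volume : Measure (Vec d)).prod (volume : Measure (Vec d))) volume := by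
  have h1 := EuclideanSpace.volume_preserving_symm_measurableEquiv_toLp (Fin d)
  have h2 := (volume_measurePreserving_sumPiEquivProdPi
    (fun _ : Fin d ⊕ Fin d => ℝ)).symm
  have h3 := (EuclideanSpace.volume_preserving_symm_measurableEquiv_toLp (Fin d ⊕ Fin d)).symm
  have h := h3.comp (h2.comp (h1.prod h1))
  have e : (fun q : Vec d × Vec d => pt q.1 q.2) =
      (MeasurableEquiv.toLp 2 (Fin d ⊕ Fin d → ℝ)).symm.symm ∘
        (MeasurableEquiv.sumPiEquivProdPi fun _ => ℝ).symm ∘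
        Prod.map (MeasurableEquiv.toLp 2 (Fin d → ℝ)).symm
          (MeasurableEquiv.toLp 2 (Fin d → ℝ)).symm := by
    funext q
    ext i
    cases i <;> simp [pt, MeasurableEquiv.sumPiEquivProdPi, Equiv.sumPiEquivProdPi]
  rw [e]
  exact h

lemma measurable_posn : Measurable (posn : Phase d → Vec d) := continuous_posn.measurable
lemma measurable_velo : Measurable (velo : Phase d → Vec d) := continuous_velo.measurable

/-- Tonelli's theorem in phase space, integrating first over positions. -/
lemma lintegral_phase {f : Phase d → ℝ≥0∞} (hf : Measurable f) :
    ∫⁻ z, f z = ∫⁻ v : Vec d, ∫⁻ x : Vec d, f (pt x v) := by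
  rw [← measurePreserving_pt.lintegral_comp hf, lintegral_prod_symm]
  exact (hf.comp (by fun_prop)).aemeasurable

lemma ae_ae_of_ae_phase {P : Phase d → Prop} (h : ∀ᵐ z, P z) :
    ∀ᵐ v : Vec d, ∀ᵐ x : Vec d, P (pt x v) := by
  have h1 : ∀ᵐ q ∂((volume : Measure (Vec d)).prod (volume : Measure (Vec d))), P (pt q.1 q.2) :=
    measurePreserving_pt.quasiMeasurePreserving.ae h
  have h2 := (Measure.measurePreserving_swap (μ := (volume : Measure (Vec d)))
    (ν := (volume : Measure (Vec d)))).quasiMeasurePreserving.ae h1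
  exact Measure.ae_ae_of_ae_prod h2

/-! ### Minkowski's inequality and mixed norms -/
/-- Minkowski's integral inequality: the `L^q` norm of an integral is at most the integral of
the `L^q` norms. -/
lemma lintegral_rpow_lintegral_le {α β : Type*} [MeasurableSpace α] [MeasurableSpace β]
    {μ : Measure α} {ν : Measure β} [SFinite μ] [SigmaFinite ν] {q : ℝ} (hq : 1 < q)
    {F : α → β → ℝ≥0∞} (hF : Measurable (Function.uncurry F)) :
    (∫⁻ x, (∫⁻ y, F x y ∂ν) ^ q ∂μ) ^ (1 / q) ≤ ∫⁻ y, (∫⁻ x, F x y ^ q ∂μ) ^ (1 / q) ∂ν := by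
  have hq0 : 0 < q := by linarith
  set N : β → ℝ≥0∞ := fun y => (∫⁻ x, F x y ^ q ∂μ) ^ (1 / q) with hN
  have hNm : Measurable N := by
    have : Measurable fun y => ∫⁻ x, F x y ^ q ∂μ :=
      Measurable.lintegral_prod_left' (f := fun z : α × β => F z.1 z.2 ^ q)
        (by exact hF.pow_const q)
    exact this.pow_const _
  by_cases hA : ∫⁻ y, N y ∂ν = ⊤
  · rw [hA]; exact le_top
  refine ENNReal.le_of_forall_pos_le_add fun ε hε _ => ?_
  obtain ⟨h, hpos, hm, hlt⟩ := exists_pos_lintegral_lt_of_sigmaFinite ν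
    (ε := (ε : ℝ≥0∞)) (by exact_mod_cast hε.ne')
  -- The perturbation by `h` makes the weight positive everywhere.
  set M : β → ℝ≥0∞ := fun y => N y + h y with hM
  have hMm : Measurable M := hNm.add hm.coe_nnreal_ennreal
  have hM0 : ∀ y, M y ≠ 0 := fun y => by
    have := hpos y
    simp only [hM, ne_eq, add_eq_zero, ENNReal.coe_eq_zero, not_and]
    exact fun _ => this.ne'
  have hMint : ∫⁻ y, M y ∂ν = ∫⁻ y, N y ∂ν + ∫⁻ y, h y ∂ν := lintegral_add_left hNm _
  have hMfin : ∀ᵐ y ∂ν, M y < ⊤ := ae_lt_top hMm (by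
    rw [hMint]; exact (ENNReal.add_lt_top.2 ⟨lt_top_iff_ne_top.2 hA, hlt.trans coe_lt_top⟩).ne)
  set B := ∫⁻ y, M y ∂ν with hB
  have hB_le : B ≤ ∫⁻ y, N y ∂ν + ε := by rw [hMint]; gcongr
  refine le_trans ?_ hB_le
  have hconj : (q / (q - 1)).HolderConjugate q := by
    have := (Real.HolderConjugate.conjExponent hq).symm
    simpa [Real.conjExponent] using this
  have key : ∀ x, (∫⁻ y, F x y ∂ν) ^ q ≤
      B ^ (q - 1) * ∫⁻ y, M y ^ (-(q - 1)) * F x y ^ q ∂ν := by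
    intro x
    have hFx : Measurable (F x) := hF.comp measurable_prodMk_left
    have e1 : ∫⁻ y, F x y ∂ν =
        ∫⁻ y, ((fun y => M y ^ ((q - 1) / q)) * fun y => M y ^ (-((q - 1) / q)) * F x y) y ∂ν := by
      apply lintegral_congr_ae
      filter_upwards [hMfin] with y hy
      simp only [Pi.mul_apply]
      rw [← mul_assoc, ← ENNReal.rpow_add _ _ (hM0 y) hy.ne]
      simp
    have e2 := ENNReal.lintegral_mul_le_Lp_mul_Lq ν hconj
      (f := fun y => M y ^ ((q - 1) / q)) (g := fun y => M y ^ (-((q - 1) / q)) * F x y)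
      (by fun_prop) (by fun_prop)
    rw [e1]
    refine (ENNReal.rpow_le_rpow e2 hq0.le).trans ?_
    rw [ENNReal.mul_rpow_of_nonneg _ _ hq0.le, ← ENNReal.rpow_mul, ← ENNReal.rpow_mul]
    have h1 : 1 / (q / (q - 1)) * q = q - 1 := by field_simp
    have h2 : 1 / q * q = 1 := by field_simp
    rw [h1, h2, ENNReal.rpow_one]
    have h3 : ∀ y, (M y ^ ((q - 1) / q)) ^ (q / (q - 1)) = M y := fun y => by
      rw [← ENNReal.rpow_mul]
      have : (q - 1) / q * (q / (q - 1)) = 1 := by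
        have : q - 1 ≠ 0 := by linarith
        field_simp
      rw [this, ENNReal.rpow_one]
    have h4 : ∀ y, (M y ^ (-((q - 1) / q)) * F x y) ^ q = M y ^ (-(q - 1)) * F x y ^ q := fun y => by
      rw [ENNReal.mul_rpow_of_nonneg _ _ hq0.le, ← ENNReal.rpow_mul]
      congr 2
      field_simp
    simp only [h3, h4]
    exact le_rfl
  have hmain : ∫⁻ x, (∫⁻ y, F x y ∂ν) ^ q ∂μ ≤ B ^ q := by
    calc ∫⁻ x, (∫⁻ y, F x y ∂ν) ^ q ∂μ
        ≤ ∫⁻ x, B ^ (q - 1) * ∫⁻ y, M y ^ (-(q - 1)) * F x y ^ q ∂ν ∂μ := lintegral_mono key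
      _ = B ^ (q - 1) * ∫⁻ x, ∫⁻ y, M y ^ (-(q - 1)) * F x y ^ q ∂ν ∂μ := by
          refine lintegral_const_mul _ ?_
          refine Measurable.lintegral_prod_right' (f := fun z : α × β => M z.2 ^ (-(q - 1)) *
            F z.1 z.2 ^ q) ?_
          exact ((hMm.comp measurable_snd).pow_const _).mul (hF.pow_const q)
      _ = B ^ (q - 1) * ∫⁻ y, ∫⁻ x, M y ^ (-(q - 1)) * F x y ^ q ∂μ ∂ν := by
          rw [lintegral_lintegral_swap]
          exact (((hMm.comp measurable_snd).pow_const _).mul (hF.pow_const q)).aemeasurable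
      _ = B ^ (q - 1) * ∫⁻ y, M y ^ (-(q - 1)) * N y ^ q ∂ν := by
          congr 1
          refine lintegral_congr fun y => ?_
          have hFy : Measurable fun x => F x y := hF.comp measurable_prodMk_right
          rw [lintegral_const_mul _ (hFy.pow_const q), hN]
          simp only
          rw [← ENNReal.rpow_mul]
          have h2 : 1 / q * q = 1 := by field_simp
          rw [h2, ENNReal.rpow_one]
      _ ≤ B ^ (q - 1) * ∫⁻ y, M y ∂ν := by
          refine mul_le_mul_right (lintegral_mono_ae ?_) _
          filter_upwards [hMfin] with y hy
          calc M y ^ (-(q - 1)) * N y ^ q ≤ M y ^ (-(q - 1)) * M y ^ q := by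
                gcongr; exact le_self_add
            _ = M y := by
                rw [← ENNReal.rpow_add _ _ (hM0 y) hy.ne]
                simp
      _ = B ^ q := by
          have : B ≠ ⊤ := by
            rw [hMint]
            exact (ENNReal.add_lt_top.2 ⟨lt_top_iff_ne_top.2 hA, hlt.trans coe_lt_top⟩).ne
          rw [← hB]
          conv_lhs => rw [← ENNReal.rpow_one B]
          rw [← ENNReal.rpow_mul, ← ENNReal.rpow_add_of_nonneg _ _ (by linarith) (by linarith)]
          congr 1; ring
  calc _ ≤ (B ^ q) ^ (1 / q) := by gcongr
    _ = B := by rw [← ENNReal.rpow_mul]; simp [hq0.ne']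

variable {d : ℕ}

/-- The mixed norm of a nonnegative function. -/
def mx (p : ℝ≥0∞ × ℝ≥0∞) (G : Phase d → ℝ≥0∞) : ℝ≥0∞ :=
  (∫⁻ v : Vec d, (∫⁻ x : Vec d, G (pt x v) ^ p.1.toReal) ^ (p.2.toReal / p.1.toReal)) ^
    (1 / p.2.toReal)

/-- The range of exponents for which the mixed norms are used. -/
structure Adm (p : ℝ≥0∞ × ℝ≥0∞) : Prop where
  x_gt : 1 < p.1
  x_lt : p.1 < ⊤
  v_gt : 1 < p.2
  v_lt : p.2 < ⊤

namespace Adm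
variable {p : ℝ≥0∞ × ℝ≥0∞} (hp : Adm p)
include hp
lemma x_one_lt : 1 < p.1.toReal := by
  rw [← ENNReal.toReal_one]; exact (ENNReal.toReal_lt_toReal (by simp) hp.x_lt.ne).2 hp.x_gt
lemma v_one_lt : 1 < p.2.toReal := by
  rw [← ENNReal.toReal_one]; exact (ENNReal.toReal_lt_toReal (by simp) hp.v_lt.ne).2 hp.v_gt
end Adm

variable {p : ℝ≥0∞ × ℝ≥0∞}

lemma mx_eq (hp : Adm p) (G : Phase d → ℝ≥0∞) :
    mx p G = (∫⁻ v : Vec d, ((∫⁻ x : Vec d, G (pt x v) ^ p.1.toReal) ^ (1 / p.1.toReal)) ^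
      p.2.toReal) ^ (1 / p.2.toReal) := by
  unfold mx
  congr 2
  funext v
  rw [← ENNReal.rpow_mul]
  congr 1
  have := hp.x_one_lt
  field_simp

lemma mixedNorm_eq_mx {F : Type} [NormedAddCommGroup F] (hp : Adm p) (g : Phase d → F) :
    mixedNorm p g = mx p fun z => ‖g z‖ₑ := by
  have h1 := hp.x_gt
  have h2 := hp.v_gt
  rw [mx_eq hp, mixedNorm, eLpNorm_eq_lintegral_rpow_enorm_toReal (by positivity) hp.v_lt.ne]
  congr 2
  funext v
  rw [eLpNorm_eq_lintegral_rpow_enorm_toReal (by positivity) hp.x_lt.ne]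
  simp

lemma mx_mono (hp : Adm p) {G H : Phase d → ℝ≥0∞} (h : ∀ z, G z ≤ H z) : mx p G ≤ mx p H := by
  have := hp.x_one_lt
  have := hp.v_one_lt
  unfold mx
  gcongr with v x
  exact h _

lemma mx_congr_ae {G H : Phase d → ℝ≥0∞} (h : G =ᵐ[volume] H) : mx p G = mx p H := by
  unfold mx
  congr 1
  apply lintegral_congr_ae
  filter_upwards [ae_ae_of_ae_phase h] with v hv
  congr 1
  apply lintegral_congr_ae
  filter_upwards [hv] with x hx
  rw [hx]

lemma mx_const_mul (hp : Adm p) (c : ℝ≥0∞) (hc : c ≠ ⊤) (G : Phase d → ℝ≥0∞) :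
    mx p (fun z => c * G z) = c * mx p G := by
  have h1 := hp.x_one_lt
  have h2 := hp.v_one_lt
  have h1' : 0 < p.1.toReal := by linarith
  have h2' : 0 < p.2.toReal := by linarith
  have h3' : 0 ≤ p.2.toReal / p.1.toReal := by positivity
  unfold mx
  simp_rw [ENNReal.mul_rpow_of_nonneg _ _ h1'.le]
  have e : ∀ v : Vec d, (∫⁻ x : Vec d, c ^ p.1.toReal * G (pt x v) ^ p.1.toReal) ^
      (p.2.toReal / p.1.toReal) = c ^ p.2.toReal *
        (∫⁻ x : Vec d, G (pt x v) ^ p.1.toReal) ^ (p.2.toReal / p.1.toReal) := by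
    intro v
    rw [lintegral_const_mul' _ _ (ENNReal.rpow_ne_top_of_nonneg h1'.le hc),
      ENNReal.mul_rpow_of_nonneg _ _ h3', ← ENNReal.rpow_mul]
    congr 2
    field_simp
  simp_rw [e]
  rw [lintegral_const_mul' _ _ (ENNReal.rpow_ne_top_of_nonneg h2'.le hc),
    ENNReal.mul_rpow_of_nonneg _ _ (by positivity), ← ENNReal.rpow_mul]
  congr 1
  rw [mul_one_div_cancel h2'.ne', ENNReal.rpow_one]

/-- Minkowski's integral inequality for the mixed norm. -/
lemma mx_lintegral_le (hp : Adm p) {β : Type*} [MeasurableSpace β] {ν : Measure β} [SigmaFinite ν]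
    {F : Phase d → β → ℝ≥0∞} (hF : Measurable (Function.uncurry F)) :
    mx p (fun z => ∫⁻ y, F z y ∂ν) ≤ ∫⁻ y, mx p (fun z => F z y) ∂ν := by
  have h1 := hp.x_one_lt
  have h2 := hp.v_one_lt
  simp only [mx_eq hp]
  have hFv : ∀ v : Vec d, Measurable (Function.uncurry fun (x : Vec d) y => F (pt x v) y) :=
    fun v => hF.comp ((measurable_pt measurable_fst measurable_const).prodMk measurable_snd)
  have hin : Measurable (Function.uncurry fun (v : Vec d) y =>
      (∫⁻ x : Vec d, F (pt x v) y ^ p.1.toReal) ^ (1 / p.1.toReal)) := by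
    refine Measurable.pow_const ?_ _
    refine Measurable.lintegral_prod_right'
      (f := fun a : (Vec d × β) × Vec d => F (pt a.2 a.1.1) a.1.2 ^ p.1.toReal) ?_
    refine Measurable.pow_const ?_ _
    exact hF.comp ((measurable_pt measurable_snd (measurable_fst.comp measurable_fst)).prodMk
      (measurable_snd.comp measurable_fst))
  refine le_trans ?_ (lintegral_rpow_lintegral_le h2 hin)
  gcongr with v
  exact lintegral_rpow_lintegral_le h1 (hFv v)

lemma mx_tsum_le (hp : Adm p) {ι : Type*} [Countable ι] {F : ι → Phase d → ℝ≥0∞}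
    (hF : ∀ i, Measurable (F i)) : mx p (fun z => ∑' i, F i z) ≤ ∑' i, mx p (F i) := by
  let _ : MeasurableSpace ι := ⊤
  have := mx_lintegral_le (d := d) hp (ν := Measure.count) (F := fun z (i : ι) => F i z)
    (measurable_from_prod_countable_left fun i => hF i)
  simpa [lintegral_count] using this

lemma mx_zero (hp : Adm p) : mx p (fun _ : Phase d => 0) = 0 := by
  have := mx_const_mul (d := d) hp 0 (by simp) (fun _ => 0)
  simpa using this

lemma mx_add_le (hp : Adm p) {F G : Phase d → ℝ≥0∞} (hF : Measurable F) (hG : Measurable G) :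
    mx p (fun z => F z + G z) ≤ mx p F + mx p G := by
  have := mx_tsum_le (d := d) hp (F := fun b : Bool => cond b F G) (by rintro (_ | _) <;> simpa)
  simpa [tsum_bool, add_comm] using this

lemma mx_comp_sub (G : Phase d → ℝ≥0∞) (w : Phase d) : mx p (fun z => G (z - w)) = mx p G := by
  unfold mx
  have e : ∀ x v : Vec d, pt x v - w = pt (x - posn w) (v - velo w) := fun x v =>
    phase_ext (by simp) (by simp)
  simp only [e]
  congr 1
  rw [← lintegral_sub_right_eq_self (fun v : Vec d => (∫⁻ x : Vec d, G (pt x v) ^ p.1.toReal) ^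
    (p.2.toReal / p.1.toReal)) (velo w)]
  congr 1
  funext v
  rw [lintegral_sub_right_eq_self (fun x : Vec d => G (pt x (v - velo w)) ^ p.1.toReal) (posn w)]

lemma mx_comp_neg (G : Phase d → ℝ≥0∞) : mx p (fun z => G (-z)) = mx p G := by
  unfold mx
  have e : ∀ x v : Vec d, -pt x v = pt (-x) (-v) := fun x v => phase_ext (by simp) (by simp)
  simp only [e]
  congr 1
  rw [← lintegral_neg_eq_self (μ := volume) (fun v : Vec d => (∫⁻ x : Vec d, G (pt x v) ^ p.1.toReal) ^
    (p.2.toReal / p.1.toReal))]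
  congr 1
  funext v
  rw [← lintegral_neg_eq_self (μ := volume) (fun x : Vec d => G (pt x (-v)) ^ p.1.toReal)]

/-- The shear `(x, v) ↦ (x + r v, v)`, the free transport of kinetic theory. -/
def shear (r : ℝ) (z : Phase d) : Phase d := pt (posn z + r • velo z) (velo z)

lemma mx_comp_shear (G : Phase d → ℝ≥0∞) (r : ℝ) : mx p (fun z => G (shear r z)) = mx p G := by
  unfold mx shear
  simp only [posn_pt, velo_pt]
  congr 1
  congr 1
  funext v
  rw [lintegral_add_right_eq_self (fun x : Vec d => G (pt x v) ^ p.1.toReal) (r • v)]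

/-! ### Hölder duality and functions of moderate growth -/

/-- The pair of conjugate exponents. -/
def conjPair (p : ℝ≥0∞ × ℝ≥0∞) : ℝ≥0∞ × ℝ≥0∞ :=
  (ENNReal.ofReal (p.1.toReal / (p.1.toReal - 1)), ENNReal.ofReal (p.2.toReal / (p.2.toReal - 1)))

lemma Adm.conj (hp : Adm p) : Adm (conjPair p) := by
  have h1 := hp.x_one_lt
  have h2 := hp.v_one_lt
  have a : ∀ t : ℝ, 1 < t → 1 < ENNReal.ofReal (t / (t - 1)) := fun t ht => by
    rw [← ENNReal.ofReal_one, ENNReal.ofReal_lt_ofReal_iff_of_nonneg (by norm_num),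
      lt_div_iff₀ (by linarith)]
    linarith
  exact ⟨a _ h1, ENNReal.ofReal_lt_top, a _ h2, ENNReal.ofReal_lt_top⟩

lemma Adm.holder_x (hp : Adm p) : p.1.toReal.HolderConjugate (conjPair p).1.toReal := by
  have h1 := hp.x_one_lt
  have : (conjPair p).1.toReal = Real.conjExponent p.1.toReal := by
    simp only [conjPair, Real.conjExponent]
    exact ENNReal.toReal_ofReal (div_nonneg (by linarith) (by linarith))
  rw [this]
  exact Real.HolderConjugate.conjExponent h1

lemma Adm.holder_v (hp : Adm p) : p.2.toReal.HolderConjugate (conjPair p).2.toReal := by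
  have h1 := hp.v_one_lt
  have : (conjPair p).2.toReal = Real.conjExponent p.2.toReal := by
    simp only [conjPair, Real.conjExponent]
    exact ENNReal.toReal_ofReal (div_nonneg (by linarith) (by linarith))
  rw [this]
  exact Real.HolderConjugate.conjExponent h1

/-- Hölder's inequality for the mixed norms. -/
lemma lintegral_mul_le_mx (hp : Adm p) {G H : Phase d → ℝ≥0∞} (hG : Measurable G)
    (hH : Measurable H) : ∫⁻ z, G z * H z ≤ mx p G * mx (conjPair p) H := by
  rw [lintegral_phase (f := fun z => G z * H z) (hG.mul hH), mx_eq hp, mx_eq hp.conj]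
  have hm : ∀ (q : ℝ) {K : Phase d → ℝ≥0∞}, Measurable K → Measurable fun v : Vec d =>
      (∫⁻ x : Vec d, K (pt x v) ^ q) ^ (1 / q) := fun q K hK => by
    refine Measurable.pow_const ?_ _
    refine Measurable.lintegral_prod_right' (f := fun a : Vec d × Vec d => K (pt a.2 a.1) ^ q) ?_
    exact (hK.comp (measurable_pt measurable_snd measurable_fst)).pow_const _
  refine le_trans ?_ (ENNReal.lintegral_mul_le_Lp_mul_Lq volume hp.holder_v
    (hm _ hG).aemeasurable (hm _ hH).aemeasurable)
  refine lintegral_mono fun v => ?_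
  exact ENNReal.lintegral_mul_le_Lp_mul_Lq volume hp.holder_x
    (hG.comp (measurable_pt measurable_id measurable_const)).aemeasurable
    (hH.comp (measurable_pt measurable_id measurable_const)).aemeasurable

lemma mx_tensor (hp : Adm p) {a b : Vec d → ℝ≥0∞} (ha : Measurable a) (hb : Measurable b) :
    mx p (fun z => a (posn z) * b (velo z)) =
      (∫⁻ x, a x ^ p.1.toReal) ^ (1 / p.1.toReal) * (∫⁻ v, b v ^ p.2.toReal) ^ (1 / p.2.toReal) := by
  have h1 := hp.x_one_lt
  have h2 := hp.v_one_lt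
  have h1' : 0 < p.1.toReal := by linarith
  have h2' : 0 < p.2.toReal := by linarith
  have h3' : 0 ≤ p.2.toReal / p.1.toReal := by positivity
  unfold mx
  simp only [posn_pt, velo_pt]
  have e : ∀ v : Vec d, (∫⁻ x : Vec d, (a x * b v) ^ p.1.toReal) ^ (p.2.toReal / p.1.toReal) =
      (∫⁻ x, a x ^ p.1.toReal) ^ (p.2.toReal / p.1.toReal) * b v ^ p.2.toReal := by
    intro v
    simp_rw [ENNReal.mul_rpow_of_nonneg _ _ h1'.le]
    rw [lintegral_mul_const _ (ha.pow_const _), ENNReal.mul_rpow_of_nonneg _ _ h3',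
      ← ENNReal.rpow_mul]
    congr 2
    field_simp
  simp_rw [e]
  rw [lintegral_const_mul _ (hb.pow_const _), ENNReal.mul_rpow_of_nonneg _ _ (by positivity),
    ← ENNReal.rpow_mul]
  congr 2
  field_simp

/-- The weight `(1 + |z|)^{-N}`. -/
def wt (N : ℕ) (z : Phase d) : ℝ := ((1 + ‖z‖) ^ N)⁻¹

lemma wt_pos (N : ℕ) (z : Phase d) : 0 < wt N z := by unfold wt; positivity

@[fun_prop] lemma continuous_wt (N : ℕ) : Continuous (wt N : Phase d → ℝ) := by
  unfold wt
  refine Continuous.inv₀ (by fun_prop) fun z => by positivity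

lemma wt_anti {N M : ℕ} (h : N ≤ M) (z : Phase d) : wt M z ≤ wt N z := by
  unfold wt
  gcongr
  linarith [norm_nonneg z]

lemma wt_sub_le (N : ℕ) (z w : Phase d) : wt N (z - w) ≤ (1 + ‖z‖) ^ N * wt N w := by
  unfold wt
  rw [← div_eq_mul_inv, inv_eq_one_div, div_le_div_iff₀ (by positivity) (by positivity), one_mul,
    ← mul_pow]
  gcongr
  have : ‖w‖ ≤ ‖z‖ + ‖z - w‖ := by
    have := norm_sub_le z (z - w)
    simpa using this
  nlinarith [norm_nonneg z, norm_nonneg (z - w), mul_nonneg (norm_nonneg z) (norm_nonneg (z - w))]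

lemma lintegral_one_add_norm_rpow_lt_top {q : ℝ} (hq : 1 < q) :
    ∫⁻ x : Vec d, ENNReal.ofReal (((1 + ‖x‖) ^ (d + 1))⁻¹) ^ q < ⊤ := by
  have h := finite_integral_one_add_norm (E := Vec d) (μ := volume) (r := d + 1)
    (by simp)
  refine lt_of_le_of_lt (lintegral_mono fun x => ?_) h
  have h1 : (1 + ‖x‖) ^ (-((d : ℝ) + 1)) = ((1 + ‖x‖) ^ (d + 1))⁻¹ := by
    rw [Real.rpow_neg (by positivity)]
    norm_cast
  rw [h1]
  have h2 : ENNReal.ofReal (((1 + ‖x‖) ^ (d + 1))⁻¹) ≤ 1 := by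
    rw [ENNReal.ofReal_le_one]
    exact inv_le_one_of_one_le₀ (one_le_pow₀ (by linarith [norm_nonneg x]))
  calc _ ≤ ENNReal.ofReal (((1 + ‖x‖) ^ (d + 1))⁻¹) ^ (1 : ℝ) :=
        ENNReal.rpow_le_rpow_of_exponent_ge h2 hq.le
    _ = _ := ENNReal.rpow_one _

lemma mx_wt_lt_top (hp : Adm p) :
    mx p (fun z : Phase d => ENNReal.ofReal (wt (2 * (d + 1)) z)) < ⊤ := by
  set a : Vec d → ℝ≥0∞ := fun x => ENNReal.ofReal (((1 + ‖x‖) ^ (d + 1))⁻¹) with ha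
  have ham : Measurable a := by fun_prop
  have h1 := hp.x_one_lt
  have h2 := hp.v_one_lt
  have hle : ∀ z : Phase d, ENNReal.ofReal (wt (2 * (d + 1)) z) ≤ a (posn z) * a (velo z) := by
    intro z
    rw [ha, ← ENNReal.ofReal_mul (by positivity), ← mul_inv, ← mul_pow]
    refine ofReal_le_ofReal ?_
    unfold wt
    rw [pow_mul]
    gcongr
    nlinarith [norm_posn_le z, norm_velo_le z, norm_nonneg (posn z), norm_nonneg (velo z)]
  refine lt_of_le_of_lt (mx_mono hp hle) ?_
  rw [mx_tensor hp ham ham]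
  refine mul_lt_top ?_ ?_
  · exact ENNReal.rpow_lt_top_of_nonneg (by positivity)
      (lintegral_one_add_norm_rpow_lt_top h1).ne
  · exact ENNReal.rpow_lt_top_of_nonneg (by positivity)
      (lintegral_one_add_norm_rpow_lt_top h2).ne

lemma exists_norm_le_wt (φ : Test d) (N : ℕ) : ∃ C : ℝ, 0 < C ∧ ∀ z, ‖φ z‖ ≤ C * wt N z := by
  obtain ⟨C, hC⟩ : ∃ C : ℝ, ∀ z, (1 + ‖z‖) ^ N * ‖φ z‖ ≤ C := by
    refine ⟨2 ^ N * ((Finset.Iic (N, 0)).sup fun m => SchwartzMap.seminorm ℝ m.1 m.2) φ,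
      fun z => ?_⟩
    have := SchwartzMap.one_add_le_sup_seminorm_apply (𝕜 := ℝ) (m := (N, 0)) (k := N) (n := 0)
      le_rfl le_rfl φ z
    simpa using this
  refine ⟨|C| + 1, by positivity, fun z => ?_⟩
  unfold wt
  rw [← div_eq_mul_inv, le_div_iff₀ (by positivity), mul_comm]
  linarith [hC z, le_abs_self C]

lemma mx_schwartz_lt_top (hp : Adm p) (φ : Test d) : mx p (fun z => ‖φ z‖ₑ) < ⊤ := by
  obtain ⟨C, hC, h⟩ := exists_norm_le_wt φ (2 * (d + 1))
  have : ∀ z, ‖φ z‖ₑ ≤ ENNReal.ofReal C * ENNReal.ofReal (wt (2 * (d + 1)) z) := fun z => by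
    rw [← ENNReal.ofReal_mul hC.le, ← ofReal_norm]
    exact ofReal_le_ofReal (h z)
  refine lt_of_le_of_lt (mx_mono hp this) ?_
  rw [mx_const_mul hp _ ofReal_ne_top]
  exact mul_lt_top ENNReal.ofReal_lt_top (mx_wt_lt_top hp)

lemma integrable_wt : Integrable (wt (2 * (d + 1)) : Phase d → ℝ) := by
  have h := integrable_one_add_norm (E := Phase d) (μ := volume) (r := 2 * (d + 1))
    (by simp; linarith)
  refine h.congr (.of_forall fun z => ?_)
  simp only [wt]
  rw [Real.rpow_neg (by positivity)]
  norm_cast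

/-- Measurable functions that are integrable against some weight `(1 + |z|)^{-N}`. -/
structure Tame (g : Phase d → ℂ) : Prop where
  meas : Measurable g
  int : ∃ N : ℕ, Integrable fun z => wt N z * ‖g z‖

lemma Tame.of_mx (hp : Adm p) {g : Phase d → ℂ} (hg : Measurable g)
    (h : mx p (fun z => ‖g z‖ₑ) < ⊤) : Tame g := by
  refine ⟨hg, 2 * (d + 1), ?_⟩
  refine ⟨by fun_prop, ?_⟩
  have h2 := lintegral_mul_le_mx hp (G := fun z => ‖g z‖ₑ)
    (H := fun z => ENNReal.ofReal (wt (2 * (d + 1)) z)) (by fun_prop) (by fun_prop)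
  refine lt_of_le_of_lt (le_trans (le_of_eq ?_) h2) (mul_lt_top h (mx_wt_lt_top hp.conj))
  refine lintegral_congr fun z => ?_
  rw [enorm_mul, mul_comm, enorm_norm, Real.enorm_of_nonneg (wt_pos _ _).le]

lemma Tame.of_le {g : Phase d → ℂ} (hg : Measurable g) {C : ℝ} {N : ℕ}
    (h : ∀ z, ‖g z‖ ≤ C * (1 + ‖z‖) ^ N) : Tame g := by
  refine ⟨hg, N + 2 * (d + 1), ?_⟩
  refine (integrable_wt.const_mul C).mono' (by fun_prop) (.of_forall fun z => ?_)
  rw [norm_mul, norm_norm, Real.norm_of_nonneg (wt_pos _ _).le]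
  calc _ ≤ wt (N + 2 * (d + 1)) z * (C * (1 + ‖z‖) ^ N) := by
        have := (wt_pos (N + 2 * (d + 1)) z).le
        gcongr
        exact h z
    _ = C * wt (2 * (d + 1)) z := by
        simp only [wt, pow_add]
        field_simp

lemma Tame.of_bounded {g : Phase d → ℂ} (hg : Measurable g) {C : ℝ} (h : ∀ z, ‖g z‖ ≤ C) :
    Tame g := Tame.of_le hg (C := C) (N := 0) (by simpa using h)

lemma Tame.schwartz (φ : Test d) : Tame (φ : Phase d → ℂ) := by
  obtain ⟨C, -, h⟩ := exists_norm_le_wt φ 0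
  exact Tame.of_bounded φ.continuous.measurable (C := C) (by simpa [wt] using h)

lemma Tame.int_of_le {g : Phase d → ℂ} (hg : Tame g) :
    ∃ N : ℕ, ∀ M, N ≤ M → Integrable fun z => wt M z * ‖g z‖ := by
  obtain ⟨N, hN⟩ := hg.int
  have := hg.meas
  refine ⟨N, fun M hM => hN.mono' (by fun_prop) (.of_forall fun z => ?_)⟩
  rw [norm_mul, norm_norm, Real.norm_of_nonneg (wt_pos _ _).le]
  exact mul_le_mul_of_nonneg_right (wt_anti hM z) (norm_nonneg _)

lemma Tame.add {g h : Phase d → ℂ} (hg : Tame g) (hh : Tame h) : Tame (fun z => g z + h z) := by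
  obtain ⟨N, hN⟩ := hg.int_of_le
  obtain ⟨M, hM⟩ := hh.int_of_le
  have h1 := hg.meas
  have h2 := hh.meas
  have h3 := (hN (max N M) (le_max_left _ _)).add (hM (max N M) (le_max_right _ _))
  refine ⟨by fun_prop, max N M, h3.mono' (by fun_prop) (.of_forall fun z => ?_)⟩
  rw [norm_mul, norm_norm, Real.norm_of_nonneg (wt_pos _ _).le, Pi.add_apply, ← mul_add]
  exact mul_le_mul_of_nonneg_left (norm_add_le _ _) (wt_pos _ _).le

lemma Tame.mul_bounded {g h : Phase d → ℂ} (hg : Tame g) (hh : Measurable h) {C : ℝ}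
    (hC : ∀ z, ‖h z‖ ≤ C) : Tame (fun z => g z * h z) := by
  obtain ⟨N, hN⟩ := hg.int
  have h1 := hg.meas
  refine ⟨by fun_prop, N, (hN.const_mul C).mono' (by fun_prop)
    (.of_forall fun z => ?_)⟩
  rw [norm_mul, norm_norm, Real.norm_of_nonneg (wt_pos _ _).le, norm_mul]
  have := wt_pos N z
  have := norm_nonneg (g z)
  calc wt N z * (‖g z‖ * ‖h z‖) ≤ wt N z * (‖g z‖ * C) := by gcongr; exact hC z
    _ = _ := by ring

lemma Tame.integrable_mul {g : Phase d → ℂ} (hg : Tame g) (φ : Test d) :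
    Integrable fun z => φ z * g z := by
  obtain ⟨N, hN⟩ := hg.int
  obtain ⟨C, hC, h⟩ := exists_norm_le_wt φ N
  have h1 := hg.meas
  have h2 := φ.continuous.measurable
  refine (hN.const_mul C).mono' (by fun_prop) (.of_forall fun z => ?_)
  rw [norm_mul, ← mul_assoc]
  exact mul_le_mul_of_nonneg_right (h z) (norm_nonneg _)

/-! ### Fourier multipliers with Schwartz symbols -/

/-- The convolution kernel of the Fourier multiplier with symbol `m`. -/
def ker (m : Test d) : Test d := 𝓕⁻ m

/-- The product of two symbols. -/
def mulS (m n : Test d) : Test d := SchwartzMap.pairing (ContinuousLinearMap.mul ℂ ℂ) m n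

@[simp] lemma mulS_apply (m n : Test d) (ξ : Phase d) : mulS m n ξ = m ξ * n ξ := rfl

lemma mulS_comm (m n : Test d) : mulS m n = mulS n m := by ext; simp [mul_comm]
lemma mulS_assoc (m n k : Test d) : mulS (mulS m n) k = mulS m (mulS n k) := by
  ext; simp [mul_assoc]

/-- The Schwartz function `w ↦ φ (z - w)`. -/
def reflAt (φ : Test d) (z : Phase d) : Test d :=
  SchwartzMap.compSubConstCLM ℂ z
    (compCLMOfContinuousLinearEquiv ℂ (ContinuousLinearEquiv.neg ℝ) φ)

@[simp] lemma reflAt_apply (φ : Test d) (z w : Phase d) : reflAt φ z w = φ (z - w) := by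
  simp [reflAt]

/-- The Fourier multiplier with symbol `m`, acting on functions by convolution with its kernel. -/
def T (m : Test d) (g : Phase d → ℂ) (z : Phase d) : ℂ := ∫ w, ker m (z - w) * g w

lemma integrable_T (m : Test d) {g : Phase d → ℂ} (hg : Tame g) (z : Phase d) :
    Integrable fun w => ker m (z - w) * g w := by
  simpa using hg.integrable_mul (reflAt (ker m) z)

lemma T_congr_ae (m : Test d) {g h : Phase d → ℂ} (e : g =ᵐ[volume] h) : T m g = T m h := by
  funext z
  refine integral_congr_ae ?_
  filter_upwards [e] with w hw
  rw [hw]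

lemma exists_norm_sub_le (φ : Test d) (N : ℕ) :
    ∃ C : ℝ, 0 < C ∧ ∀ z w, ‖φ (z - w)‖ ≤ C * (1 + ‖z‖) ^ N * wt N w := by
  obtain ⟨C, hC, h⟩ := exists_norm_le_wt φ N
  refine ⟨C, hC, fun z w => (h _).trans ?_⟩
  rw [mul_assoc]
  exact mul_le_mul_of_nonneg_left (wt_sub_le N z w) hC.le

lemma measurable_T {α : Type*} [MeasurableSpace α] (m : Test d) {g : α → Phase d → ℂ}
    (hg : Measurable (Function.uncurry g)) : Measurable fun q : α × Phase d => T m (g q.1) q.2 := by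
  have : StronglyMeasurable fun q : (α × Phase d) × Phase d => ker m (q.1.2 - q.2) * g q.1.1 q.2 := by
    refine Measurable.stronglyMeasurable ?_
    have h1 := (ker m).continuous.measurable
    have h2 : Measurable fun q : (α × Phase d) × Phase d => g q.1.1 q.2 :=
      hg.comp ((measurable_fst.comp measurable_fst).prodMk measurable_snd)
    exact (h1.comp ((measurable_snd.comp measurable_fst).sub measurable_snd)).mul h2
  exact this.integral_prod_right.measurable

lemma measurable_T' (m : Test d) {g : Phase d → ℂ} (hg : Measurable g) : Measurable (T m g) := by
  have : StronglyMeasurable fun q : Phase d × Phase d => ker m (q.1 - q.2) * g q.2 := by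
    refine Measurable.stronglyMeasurable ?_
    have h1 := (ker m).continuous.measurable
    exact (h1.comp (measurable_fst.sub measurable_snd)).mul (hg.comp measurable_snd)
  exact this.integral_prod_right.measurable

lemma exists_norm_T_le (m : Test d) {g : Phase d → ℂ} (hg : Tame g) :
    ∃ (C : ℝ) (N : ℕ), ∀ z, ‖T m g z‖ ≤ C * (1 + ‖z‖) ^ N := by
  obtain ⟨N, hN⟩ := hg.int
  obtain ⟨C, hC, h⟩ := exists_norm_sub_le (ker m) N
  refine ⟨C * ∫ w, wt N w * ‖g w‖, N, fun z => ?_⟩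
  refine (norm_integral_le_integral_norm _).trans ?_
  rw [mul_right_comm, ← integral_const_mul]
  refine integral_mono_of_nonneg (.of_forall fun w => norm_nonneg _)
    (hN.const_mul _) (.of_forall fun w => ?_)
  simp only [norm_mul, ← mul_assoc]
  exact mul_le_mul_of_nonneg_right (h z w) (norm_nonneg _)

lemma Tame.T (m : Test d) {g : Phase d → ℂ} (hg : Tame g) : Tame (T m g) := by
  obtain ⟨C, N, h⟩ := exists_norm_T_le m hg
  exact Tame.of_le (measurable_T' m hg.meas) h

lemma continuous_T (m : Test d) {g : Phase d → ℂ} (hg : Tame g) : Continuous (T m g) := by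
  obtain ⟨N, hN⟩ := hg.int
  obtain ⟨C, hC, h⟩ := exists_norm_sub_le (ker m) N
  have hgm := hg.meas
  have hk := (ker m).continuous
  rw [continuous_iff_continuousAt]
  intro z₀
  refine continuousAt_of_dominated (F := fun z w => ker m (z - w) * g w)
    (bound := fun w => C * (1 + (‖z₀‖ + 1)) ^ N * (wt N w * ‖g w‖)) ?_ ?_ (hN.const_mul _) ?_
  · refine .of_forall fun z => ?_
    exact ((hk.measurable.comp (by fun_prop)).mul hgm).aestronglyMeasurable
  · filter_upwards [Metric.ball_mem_nhds z₀ one_pos] with z hz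
    refine .of_forall fun w => ?_
    have hz' : ‖z‖ ≤ ‖z₀‖ + 1 := by
      have := norm_le_norm_add_norm_sub' z z₀
      rw [Metric.mem_ball, dist_eq_norm] at hz
      linarith
    rw [norm_mul, ← mul_assoc]
    refine mul_le_mul_of_nonneg_right ((h z w).trans ?_) (norm_nonneg _)
    have := (wt_pos N w).le
    gcongr
  · refine .of_forall fun w => ?_
    exact ContinuousAt.mul (hk.continuousAt.comp (by fun_prop)) continuousAt_const

lemma integrable_mul_conv (φ k : Test d) {g : Phase d → ℂ} (hg : Tame g) :
    Integrable (fun q : Phase d × Phase d => φ q.1 * (k (q.1 - q.2) * g q.2))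
      (volume.prod volume) := by
  obtain ⟨N, hN⟩ := hg.int
  obtain ⟨C, hC, h⟩ := exists_norm_sub_le k N
  obtain ⟨C', hC', h'⟩ := exists_norm_le_wt φ (N + 2 * (d + 1))
  have hgm := hg.meas
  have hk := k.continuous.measurable
  have hφ := φ.continuous.measurable
  have h1 : Integrable (fun q : Phase d × Phase d => (C' * wt (2 * (d + 1)) q.1) *
      (C * (wt N q.2 * ‖g q.2‖))) (volume.prod volume) :=
    (integrable_wt.const_mul C').mul_prod (hN.const_mul C)
  refine h1.mono' ?_ (.of_forall fun q => ?_)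
  · exact ((hφ.comp measurable_fst).mul ((hk.comp (measurable_fst.sub measurable_snd)).mul
      (hgm.comp measurable_snd))).aestronglyMeasurable
  · rw [norm_mul, norm_mul]
    have a1 : ‖φ q.1‖ * (1 + ‖q.1‖) ^ N ≤ C' * wt (2 * (d + 1)) q.1 := by
      calc _ ≤ C' * wt (N + 2 * (d + 1)) q.1 * (1 + ‖q.1‖) ^ N := by gcongr; exact h' _
        _ = _ := by simp only [wt, pow_add]; field_simp
    calc ‖φ q.1‖ * (‖k (q.1 - q.2)‖ * ‖g q.2‖)
        ≤ ‖φ q.1‖ * ((C * (1 + ‖q.1‖) ^ N * wt N q.2) * ‖g q.2‖) := by gcongr; exact h _ _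
      _ = (‖φ q.1‖ * (1 + ‖q.1‖) ^ N) * (C * (wt N q.2 * ‖g q.2‖)) := by ring
      _ ≤ _ := by
        refine mul_le_mul_of_nonneg_right a1 ?_
        have := wt_pos N q.2
        positivity

/-- Fubini's theorem for a convolution paired with a Schwartz function. -/
lemma integral_mul_conv (φ k : Test d) {g : Phase d → ℂ} (hg : Tame g) :
    ∫ z, φ z * ∫ w, k (z - w) * g w = ∫ w, (∫ z, φ z * k (z - w)) * g w := by
  simp_rw [← integral_const_mul]
  rw [integral_integral_swap (integrable_mul_conv φ k hg)]
  simp_rw [← integral_mul_const, mul_assoc]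

lemma ker_mulS (m n : Test d) (z : Phase d) :
    ker (mulS m n) z = ∫ y, ker m y * ker n (z - y) := by
  have h : SchwartzMap.convolution (ContinuousLinearMap.mul ℂ ℂ) (ker m) (ker n) =
      ker (mulS m n) := by
    simp [SchwartzMap.convolution, ker, mulS]
  rw [← h, SchwartzMap.convolution_apply]
  rfl

/-- Composition of Fourier multipliers multiplies their symbols. -/
lemma T_T (m n : Test d) {g : Phase d → ℂ} (hg : Tame g) : T m (T n g) = T (mulS m n) g := by
  funext z
  have h := integral_mul_conv (reflAt (ker m) z) (ker n) hg
  simp only [reflAt_apply] at h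
  unfold T
  rw [h]
  congr 1
  funext w
  congr 1
  rw [ker_mulS, ← integral_sub_left_eq_self _ volume z]
  congr 1
  funext y
  rw [sub_right_comm z y w, sub_sub_self]

lemma T_add_fun (m : Test d) {g h : Phase d → ℂ} (hg : Tame g) (hh : Tame h) (z : Phase d) :
    T m (fun w => g w + h w) z = T m g z + T m h z := by
  unfold T
  rw [← integral_add (integrable_T m hg z) (integrable_T m hh z)]
  simp only [mul_add]

lemma T_const_mul (m : Test d) (c : ℂ) (g : Phase d → ℂ) (z : Phase d) :
    T m (fun w => c * g w) z = c * T m g z := by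
  unfold T
  rw [← integral_const_mul]
  congr 1; funext w; ring

lemma ker_add (m n : Test d) : ker (m + n) = ker m + ker n := fourierInv_add m n

lemma T_add_sym (m n : Test d) {g : Phase d → ℂ} (hg : Tame g) (z : Phase d) :
    T (m + n) g z = T m g z + T n g z := by
  unfold T
  rw [← integral_add (integrable_T m hg z) (integrable_T n hg z), ker_add]
  simp only [add_apply, add_mul]

lemma ker_smul (c : ℂ) (m : Test d) : ker (c • m) = c • ker m := fourierInv_smul c m

lemma ker_zero : ker (0 : Test d) = 0 := by
  have := ker_smul 0 (0 : Test d)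
  simpa using this

lemma T_zero_sym (g : Phase d → ℂ) : T (0 : Test d) g = fun _ => 0 := by
  funext z; simp [T, ker_zero]

lemma ker_sum {ι : Type*} (s : Finset ι) (m : ι → Test d) : ker (∑ i ∈ s, m i) = ∑ i ∈ s, ker (m i) := by
  classical
  induction s using Finset.induction_on with
  | empty => simp [ker_zero]
  | insert a s ha ih => rw [Finset.sum_insert ha, Finset.sum_insert ha, ker_add, ih]

lemma T_sum_sym {ι : Type*} (s : Finset ι) (m : ι → Test d) {g : Phase d → ℂ} (hg : Tame g)
    (z : Phase d) : T (∑ i ∈ s, m i) g z = ∑ i ∈ s, T (m i) g z := by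
  classical
  induction s using Finset.induction_on with
  | empty => simp [T_zero_sym]
  | insert a s ha ih => rw [Finset.sum_insert ha, Finset.sum_insert ha, T_add_sym _ _ hg, ih]

/-- The norm of a symbol in the Wiener algebra: the `L¹` norm of its kernel. -/
def wiener (m : Test d) : ℝ≥0∞ := ∫⁻ z, ‖ker m z‖ₑ

lemma wiener_lt_top (m : Test d) : wiener m < ⊤ := (ker m).integrable.2

lemma enorm_T_le (m : Test d) (g : Phase d → ℂ) (z : Phase d) :
    ‖T m g z‖ₑ ≤ ∫⁻ y, ‖ker m y‖ₑ * ‖g (z - y)‖ₑ := by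
  refine (enorm_integral_le_lintegral_enorm _).trans (le_of_eq ?_)
  rw [← lintegral_sub_left_eq_self _ z]
  simp [enorm_mul]

/-- A Fourier multiplier acts on the mixed Lebesgue space with norm at most that of its symbol in
the Wiener algebra. -/
lemma mx_T_le (hp : Adm p) (m : Test d) {g : Phase d → ℂ} (hg : Measurable g) :
    mx p (fun z => ‖T m g z‖ₑ) ≤ wiener m * mx p (fun z => ‖g z‖ₑ) := by
  have hk := (ker m).continuous.measurable
  refine (mx_mono hp (enorm_T_le m g)).trans ?_
  refine (mx_lintegral_le hp (F := fun z y => ‖ker m y‖ₑ * ‖g (z - y)‖ₑ) ?_).trans ?_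
  · exact (hk.comp measurable_snd).enorm.mul (hg.comp (measurable_fst.sub measurable_snd)).enorm
  · unfold wiener
    rw [← lintegral_mul_const _ hk.enorm]
    refine lintegral_mono fun y => ?_
    rw [mx_const_mul hp _ enorm_ne_top, mx_comp_sub (fun z => ‖g z‖ₑ)]

lemma enorm_T_le_of_bounded (m : Test d) {g : Phase d → ℂ} {B : ℝ≥0∞} (hB : ∀ z, ‖g z‖ₑ ≤ B)
    (z : Phase d) : ‖T m g z‖ₑ ≤ wiener m * B := by
  refine (enorm_T_le m g z).trans ?_
  have hk := (ker m).continuous.measurable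
  unfold wiener
  rw [← lintegral_mul_const _ hk.enorm]
  exact lintegral_mono fun y => mul_le_mul_right (hB _) _

lemma lintegral_T_le (m : Test d) {g : Phase d → ℂ} (hg : Measurable g) :
    ∫⁻ z, ‖T m g z‖ₑ ≤ wiener m * ∫⁻ z, ‖g z‖ₑ := by
  have hk := (ker m).continuous.measurable
  refine (lintegral_mono (enorm_T_le m g)).trans ?_
  rw [lintegral_lintegral_swap]
  · unfold wiener
    rw [← lintegral_mul_const _ hk.enorm]
    refine lintegral_mono fun y => ?_
    rw [lintegral_const_mul' _ _ enorm_ne_top, lintegral_sub_right_eq_self (fun z => ‖g z‖ₑ) y]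
  · exact ((hk.comp measurable_snd).enorm.mul
      (hg.comp (measurable_fst.sub measurable_snd)).enorm).aemeasurable

/-- A Fourier multiplier maps the mixed Lebesgue space to bounded functions. -/
lemma enorm_T_le_mx (hp : Adm p) (m : Test d) {g : Phase d → ℂ} (hg : Measurable g) (z : Phase d) :
    ‖T m g z‖ₑ ≤ mx (conjPair p) (fun y => ‖ker m y‖ₑ) * mx p (fun z => ‖g z‖ₑ) := by
  have hk := (ker m).continuous.measurable
  refine (enorm_integral_le_lintegral_enorm _).trans ?_
  simp only [enorm_mul]
  rw [mul_comm (mx _ _)]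
  have e : mx (conjPair p) (fun y => ‖ker m y‖ₑ) = mx (conjPair p) (fun y => ‖ker m (z - y)‖ₑ) := by
    rw [← mx_comp_neg (fun y => ‖ker m y‖ₑ), ← mx_comp_sub _ z]
    congr 1
    funext y
    rw [neg_sub]
  rw [e]
  simp_rw [mul_comm ‖ker m _‖ₑ]
  exact lintegral_mul_le_mx hp hg.enorm (hk.comp (by fun_prop)).enorm

lemma wiener_mulS_le (m n : Test d) : wiener (mulS m n) ≤ wiener m * wiener n := by
  have hk := (ker n).continuous.measurable
  have e : ∀ z, ker (mulS m n) z = T m (ker n) z := fun z => by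
    rw [ker_mulS, T, ← integral_sub_left_eq_self _ volume z]
    simp
  unfold wiener
  simp_rw [e]
  exact lintegral_T_le m hk

lemma wiener_smul (c : ℂ) (m : Test d) : wiener (c • m) = ‖c‖ₑ * wiener m := by
  unfold wiener
  rw [← lintegral_const_mul' _ _ enorm_ne_top, ker_smul]
  simp

lemma wiener_add_le (m n : Test d) : wiener (m + n) ≤ wiener m + wiener n := by
  have hk := (ker m).continuous.measurable
  unfold wiener
  rw [← lintegral_add_left hk.enorm, ker_add]
  exact lintegral_mono fun z => enorm_add_le _ _

/-! ### Shears and dilations -/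

/-- The shear `(ξ, η) ↦ (ξ, η + r ξ)` of the frequency variables, the transpose of `shear r`. -/
def fshear (r : ℝ) (ξ : Phase d) : Phase d := pt (posn ξ) (velo ξ + r • posn ξ)

/-- The anisotropic dilation `(x, v) ↦ (s³ x, s v)`. -/
def dil (s : ℝ) (z : Phase d) : Phase d := pt (s ^ 3 • posn z) (s • velo z)

@[simp] lemma posn_shear (r : ℝ) (z : Phase d) : posn (shear r z) = posn z + r • velo z := by
  simp [shear]
@[simp] lemma velo_shear (r : ℝ) (z : Phase d) : velo (shear r z) = velo z := by simp [shear]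
@[simp] lemma posn_fshear (r : ℝ) (z : Phase d) : posn (fshear r z) = posn z := by simp [fshear]
@[simp] lemma velo_fshear (r : ℝ) (z : Phase d) : velo (fshear r z) = velo z + r • posn z := by
  simp [fshear]
@[simp] lemma posn_dil (s : ℝ) (z : Phase d) : posn (dil s z) = s ^ 3 • posn z := by simp [dil]
@[simp] lemma velo_dil (s : ℝ) (z : Phase d) : velo (dil s z) = s • velo z := by simp [dil]

lemma shear_shear (r s : ℝ) (z : Phase d) : shear r (shear s z) = shear (r + s) z :=
  phase_ext (by simp [add_smul]; abel) (by simp)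
lemma fshear_fshear (r s : ℝ) (z : Phase d) : fshear r (fshear s z) = fshear (r + s) z :=
  phase_ext (by simp) (by simp [add_smul]; abel)
@[simp] lemma shear_zero (z : Phase d) : shear 0 z = z := phase_ext (by simp) (by simp)
@[simp] lemma fshear_zero (z : Phase d) : fshear 0 z = z := phase_ext (by simp) (by simp)
lemma dil_dil (r s : ℝ) (z : Phase d) : dil r (dil s z) = dil (r * s) z :=
  phase_ext (by simp [smul_smul, mul_pow]) (by simp [smul_smul])
@[simp] lemma dil_one (z : Phase d) : dil 1 z = z := phase_ext (by simp) (by simp)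
lemma shear_sub (r : ℝ) (z w : Phase d) : shear r (z - w) = shear r z - shear r w :=
  phase_ext (by simp [smul_sub]; abel) (by simp)

/-- `shear r` as a continuous linear equivalence. -/
def shearE (r : ℝ) : Phase d ≃L[ℝ] Phase d :=
  LinearEquiv.toContinuousLinearEquiv
    { toFun := shear r, invFun := shear (-r),
      map_add' := fun z w => phase_ext (by simp [smul_add]; abel) (by simp),
      map_smul' := fun c z => phase_ext (by simp [smul_add, smul_comm c r]) (by simp),
      left_inv := fun z => by simp [shear_shear], right_inv := fun z => by simp [shear_shear] }

/-- `fshear r` as a continuous linear equivalence. -/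
def fshearE (r : ℝ) : Phase d ≃L[ℝ] Phase d :=
  LinearEquiv.toContinuousLinearEquiv
    { toFun := fshear r, invFun := fshear (-r),
      map_add' := fun z w => phase_ext (by simp) (by simp [smul_add]; abel),
      map_smul' := fun c z => phase_ext (by simp) (by simp [smul_add, smul_comm c r]),
      left_inv := fun z => by simp [fshear_fshear], right_inv := fun z => by simp [fshear_fshear] }

/-- `dil s` as a continuous linear equivalence. -/
def dilE (s : ℝ) (hs : s ≠ 0) : Phase d ≃L[ℝ] Phase d :=
  LinearEquiv.toContinuousLinearEquiv
    { toFun := dil s, invFun := dil s⁻¹,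
      map_add' := fun z w => phase_ext (by simp) (by simp),
      map_smul' := fun c z => phase_ext (by simp [smul_comm c]) (by simp [smul_comm c]),
      left_inv := fun z => by simp [dil_dil, hs], right_inv := fun z => by simp [dil_dil, hs] }

/-- Composition of a Schwartz function with `shear r`. -/
def compShear (r : ℝ) (φ : Test d) : Test d := compCLMOfContinuousLinearEquiv ℂ (shearE r) φ
/-- Composition of a symbol with `fshear r`. -/
def compFshear (r : ℝ) (m : Test d) : Test d :=
  compCLMOfContinuousLinearEquiv ℂ (fshearE r) m
/-- Composition of a symbol with `dil s`, for `s ≠ 0`. -/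
def compDil (s : ℝ) (m : Test d) : Test d :=
  if hs : s ≠ 0 then compCLMOfContinuousLinearEquiv ℂ (dilE s hs) m else 0

@[simp] lemma compShear_apply (r : ℝ) (φ : Test d) (z : Phase d) : compShear r φ z = φ (shear r z) := rfl
@[simp] lemma compFshear_apply (r : ℝ) (φ : Test d) (z : Phase d) :
    compFshear r φ z = φ (fshear r z) := rfl
lemma compDil_apply {s : ℝ} (hs : 0 < s) (φ : Test d) (z : Phase d) :
    compDil s φ z = φ (dil s z) := by
  rw [compDil, dif_pos hs.ne']; rfl

lemma compDil_compDil {r s : ℝ} (hr : 0 < r) (hs : 0 < s) (φ : Test d) :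
    compDil r (compDil s φ) = compDil (s * r) φ := by
  ext z; rw [compDil_apply hr, compDil_apply hs, compDil_apply (by positivity), dil_dil]

lemma compDil_mulS {s : ℝ} (hs : 0 < s) (m n : Test d) :
    compDil s (mulS m n) = mulS (compDil s m) (compDil s n) := by
  ext z; simp [compDil_apply hs]

lemma compFshear_mulS (r : ℝ) (m n : Test d) :
    compFshear r (mulS m n) = mulS (compFshear r m) (compFshear r n) := by
  ext z; simp

/-- Tonelli's theorem in phase space, integrating first over velocities. -/
lemma lintegral_phase' {f : Phase d → ℝ≥0∞} (hf : Measurable f) :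
    ∫⁻ z, f z = ∫⁻ x : Vec d, ∫⁻ v : Vec d, f (pt x v) := by
  rw [← measurePreserving_pt.lintegral_comp hf, lintegral_prod]
  exact (hf.comp (measurable_pt measurable_fst measurable_snd)).aemeasurable

lemma measurePreserving_of_lintegral {L : Phase d → Phase d} (hL : Measurable L)
    (h : ∀ f : Phase d → ℝ≥0∞, Measurable f → ∫⁻ z, f (L z) = ∫⁻ z, f z) :
    MeasurePreserving L := by
  refine ⟨hL, Measure.ext fun s hs => ?_⟩
  rw [Measure.map_apply hL hs, ← lintegral_indicator_one hs, ← lintegral_indicator_one (hL hs),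
    ← h _ (measurable_one.indicator hs)]
  rfl

lemma measurePreserving_shear (r : ℝ) : MeasurePreserving (shear r : Phase d → Phase d) := by
  refine measurePreserving_of_lintegral (shearE r).continuous.measurable fun f hf => ?_
  rw [lintegral_phase (f := fun z => f (shear r z)) (hf.comp (shearE r).continuous.measurable),
    lintegral_phase hf]
  congr 1; funext v
  simp only [shear, posn_pt, velo_pt]
  exact lintegral_add_right_eq_self (fun x : Vec d => f (pt x v)) (r • v)

lemma measurePreserving_fshear (r : ℝ) : MeasurePreserving (fshear r : Phase d → Phase d) := by
  refine measurePreserving_of_lintegral (fshearE r).continuous.measurable fun f hf => ?_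
  rw [lintegral_phase' (f := fun z => f (fshear r z)) (hf.comp (fshearE r).continuous.measurable),
    lintegral_phase' hf]
  congr 1; funext x
  simp only [fshear, posn_pt, velo_pt]
  exact lintegral_add_right_eq_self (fun v : Vec d => f (pt x v)) (r • x)

lemma integral_comp_shear {E : Type*} [NormedAddCommGroup E] [NormedSpace ℝ E] (r : ℝ)
    (f : Phase d → E) : ∫ z, f (shear r z) = ∫ z, f z :=
  (measurePreserving_shear r).integral_comp (shearE r).toHomeomorph.measurableEmbedding f

lemma integral_comp_fshear {E : Type*} [NormedAddCommGroup E] [NormedSpace ℝ E] (r : ℝ)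
    (f : Phase d → E) : ∫ z, f (fshear r z) = ∫ z, f z :=
  (measurePreserving_fshear r).integral_comp (fshearE r).toHomeomorph.measurableEmbedding f

lemma lintegral_comp_smul_vec {s : ℝ} (hs : 0 < s) {f : Vec d → ℝ≥0∞} (hf : Measurable f) :
    ∫⁻ x, f (s • x) = ENNReal.ofReal (s ^ d)⁻¹ * ∫⁻ x, f x := by
  have h := Measure.map_addHaar_smul (volume : Measure (Vec d)) hs.ne'
  rw [finrank_euclideanSpace_fin, abs_of_pos (by positivity)] at h
  rw [← lintegral_map hf (measurable_const_smul s), h, lintegral_smul_measure, smul_eq_mul]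

lemma lintegral_comp_dil {s : ℝ} (hs : 0 < s) {f : Phase d → ℝ≥0∞} (hf : Measurable f) :
    ∫⁻ z, f (dil s z) = ENNReal.ofReal (s ^ (4 * d))⁻¹ * ∫⁻ z, f z := by
  rw [lintegral_phase (f := fun z => f (dil s z)) (hf.comp (dilE s hs.ne').continuous.measurable),
    lintegral_phase hf]
  simp only [dil, posn_pt, velo_pt]
  have e : ∀ v : Vec d, ∫⁻ x, f (pt (s ^ 3 • x) (s • v)) =
      ENNReal.ofReal ((s ^ 3) ^ d)⁻¹ * ∫⁻ x, f (pt x (s • v)) := fun v =>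
    lintegral_comp_smul_vec (by positivity) (f := fun x : Vec d => f (pt x (s • v)))
      (hf.comp (measurable_pt measurable_id measurable_const))
  simp_rw [e]
  rw [lintegral_const_mul' _ _ ofReal_ne_top,
    lintegral_comp_smul_vec hs (f := fun v : Vec d => ∫⁻ x, f (pt x v)), ← mul_assoc,
    ← ENNReal.ofReal_mul (by positivity)]
  · congr 2
    rw [← mul_inv, ← pow_mul, ← pow_add]
    ring_nf
  · exact Measurable.lintegral_prod_right' (f := fun a : Vec d × Vec d => f (pt a.2 a.1))
      (hf.comp (measurable_pt measurable_snd measurable_fst))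

lemma map_dil {s : ℝ} (hs : 0 < s) : Measure.map (dil s) (volume : Measure (Phase d)) =
    ENNReal.ofReal (s ^ (4 * d))⁻¹ • volume := by
  have hm : Measurable (dil s : Phase d → Phase d) := (dilE s hs.ne').continuous.measurable
  refine Measure.ext fun t ht => ?_
  have := lintegral_comp_dil (d := d) hs (measurable_one.indicator ht)
  rw [Measure.map_apply hm ht, ← lintegral_indicator_one (hm ht), Measure.smul_apply,
    ← lintegral_indicator_one ht, smul_eq_mul, ← this]
  rfl

lemma integral_comp_dil {E : Type*} [NormedAddCommGroup E] [NormedSpace ℝ E] {s : ℝ} (hs : 0 < s)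
    (f : Phase d → E) : ∫ z, f (dil s z) = (s ^ (4 * d))⁻¹ • ∫ z, f z := by
  have h : MeasurableEmbedding (dil s : Phase d → Phase d) :=
    (dilE s hs.ne').toHomeomorph.measurableEmbedding
  rw [← h.integral_map, map_dil hs, integral_smul_measure, ENNReal.toReal_ofReal (by positivity)]

lemma ker_eq_integral (m : Test d) (z : Phase d) :
    ker m z = ∫ ξ, Complex.exp ((2 * π * inner ℝ ξ z : ℝ) * Complex.I) • m ξ := by
  rw [ker, SchwartzMap.fourierInv_coe, Real.fourierInv_eq']

lemma inner_fshear (r : ℝ) (ξ z : Phase d) : inner ℝ (fshear r ξ) z = inner ℝ ξ (shear r z) := by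
  simp only [inner_phase, posn_fshear, velo_fshear, posn_shear, velo_shear, inner_add_left,
    inner_add_right, real_inner_smul_left, real_inner_smul_right]
  ring

lemma inner_dil (s : ℝ) (ξ z : Phase d) : inner ℝ (dil s ξ) z = inner ℝ ξ (dil s z) := by
  simp only [inner_phase, posn_dil, velo_dil, real_inner_smul_left, real_inner_smul_right]

lemma ker_compFshear (r : ℝ) (m : Test d) (z : Phase d) :
    ker (compFshear r m) z = ker m (shear (-r) z) := by
  symm
  rw [ker_eq_integral, ker_eq_integral, ← integral_comp_fshear r]
  congr 1; funext ξ
  rw [inner_fshear, shear_shear]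
  simp

lemma ker_compDil {s : ℝ} (hs : 0 < s) (m : Test d) (z : Phase d) :
    ker (compDil s m) z = ((s ^ (4 * d))⁻¹ : ℝ) • ker m (dil s⁻¹ z) := by
  rw [ker_eq_integral, ker_eq_integral, ← integral_comp_dil hs]
  congr 1; funext ξ
  rw [inner_dil, dil_dil, compDil_apply hs, mul_inv_cancel₀ hs.ne', dil_one]

lemma wiener_compFshear (r : ℝ) (m : Test d) : wiener (compFshear r m) = wiener m := by
  unfold wiener
  simp_rw [ker_compFshear]
  exact (measurePreserving_shear (-r)).lintegral_comp (ker m).continuous.measurable.enorm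

lemma wiener_compDil {s : ℝ} (hs : 0 < s) (m : Test d) : wiener (compDil s m) = wiener m := by
  unfold wiener
  have e : ∀ z, ‖ker (compDil s m) z‖ₑ =
      ENNReal.ofReal (s ^ (4 * d))⁻¹ * ‖ker m (dil s⁻¹ z)‖ₑ := fun z => by
    rw [ker_compDil hs, enorm_smul, Real.enorm_of_nonneg (by positivity)]
  simp_rw [e]
  rw [lintegral_const_mul' _ _ ofReal_ne_top,
    lintegral_comp_dil (inv_pos.2 hs) (f := fun z => ‖ker m z‖ₑ) (ker m).continuous.measurable.enorm,
    ← mul_assoc, ← ENNReal.ofReal_mul (by positivity)]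
  have : (s ^ (4 * d))⁻¹ * (s⁻¹ ^ (4 * d))⁻¹ = 1 := by
    rw [inv_pow, inv_inv]
    exact inv_mul_cancel₀ (by positivity)
  rw [this, ENNReal.ofReal_one, one_mul]

/-- Conjugation of a Fourier multiplier by the free transport shears its symbol. -/
lemma T_comp_shear (m : Test d) (r : ℝ) (g : Phase d → ℂ) (z : Phase d) :
    T m (fun w => g (shear r w)) z = T (compFshear r m) g (shear r z) := by
  unfold T
  symm
  rw [← integral_comp_shear r]
  congr 1; funext w
  rw [ker_compFshear, ← shear_sub, shear_shear]
  simp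

/-- A symbol with `m (-ξ) = conj (m ξ)`; its kernel is real. -/
def Herm (m : Test d) : Prop := ∀ ξ, m (-ξ) = (starRingEnd ℂ) (m ξ)

lemma Herm.ker_im {m : Test d} (hm : Herm m) (z : Phase d) : (ker m z).im = 0 := by
  rw [← Complex.conj_eq_iff_im, ker_eq_integral, ← integral_conj, ← integral_neg_eq_self]
  congr 1; funext ξ
  simp only [smul_eq_mul, map_mul, hm ξ, Complex.conj_conj, ← Complex.exp_conj,
    Complex.conj_ofReal, Complex.conj_I, inner_neg_left]
  congr 2
  push_cast
  ring

lemma Herm.T_im {m : Test d} (hm : Herm m) {g : Phase d → ℂ} (hg : ∀ z, (g z).im = 0)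
    (z : Phase d) : (T m g z).im = 0 := by
  rw [← Complex.conj_eq_iff_im, T, ← integral_conj]
  congr 1; funext w
  rw [map_mul, Complex.conj_eq_iff_im.2 (hm.ker_im _), Complex.conj_eq_iff_im.2 (hg w)]

/-- The reflected symbol `ξ ↦ m (-ξ)`. -/
def negS (m : Test d) : Test d :=
  compCLMOfContinuousLinearEquiv ℂ (ContinuousLinearEquiv.neg ℝ) m

@[simp] lemma negS_apply (m : Test d) (ξ : Phase d) : negS m ξ = m (-ξ) := rfl

lemma ker_negS (m : Test d) (z : Phase d) : ker (negS m) z = ker m (-z) := by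
  rw [ker_eq_integral, ker_eq_integral, ← integral_neg_eq_self]
  congr 1; funext ξ
  simp

/-- The Fourier multiplier acting on test functions. -/
def TS (m : Test d) (φ : Test d) : Test d := 𝓕⁻ (mulS m (𝓕 φ))

lemma TS_apply (m φ : Test d) (z : Phase d) : TS m φ z = T m φ z := by
  have h : SchwartzMap.convolution (ContinuousLinearMap.mul ℂ ℂ) (ker m) φ = TS m φ := by
    simp [SchwartzMap.convolution, ker, TS, mulS]
  rw [← h, SchwartzMap.convolution_apply, T, ← integral_sub_left_eq_self _ volume z]
  simp only [sub_sub_self]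
  rfl

/-- The transpose of a Fourier multiplier has the reflected symbol. -/
lemma integral_T_mul (m φ : Test d) {g : Phase d → ℂ} (hg : Tame g) :
    ∫ z, φ z * T m g z = ∫ w, TS (negS m) φ w * g w := by
  unfold T
  rw [integral_mul_conv φ (ker m) hg]
  congr 1; funext w
  rw [TS_apply, T]
  congr 1
  refine integral_congr_ae (.of_forall fun z => ?_)
  simp only [ker_negS, neg_sub]
  ring

/-! ### Littlewood-Paley symbols -/

lemma anisoNorm_nonneg (z : Phase d) : 0 ≤ anisoNorm z := by unfold anisoNorm; positivity

lemma anisoNorm_dil {s : ℝ} (hs : 0 ≤ s) (z : Phase d) : anisoNorm (dil s z) = s * anisoNorm z := by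
  unfold anisoNorm
  rw [posn_dil, velo_dil, norm_smul, norm_smul, Real.norm_of_nonneg (by positivity),
    Real.norm_of_nonneg hs, Real.mul_rpow (by positivity) (norm_nonneg _), mul_add]
  congr 2
  rw [← Real.rpow_natCast, ← Real.rpow_mul hs]
  norm_num

lemma anisoNorm_add_le (z w : Phase d) : anisoNorm (z + w) ≤ anisoNorm z + anisoNorm w := by
  unfold anisoNorm
  have h1 : ‖posn (z + w)‖ ^ (1 / 3 : ℝ) ≤ ‖posn z‖ ^ (1 / 3 : ℝ) + ‖posn w‖ ^ (1 / 3 : ℝ) := by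
    refine (Real.rpow_le_rpow (norm_nonneg _) ?_ (by norm_num)).trans
      (Real.rpow_add_le_add_rpow (norm_nonneg _) (norm_nonneg _) (by norm_num) (by norm_num))
    rw [posn_add]; exact norm_add_le _ _
  have h2 : ‖velo (z + w)‖ ≤ ‖velo z‖ + ‖velo w‖ := by rw [velo_add]; exact norm_add_le _ _
  linarith

lemma norm_posn_le_anisoNorm (z : Phase d) : ‖posn z‖ ≤ anisoNorm z ^ 3 := by
  have h : ‖posn z‖ ^ (1 / 3 : ℝ) ≤ anisoNorm z := by unfold anisoNorm; linarith [norm_nonneg (velo z)]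
  calc ‖posn z‖ = (‖posn z‖ ^ (1 / 3 : ℝ)) ^ 3 := by
        rw [← Real.rpow_natCast, ← Real.rpow_mul (norm_nonneg _)]; norm_num
    _ ≤ _ := by gcongr

lemma norm_velo_le_anisoNorm (z : Phase d) : ‖velo z‖ ≤ anisoNorm z := by
  unfold anisoNorm
  have : 0 ≤ ‖posn z‖ ^ (1 / 3 : ℝ) := by positivity
  linarith

lemma continuous_anisoNorm : Continuous (anisoNorm : Phase d → ℝ) := by
  unfold anisoNorm
  exact ((continuous_posn.norm).rpow_const fun _ => Or.inr (by norm_num)).add continuous_velo.norm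

lemma anisoNorm_fshear_le {r : ℝ} (hr : 0 ≤ r) (z : Phase d) :
    anisoNorm (fshear r z) ≤ anisoNorm z + r * anisoNorm z ^ 3 := by
  have h1 : anisoNorm (fshear r z) ≤ anisoNorm z + r * ‖posn z‖ := by
    unfold anisoNorm
    rw [posn_fshear, velo_fshear]
    have := norm_add_le (velo z) (r • posn z)
    rw [norm_smul, Real.norm_of_nonneg hr] at this
    linarith
  have := mul_le_mul_of_nonneg_left (norm_posn_le_anisoNorm z) hr
  linarith

lemma anisoNorm_le_fshear {r : ℝ} (hr : 0 ≤ r) (z : Phase d) :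
    anisoNorm z ≤ anisoNorm (fshear r z) + r * anisoNorm (fshear r z) ^ 3 := by
  have h1 : anisoNorm z ≤ anisoNorm (fshear r z) + r * ‖posn (fshear r z)‖ := by
    unfold anisoNorm
    rw [posn_fshear, velo_fshear]
    have := norm_sub_le (velo z + r • posn z) (r • posn z)
    rw [norm_smul, Real.norm_of_nonneg hr, add_sub_cancel_right] at this
    linarith
  have := mul_le_mul_of_nonneg_left (norm_posn_le_anisoNorm (fshear r z)) hr
  linarith

/-- The gauge `|2πξ|ₐ`, which localizes the symbols for the library's Fourier transform. -/
def gauge (ξ : Phase d) : ℝ := anisoNorm ((2 * π) • ξ)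

lemma smul_dil (c s : ℝ) (z : Phase d) : c • dil s z = dil s (c • z) :=
  phase_ext (by simp [smul_comm c]) (by simp [smul_comm c])

lemma smul_fshear (c s : ℝ) (z : Phase d) : c • fshear s z = fshear s (c • z) :=
  phase_ext (by simp) (by simp [smul_comm c])

lemma gauge_nonneg (ξ : Phase d) : 0 ≤ gauge ξ := anisoNorm_nonneg _
lemma gauge_dil {s : ℝ} (hs : 0 ≤ s) (ξ : Phase d) : gauge (dil s ξ) = s * gauge ξ := by
  rw [gauge, smul_dil, anisoNorm_dil hs, gauge]
lemma gauge_add_le (ξ η : Phase d) : gauge (ξ + η) ≤ gauge ξ + gauge η := by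
  rw [gauge, smul_add]; exact anisoNorm_add_le _ _
lemma gauge_fshear_le {r : ℝ} (hr : 0 ≤ r) (ξ : Phase d) :
    gauge (fshear r ξ) ≤ gauge ξ + r * gauge ξ ^ 3 := by
  rw [gauge, smul_fshear]; exact anisoNorm_fshear_le hr _
lemma gauge_le_fshear {r : ℝ} (hr : 0 ≤ r) (ξ : Phase d) :
    gauge ξ ≤ gauge (fshear r ξ) + r * gauge (fshear r ξ) ^ 3 := by
  rw [gauge, gauge, smul_fshear]; exact anisoNorm_le_fshear hr _
lemma continuous_gauge : Continuous (gauge : Phase d → ℝ) :=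
  continuous_anisoNorm.comp (continuous_const_smul _)
@[simp] lemma gauge_zero : gauge (0 : Phase d) = 0 := by simp [gauge, anisoNorm]

lemma isCompact_gauge_le (R : ℝ) : IsCompact {ξ : Phase d | gauge ξ ≤ R} := by
  refine Metric.isCompact_of_isClosed_isBounded (isClosed_le continuous_gauge continuous_const) ?_
  refine (Metric.isBounded_iff_subset_closedBall 0).2 ⟨R ^ 3 + R, fun ξ (hξ : gauge ξ ≤ R) => ?_⟩
  have h1 := norm_posn_le_anisoNorm ((2 * π) • ξ)
  have h2 := norm_velo_le_anisoNorm ((2 * π) • ξ)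
  rw [← gauge] at h1 h2
  have h3 : gauge ξ ^ 3 ≤ R ^ 3 := by have := gauge_nonneg ξ; gcongr
  have h4 := norm_le_posn_add_velo ((2 * π) • ξ)
  rw [norm_smul, Real.norm_of_nonneg (by positivity)] at h4
  rw [mem_closedBall_zero_iff]
  nlinarith [Real.pi_gt_three, norm_nonneg ξ]

lemma hasCompactSupport_of_gauge {E : Type*} [Zero E] {f : Phase d → E} (R : ℝ)
    (h : ∀ ξ, R < gauge ξ → f ξ = 0) : HasCompactSupport f :=
  HasCompactSupport.intro (isCompact_gauge_le R) fun ξ hξ => h ξ (not_le.1 hξ)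

/-- The data of the Littlewood-Paley decompositions: an anisotropic cutoff, and a cutoff in the
position frequencies. The latter may also be identically `1`, in which case the decomposition in
`x` is trivial; this makes the anisotropic Besov norm a special case of the mixed one. -/
structure LP (d : ℕ) where
  χ : Phase d → ℝ
  hχ : IsCutoff anisoNorm χ
  χx : Vec d → ℝ
  smooth : ContDiff ℝ ∞ χx
  even : ∀ ξ, χx (-ξ) = χx ξ
  eq_one : ∀ ξ, ‖ξ‖ ≤ 1 → χx ξ = 1
  supp : (∀ ξ, 2 < ‖ξ‖ → χx ξ = 0) ∨ ∀ ξ, χx ξ = 1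

namespace LP
variable (D : LP d)

/-- The base cutoff symbol `ξ ↦ χ(2πξ)`. -/
def c : Test d :=
  HasCompactSupport.toSchwartzMap (f := fun ξ : Phase d => (D.χ ((2 * π) • ξ) : ℂ))
    (hasCompactSupport_of_gauge 2 fun ξ hξ => by simp [D.hχ.eq_zero _ hξ])
    (Complex.ofRealCLM.contDiff.comp (D.hχ.smooth.comp (contDiff_const_smul _)))

lemma c_apply (ξ : Phase d) : D.c ξ = (D.χ ((2 * π) • ξ) : ℂ) := rfl
lemma c_eq_one {ξ : Phase d} (h : gauge ξ ≤ 1) : D.c ξ = 1 := by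
  rw [c_apply, D.hχ.eq_one _ h]; simp
lemma c_eq_zero {ξ : Phase d} (h : 2 < gauge ξ) : D.c ξ = 0 := by
  rw [c_apply, D.hχ.eq_zero _ h]; simp
lemma c_neg (ξ : Phase d) : D.c (-ξ) = D.c ξ := by rw [c_apply, c_apply, smul_neg, D.hχ.even]
lemma c_im (ξ : Phase d) : (D.c ξ).im = 0 := by rw [c_apply]; simp

/-- The low-pass symbol at frequency `2^n`. -/
def cut (n : ℕ) : Test d := compDil ((2 : ℝ) ^ n)⁻¹ D.c

lemma cut_apply (n : ℕ) (ξ : Phase d) : D.cut n ξ = D.c (dil ((2 : ℝ) ^ n)⁻¹ ξ) :=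
  compDil_apply (by positivity) _ _

lemma cut_eq_one {n : ℕ} {ξ : Phase d} (h : gauge ξ ≤ 2 ^ n) : D.cut n ξ = 1 := by
  rw [cut_apply, c_eq_one]
  rw [gauge_dil (by positivity), inv_mul_le_iff₀ (by positivity)]
  simpa using h

lemma cut_eq_zero {n : ℕ} {ξ : Phase d} (h : 2 ^ (n + 1) < gauge ξ) : D.cut n ξ = 0 := by
  rw [cut_apply, c_eq_zero]
  rw [gauge_dil (by positivity), lt_inv_mul_iff₀ (by positivity), ← pow_succ]
  exact h

/-- The symbol of the block `Rᵃ_j`. -/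
def phi : ℕ → Test d
  | 0 => D.cut 0
  | j + 1 => D.cut (j + 1) - D.cut j

/-- A symbol that is `1` on the support of `phi l`, with support in a slightly larger annulus. -/
def psi (l : ℕ) : Test d := if 2 ≤ l then D.cut (l + 1) - D.cut (l - 2) else D.cut (l + 1)

lemma phi_eq_anisoPart (j : ℕ) (ξ : Phase d) :
    D.phi j ξ = (anisoPart D.χ j ((2 * π) • ξ) : ℂ) := by
  have e : ∀ (n : ℕ) (ξ : Phase d), anisoShrink n ξ = dil ((2 : ℝ) ^ n)⁻¹ ξ := fun n ξ =>
    phase_ext (by simp [anisoShrink, ← inv_pow, ← pow_mul, mul_comm]) (by simp [anisoShrink])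
  cases j with
  | zero => simp [phi, anisoPart, cut_apply, c_apply]
  | succ j => simp [phi, anisoPart, cut_apply, c_apply, e, smul_dil]

lemma phi_eq_zero_of_gt {j : ℕ} {ξ : Phase d} (h : 2 ^ (j + 1) < gauge ξ) : D.phi j ξ = 0 := by
  cases j with
  | zero => exact D.cut_eq_zero h
  | succ j =>
    have : (2 : ℝ) ^ (j + 1) ≤ 2 ^ (j + 1 + 1) := by gcongr <;> norm_num
    rw [phi, sub_apply, D.cut_eq_zero h, D.cut_eq_zero (this.trans_lt h), sub_zero]

lemma phi_succ_eq_zero_of_le {j : ℕ} {ξ : Phase d} (h : gauge ξ ≤ 2 ^ j) : D.phi (j + 1) ξ = 0 := by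
  have : (2 : ℝ) ^ j ≤ 2 ^ (j + 1) := by gcongr <;> norm_num
  rw [phi, sub_apply, D.cut_eq_one h, D.cut_eq_one (h.trans this), sub_self]

lemma psi_eq_zero_of_gt {l : ℕ} {ξ : Phase d} (h : 2 ^ (l + 2) < gauge ξ) : D.psi l ξ = 0 := by
  unfold psi
  split_ifs with hl
  · have : (2 : ℝ) ^ (l - 2 + 1) ≤ 2 ^ (l + 2) := pow_le_pow_right₀ (by norm_num) (by omega)
    rw [sub_apply, D.cut_eq_zero h, D.cut_eq_zero (this.trans_lt h), sub_zero]
  · exact D.cut_eq_zero h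

lemma psi_eq_zero_of_le {l : ℕ} (hl : 2 ≤ l) {ξ : Phase d} (h : gauge ξ ≤ 2 ^ (l - 2)) :
    D.psi l ξ = 0 := by
  have : (2 : ℝ) ^ (l - 2) ≤ 2 ^ (l + 1) := pow_le_pow_right₀ (by norm_num) (by omega)
  rw [psi, if_pos hl, sub_apply, D.cut_eq_one h, D.cut_eq_one (h.trans this), sub_self]

lemma psi_mul_phi (l : ℕ) (ξ : Phase d) : D.psi l ξ * D.phi l ξ = D.phi l ξ := by
  by_cases h1 : 2 ^ (l + 1) < gauge ξ
  · rw [D.phi_eq_zero_of_gt h1, mul_zero]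
  push Not at h1
  by_cases hl : 2 ≤ l
  · obtain ⟨n, rfl⟩ : ∃ n, l = n + 2 := ⟨l - 2, by omega⟩
    by_cases h2 : gauge ξ ≤ 2 ^ (n + 1)
    · rw [D.phi_succ_eq_zero_of_le h2, mul_zero]
    · push Not at h2
      rw [psi, if_pos hl, sub_apply, D.cut_eq_one h1, Nat.add_sub_cancel, D.cut_eq_zero h2]
      simp
  · rw [psi, if_neg hl, D.cut_eq_one h1, one_mul]

lemma mulS_psi_phi (l : ℕ) : mulS (D.psi l) (D.phi l) = D.phi l := by
  ext ξ; exact D.psi_mul_phi l ξ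

lemma sum_phi (J : ℕ) : ∑ j ∈ Finset.range (J + 1), D.phi j = D.cut J := by
  induction J with
  | zero => simp [phi]
  | succ J ih => rw [Finset.sum_range_succ, ih, phi]; abel

lemma dil_neg (s : ℝ) (z : Phase d) : dil s (-z) = -dil s z := phase_ext (by simp) (by simp)
lemma cut_neg (n : ℕ) (ξ : Phase d) : D.cut n (-ξ) = D.cut n ξ := by
  rw [cut_apply, cut_apply, dil_neg, c_neg]
lemma cut_im (n : ℕ) (ξ : Phase d) : (D.cut n ξ).im = 0 := by rw [cut_apply, c_im]

lemma phi_neg (j : ℕ) (ξ : Phase d) : D.phi j (-ξ) = D.phi j ξ := by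
  cases j <;> simp [phi, cut_neg]
lemma phi_im (j : ℕ) (ξ : Phase d) : (D.phi j ξ).im = 0 := by
  cases j <;> simp [phi, cut_im]
lemma psi_neg (j : ℕ) (ξ : Phase d) : D.psi j (-ξ) = D.psi j ξ := by
  unfold psi; split_ifs <;> simp [cut_neg]
lemma herm_phi (j : ℕ) : Herm (D.phi j) := fun ξ => by
  rw [phi_neg, Complex.conj_eq_iff_im.2 (D.phi_im j ξ)]
lemma negS_phi (j : ℕ) : negS (D.phi j) = D.phi j := by ext ξ; simp [phi_neg]
lemma negS_psi (j : ℕ) : negS (D.psi j) = D.psi j := by ext ξ; simp [psi_neg]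
/-- The annular symbol of which the `phi (j + 1)` are dilations. -/
def annPhi : Test d := compDil 2⁻¹ D.c - D.c
/-- The annular symbol of which the `psi (l + 2)` are dilations. -/
def annPsi : Test d := compDil 8⁻¹ D.c - D.c

lemma annPhi_eq_zero {ξ : Phase d} (h : gauge ξ ≤ 1) : D.annPhi ξ = 0 := by
  rw [annPhi, sub_apply, compDil_apply (by norm_num), D.c_eq_one h, D.c_eq_one, sub_self]
  rw [gauge_dil (by norm_num)]; linarith

lemma annPsi_eq_zero {ξ : Phase d} (h : gauge ξ ≤ 1) : D.annPsi ξ = 0 := by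
  rw [annPsi, sub_apply, compDil_apply (by norm_num), D.c_eq_one h, D.c_eq_one, sub_self]
  rw [gauge_dil (by norm_num)]; linarith

lemma annPsi_supp : HasCompactSupport (D.annPsi : Phase d → ℂ) :=
  hasCompactSupport_of_gauge 16 fun ξ h => by
    rw [annPsi, sub_apply, compDil_apply (by norm_num), D.c_eq_zero (ξ := ξ) (by linarith),
      D.c_eq_zero, sub_self]
    rw [gauge_dil (by norm_num)]; linarith

lemma phi_succ (j : ℕ) : D.phi (j + 1) = compDil ((2 : ℝ) ^ j)⁻¹ D.annPhi := by
  ext ξ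
  rw [phi, sub_apply, cut_apply, cut_apply, compDil_apply (by positivity), annPhi, sub_apply,
    compDil_apply (by norm_num), dil_dil]
  congr 4
  rw [pow_succ, mul_inv, mul_comm]

lemma psi_add_two (l : ℕ) : D.psi (l + 2) = compDil ((2 : ℝ) ^ l)⁻¹ D.annPsi := by
  ext ξ
  rw [psi, if_pos (by omega), sub_apply, cut_apply, cut_apply, compDil_apply (by positivity), annPsi,
    sub_apply, compDil_apply (by norm_num), dil_dil, Nat.add_sub_cancel]
  congr 4
  rw [show l + 2 + 1 = l + 3 from rfl, pow_add, mul_inv, mul_comm]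
  norm_num

lemma wiener_cut (n : ℕ) : wiener (D.cut n) = wiener D.c := wiener_compDil (by positivity) _

lemma wiener_phi_le : ∃ C : ℝ, 0 < C ∧ ∀ j, wiener (D.phi j) ≤ ENNReal.ofReal C := by
  refine ⟨max (wiener D.c).toReal (wiener D.annPhi).toReal + 1, by positivity, fun j => ?_⟩
  cases j with
  | zero =>
    rw [phi, wiener_cut]
    refine (ENNReal.ofReal_toReal (wiener_lt_top _).ne).symm.le.trans (ofReal_le_ofReal ?_)
    linarith [le_max_left (wiener D.c).toReal (wiener D.annPhi).toReal]
  | succ j =>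
    rw [phi_succ, wiener_compDil (by positivity)]
    refine (ENNReal.ofReal_toReal (wiener_lt_top _).ne).symm.le.trans (ofReal_le_ofReal ?_)
    linarith [le_max_right (wiener D.c).toReal (wiener D.annPhi).toReal]

end LP

/-! ### Bernstein inequalities -/

/-- The real power `2 ^ x` as an extended nonnegative number. -/
def pw (x : ℝ) : ℝ≥0∞ := (2 : ℝ≥0∞) ^ x

lemma pw_add (x y : ℝ) : pw (x + y) = pw x * pw y :=
  ENNReal.rpow_add _ _ (by norm_num) (by norm_num)
@[simp] lemma pw_zero : pw 0 = 1 := by simp [pw]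
lemma pw_ne_top (x : ℝ) : pw x ≠ ⊤ := ENNReal.rpow_ne_top_of_ne_zero (by norm_num) (by norm_num)
lemma pw_ne_zero (x : ℝ) : pw x ≠ 0 := by simp [pw, ENNReal.rpow_eq_zero_iff]
lemma pw_mono {x y : ℝ} (h : x ≤ y) : pw x ≤ pw y :=
  ENNReal.rpow_le_rpow_of_exponent_le (by norm_num) h
lemma pw_eq_ofReal (x : ℝ) : pw x = ENNReal.ofReal ((2 : ℝ) ^ x) := by
  rw [← ENNReal.ofReal_rpow_of_pos (by norm_num)]; simp [pw]
lemma pw_mul_neg (x : ℝ) : pw x * pw (-x) = 1 := by rw [← pw_add]; simp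
lemma pw_nat (n : ℕ) : pw n = 2 ^ n := by simp [pw]

/-- The exponent `a · d/p = 3 d / p_x + d / p_v`. -/
def al (d : ℕ) (p : ℝ≥0∞ × ℝ≥0∞) : ℝ := 3 * (d / p.1.toReal) + d / p.2.toReal

lemma al_nonneg : 0 ≤ al d p := by unfold al; positivity

lemma al_conj (hp : Adm p) : al d (conjPair p) = 4 * d - al d p := by
  have h1 := hp.holder_x.inv_add_inv_eq_one
  have h2 := hp.holder_v.inv_add_inv_eq_one
  unfold al
  simp only [div_eq_mul_inv]
  rw [eq_sub_of_add_eq' h1, eq_sub_of_add_eq' h2]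
  ring

lemma ofReal_inv_pow_rpow {s : ℝ} (hs : 0 < s) (n : ℕ) (q : ℝ) :
    ENNReal.ofReal (s ^ n)⁻¹ ^ (1 / q) = ENNReal.ofReal (s ^ (-(n / q))) := by
  rw [ENNReal.ofReal_rpow_of_pos (by positivity), ← Real.rpow_natCast, ← Real.rpow_neg hs.le,
    ← Real.rpow_mul hs.le]
  congr 2; ring

lemma mx_comp_dil (hp : Adm p) {s : ℝ} (hs : 0 < s) {G : Phase d → ℝ≥0∞} (hG : Measurable G) :
    mx p (fun z => G (dil s z)) = ENNReal.ofReal (s ^ (-al d p)) * mx p G := by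
  have hx : 0 < p.1.toReal := zero_lt_one.trans hp.x_one_lt
  have hv : 0 < p.2.toReal := zero_lt_one.trans hp.v_one_lt
  rw [mx_eq hp, mx_eq hp]
  simp only [dil, posn_pt, velo_pt]
  have e : ∀ v : Vec d, ∫⁻ x, G (pt (s ^ 3 • x) (s • v)) ^ p.1.toReal =
      ENNReal.ofReal ((s ^ 3) ^ d)⁻¹ * ∫⁻ x, G (pt x (s • v)) ^ p.1.toReal := fun v =>
    lintegral_comp_smul_vec (by positivity) (f := fun x : Vec d => G (pt x (s • v)) ^ p.1.toReal)
      ((hG.comp (measurable_pt measurable_id measurable_const)).pow_const _)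
  have hm : Measurable fun v : Vec d => ∫⁻ x, G (pt x v) ^ p.1.toReal :=
    Measurable.lintegral_prod_right' (f := fun a : Vec d × Vec d => G (pt a.2 a.1) ^ p.1.toReal)
      ((hG.comp (measurable_pt measurable_snd measurable_fst)).pow_const _)
  simp_rw [e, ENNReal.mul_rpow_of_nonneg _ _ (one_div_nonneg.2 hx.le),
    ENNReal.mul_rpow_of_nonneg _ _ hv.le]
  rw [lintegral_const_mul' _ _ (by finiteness),
    lintegral_comp_smul_vec hs
      (f := fun v : Vec d => ((∫⁻ x, G (pt x v) ^ p.1.toReal) ^ (1 / p.1.toReal)) ^ p.2.toReal)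
      ((hm.pow_const _).pow_const _),
    ENNReal.mul_rpow_of_nonneg _ _ (one_div_nonneg.2 hv.le),
    ENNReal.mul_rpow_of_nonneg _ _ (one_div_nonneg.2 hv.le), ← ENNReal.rpow_mul,
    mul_one_div_cancel hv.ne', ENNReal.rpow_one, ← mul_assoc, ofReal_inv_pow_rpow hs,
    ofReal_inv_pow_rpow (by positivity), ← ENNReal.ofReal_mul (by positivity)]
  congr 2
  rw [← Real.rpow_natCast s 3, ← Real.rpow_mul hs.le, ← Real.rpow_add hs]
  congr 1
  unfold al; push_cast; ring

/-- Scaling of the norm that controls a multiplier from the mixed Lebesgue space to `L^∞`. -/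
lemma mx_conj_ker_compDil (hp : Adm p) {s : ℝ} (hs : 0 < s) (m : Test d) :
    mx (conjPair p) (fun z => ‖ker (compDil s m) z‖ₑ) =
      ENNReal.ofReal (s ^ (-al d p)) * mx (conjPair p) (fun z => ‖ker m z‖ₑ) := by
  have e : ∀ z, ‖ker (compDil s m) z‖ₑ =
      ENNReal.ofReal (s ^ (4 * d))⁻¹ * ‖ker m (dil s⁻¹ z)‖ₑ := fun z => by
    rw [ker_compDil hs, enorm_smul, Real.enorm_of_nonneg (by positivity)]
  simp_rw [e]
  rw [mx_const_mul hp.conj _ (by finiteness),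
    mx_comp_dil hp.conj (inv_pos.2 hs) (G := fun z => ‖ker m z‖ₑ) (ker m).continuous.measurable.enorm,
    ← mul_assoc, ← ENNReal.ofReal_mul (by positivity)]
  congr 2
  rw [al_conj hp, Real.inv_rpow hs.le, ← Real.rpow_natCast, ← Real.rpow_neg hs.le,
    ← Real.rpow_neg hs.le, ← Real.rpow_add hs]
  congr 1; push_cast; ring

lemma ofReal_two_pow_inv_rpow (l : ℕ) (a : ℝ) :
    ENNReal.ofReal ((((2 : ℝ) ^ l)⁻¹) ^ (-a)) = pw (l * a) := by
  rw [pw_eq_ofReal, Real.inv_rpow (by positivity), Real.rpow_neg (by positivity), inv_inv,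
    ← Real.rpow_natCast, ← Real.rpow_mul (by norm_num)]

/-! ### Multipliers with a velocity derivative -/

/-- The symbol `2πi ξ_{v_i} m` of `∂_{v_i}` composed with the multiplier of symbol `m`. -/
def gradS (i : Fin d) (m : Test d) : Test d := 𝓕 (lineDerivOp (eV i) (𝓕⁻ m))

lemma inner_eV (ξ : Phase d) (i : Fin d) : inner ℝ ξ (eV i) = velo ξ i := by
  rw [inner_phase]; simp [eV, PiLp.inner_apply]

lemma fourier_lineDeriv (φ : Test d) (i : Fin d) (ξ : Phase d) :
    𝓕 (lineDerivOp (eV i) φ) ξ = (2 * π * Complex.I * velo ξ i) * 𝓕 φ ξ := by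
  rw [SchwartzMap.fourier_lineDerivOp_eq, smul_apply,
    smulLeftCLM_apply_apply (by fun_prop), inner_eV]
  simp [mul_assoc]

@[simp] lemma gradS_apply (i : Fin d) (m : Test d) (ξ : Phase d) :
    gradS i m ξ = (2 * π * Complex.I * velo ξ i) * m ξ := by
  rw [gradS, fourier_lineDeriv, fourier_fourierInv_eq]

lemma gradS_compDil (i : Fin d) {s : ℝ} (hs : 0 < s) (m : Test d) :
    gradS i (compDil s m) = ((s⁻¹ : ℝ) : ℂ) • compDil s (gradS i m) := by
  ext ξ
  have : (s : ℂ) ≠ 0 := by exact_mod_cast hs.ne'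
  rw [gradS_apply, smul_apply, compDil_apply hs, compDil_apply hs, gradS_apply]
  simp [dil]; field_simp

lemma gradS_mulS (i : Fin d) (m n : Test d) : gradS i (mulS m n) = mulS (gradS i m) n := by
  ext ξ; simp [mul_assoc]

lemma negS_gradS (i : Fin d) (m : Test d) : negS (gradS i m) = -gradS i (negS m) := by
  ext ξ; rw [neg_apply]; simp

lemma Herm.gradS {m : Test d} (hm : Herm m) (i : Fin d) : Herm (gradS i m) := fun ξ => by
  simp [hm ξ, Complex.conj_ofReal, Complex.conj_ofNat]

lemma TS_lineDeriv (m φ : Test d) (i : Fin d) :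
    TS m (lineDerivOp (eV i) φ) = TS (gradS i m) φ := by
  unfold TS
  congr 1; ext ξ
  rw [mulS_apply, fourier_lineDeriv, mulS_apply, gradS_apply]; ring

/-- Integration by parts for a frequency-localized function. -/
lemma integral_T_lineDeriv (m φ : Test d) (i : Fin d) {g : Phase d → ℂ} (hg : Tame g) :
    ∫ z, lineDerivOp (eV i) φ z * T m g z = -∫ z, φ z * T (gradS i m) g z := by
  rw [integral_T_mul _ _ hg, integral_T_mul _ _ hg, TS_lineDeriv, negS_gradS, ← integral_neg]
  congr 1; funext w
  rw [← neg_mul]; congr 1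
  have : mulS (-gradS i (negS m)) (𝓕 φ) = -mulS (gradS i (negS m)) (𝓕 φ) := by
    ext ξ; rw [neg_apply, mulS_apply, mulS_apply, neg_apply, neg_mul]
  rw [TS, TS, this, fourierInv_neg, neg_apply, neg_neg]

/-- A bound which scales along the dilations `2^{-l}` from rank two on holds at all ranks. -/
lemma exists_bound_of_two {a : ℕ → ℝ≥0∞} {e : ℝ} {A : ℝ≥0∞} (h0 : a 0 ≠ ⊤) (h1 : a 1 ≠ ⊤)
    (hA : A ≠ ⊤) (he : 0 ≤ e) (h : ∀ l, a (l + 2) ≤ pw (l * e) * A) :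
    ∃ C : ℝ≥0, ∀ l, a l ≤ C * pw (l * e) := by
  refine ⟨(a 0 + a 1 + A).toNNReal, fun l => ?_⟩
  rw [coe_toNNReal (by finiteness)]
  have h2 : ∀ x : ℝ, 0 ≤ x → 1 ≤ pw x := fun x hx => by
    have := pw_mono hx; rwa [pw_zero] at this
  match l with
  | 0 => simpa using (le_add_right (le_add_right le_rfl) : a 0 ≤ a 0 + a 1 + A)
  | 1 =>
    refine le_trans ?_ (mul_le_mul' (le_add_right le_add_self) (h2 _ (by positivity)))
    simp
  | l + 2 =>
    refine (h l).trans ?_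
    rw [mul_comm]
    refine mul_le_mul' le_add_self (pw_mono ?_)
    push_cast; nlinarith

namespace LP
variable (D : LP d)

lemma wiener_psi_le : ∃ C : ℝ≥0, ∀ l, wiener (D.psi l) ≤ C := by
  obtain ⟨C, hC⟩ := exists_bound_of_two (a := fun l => wiener (D.psi l)) (e := 0)
    (A := wiener D.annPsi) (wiener_lt_top _).ne (wiener_lt_top _).ne (wiener_lt_top _).ne le_rfl
    (fun l => by simp [D.psi_add_two, wiener_compDil])
  exact ⟨C, by simpa using hC⟩

lemma mx_conj_ker_psi_le (hp : Adm p) :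
    ∃ C : ℝ≥0, ∀ l : ℕ, mx (conjPair p) (fun z => ‖ker (D.psi l) z‖ₑ) ≤ C * pw (l * al d p) :=
  exists_bound_of_two (mx_schwartz_lt_top hp.conj _).ne (mx_schwartz_lt_top hp.conj _).ne
    (mx_schwartz_lt_top hp.conj (ker D.annPsi)).ne al_nonneg fun l => by
      rw [D.psi_add_two, mx_conj_ker_compDil hp (by positivity), ofReal_two_pow_inv_rpow]

lemma mx_conj_ker_gradS_psi_le (hp : Adm p) (i : Fin d) :
    ∃ C : ℝ≥0, ∀ l : ℕ, mx (conjPair p) (fun z => ‖ker (gradS i (D.psi l)) z‖ₑ) ≤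
      C * pw (l * (1 + al d p)) := by
  refine exists_bound_of_two (mx_schwartz_lt_top hp.conj _).ne (mx_schwartz_lt_top hp.conj _).ne
    (mx_schwartz_lt_top hp.conj (ker (gradS i D.annPsi))).ne (by linarith [al_nonneg (d := d) (p := p)])
    fun l => ?_
  have e : ∀ z, ‖ker (gradS i (D.psi (l + 2))) z‖ₑ =
      pw l * ‖ker (compDil ((2 : ℝ) ^ l)⁻¹ (gradS i D.annPsi)) z‖ₑ := fun z => by
    rw [D.psi_add_two, gradS_compDil i (by positivity), ker_smul, smul_apply, enorm_smul, inv_inv]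
    congr 1
    rw [pw_nat, ← ofReal_norm]; simp
  simp_rw [e]
  rw [mx_const_mul hp.conj _ (pw_ne_top _), mx_conj_ker_compDil hp (by positivity),
    ofReal_two_pow_inv_rpow, ← mul_assoc, ← pw_add, mul_add, mul_one]

end LP

/-! ### Blocks in the position variable -/

/-- The linear map `(x, v) ↦ (a x, b v)`. -/
def dil2 (a b : ℝ) (z : Phase d) : Phase d := pt (a • posn z) (b • velo z)

/-- `dil2 a b` as a continuous linear equivalence. -/
def dil2E (a b : ℝ) (ha : a ≠ 0) (hb : b ≠ 0) : Phase d ≃L[ℝ] Phase d :=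
  LinearEquiv.toContinuousLinearEquiv
    { toFun := dil2 a b, invFun := dil2 a⁻¹ b⁻¹,
      map_add' := fun z w => phase_ext (by simp [dil2]) (by simp [dil2]),
      map_smul' := fun c z => phase_ext (by simp [dil2, smul_comm c]) (by simp [dil2, smul_comm c]),
      left_inv := fun z => phase_ext (by simp [dil2, ha]) (by simp [dil2, hb]),
      right_inv := fun z => phase_ext (by simp [dil2, ha]) (by simp [dil2, hb]) }

lemma inner_dil2 (a b : ℝ) (ξ z : Phase d) : inner ℝ (dil2 a b ξ) z = inner ℝ ξ (dil2 a b z) := by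
  simp [inner_phase, dil2, inner_smul_left, inner_smul_right]

/-- Composition with a self-adjoint isomorphism does not change the Wiener norm of a symbol. -/
lemma wiener_comp (L : Phase d ≃L[ℝ] Phase d) (hL : ∀ ξ z, inner ℝ (L ξ) z = inner ℝ ξ (L z))
    (m : Test d) : wiener (compCLMOfContinuousLinearEquiv ℂ L m) = wiener m := by
  have hdet : LinearMap.det (L : Phase d →ₗ[ℝ] Phase d) ≠ 0 := L.toLinearEquiv.isUnit_det'.ne_zero
  have hmap : Measure.map L (volume : Measure (Phase d)) =
      ENNReal.ofReal |(LinearMap.det (L : Phase d →ₗ[ℝ] Phase d))⁻¹| • volume :=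
    Measure.map_linearMap_addHaar_eq_smul_addHaar volume hdet
  set D := |(LinearMap.det (L : Phase d →ₗ[ℝ] Phase d))⁻¹| with hD
  have hD0 : 0 < D := abs_pos.2 (inv_ne_zero hdet)
  have hk : ∀ z, ker (compCLMOfContinuousLinearEquiv ℂ L m) (L z) = D • ker m z := by
    intro z
    have e : ∀ ξ, Complex.exp ((2 * π * inner ℝ ξ (L z) : ℝ) * Complex.I) •
        compCLMOfContinuousLinearEquiv ℂ L m ξ =
        (fun η => Complex.exp ((2 * π * inner ℝ η z : ℝ) * Complex.I) • m η) (L ξ) :=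
      fun ξ => by
        simp only [hL]; rfl
    rw [ker_eq_integral, ker_eq_integral]
    simp_rw [e]
    have hme : MeasurableEmbedding (L : Phase d → Phase d) := L.toHomeomorph.measurableEmbedding
    rw [← hme.integral_map (μ := volume) (fun η =>
      Complex.exp ((2 * π * inner ℝ η z : ℝ) * Complex.I) • m η), hmap, integral_smul_measure, ENNReal.toReal_ofReal hD0.le]
  have h1 : ∫⁻ z, ‖ker (compCLMOfContinuousLinearEquiv ℂ L m) (L z)‖ₑ =
      ENNReal.ofReal D * wiener (compCLMOfContinuousLinearEquiv ℂ L m) := by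
    rw [← lintegral_map (f := fun z => ‖ker (compCLMOfContinuousLinearEquiv ℂ L m) z‖ₑ)
      (SchwartzMap.continuous _).measurable.enorm L.continuous.measurable, hmap,
      lintegral_smul_measure]
    rfl
  simp_rw [hk, enorm_smul, Real.enorm_of_nonneg hD0.le] at h1
  rw [lintegral_const_mul' _ _ ofReal_ne_top] at h1
  exact ((ENNReal.mul_right_inj (by simpa using hD0) ofReal_ne_top).1 h1).symm


lemma isoPart_smooth {χ : Vec d → ℝ} (h : ContDiff ℝ ∞ χ) (k : ℕ) : ContDiff ℝ ∞ (isoPart χ k) := by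
  cases k with
  | zero => exact h
  | succ k => exact (h.comp (contDiff_const_smul _)).sub (h.comp (contDiff_const_smul _))

namespace LP
variable (D : LP d)

/-- The symbol of the block `Rˣ_k`. -/
def xs (k : ℕ) (ξ : Phase d) : ℂ := (isoPart D.χx k ((2 * π) • posn ξ) : ℂ)

lemma isoPart_neg (k : ℕ) (ξ : Vec d) : isoPart D.χx k (-ξ) = isoPart D.χx k ξ := by
  cases k <;> simp [isoPart, smul_neg, D.even]

lemma xs_neg (k : ℕ) (ξ : Phase d) : D.xs k (-ξ) = D.xs k ξ := by
  simp [xs, isoPart_neg]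

lemma xs_fshear (k : ℕ) (r : ℝ) (ξ : Phase d) : D.xs k (fshear r ξ) = D.xs k ξ := by
  simp [xs, fshear]

lemma isoPart_eq_zero_of_gt (k : ℕ) {ξ : Vec d} (h : 2 ^ (k + 2) < ‖ξ‖)
    (hs : ∀ ξ, 2 < ‖ξ‖ → D.χx ξ = 0) : isoPart D.χx k ξ = 0 := by
  have key : ∀ n ≤ k, D.χx (((2 : ℝ) ^ n)⁻¹ • ξ) = 0 := fun n hn => by
    apply hs
    rw [norm_smul, norm_inv, norm_pow, Real.norm_ofNat, lt_inv_mul_iff₀ (by positivity)]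
    calc (2 : ℝ) ^ n * 2 ≤ 2 ^ k * 2 := by gcongr; norm_num
      _ ≤ 2 ^ (k + 2) := by rw [pow_add]; nlinarith [pow_pos (two_pos (α := ℝ)) k]
      _ < _ := h
  cases k with
  | zero => simpa [isoPart] using key 0 le_rfl
  | succ k => rw [isoPart, key _ le_rfl, key k (by omega), sub_zero]

lemma isoPart_succ_eq_zero {k : ℕ} {ξ : Vec d} (h : ‖ξ‖ ≤ 2 ^ k) :
    isoPart D.χx (k + 1) ξ = 0 := by
  have key : ∀ n, k ≤ n → D.χx (((2 : ℝ) ^ n)⁻¹ • ξ) = 1 := fun n hn => by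
    apply D.eq_one
    rw [norm_smul, norm_inv, norm_pow, Real.norm_ofNat, inv_mul_le_iff₀ (by positivity), mul_one]
    exact h.trans (pow_le_pow_right₀ (by norm_num) hn)
  rw [isoPart, key k le_rfl, key _ (by omega), sub_self]

lemma isoPart_temperate (k : ℕ) : Function.HasTemperateGrowth (isoPart D.χx k) := by
  rcases D.supp with hs | hs
  · have hc : HasCompactSupport (isoPart D.χx k) :=
      HasCompactSupport.intro (isCompact_closedBall 0 (2 ^ (k + 2))) fun ξ hξ =>
        D.isoPart_eq_zero_of_gt k (by simpa using hξ) hs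
    exact (hc.toSchwartzMap (isoPart_smooth D.smooth k)).hasTemperateGrowth
  · have : isoPart D.χx k = fun _ => if k = 0 then 1 else 0 := by
      funext ξ; cases k <;> simp [isoPart, hs]
    rw [this]; exact Function.HasTemperateGrowth.const _

lemma xs_temperate (k : ℕ) : Function.HasTemperateGrowth (D.xs k) := by
  refine Function.HasTemperateGrowth.comp Function.Complex.hasTemperateGrowth_ofReal ((D.isoPart_temperate k).comp
    (f := fun ξ : Phase d => (2 * π) • posn ξ) ?_)
  exact ((2 * π) • posnL (d := d)).hasTemperateGrowth

/-- The product of a symbol with that of `Rˣ_k`. -/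
def mulX (k : ℕ) (m : Test d) : Test d := smulLeftCLM ℂ (D.xs k) m

@[simp] lemma mulX_apply (k : ℕ) (m : Test d) (ξ : Phase d) : D.mulX k m ξ = D.xs k ξ * m ξ := by
  rw [mulX, smulLeftCLM_apply_apply (D.xs_temperate k), smul_eq_mul]

lemma mulX_mulS (k : ℕ) (m n : Test d) : D.mulX k (mulS m n) = mulS (D.mulX k m) n := by
  ext ξ; simp [mul_assoc]

lemma compFshear_mulX (k : ℕ) (r : ℝ) (m : Test d) :
    compFshear r (D.mulX k m) = D.mulX k (compFshear r m) := by
  ext ξ; simp [xs_fshear]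

lemma negS_mulX (k : ℕ) (m : Test d) : negS (D.mulX k m) = D.mulX k (negS m) := by
  ext ξ; simp [xs_neg]

lemma norm_posn_le_gauge (ξ : Phase d) : ‖(2 * π) • posn ξ‖ ≤ gauge ξ ^ 3 := by
  have := norm_posn_le_anisoNorm ((2 * π) • ξ)
  rwa [posn_smul] at this

/-- The low-pass symbols in the position frequency are sums of the blocks. -/
lemma sum_isoPart (K : ℕ) (ξ : Vec d) :
    ∑ k ∈ Finset.range (K + 1), isoPart D.χx k ξ = D.χx (((2 : ℝ) ^ K)⁻¹ • ξ) := by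
  induction K with
  | zero => simp [isoPart]
  | succ K ih => rw [Finset.sum_range_succ, ih, isoPart]; ring

lemma sum_xs {K : ℕ} {ξ : Phase d} (h : gauge ξ ^ 3 ≤ 2 ^ K) :
    ∑ k ∈ Finset.range (K + 1), D.xs k ξ = 1 := by
  have := D.sum_isoPart K ((2 * π) • posn ξ)
  rw [D.eq_one] at this
  · unfold xs; exact_mod_cast this
  · rw [norm_smul, norm_inv, norm_pow, Real.norm_ofNat, inv_mul_le_iff₀ (by positivity), mul_one]
    exact (norm_posn_le_gauge ξ).trans h

lemma xs_eq_zero {K k : ℕ} (hk : K < k) {ξ : Phase d} (h : gauge ξ ^ 3 ≤ 2 ^ K) : D.xs k ξ = 0 := by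
  obtain ⟨n, rfl⟩ : ∃ n, k = n + 1 := ⟨k - 1, by omega⟩
  rw [xs, D.isoPart_succ_eq_zero, Complex.ofReal_zero]
  exact ((norm_posn_le_gauge ξ).trans h).trans (pow_le_pow_right₀ (by norm_num) (by omega))

/-- The position frequencies of a product of two blocks are dominated by the larger rank. -/
lemma xs_add_mul_mul {k k₁ k₂ : ℕ} (h₁ : k₁ + 4 ≤ k) (h₂ : k₂ + 4 ≤ k) (ξ ζ : Phase d) :
    D.xs k (ξ + ζ) * (D.xs k₁ ξ * D.xs k₂ ζ) = 0 := by
  obtain ⟨n, rfl⟩ : ∃ n, k = n + 1 := ⟨k - 1, by omega⟩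
  rcases D.supp with hs | hs
  · by_cases c₁ : 2 ^ (k₁ + 2) < ‖(2 * π) • posn ξ‖
    · simp [xs, D.isoPart_eq_zero_of_gt k₁ c₁ hs]
    by_cases c₂ : 2 ^ (k₂ + 2) < ‖(2 * π) • posn ζ‖
    · simp [xs, D.isoPart_eq_zero_of_gt k₂ c₂ hs]
    push Not at c₁ c₂
    rw [xs, D.isoPart_succ_eq_zero]
    · simp
    rw [posn_add, smul_add]
    have e₁ : (2 : ℝ) ^ (k₁ + 2) ≤ 2 ^ (n - 1) := pow_le_pow_right₀ (by norm_num) (by omega)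
    have e₂ : (2 : ℝ) ^ (k₂ + 2) ≤ 2 ^ (n - 1) := pow_le_pow_right₀ (by norm_num) (by omega)
    have e₃ : (2 : ℝ) ^ n = 2 ^ (n - 1) * 2 := by rw [← pow_succ]; congr 1; omega
    linarith [norm_add_le ((2 * π) • posn ξ) ((2 * π) • posn ζ)]
  · simp [xs, isoPart, hs]

/-- The tensor symbol `χₓ(2πξ_x) χ(0, 2πξ_v)`, used to turn the position cutoff, which does not
decay in `ξ_v`, into a Schwartz function. -/
lemma exists_tensor (hs : ∀ ξ, 2 < ‖ξ‖ → D.χx ξ = 0) : ∃ G : Test d, ∀ ξ : Phase d,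
    G ξ = (D.χx ((2 * π) • posn ξ) * D.χ (pt 0 ((2 * π) • velo ξ)) : ℝ) := by
  let f : Phase d → ℂ := fun ξ =>
    ((D.χx ((2 * π) • posn ξ) * D.χ (pt 0 ((2 * π) • velo ξ)) : ℝ) : ℂ)
  have hsupp : HasCompactSupport f := by
    refine HasCompactSupport.intro (isCompact_closedBall 0 4) fun ξ hξ => ?_
    rw [mem_closedBall_zero_iff, not_le] at hξ
    have h1 := norm_le_posn_add_velo ξ
    have hpi := Real.pi_gt_three
    by_cases h : 2 < ‖(2 * π) • posn ξ‖
    · simp [f, hs _ h]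
    · have h2 : D.χ (pt 0 ((2 * π) • velo ξ)) = 0 := by
        apply D.hχ.eq_zero
        rw [anisoNorm, velo_pt, posn_pt, norm_smul, Real.norm_of_nonneg (by positivity)]
        rw [norm_smul, Real.norm_of_nonneg (by positivity)] at h
        have : 0 ≤ ‖(0 : Vec d)‖ ^ (1 / 3 : ℝ) := by positivity
        nlinarith [norm_nonneg (velo ξ), norm_nonneg (posn ξ)]
      simp [f, h2]
  have hsm : ContDiff ℝ ∞ f := by
    have h1 : ContDiff ℝ ∞ fun ξ : Phase d => D.χx ((2 * π) • posn ξ) :=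
      D.smooth.comp ((2 * π) • posnL (d := d)).contDiff
    have h2 : ContDiff ℝ ∞ fun ξ : Phase d => D.χ (pt 0 ((2 * π) • velo ξ)) := by
      let L : Phase d →ₗ[ℝ] Phase d :=
        { toFun := fun ξ => pt 0 ((2 * π) • velo ξ)
          map_add' := fun z w => phase_ext (by simp) (by simp)
          map_smul' := fun c z => phase_ext (by simp) (by simp [smul_comm c]) }
      exact D.hχ.smooth.comp (LinearMap.toContinuousLinearMap L).contDiff
    exact Complex.ofRealCLM.contDiff.comp (h1.mul h2)
  exact ⟨hsupp.toSchwartzMap hsm, fun ξ => rfl⟩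

lemma norm_velo_le_gauge (ξ : Phase d) : ‖(2 * π) • velo ξ‖ ≤ gauge ξ := by
  have := norm_velo_le_anisoNorm ((2 * π) • ξ)
  rwa [velo_smul] at this

/-- The position blocks are bounded uniformly in their rank on functions with frequencies in a
ball: the symbols are truncated in `ξ_v` at a scale depending on the ball, which does not change
the Wiener norm. -/
lemma wiener_mulX_le : ∃ C : ℝ≥0, ∀ (k n : ℕ) (m : Test d), (∀ ξ, 2 ^ n < gauge ξ → m ξ = 0) →
    wiener (D.mulX k m) ≤ C * wiener m := by
  rcases D.supp with hs | hs
  · obtain ⟨G, hG⟩ := D.exists_tensor hs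
    have two : ∀ n : ℕ, ((2 : ℝ) ^ n)⁻¹ ≠ 0 := fun n => by positivity
    let H : ℕ → ℕ → Test d := fun k n =>
      compCLMOfContinuousLinearEquiv ℂ (dil2E _ _ (two k) (two n)) G
    have hH : ∀ k n, wiener (H k n) = wiener G := fun k n =>
      wiener_comp _ (fun ξ z => inner_dil2 _ _ ξ z) G
    have key : ∀ k n (m : Test d), (∀ ξ, 2 ^ n < gauge ξ → m ξ = 0) → ∀ ξ,
        H k n ξ * m ξ = (D.χx (((2 : ℝ) ^ k)⁻¹ • (2 * π) • posn ξ) : ℂ) * m ξ := by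
      intro k n m hm ξ
      by_cases h : 2 ^ n < gauge ξ
      · rw [hm ξ h]; simp
      push Not at h
      congr 1
      change G (dil2 _ _ ξ) = _
      rw [hG, D.hχ.eq_one]
      · rw [dil2, posn_pt, smul_comm, mul_one]
      · rw [anisoNorm]
        simp only [dil2, posn_pt, velo_pt, norm_zero]
        rw [Real.zero_rpow (by norm_num), zero_add, smul_comm, norm_smul, norm_inv, norm_pow,
          Real.norm_ofNat, inv_mul_le_iff₀ (by positivity), mul_one]
        exact (norm_velo_le_gauge ξ).trans h
    refine ⟨(2 * wiener G).toNNReal, fun k n m hm => ?_⟩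
    rw [coe_toNNReal (by finiteness [wiener_lt_top G])]
    cases k with
    | zero =>
      have : D.mulX 0 m = mulS (H 0 n) m := by
        ext ξ; rw [mulX_apply, mulS_apply, key 0 n m hm]; simp [xs, isoPart]
      rw [this]
      refine (wiener_mulS_le _ _).trans ?_
      rw [hH, two_mul]
      gcongr; exact le_add_self
    | succ k =>
      have : D.mulX (k + 1) m = mulS (H (k + 1) n) m + (-1 : ℂ) • mulS (H k n) m := by
        ext ξ
        rw [mulX_apply, add_apply, smul_apply, mulS_apply, mulS_apply, key _ n m hm, key _ n m hm,
          xs, isoPart]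
        push_cast; simp; ring
      rw [this]
      refine (wiener_add_le _ _).trans ?_
      rw [wiener_smul, two_mul, add_mul]
      have h1 : ‖(-1 : ℂ)‖ₑ = 1 := by simp
      rw [h1, one_mul]
      refine add_le_add ?_ ?_ <;>
      · refine (wiener_mulS_le _ _).trans ?_
        rw [hH]
  · refine ⟨1, fun k n m _ => ?_⟩
    rw [ENNReal.coe_one, one_mul]
    cases k with
    | zero =>
      have : D.mulX 0 m = m := by ext ξ; simp [xs, isoPart, hs]
      rw [this]
    | succ k =>
      have : D.mulX (k + 1) m = 0 := by ext ξ; simp [xs, isoPart, hs]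
      rw [this]; simp [wiener, ker_zero]

lemma wiener_mulX_phi_le : ∃ C : ℝ≥0, ∀ k l : ℕ, wiener (D.mulX k (D.phi l)) ≤ C := by
  obtain ⟨C, hC⟩ := D.wiener_mulX_le
  obtain ⟨C', -, hC'⟩ := D.wiener_phi_le
  refine ⟨C * C'.toNNReal, fun k l => ?_⟩
  rw [ENNReal.coe_mul]
  exact (hC k (l + 1) _ fun ξ h => D.phi_eq_zero_of_gt h).trans (mul_le_mul' le_rfl (hC' l))

/-- A rank beyond which the position blocks vanish on the support of `psi l`. -/
def rk (l : ℕ) : ℕ := 3 * (l + 2)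

lemma gauge_pow_le_rk {l : ℕ} {ξ : Phase d} (h : gauge ξ ≤ 2 ^ (l + 2)) : gauge ξ ^ 3 ≤ 2 ^ rk l := by
  rw [rk, mul_comm, pow_mul]
  have := gauge_nonneg ξ
  gcongr

lemma sum_mulX {l : ℕ} {m : Test d} (hm : ∀ ξ, 2 ^ (l + 2) < gauge ξ → m ξ = 0) :
    ∑ k ∈ Finset.range (rk l + 1), D.mulX k m = m := by
  ext ξ
  rw [sum_apply]
  simp only [mulX_apply]
  by_cases h : 2 ^ (l + 2) < gauge ξ
  · simp [hm ξ h]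
  · rw [← Finset.sum_mul, D.sum_xs (gauge_pow_le_rk (not_lt.1 h)), one_mul]

lemma mulX_eq_zero {k l : ℕ} (hk : rk l < k) {m : Test d}
    (hm : ∀ ξ, 2 ^ (l + 2) < gauge ξ → m ξ = 0) : D.mulX k m = 0 := by
  ext ξ
  rw [mulX_apply]
  by_cases h : 2 ^ (l + 2) < gauge ξ
  · simp [hm ξ h]
  · rw [D.xs_eq_zero hk (gauge_pow_le_rk (not_lt.1 h)), zero_mul]; rfl

end LP

/-! ### The symbol of the kinetic semigroup -/

lemma one_add_pow_mul_exp_le (M : ℕ) {c : ℝ} (hc : 0 < c) :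
    ∃ C : ℝ, ∀ t : ℝ, 0 ≤ t → (1 + t) ^ M * Real.exp (-(c * t ^ 2)) ≤ C := by
  refine ⟨2 ^ M * (M.factorial * (c⁻¹) ^ M * Real.exp c), fun t ht => ?_⟩
  have h1 : (1 + t) ^ M ≤ 2 ^ M * (1 + t ^ 2) ^ M := by
    rw [← mul_pow]; gcongr; nlinarith [sq_nonneg (t - 1)]
  have h2 := Real.pow_div_factorial_le_exp (c * (1 + t ^ 2)) (by positivity) M
  rw [div_le_iff₀ (by positivity)] at h2
  have h3 : (1 + t ^ 2) ^ M = (c⁻¹) ^ M * (c * (1 + t ^ 2)) ^ M := by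
    rw [← mul_pow, inv_mul_cancel_left₀ hc.ne']
  have h4 : Real.exp (c * (1 + t ^ 2)) * Real.exp (-(c * t ^ 2)) = Real.exp c := by
    rw [← Real.exp_add]; ring_nf
  calc (1 + t) ^ M * Real.exp (-(c * t ^ 2))
      ≤ 2 ^ M * ((c⁻¹) ^ M * (Real.exp (c * (1 + t ^ 2)) * M.factorial)) *
        Real.exp (-(c * t ^ 2)) := by
        gcongr
        refine h1.trans ?_
        rw [h3]; gcongr
    _ = 2 ^ M * ((c⁻¹) ^ M * M.factorial * (Real.exp (c * (1 + t ^ 2)) * Real.exp (-(c * t ^ 2)))) := by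
        ring
    _ = _ := by rw [h4]; ring

/-- Gaussians are Schwartz functions. -/
lemma exists_gaussian {c : ℝ} (hc : 0 < c) :
    ∃ G : Test d, ∀ ξ, G ξ = (Real.exp (-(c * ‖ξ‖ ^ 2)) : ℂ) := by
  let f : Phase d → ℝ := fun ξ => (-c) • ‖ξ‖ ^ 2
  have hf : Function.HasTemperateGrowth f :=
    Function.HasTemperateGrowth.smul (Function.HasTemperateGrowth.const (-c))
      (Function.hasTemperateGrowth_norm_sq _)
  let h : SchwartzMap (Phase d) ℝ :=
    { toFun := Real.exp ∘ f
      smooth' := Real.contDiff_exp.comp hf.1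
      decay' := by
        intro k n
        obtain ⟨K, C, hC, hb⟩ := hf.norm_iteratedFDeriv_le_uniform n
        obtain ⟨B, hB⟩ := one_add_pow_mul_exp_le (k + K * n) hc
        refine ⟨n.factorial * (C + 1) ^ n * B, fun x => ?_⟩
        have h1 := norm_iteratedFDeriv_comp_le (n := n) (N := ∞) Real.contDiff_exp hf.1
          (mod_cast le_top) x (C := Real.exp (f x)) (D := (C + 1) * (1 + ‖x‖) ^ K)
          (fun i _ => by
            rw [norm_iteratedFDeriv_eq_norm_iteratedDeriv, iteratedDeriv_eq_iterate,
              Real.iter_deriv_exp, Real.norm_of_nonneg (Real.exp_pos _).le])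
          (fun i hi hin => by
            refine (hb i hin x).trans ?_
            have h2 : 1 ≤ (C + 1) * (1 + ‖x‖) ^ K :=
              one_le_mul_of_one_le_of_one_le (by linarith)
                (one_le_pow₀ (by linarith [norm_nonneg x]))
            refine le_trans ?_ (le_self_pow₀ h2 (by omega))
            gcongr; linarith)
        have h3 := hB ‖x‖ (norm_nonneg x)
        have h4 : f x = -(c * ‖x‖ ^ 2) := by simp [f]
        rw [h4] at h1
        calc ‖x‖ ^ k * ‖iteratedFDeriv ℝ n (Real.exp ∘ f) x‖
            ≤ (1 + ‖x‖) ^ k * (n.factorial * Real.exp (-(c * ‖x‖ ^ 2)) *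
              ((C + 1) * (1 + ‖x‖) ^ K) ^ n) := by gcongr; linarith
          _ = n.factorial * (C + 1) ^ n *
              ((1 + ‖x‖) ^ (k + K * n) * Real.exp (-(c * ‖x‖ ^ 2))) := by
              rw [pow_add, pow_mul, mul_pow]; ring
          _ ≤ _ := by gcongr }
  refine ⟨SchwartzMap.postcompCLM Complex.ofRealCLM h, fun ξ => ?_⟩
  change ((Real.exp (f ξ) : ℝ) : ℂ) = _
  simp [f]

/-- The quadratic form of the kinetic heat symbol, `∫₀¹ |ξ_v + ρ ξ_x|² dρ`. -/
def heatQ (ξ : Phase d) : ℝ :=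
  ‖velo ξ‖ ^ 2 + inner ℝ (velo ξ) (posn ξ) + ‖posn ξ‖ ^ 2 / 3

/-- The linear isomorphism that diagonalizes `heatQ`. -/
def heatL : Phase d ≃L[ℝ] Phase d :=
  (fshearE (1 / 2)).trans (dil2E (√12)⁻¹ 1 (by positivity) one_ne_zero)

lemma norm_heatL (ξ : Phase d) : ‖heatL ξ‖ ^ 2 = heatQ ξ := by
  have : heatL ξ = dil2 (√12)⁻¹ 1 (fshear (1 / 2) ξ) := rfl
  rw [this, norm_sq_phase, heatQ]
  simp only [dil2, fshear, posn_pt, velo_pt, one_smul]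
  rw [norm_smul, mul_pow, norm_inv, Real.norm_of_nonneg (by positivity), inv_pow,
    Real.sq_sqrt (by norm_num), norm_add_sq_real, inner_smul_right, norm_smul]
  norm_num
  ring

/-- The symbol `exp(-4π² ∫₀¹ |ξ_v + ρ ξ_x|² dρ)` of the kinetic semigroup at time one. -/
def heat1 : Test d :=
  compCLMOfContinuousLinearEquiv ℂ heatL
    (exists_gaussian (c := 4 * π ^ 2) (by positivity)).choose

lemma heat1_apply (ξ : Phase d) : heat1 ξ = (Real.exp (-(4 * π ^ 2 * heatQ ξ)) : ℂ) := by
  have := (exists_gaussian (d := d) (c := 4 * π ^ 2) (by positivity)).choose_spec (heatL ξ)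
  rw [norm_heatL] at this
  exact this

/-- The symbol of the kinetic semigroup at time `r > 0`. -/
def heatS (r : ℝ) : Test d := compDil (√r) heat1

lemma heatQ_dil (s : ℝ) (ξ : Phase d) : heatQ (dil s ξ) =
    s ^ 2 * ‖velo ξ‖ ^ 2 + (s ^ 2) ^ 2 * inner ℝ (velo ξ) (posn ξ) +
      (s ^ 2) ^ 3 * ‖posn ξ‖ ^ 2 / 3 := by
  simp only [heatQ, dil, posn_pt, velo_pt, norm_smul, mul_pow, Real.norm_eq_abs, sq_abs,
    inner_smul_left, inner_smul_right, RCLike.conj_to_real]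
  ring

lemma heatS_apply {r : ℝ} (hr : 0 < r) (ξ : Phase d) : heatS r ξ =
    (Real.exp (-(4 * π ^ 2 * (r * ‖velo ξ‖ ^ 2 + r ^ 2 * inner ℝ (velo ξ) (posn ξ) +
      r ^ 3 * ‖posn ξ‖ ^ 2 / 3))) : ℂ) := by
  rw [heatS, compDil_apply (Real.sqrt_pos.2 hr), heat1_apply, heatQ_dil, Real.sq_sqrt hr.le]

lemma fshear_dil (r s : ℝ) (ξ : Phase d) : fshear r (dil s ξ) = dil s (fshear (s ^ 2 * r) ξ) :=
  phase_ext (by simp [fshear, dil])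
    (by simp only [fshear, dil, velo_pt, posn_pt, smul_add, smul_smul]; congr 2; ring)

lemma compFshear_heatS {r : ℝ} (hr : 0 < r) :
    compFshear (-r) (heatS r : Test d) = compDil (√r) (compFshear (-1) heat1) := by
  have h := Real.sqrt_pos.2 hr
  ext ξ
  rw [compFshear_apply, heatS, compDil_apply h, compDil_apply h, compFshear_apply, fshear_dil,
    Real.sq_sqrt hr.le, mul_neg_one]

lemma herm_heatS {r : ℝ} (hr : 0 < r) : Herm (heatS r : Test d) := fun ξ => by
  rw [heatS_apply hr, heatS_apply hr, Complex.conj_ofReal]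
  simp

/-! ### Decay of the semigroup on annuli -/

/-- A symbol that vanishes near the origin and at infinity. -/
structure Annular (η : Test d) : Prop where
  zero : ∀ ξ, gauge ξ ≤ 1 → η ξ = 0
  supp : HasCompactSupport (η : Phase d → ℂ)

/-- The polynomial `|ξ_x|² + |ξ_v|⁶`, homogeneous of degree six for the anisotropic dilations. -/
def hom6 (ξ : Phase d) : ℝ := ‖posn ξ‖ ^ 2 + (‖velo ξ‖ ^ 2) ^ 3

lemma hom6_dil (s : ℝ) (ξ : Phase d) : hom6 (dil s ξ) = s ^ 6 * hom6 ξ := by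
  simp only [hom6, dil, posn_pt, velo_pt, norm_smul, mul_pow, Real.norm_eq_abs, sq_abs]
  ring

lemma hom6_pos {ξ : Phase d} (h : 0 < gauge ξ) : 0 < hom6 ξ := by
  have h0 : 0 ≤ hom6 ξ := by unfold hom6; positivity
  refine h0.lt_of_ne fun e => h.ne' ?_
  have h1 : ‖posn ξ‖ = 0 := by
    unfold hom6 at e
    have : ‖posn ξ‖ ^ 2 = 0 := by nlinarith [sq_nonneg ‖posn ξ‖, pow_nonneg (sq_nonneg ‖velo ξ‖) 3]
    simpa using this
  have h2 : ‖velo ξ‖ = 0 := by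
    unfold hom6 at e
    rw [h1] at e
    have : (‖velo ξ‖ ^ 2) ^ 3 = 0 := by linarith
    simpa using this
  have : ξ = 0 := phase_ext (by simpa using h1) (by simpa using h2)
  rw [this, gauge_zero]

lemma hom6_temperate : Function.HasTemperateGrowth (fun ξ : Phase d => (hom6 ξ : ℂ)) := by
  refine Function.HasTemperateGrowth.comp Function.Complex.hasTemperateGrowth_ofReal ?_
  have h1 : Function.HasTemperateGrowth fun ξ : Phase d => ‖posnL ξ‖ ^ 2 :=
    Function.HasTemperateGrowth.comp (g := fun x : Vec d => ‖x‖ ^ 2)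
      (Function.hasTemperateGrowth_norm_sq _) posnL.hasTemperateGrowth
  have h2 : Function.HasTemperateGrowth fun ξ : Phase d => ‖veloL ξ‖ ^ 2 :=
    Function.HasTemperateGrowth.comp (g := fun x : Vec d => ‖x‖ ^ 2)
      (Function.hasTemperateGrowth_norm_sq _) veloL.hasTemperateGrowth
  exact h1.add (h2.pow 3)

/-- Multiplication of a symbol by `hom6`. -/
def mulH (m : Test d) : Test d := smulLeftCLM ℂ (fun ξ : Phase d => (hom6 ξ : ℂ)) m

@[simp] lemma mulH_apply (m : Test d) (ξ : Phase d) : mulH m ξ = hom6 ξ * m ξ := by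
  rw [mulH, smulLeftCLM_apply_apply hom6_temperate, smul_eq_mul]

/-- Annular symbols can be divided by `hom6`. -/
lemma Annular.exists_mulH {η : Test d} (h : Annular η) : ∃ ζ : Test d, Annular ζ ∧ mulH ζ = η := by
  let f : Phase d → ℂ := fun ξ => (hom6 ξ : ℂ)⁻¹ * η ξ
  have hsm : ContDiff ℝ ∞ f := by
    rw [contDiff_iff_contDiffAt]
    intro ξ
    by_cases hξ : gauge ξ < 1
    · have : f =ᶠ[nhds ξ] fun _ => 0 := by
        filter_upwards [(isOpen_lt continuous_gauge continuous_const).mem_nhds hξ] with y hy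
        simp [f, h.zero y (le_of_lt hy)]
      exact contDiffAt_const.congr_of_eventuallyEq this
    · have h0 : (hom6 ξ : ℂ) ≠ 0 := by
        exact_mod_cast (hom6_pos (zero_lt_one.trans_le (not_lt.1 hξ))).ne'
      exact (hom6_temperate.1.contDiffAt.inv h0).mul (η.smooth ⊤).contDiffAt
  have hc : HasCompactSupport f := h.supp.mul_left
  refine ⟨hc.toSchwartzMap hsm, ⟨fun ξ hξ => ?_, hc⟩, ?_⟩
  · change f ξ = 0
    simp [f, h.zero ξ hξ]
  · ext ξ
    rw [mulH_apply]
    change (hom6 ξ : ℂ) * ((hom6 ξ : ℂ)⁻¹ * η ξ) = _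
    by_cases hξ : gauge ξ ≤ 1
    · simp [h.zero ξ hξ]
    · have h0 : (hom6 ξ : ℂ) ≠ 0 := by
        exact_mod_cast (hom6_pos (zero_lt_one.trans (not_le.1 hξ))).ne'
      rw [mul_inv_cancel_left₀ h0]

lemma Annular.exists_mulH_iterate {η : Test d} (h : Annular η) (M : ℕ) :
    ∃ ζ : Test d, Annular ζ ∧ mulH^[M] ζ = η := by
  induction M with
  | zero => exact ⟨η, h, rfl⟩
  | succ M ih =>
    obtain ⟨ζ, hζ, e⟩ := ih
    obtain ⟨ζ', hζ', e'⟩ := hζ.exists_mulH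
    exact ⟨ζ', hζ', by rw [Function.iterate_succ_apply, e', e]⟩

lemma mulH_iterate_apply (M : ℕ) (m : Test d) (ξ : Phase d) :
    mulH^[M] m ξ = (hom6 ξ : ℂ) ^ M * m ξ := by
  induction M generalizing m with
  | zero => simp
  | succ M ih => rw [Function.iterate_succ_apply, ih, mulH_apply]; ring

lemma wiener_le_ofReal (m : Test d) : wiener m = ENNReal.ofReal (wiener m).toReal :=
  (ENNReal.ofReal_toReal (wiener_lt_top _).ne).symm

/-- The decay `(1 + t²)^{-M}` of a dilated Schwartz symbol on an annulus, in the Wiener norm: the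
factor `hom6 ^ M`, taken from the annular symbol, produces the power `t^{-6M}`. -/
lemma Annular.wiener_mulS_le {η : Test d} (h : Annular η) (g : Test d) (M : ℕ) :
    ∃ C : ℝ, 0 < C ∧ ∀ t : ℝ, 0 < t →
      wiener (mulS (compDil t g) η) ≤ ENNReal.ofReal (C * ((1 + t ^ 2) ^ M)⁻¹) := by
  obtain ⟨ζ, hζ, e⟩ := h.exists_mulH_iterate M
  set A := (wiener g).toReal * (wiener η).toReal
  set B := (wiener (mulH^[M] g)).toReal * (wiener ζ).toReal
  have hA : 0 ≤ A := by positivity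
  have hB : 0 ≤ B := by positivity
  refine ⟨2 ^ M * (A + B + 1), by positivity, fun t ht => ?_⟩
  rcases le_total t 1 with h1 | h1
  · refine (Kinetic.wiener_mulS_le _ _).trans ?_
    rw [wiener_compDil ht, wiener_le_ofReal g, wiener_le_ofReal η, ← ENNReal.ofReal_mul (by positivity)]
    refine ofReal_le_ofReal ?_
    rw [← div_eq_mul_inv, le_div_iff₀ (by positivity)]
    calc A * (1 + t ^ 2) ^ M ≤ (A + B + 1) * 2 ^ M := by
          gcongr
          · linarith
          · nlinarith
      _ = _ := mul_comm _ _
  · have e2 : mulS (compDil t g) η =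
        (((t ^ (6 * M))⁻¹ : ℝ) : ℂ) • mulS (compDil t (mulH^[M] g)) ζ := by
      ext ξ
      have ht' : (t : ℂ) ≠ 0 := by exact_mod_cast ht.ne'
      rw [← e, mulS_apply, smul_apply, mulS_apply, compDil_apply ht, compDil_apply ht,
        mulH_iterate_apply, mulH_iterate_apply, hom6_dil, smul_eq_mul]
      push_cast
      rw [mul_pow, ← pow_mul]
      field_simp
    rw [e2, wiener_smul]
    refine (mul_le_mul' le_rfl (Kinetic.wiener_mulS_le _ _)).trans ?_
    rw [wiener_compDil ht, wiener_le_ofReal ζ, wiener_le_ofReal (mulH^[M] g),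
      ← ENNReal.ofReal_mul (by positivity), ← ofReal_norm, Complex.norm_real,
      Real.norm_of_nonneg (by positivity), ← ENNReal.ofReal_mul (by positivity)]
    refine ofReal_le_ofReal ?_
    rw [← div_eq_inv_mul, ← div_eq_mul_inv, div_le_div_iff₀ (by positivity) (by positivity)]
    have h2 : (1 + t ^ 2) ^ M ≤ 2 ^ M * t ^ (6 * M) := by
      rw [pow_mul, ← mul_pow]
      gcongr
      have : t ^ 2 ≤ t ^ 6 := pow_le_pow_right₀ h1 (by norm_num)
      nlinarith
    calc B * (1 + t ^ 2) ^ M ≤ (A + B + 1) * (2 ^ M * t ^ (6 * M)) := by gcongr; linarith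
      _ = _ := by ring

/-- Decay of the semigroup on dyadic annuli. -/
lemma Annular.wiener_heat_le {η : Test d} (h : Annular η) (g : Test d) (M : ℕ) {T : ℝ} (hT : 0 ≤ T)
    {a : ℕ → Test d} (ha : ∀ l, a (l + 2) = compDil ((2 : ℝ) ^ l)⁻¹ η) :
    ∃ C : ℝ, 0 < C ∧ ∀ r ∈ Ioc 0 T, ∀ l,
      wiener (mulS (compDil (√r) g) (a l)) ≤ ENNReal.ofReal (C * ((1 + r * 4 ^ l) ^ M)⁻¹) := by
  obtain ⟨C, hC, hb⟩ := h.wiener_mulS_le g M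
  set A := fun l => (wiener g).toReal * (wiener (a l)).toReal
  have hA : ∀ l, 0 ≤ A l := fun l => by positivity
  refine ⟨(A 0 + A 1) * (1 + T * 4) ^ M + 16 ^ M * C, by have := hA 0; have := hA 1; positivity,
    fun r hr l => ?_⟩
  have hr0 : 0 < r := hr.1
  have small : ∀ l, l ≤ 1 → wiener (mulS (compDil (√r) g) (a l)) ≤
      ENNReal.ofReal (((A 0 + A 1) * (1 + T * 4) ^ M + 16 ^ M * C) * ((1 + r * 4 ^ l) ^ M)⁻¹) := by
    intro l hl
    refine (Kinetic.wiener_mulS_le _ _).trans ?_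
    rw [wiener_compDil (Real.sqrt_pos.2 hr0), wiener_le_ofReal g, wiener_le_ofReal (a l),
      ← ENNReal.ofReal_mul (by positivity)]
    refine ofReal_le_ofReal ?_
    rw [← div_eq_mul_inv, le_div_iff₀ (by positivity)]
    have h1 : A l ≤ A 0 + A 1 := by
      interval_cases l
      · linarith [hA 1]
      · linarith [hA 0]
    have h2 : r * 4 ^ l ≤ T * 4 := by
      have h3 : (4 : ℝ) ^ l ≤ 4 ^ 1 := pow_le_pow_right₀ (by norm_num) hl
      have := hr.2
      gcongr; simpa using h3
    have := hA 0; have := hA 1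
    calc A l * (1 + r * 4 ^ l) ^ M ≤ (A 0 + A 1) * (1 + T * 4) ^ M := by gcongr
      _ ≤ _ := by linarith [show 0 ≤ 16 ^ M * C by positivity]
  match l with
  | 0 => exact small 0 (by norm_num)
  | 1 => exact small 1 le_rfl
  | l + 2 =>
    have h2 : (0 : ℝ) < 2 ^ l := by positivity
    have e : mulS (compDil (√r) g) (a (l + 2)) =
        compDil ((2 : ℝ) ^ l)⁻¹ (mulS (compDil (√r * 2 ^ l) g) η) := by
      rw [compDil_mulS (by positivity), ha, compDil_compDil (by positivity)
        (mul_pos (Real.sqrt_pos.2 hr0) h2), mul_assoc, mul_inv_cancel₀ h2.ne', mul_one]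
    rw [e, wiener_compDil (by positivity)]
    refine (hb _ (mul_pos (Real.sqrt_pos.2 hr0) h2)).trans (ofReal_le_ofReal ?_)
    rw [mul_pow, Real.sq_sqrt hr0.le, ← pow_mul, mul_comm l 2, pow_mul, pow_add]
    norm_num only
    rw [← div_eq_mul_inv, ← div_eq_mul_inv, div_le_div_iff₀ (by positivity) (by positivity)]
    have h3 : (1 + r * (4 ^ l * 16)) ^ M ≤ 16 ^ M * (1 + r * 4 ^ l) ^ M := by
      rw [← mul_pow]; gcongr; nlinarith [pow_pos (four_pos (α := ℝ)) l]
    have h4 : 0 ≤ (A 0 + A 1) * (1 + T * 4) ^ M := by have := hA 0; have := hA 1; positivity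
    calc C * (1 + r * (4 ^ l * 16)) ^ M ≤ C * (16 ^ M * (1 + r * 4 ^ l) ^ M) := by gcongr
      _ = (16 ^ M * C) * (1 + r * 4 ^ l) ^ M := by ring
      _ ≤ _ := by gcongr; linarith

namespace LP
variable (D : LP d)

lemma annular_annPsi : Annular D.annPsi := ⟨fun _ h => D.annPsi_eq_zero h, D.annPsi_supp⟩

lemma annular_annPhi : Annular (compDil 2⁻¹ D.annPhi) := by
  have e : ∀ ξ, compDil 2⁻¹ D.annPhi ξ = D.annPhi (dil 2⁻¹ ξ) := compDil_apply (by norm_num) _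
  refine ⟨fun ξ h => ?_, hasCompactSupport_of_gauge 8 fun ξ h => ?_⟩
  · rw [e, D.annPhi_eq_zero]
    rw [gauge_dil (by norm_num)]; linarith
  · rw [e, annPhi, sub_apply, compDil_apply (by norm_num), D.c_eq_zero, D.c_eq_zero, sub_self]
    · rw [gauge_dil (by norm_num)]; linarith
    · rw [gauge_dil (by norm_num), gauge_dil (by norm_num)]; linarith

/-- The symbol of the frequency-localized semigroup, from the annulus of rank `l` to that of rank
`j`. -/
def sig (j l : ℕ) (r : ℝ) : Test d := mulS (compFshear r (D.phi j)) (mulS (heatS r) (D.psi l))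

/-- The shear changes the gauge of a frequency `ξ` by at most the factor
`1 + r gauge ξ ^ 2`, so that ranks too far apart for the time `r` do not interact. -/
lemma sig_eq_zero {j l : ℕ} {r : ℝ} (hr : 0 ≤ r)
    (h : ¬((2 : ℝ) ^ j ≤ 2 ^ 7 * 2 ^ l * (1 + r * 4 ^ l) ∧
      (2 : ℝ) ^ l ≤ 2 ^ 7 * 2 ^ j * (1 + r * 4 ^ j))) : D.sig j l r = 0 := by
  ext ξ
  rw [sig, mulS_apply, mulS_apply, compFshear_apply]
  change _ = (0 : ℂ)
  by_contra hne
  apply h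
  have n1 : D.phi j (fshear r ξ) ≠ 0 := fun e => hne (by rw [e, zero_mul])
  have n2 : D.psi l ξ ≠ 0 := fun e => hne (by rw [e, mul_zero, mul_zero])
  have a1 : gauge (fshear r ξ) ≤ 2 ^ (j + 1) := not_lt.1 fun e => n1 (D.phi_eq_zero_of_gt e)
  have a2 : gauge ξ ≤ 2 ^ (l + 2) := not_lt.1 fun e => n2 (D.psi_eq_zero_of_gt e)
  have g1 := gauge_fshear_le hr ξ
  have g2 := gauge_le_fshear hr ξ
  have p1 := gauge_nonneg ξ
  have p2 := gauge_nonneg (fshear r ξ)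
  have q4 : ∀ n : ℕ, (4 : ℝ) ^ n = 2 ^ n * 2 ^ n := fun n => by rw [← mul_pow]; norm_num
  have one : ∀ n : ℕ, (1 : ℝ) ≤ 2 ^ n := fun n => one_le_pow₀ (by norm_num)
  have b1 : ∀ {x y : ℝ} {n : ℕ}, 0 ≤ x → x ≤ 2 ^ n → y ≤ x + r * x ^ 3 →
      y ≤ 2 ^ n * (1 + r * 4 ^ n) := fun {x y n} hx hxn hy => by
    have : r * x ^ 3 ≤ r * (2 ^ n) ^ 3 := by gcongr
    rw [q4]; nlinarith
  have c1 := b1 p1 a2 g1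
  have c2 := b1 p2 a1 g2
  constructor
  · have hj : (2 : ℝ) ^ j ≤ 2 * (2 ^ (l + 2) * (1 + r * 4 ^ (l + 2))) := by
      cases j with
      | zero =>
        have := one (l + 2)
        have h0 : 0 ≤ r * (4 : ℝ) ^ (l + 2) := by positivity
        nlinarith
      | succ j =>
        have : (2 : ℝ) ^ j < gauge (fshear r ξ) :=
          not_le.1 fun e => n1 (D.phi_succ_eq_zero_of_le e)
        rw [pow_succ]; linarith
    refine hj.trans ?_
    rw [pow_add, pow_add]
    have h0 : 0 ≤ r * (4 : ℝ) ^ l := by positivity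
    nlinarith [one l, mul_nonneg (zero_le_one.trans (one l)) h0]
  · have hl : (2 : ℝ) ^ l ≤ 4 * (2 ^ (j + 1) * (1 + r * 4 ^ (j + 1))) := by
      by_cases h2 : 2 ≤ l
      · have : (2 : ℝ) ^ (l - 2) < gauge ξ := not_le.1 fun e => n2 (D.psi_eq_zero_of_le h2 e)
        have e : (2 : ℝ) ^ l = 2 ^ (l - 2) * 4 := by
          rw [show (4 : ℝ) = 2 ^ 2 by norm_num, ← pow_add]; congr 1; omega
        rw [e]; linarith
      · have : (2 : ℝ) ^ l ≤ 2 ^ 1 := pow_le_pow_right₀ (by norm_num) (by omega)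
        have := one (j + 1)
        have h0 : 0 ≤ r * (4 : ℝ) ^ (j + 1) := by positivity
        nlinarith
    refine hl.trans ?_
    rw [pow_add, pow_add]
    have h0 : 0 ≤ r * (4 : ℝ) ^ j := by positivity
    nlinarith [one j, mul_nonneg (zero_le_one.trans (one j)) h0]

/-- The semigroup is almost diagonal with respect to the dyadic annuli and decays on them like the
heat semigroup. Frequencies `ξ` are moved to `fshear r ξ`, so that a change of rank by `n` forces
`r 4^l` or `r 4^j` to be large, which the decay of the symbol pays for. -/
lemma wiener_sig_le (N : ℕ) {T : ℝ} (hT : 0 ≤ T) : ∃ C : ℝ, 0 < C ∧ ∀ r ∈ Ioc 0 T, ∀ j l,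
    wiener (D.sig j l r) ≤
      ENNReal.ofReal (C * ((2 ^ ((j - l) + (l - j))) ^ N)⁻¹ * ((1 + r * 4 ^ l) ^ 2)⁻¹) := by
  obtain ⟨C₁, h₁, b₁⟩ := D.annular_annPsi.wiener_heat_le heat1 (N + 2) hT D.psi_add_two
  obtain ⟨C₂, h₂, b₂⟩ := D.annular_annPhi.wiener_heat_le (compFshear (-1) heat1) (N + 4 + 2) hT
    (a := D.phi) (fun l => by
      rw [D.phi_succ, compDil_compDil (by positivity) (by norm_num), pow_succ, mul_inv, mul_comm])
  obtain ⟨C₃, h₃, b₃⟩ := D.wiener_phi_le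
  obtain ⟨C₄, b₄⟩ := D.wiener_psi_le
  refine ⟨C₃ * C₁ * (2 ^ 7) ^ N + (C₄ + 1) * C₂ * (2 ^ 7) ^ (N + 4), by positivity,
    fun r hr j l => ?_⟩
  have hr0 : 0 < r := hr.1
  by_cases hsup : (2 : ℝ) ^ j ≤ 2 ^ 7 * 2 ^ l * (1 + r * 4 ^ l) ∧
      (2 : ℝ) ^ l ≤ 2 ^ 7 * 2 ^ j * (1 + r * 4 ^ j)
  swap
  · rw [D.sig_eq_zero hr0.le hsup]; simp [wiener, ker_zero]
  obtain ⟨s1, s2⟩ := hsup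
  set x := 1 + r * 4 ^ l with hx
  set y := 1 + r * 4 ^ j with hy
  have hx1 : 0 < x := by positivity
  have hy1 : 0 < y := by positivity
  rcases le_total l j with hlj | hlj
  · have w : wiener (D.sig j l r) ≤ ENNReal.ofReal (C₃ * (C₁ * (x ^ (N + 2))⁻¹)) := by
      refine (wiener_mulS_le _ _).trans ?_
      rw [wiener_compFshear, ENNReal.ofReal_mul h₃.le]
      exact mul_le_mul' (b₃ j) (b₁ r hr l)
    refine w.trans (ofReal_le_ofReal ?_)
    obtain ⟨n, rfl⟩ := Nat.exists_eq_add_of_le hlj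
    have e : l + n - l + (l - (l + n)) = n := by omega
    rw [e]
    have s3 : (2 : ℝ) ^ n ≤ 2 ^ 7 * x := by
      rw [pow_add] at s1
      have : (0 : ℝ) < 2 ^ l := by positivity
      nlinarith
    have s4 : (x ^ N)⁻¹ ≤ (2 ^ 7) ^ N * ((2 ^ n) ^ N)⁻¹ := by
      rw [← div_eq_mul_inv, le_div_iff₀ (by positivity), ← div_eq_inv_mul,
        div_le_iff₀ (by positivity), ← mul_pow]
      gcongr
    calc C₃ * (C₁ * (x ^ (N + 2))⁻¹) = C₃ * C₁ * (x ^ N)⁻¹ * (x ^ 2)⁻¹ := by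
          rw [pow_add, mul_inv]; ring
      _ ≤ C₃ * C₁ * ((2 ^ 7) ^ N * ((2 ^ n) ^ N)⁻¹) * (x ^ 2)⁻¹ := by gcongr
      _ = (C₃ * C₁ * (2 ^ 7) ^ N) * ((2 ^ n) ^ N)⁻¹ * (x ^ 2)⁻¹ := by ring
      _ ≤ _ := by
          gcongr
          linarith [show 0 ≤ (C₄ + 1) * C₂ * (2 ^ 7) ^ (N + 4) by positivity]
  -- for `l ≤ j` the shear is undone, and the decay is taken on the annulus of rank `j`
  · have e0 : wiener (D.sig j l r) = wiener (mulS (compFshear (-r) (D.psi l))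
        (mulS (compDil (√r) (compFshear (-1) heat1)) (D.phi j))) := by
      rw [← wiener_compFshear (-r), sig, compFshear_mulS, compFshear_mulS, compFshear_heatS hr0]
      congr 1
      ext ξ
      simp [fshear_fshear]; ring
    have w : wiener (D.sig j l r) ≤ ENNReal.ofReal ((C₄ + 1) * (C₂ * (y ^ (N + 4 + 2))⁻¹)) := by
      rw [e0]
      refine (wiener_mulS_le _ _).trans ?_
      rw [wiener_compFshear, ENNReal.ofReal_mul (by positivity)]
      refine mul_le_mul' ((b₄ l).trans ?_) (b₂ r hr j)
      rw [← ENNReal.ofReal_coe_nnreal]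
      exact ofReal_le_ofReal (by linarith)
    refine w.trans (ofReal_le_ofReal ?_)
    obtain ⟨n, rfl⟩ := Nat.exists_eq_add_of_le hlj
    have e : j - (j + n) + (j + n - j) = n := by omega
    rw [e]
    have s3 : (2 : ℝ) ^ n ≤ 2 ^ 7 * y := by
      rw [pow_add] at s2
      have : (0 : ℝ) < 2 ^ j := by positivity
      nlinarith
    have s4 : (y ^ (N + 4))⁻¹ ≤ (2 ^ 7) ^ (N + 4) * ((2 ^ n) ^ (N + 4))⁻¹ := by
      rw [← div_eq_mul_inv, le_div_iff₀ (by positivity), ← div_eq_inv_mul,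
        div_le_iff₀ (by positivity), ← mul_pow]
      gcongr
    have s5 : (y ^ 2)⁻¹ ≤ (2 ^ n) ^ 4 * (x ^ 2)⁻¹ := by
      rw [← div_eq_mul_inv, le_div_iff₀ (by positivity), ← div_eq_inv_mul,
        div_le_iff₀ (by positivity)]
      have : x ≤ (2 ^ n) ^ 2 * y := by
        rw [hx, hy, pow_add, mul_add, ← pow_mul, mul_comm n 2, pow_mul]
        norm_num only
        have : (1 : ℝ) ≤ 4 ^ n := one_le_pow₀ (by norm_num)
        nlinarith
      calc x ^ 2 ≤ ((2 ^ n) ^ 2 * y) ^ 2 := by gcongr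
        _ = _ := by ring
    calc (C₄ + 1) * (C₂ * (y ^ (N + 4 + 2))⁻¹) = (C₄ + 1) * C₂ * (y ^ (N + 4))⁻¹ * (y ^ 2)⁻¹ := by
          rw [pow_add y (N + 4) 2, mul_inv]; ring
      _ ≤ (C₄ + 1) * C₂ * ((2 ^ 7) ^ (N + 4) * ((2 ^ n) ^ (N + 4))⁻¹) *
          ((2 ^ n) ^ 4 * (x ^ 2)⁻¹) := by gcongr
      _ = ((C₄ + 1) * C₂ * (2 ^ 7) ^ (N + 4)) * ((2 ^ n) ^ N)⁻¹ * (x ^ 2)⁻¹ := by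
          rw [pow_add ((2 : ℝ) ^ n) N 4, mul_inv]; field_simp
      _ ≤ _ := by
          gcongr
          linarith [show 0 ≤ C₃ * C₁ * (2 ^ 7) ^ N by positivity]

end LP

/-! ### Cutoffs in the Schwartz space -/

lemma norm_dil_le {s : ℝ} (hs : 0 ≤ s) (h1 : s ≤ 1) (z : Phase d) : ‖dil s z‖ ≤ s * ‖z‖ := by
  refine abs_le_of_sq_le_sq' ?_ (by positivity) |>.2
  rw [mul_pow, norm_sq_phase, norm_sq_phase z]
  simp only [dil, posn_pt, velo_pt, norm_smul, Real.norm_eq_abs, mul_pow, abs_pow, abs_of_nonneg hs]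
  have : (s ^ 3) ^ 2 ≤ s ^ 2 := by
    rw [← pow_mul]; exact pow_le_pow_of_le_one hs h1 (by norm_num)
  nlinarith [sq_nonneg ‖posn z‖, sq_nonneg ‖velo z‖]

namespace LP
variable (D : LP d)

lemma norm_iteratedFDeriv_cut_sub_le (l : ℕ) : ∃ C : ℝ, 0 ≤ C ∧ ∀ n i, i ≤ l → ∀ x : Phase d,
    ‖iteratedFDeriv ℝ i (fun y => D.cut n y - 1) x‖ ≤ C * ((2 : ℝ) ^ n)⁻¹ * (1 + ‖x‖) := by
  refine ⟨∑ i ∈ Finset.range (l + 2), SchwartzMap.seminorm ℝ 0 i D.c,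
    Finset.sum_nonneg fun _ _ => by positivity, fun n i hi x => ?_⟩
  set s : ℝ := ((2 : ℝ) ^ n)⁻¹ with hs
  have hs0 : 0 < s := by positivity
  have hs1 : s ≤ 1 := inv_le_one_of_one_le₀ (one_le_pow₀ (by norm_num))
  have hle : ∀ i, i ≤ l + 1 → SchwartzMap.seminorm ℝ 0 i D.c ≤
      ∑ i ∈ Finset.range (l + 2), SchwartzMap.seminorm ℝ 0 i D.c := fun i hi =>
    Finset.single_le_sum (f := fun i => SchwartzMap.seminorm ℝ 0 i D.c)
      (fun _ _ => by positivity) (Finset.mem_range.2 (by omega))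
  have hcut : ∀ y, D.cut n y = D.c (dil s y) := fun y => D.cut_apply n y
  rcases Nat.eq_zero_or_pos i with rfl | hi0
  · rw [norm_iteratedFDeriv_zero, hcut]
    have h0 : D.c 0 = 1 := D.c_eq_one (by simp)
    have := Convex.norm_image_sub_le_of_norm_fderiv_le (𝕜 := ℝ) (f := D.c) (s := univ)
      (C := SchwartzMap.seminorm ℝ 0 1 D.c) (fun y _ => D.c.differentiableAt)
      (fun y _ => by
        have := SchwartzMap.norm_iteratedFDeriv_le_seminorm ℝ D.c 1 y
        rwa [norm_iteratedFDeriv_one] at this) convex_univ (mem_univ 0) (mem_univ (dil s x))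
    rw [h0, sub_zero] at this
    have h1 := hle 1 (by omega)
    have h2 := norm_dil_le hs0.le hs1 x
    calc _ ≤ _ := this
      _ ≤ (∑ i ∈ Finset.range (l + 2), SchwartzMap.seminorm ℝ 0 i D.c) * (s * ‖x‖) := by gcongr
      _ ≤ _ := by
        rw [← mul_assoc]; gcongr; linarith
  · have e1 : iteratedFDeriv ℝ i (fun y => D.cut n y - 1) x =
        iteratedFDeriv ℝ i (D.c ∘ ((dilE s hs0.ne' : Phase d ≃L[ℝ] Phase d) : Phase d →L[ℝ] Phase d)) x := by
      have h1 : (fun y => D.cut n y - 1) = (D.cut n : Phase d → ℂ) + fun _ => (-1 : ℂ) := by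
        funext y; simp [sub_eq_add_neg]
      have h2 : (D.cut n : Phase d → ℂ) = D.c ∘ ((dilE s hs0.ne' : Phase d ≃L[ℝ] Phase d) : Phase d →L[ℝ] Phase d) := by
        funext y; exact hcut y
      rw [h1, iteratedFDeriv_add_apply ((D.cut n).contDiffAt _) contDiffAt_const,
        iteratedFDeriv_const_of_ne (by omega)]
      simp [h2]
    rw [e1, ContinuousLinearMap.iteratedFDeriv_comp_right _ (D.c.smooth ⊤) x
      (i := i) (by exact_mod_cast le_top)]
    refine (ContinuousMultilinearMap.norm_compContinuousLinearMap_le _ _).trans ?_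
    rw [Finset.prod_const, Finset.card_univ, Fintype.card_fin]
    set Λ : Phase d →L[ℝ] Phase d := ((dilE s hs0.ne' : Phase d ≃L[ℝ] Phase d) : Phase d →L[ℝ] Phase d)
    have hn : ‖Λ‖ ≤ s :=
      ContinuousLinearMap.opNorm_le_bound _ hs0.le fun y => norm_dil_le hs0.le hs1 y
    have h3 := SchwartzMap.norm_iteratedFDeriv_le_seminorm ℝ D.c i (Λ x)
    have h4 : ‖Λ‖ ^ i ≤ s :=
      (pow_le_pow_left₀ (norm_nonneg _) hn i).trans (pow_le_of_le_one hs0.le hs1 (by omega))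
    have h5 := h3.trans (hle i (by omega))
    have h6 : 0 ≤ ∑ i ∈ Finset.range (l + 2), SchwartzMap.seminorm ℝ 0 i D.c :=
      Finset.sum_nonneg fun _ _ => by positivity
    have h9 : 0 ≤ ‖Λ‖ ^ i := by positivity
    generalize ∑ i ∈ Finset.range (l + 2), SchwartzMap.seminorm ℝ 0 i D.c = A at h5 h6 ⊢
    generalize ‖iteratedFDeriv ℝ i D.c (Λ x)‖ = B at h5 ⊢
    generalize ‖Λ‖ ^ i = E at h4 h9 ⊢
    have h7 : A * s ≤ A * s * (1 + ‖x‖) :=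
      le_mul_of_one_le_right (by positivity) (by linarith [norm_nonneg x])
    exact (mul_le_mul h5 h4 h9 h6).trans h7

/-- The smooth cutoffs `cut n` are an approximate unit of the Schwartz space. -/
lemma tendsto_mulS_cut (ψ : Test d) :
    Tendsto (fun n => mulS (D.cut n) ψ) atTop (nhds ψ) := by
  rw [(schwartz_withSeminorms ℝ (Phase d) ℂ).tendsto_nhds]
  rintro ⟨k, l⟩ ε hε
  obtain ⟨C, hC, hb⟩ := D.norm_iteratedFDeriv_cut_sub_le l
  set A := ∑ i ∈ Finset.range (l + 1), (l.choose i : ℝ) * C *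
    (SchwartzMap.seminorm ℝ k (l - i) ψ + SchwartzMap.seminorm ℝ (k + 1) (l - i) ψ) with hA
  have hA0 : 0 ≤ A := Finset.sum_nonneg fun _ _ => by positivity
  have key : ∀ n, SchwartzMap.seminorm ℝ k l (mulS (D.cut n) ψ - ψ) ≤ A * ((2 : ℝ) ^ n)⁻¹ := by
    intro n
    refine SchwartzMap.seminorm_le_bound ℝ k l _ (by positivity) fun x => ?_
    have e : ((mulS (D.cut n) ψ - ψ : Test d) : Phase d → ℂ) = fun y => (D.cut n y - 1) * ψ y := by
      funext y; simp [sub_mul]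
    rw [e]
    have hsm : ContDiff ℝ ∞ fun y => D.cut n y - 1 := ((D.cut n).smooth ⊤).sub contDiff_const
    have h1 := norm_iteratedFDeriv_mul_le hsm (ψ.smooth ⊤) x (n := l) (by exact_mod_cast le_top)
    refine (mul_le_mul_of_nonneg_left h1 (by positivity)).trans ?_
    rw [hA, Finset.mul_sum, Finset.sum_mul]
    refine Finset.sum_le_sum fun i hi => ?_
    have h2 := hb n i (by simpa [Nat.lt_succ_iff] using hi) x
    have h3 := SchwartzMap.le_seminorm ℝ k (l - i) ψ x
    have h4 := SchwartzMap.le_seminorm ℝ (k + 1) (l - i) ψ x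
    calc ‖x‖ ^ k * ((l.choose i : ℝ) * ‖iteratedFDeriv ℝ i (fun y => D.cut n y - 1) x‖ *
          ‖iteratedFDeriv ℝ (l - i) ψ x‖)
        ≤ ‖x‖ ^ k * ((l.choose i : ℝ) * (C * ((2 : ℝ) ^ n)⁻¹ * (1 + ‖x‖)) *
          ‖iteratedFDeriv ℝ (l - i) ψ x‖) := by gcongr
      _ = (l.choose i : ℝ) * C * (‖x‖ ^ k * ‖iteratedFDeriv ℝ (l - i) ψ x‖ +
          ‖x‖ ^ (k + 1) * ‖iteratedFDeriv ℝ (l - i) ψ x‖) * ((2 : ℝ) ^ n)⁻¹ := by ring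
      _ ≤ _ := by gcongr
  have hlim : Tendsto (fun n : ℕ => A * ((2 : ℝ) ^ n)⁻¹) atTop (nhds 0) := by
    have : Tendsto (fun n : ℕ => ((2 : ℝ) ^ n)⁻¹) atTop (nhds 0) := by
      simp_rw [← inv_pow]
      exact tendsto_pow_atTop_nhds_zero_of_lt_one (by norm_num) (by norm_num)
    simpa using this.const_mul A
  filter_upwards [hlim.eventually_lt_const hε] with n hn
  exact (key n).trans_lt hn

lemma tendsto_TS_cut (φ : Test d) :
    Tendsto (fun n => TS (D.cut n) φ) atTop (nhds φ) := by
  have h := ((fourierInvCLM ℂ (Test d)).continuous.tendsto _).comp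
    (D.tendsto_mulS_cut (𝓕 φ))
  rw [fourierInvCLM_apply, fourierInv_fourier_eq] at h
  exact h

end LP

/-! ### Uniqueness of densities -/

lemma Tame.locallyIntegrable {g : Phase d → ℂ} (hg : Tame g) : LocallyIntegrable g := by
  obtain ⟨N, hN⟩ := hg.int
  rw [locallyIntegrable_iff]
  intro K hK
  obtain ⟨R, hR⟩ := hK.isBounded.exists_norm_le
  have h0 : 0 ≤ max R 0 := le_max_right _ _
  have h2 : IntegrableOn (fun z => (1 + max R 0) ^ N * (wt N z * ‖g z‖)) K :=
    (hN.const_mul _).integrableOn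
  refine Integrable.mono' h2 hg.meas.aestronglyMeasurable ?_
  filter_upwards [ae_restrict_mem hK.measurableSet] with z hz
  have h1 : ‖z‖ ≤ max R 0 := (hR z hz).trans (le_max_left _ _)
  rw [← mul_assoc]
  refine le_mul_of_one_le_left (norm_nonneg _) ?_
  rw [wt, ← div_eq_mul_inv, one_le_div (by positivity)]
  gcongr

/-- Functions with the same integrals against test functions coincide. -/
lemma ae_eq_of_test {g h : Phase d → ℂ} (hg : LocallyIntegrable g) (hh : LocallyIntegrable h)
    (e : ∀ φ : Test d, HasCompactSupport φ → ∫ z, φ z * g z = ∫ z, φ z * h z) :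
    g =ᵐ[volume] h := by
  refine ae_eq_of_integral_contDiff_smul_eq hg hh fun f hf hc => ?_
  have hc' : HasCompactSupport fun z => (f z : ℂ) := hc.comp_left (g := fun x : ℝ => (x : ℂ)) rfl
  have := e (hc'.toSchwartzMap (Complex.ofRealCLM.contDiff.comp hf)) hc'
  exact this

lemma exists_pos_test : ∃ φ : Test d, ∀ z, φ z ≠ 0 := by
  obtain ⟨G, hG⟩ := exists_gaussian (d := d) (c := 1) one_pos
  exact ⟨G, fun z => by rw [hG]; exact_mod_cast (Real.exp_pos _).ne'⟩

variable {F : Type} [NormedAddCommGroup F] [NormedSpace ℂ F]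

lemma Represents.aestronglyMeasurable {g : Phase d → F} {Φ : Temp d F} (h : Represents g Φ) :
    AEStronglyMeasurable g := by
  obtain ⟨φ, hφ⟩ := exists_pos_test (d := d)
  have h1 := (h φ).1.aestronglyMeasurable
  have h2 : AEStronglyMeasurable (fun z => (φ z)⁻¹) (volume : Measure (Phase d)) :=
    (φ.continuous.inv₀ hφ).aestronglyMeasurable
  refine (h2.smul h1).congr (.of_forall fun z => ?_)
  simp [smul_smul, inv_mul_cancel₀ (hφ z)]

lemma Represents.locallyIntegrable {g : Phase d → F} {Φ : Temp d F} (h : Represents g Φ) :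
    LocallyIntegrable g := by
  obtain ⟨φ, hφ⟩ := exists_pos_test (d := d)
  rw [locallyIntegrable_iff]
  intro K hK
  have hc : Continuous fun z => (φ z)⁻¹ := φ.continuous.inv₀ hφ
  obtain ⟨C, hC⟩ := hK.exists_bound_of_continuousOn hc.continuousOn
  have h2 : IntegrableOn (fun z => C * ‖φ z • g z‖) K := ((h φ).1.norm.const_mul C).integrableOn
  refine Integrable.mono' h2 h.aestronglyMeasurable.restrict ?_
  filter_upwards [ae_restrict_mem hK.measurableSet] with z hz
  calc ‖g z‖ = ‖(φ z)⁻¹‖ * ‖φ z • g z‖ := by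
        rw [← norm_smul, smul_smul, inv_mul_cancel₀ (hφ z), one_smul]
    _ ≤ _ := by gcongr; exact hC z hz

lemma represents_of_tame {g : Phase d → ℂ} {Φ : Temp d ℂ} (hg : Tame g)
    (h : ∀ φ : Test d, Φ φ = ∫ z, φ z * g z) : Represents g Φ :=
  fun φ => ⟨hg.integrable_mul φ, h φ⟩

lemma Represents.unique {g : Phase d → F} {Φ Ψ : Temp d F} (h : Represents g Φ)
    (h' : Represents g Ψ) : Φ = Ψ := by
  ext φ; rw [(h φ).2, (h' φ).2]

lemma ofFun_eq {g : Phase d → F} {Φ : Temp d F} (h : Represents g Φ) (N : Temp d F → ℝ≥0∞) :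
    ofFun N g = N Φ :=
  le_antisymm (iInf₂_le Φ h) (le_iInf₂ fun Ψ hΨ => by rw [h.unique hΨ])

lemma exists_represents_of_ofFun_lt {g : Phase d → F} {N : Temp d F → ℝ≥0∞}
    (h : ofFun N g < ⊤) : ∃ Φ, Represents g Φ ∧ ofFun N g = N Φ := by
  simp only [ofFun, iInf_lt_iff] at h
  obtain ⟨Φ, hΦ, -⟩ := h
  exact ⟨Φ, hΦ, ofFun_eq hΦ N⟩

/-! ### Densities of localized distributions -/

lemma fourier_eq_fourierInv_neg (φ : Test d) : 𝓕 φ = negS (𝓕⁻ φ) := by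
  ext ξ
  rw [negS_apply, SchwartzMap.fourier_coe, SchwartzMap.fourierInv_coe, Real.fourierInv_eq_fourier_neg,
    neg_neg]

lemma fourierInv_eq_fourier_neg (φ : Test d) : 𝓕⁻ φ = negS (𝓕 φ) := by
  ext ξ
  rw [negS_apply, SchwartzMap.fourier_coe, SchwartzMap.fourierInv_coe, Real.fourierInv_eq_fourier_neg]

lemma TS_eq (m φ : Test d) : TS (negS m) φ = 𝓕 (mulS m (𝓕⁻ φ)) := by
  ext z
  rw [fourier_eq_fourierInv_neg, negS_apply]
  change ker _ z = ker _ (-z)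
  rw [← ker_negS]
  congr 2
  ext ξ
  rw [mulS_apply, negS_apply, negS_apply, mulS_apply, fourierInv_eq_fourier_neg, negS_apply, neg_neg]

lemma TS_TS (m n φ : Test d) : TS m (TS n φ) = TS (mulS m n) φ := by
  unfold TS
  rw [fourier_fourierInv_eq, mulS_assoc]

lemma TS_sum {ι : Type*} (s : Finset ι) (m : ι → Test d) (φ : Test d) :
    TS (∑ i ∈ s, m i) φ = ∑ i ∈ s, TS (m i) φ := by
  ext z
  rw [TS_apply, sum_apply, T_sum_sym _ _ (Tame.schwartz φ)]
  simp [TS_apply]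

lemma TS_reflAt (m n : Test d) (z : Phase d) :
    TS m (reflAt (ker n) z) = reflAt (ker (mulS (negS m) n)) z := by
  ext w
  rw [TS_apply, reflAt_apply, ker_mulS, T]
  rw [← integral_sub_left_eq_self (fun y => ker m (w - y) * (reflAt (ker n) z) y) volume w]
  rw [← integral_neg_eq_self]
  congr 1; funext y
  rw [ker_negS, reflAt_apply]
  congr 2 <;> abel

/-- The smooth function `z ↦ L (Φ (ker m (z - ·)))`, the density of the Fourier multiplier of
symbol `m` applied to the component `L ∘ Φ` of a distribution. -/
def dens (L : F →L[ℂ] ℂ) (Φ : Temp d F) (m : Test d) (z : Phase d) : ℂ := L (Φ (reflAt (ker m) z))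

lemma reflAt_sum {ι : Type*} (s : Finset ι) (m : ι → Test d) (z : Phase d) :
    reflAt (ker (∑ i ∈ s, m i)) z = ∑ i ∈ s, reflAt (ker (m i)) z := by
  ext w; simp [ker_sum]

lemma dens_sum (L : F →L[ℂ] ℂ) (Φ : Temp d F) {ι : Type*} (s : Finset ι) (m : ι → Test d)
    (z : Phase d) : dens L Φ (∑ i ∈ s, m i) z = ∑ i ∈ s, dens L Φ (m i) z := by
  simp only [dens, reflAt_sum, map_sum]

/-- For a distribution with a density, `dens` is the multiplier applied to the density. -/
lemma Represents.T_eq {g : Phase d → F} {Φ : Temp d F} (h : Represents g Φ) [CompleteSpace F]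
    (L : F →L[ℂ] ℂ) (m : Test d) : T m (fun z => L (g z)) = dens L Φ m := by
  funext z
  have h1 := h (reflAt (ker m) z)
  rw [dens, h1.2, ← ContinuousLinearMap.integral_comp_comm L h1.1, T]
  simp

/-- A distribution localized by the symbol `m` whose localization has a density of finite norm:
the function `dens L Φ m` is measurable, has a comparable norm, and is the density. -/
lemma dens_of_distNorm (hp : Adm p) [CompleteSpace F] {L : F →L[ℂ] ℂ} (hL : ∀ x, ‖L x‖ₑ ≤ ‖x‖ₑ)
    {Φ Ψ : Temp d F} {m n : Test d} (hm : negS m = m) (hn : negS n = n) (hmn : mulS m n = m)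
    (hΨ : ∀ φ, Ψ φ = Φ (TS m φ)) (hfin : distNorm p Ψ < ⊤) :
    mx p (fun z => ‖dens L Φ m z‖ₑ) ≤ wiener n * distNorm p Ψ ∧ Tame (dens L Φ m) ∧
      ∀ φ, L (Φ (TS m φ)) = ∫ z, φ z * dens L Φ m z := by
  have key : ∀ h : Phase d → F, Represents h Ψ → mixedNorm p h < ⊤ →
      mx p (fun z => ‖dens L Φ m z‖ₑ) ≤ wiener n * mixedNorm p h ∧ Tame (dens L Φ m) ∧
        ∀ φ, L (Φ (TS m φ)) = ∫ z, φ z * dens L Φ m z := by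
    intro h hh hlt
    have hsm : AEStronglyMeasurable (fun z => L (h z)) :=
      L.continuous.comp_aestronglyMeasurable hh.aestronglyMeasurable
    set g := hsm.mk _ with hg
    have hgm : Measurable g := hsm.stronglyMeasurable_mk.measurable
    have hae : (fun z => L (h z)) =ᵐ[volume] g := hsm.ae_eq_mk
    have hmx : mx p (fun z => ‖g z‖ₑ) ≤ mixedNorm p h := by
      rw [mixedNorm_eq_mx hp]
      have : mx p (fun z => ‖g z‖ₑ) = mx p (fun z => ‖L (h z)‖ₑ) :=
        mx_congr_ae (hae.symm.fun_comp fun x : ℂ => ‖x‖ₑ)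
      rw [this]
      exact mx_mono hp fun z => hL _
    have hT : Tame g := Tame.of_mx hp hgm (hmx.trans_lt hlt)
    have e : dens L Φ m = T n g := by
      rw [← T_congr_ae n hae, hh.T_eq L n]
      funext z
      rw [dens, dens, hΨ, TS_reflAt, hm, hmn]
    refine ⟨?_, e ▸ hT.T n, fun φ => ?_⟩
    · rw [e]
      exact (mx_T_le hp n hgm).trans (mul_le_mul' le_rfl hmx)
    · have h1 := hh (TS n φ)
      have h2 : TS m φ = TS m (TS n φ) := by rw [TS_TS, hmn]
      rw [h2, ← hΨ, h1.2, ← ContinuousLinearMap.integral_comp_comm L h1.1, e, integral_T_mul n φ hT,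
        hn]
      refine integral_congr_ae ?_
      filter_upwards [hae] with z hz
      rw [map_smul, hz, smul_eq_mul]
  have hex : ∃ h, ∃ _ : Represents h Ψ, mixedNorm p h < ⊤ := by
    simpa only [distNorm, iInf_lt_iff] using hfin
  obtain ⟨h, hh, hlt⟩ := hex
  refine ⟨?_, (key h hh hlt).2⟩
  rcases eq_or_ne (wiener n) 0 with h0 | h0
  · have := (key h hh hlt).1
    rw [h0, zero_mul] at this ⊢
    exact this
  · rw [distNorm, ENNReal.mul_iInf_of_ne h0 (wiener_lt_top n).ne]
    refine le_iInf fun h' => ?_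
    rw [ENNReal.mul_iInf_of_ne h0 (wiener_lt_top n).ne]
    refine le_iInf fun hh' => ?_
    rcases eq_or_ne (mixedNorm p h') ⊤ with ht | ht
    · rw [ht, ENNReal.mul_top h0]; exact le_top
    · exact (key h' hh' (lt_top_iff_ne_top.2 ht)).1

/-- The tempered distribution with density `g`. -/
def Tame.toTemp {g : Phase d → ℂ} (hg : Tame g) : Temp d ℂ :=
  ContinuousLinearMap.toPointwiseConvergenceCLM _ _ _ _
    (SchwartzMap.mkCLMtoNormedSpace (𝕜 := ℂ) (σ := RingHom.id ℂ) (fun φ : Test d => ∫ z, φ z * g z)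
      (fun φ ψ => by
        simp only [add_apply, add_mul]
        exact integral_add (hg.integrable_mul φ) (hg.integrable_mul ψ))
      (fun a φ => by
        simp only [smul_apply, smul_eq_mul, mul_assoc, RingHom.id_apply]
        exact integral_const_mul _ _)
      (by
        obtain ⟨N, hN⟩ := hg.int
        refine ⟨Finset.Iic (N, 0), 2 ^ N * ∫ z, wt N z * ‖g z‖, ?_, fun φ => ?_⟩
        · have : 0 ≤ ∫ z, wt N z * ‖g z‖ :=
            integral_nonneg fun z => mul_nonneg (wt_pos N z).le (norm_nonneg _)
          positivity
        set S := (Finset.Iic (N, 0)).sup (schwartzSeminormFamily ℂ (Phase d) ℂ) φ with hS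
        have h1 : ∀ z, ‖φ z * g z‖ ≤ (2 ^ N * S) * (wt N z * ‖g z‖) := fun z => by
          have h2 := SchwartzMap.one_add_le_sup_seminorm_apply (𝕜 := ℂ) (m := (N, 0)) (k := N)
            (n := 0) le_rfl le_rfl φ z
          rw [norm_iteratedFDeriv_zero] at h2
          rw [norm_mul, ← mul_assoc]
          refine mul_le_mul_of_nonneg_right ?_ (norm_nonneg _)
          rw [wt, ← div_eq_mul_inv, le_div_iff₀ (by positivity), mul_comm]
          exact h2
        refine (norm_integral_le_of_norm_le (hN.const_mul _)
          (.of_forall h1)).trans ?_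
        rw [integral_const_mul]
        exact le_of_eq (by ring)))

lemma Tame.toTemp_apply {g : Phase d → ℂ} (hg : Tame g) (φ : Test d) :
    hg.toTemp φ = ∫ z, φ z * g z := rfl

lemma Tame.represents {g : Phase d → ℂ} (hg : Tame g) : Represents g hg.toTemp :=
  represents_of_tame hg hg.toTemp_apply

lemma Tame.dens {g : Phase d → ℂ} (hg : Tame g) (m : Test d) :
    dens (ContinuousLinearMap.id ℂ ℂ) hg.toTemp m = Kinetic.T m g :=
  (hg.represents.T_eq (ContinuousLinearMap.id ℂ ℂ) m).symm

/-! ### Geometric sums -/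

lemma tsum_pw_neg_lt_top {a : ℝ} (ha : 0 < a) : ∑' k : ℕ, pw (-(k * a)) < ⊤ := by
  have h1 : ∀ k : ℕ, pw (-(k * a)) = pw (-a) ^ k := fun k => by
    rw [pw, pw, ← ENNReal.rpow_natCast, ← ENNReal.rpow_mul]; congr 1; ring
  simp_rw [h1]
  rw [ENNReal.tsum_geometric]
  have : pw (-a) < 1 := by
    rw [pw_eq_ofReal, ENNReal.ofReal_lt_one]
    exact Real.rpow_lt_one_of_one_lt_of_neg (by norm_num) (by linarith)
  rw [ENNReal.inv_lt_top]
  exact tsub_pos_of_lt this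

/-- The sum of `2^{-ka}` over `k`. -/
def geo (a : ℝ) : ℝ≥0∞ := ∑' k : ℕ, pw (-(k * a))

lemma le_pw_neg_mul {x : ℝ} {a b : ℝ≥0∞} (h : pw x * a ≤ b) : a ≤ pw (-x) * b := by
  calc a = pw (-x) * (pw x * a) := by rw [← mul_assoc, mul_comm (pw (-x)), pw_mul_neg, one_mul]
    _ ≤ _ := by gcongr

lemma pw_mul_le {x : ℝ} {a b : ℝ≥0∞} (h : a ≤ pw (-x) * b) : pw x * a ≤ b := by
  calc pw x * a ≤ pw x * (pw (-x) * b) := by gcongr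
    _ = b := by rw [← mul_assoc, pw_mul_neg, one_mul]

/-! ### Reconstruction from the blocks -/

section
variable (D : LP d)

/-- A distribution is the sum of its blocks; if these are summable, the sum is a density. -/
lemma recon_dist (hp : Adm p) (L : F →L[ℂ] ℂ) (Φ : Temp d F)
    (ht : ∀ j, Tame (dens L Φ (D.phi j)))
    (hr : ∀ j φ, L (Φ (TS (D.phi j) φ)) = ∫ z, φ z * dens L Φ (D.phi j) z)
    (hs : ∑' j, mx p (fun z => ‖dens L Φ (D.phi j) z‖ₑ) < ⊤) (φ : Test d) :
    Integrable (fun z => φ z * ∑' j, dens L Φ (D.phi j) z) ∧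
      HasSum (fun j => ∫ z, φ z * dens L Φ (D.phi j) z) (L (Φ φ)) ∧
      L (Φ φ) = ∫ z, φ z * ∑' j, dens L Φ (D.phi j) z := by
  have hi : ∀ j, Integrable fun z => φ z * dens L Φ (D.phi j) z := fun j => (ht j).integrable_mul φ
  have hfin : ∑' j, ∫⁻ z, ‖φ z * dens L Φ (D.phi j) z‖ₑ < ⊤ := by
    refine lt_of_le_of_lt (ENNReal.tsum_le_tsum (g := fun j =>
      mx (conjPair p) (fun z => ‖φ z‖ₑ) * mx p (fun z => ‖dens L Φ (D.phi j) z‖ₑ)) fun j => ?_) ?_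
    · simp_rw [enorm_mul]
      rw [mul_comm]
      simp_rw [mul_comm ‖φ _‖ₑ]
      exact lintegral_mul_le_mx hp (ht j).meas.enorm φ.continuous.measurable.enorm
    · rw [ENNReal.tsum_mul_left]
      exact mul_lt_top (mx_schwartz_lt_top hp.conj φ) hs
  have h1 := hasSum_integral_of_summable_integral_norm hi (by
    have : Summable fun j => (∫⁻ z, ‖φ z * dens L Φ (D.phi j) z‖ₑ).toReal :=
      ENNReal.summable_toReal hfin.ne
    refine this.congr fun j => ?_
    rw [integral_norm_eq_lintegral_enorm (hi j).aestronglyMeasurable])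
  have h2 : L (Φ φ) = ∫ z, ∑' j, φ z * dens L Φ (D.phi j) z := by
    have h3 := h1.tendsto_sum_nat.comp (tendsto_add_atTop_nat 1)
    have h4 : (fun n => L (Φ (TS (D.cut n) φ))) =
        (fun n => ∑ i ∈ Finset.range n, ∫ z, φ z * dens L Φ (D.phi i) z) ∘ fun a => a + 1 := by
      funext n
      simp only [Function.comp]
      rw [← D.sum_phi, TS_sum, map_sum, map_sum]
      exact Finset.sum_congr rfl fun j _ => hr j φ
    rw [← h4] at h3
    have h5 : Tendsto (fun n => L (Φ (TS (D.cut n) φ))) atTop (nhds (L (Φ φ))) :=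
      (L.continuous.tendsto _).comp ((Φ.continuous.tendsto _).comp (D.tendsto_TS_cut φ))
    exact tendsto_nhds_unique h5 h3
  refine ⟨?_, ?_, ?_⟩
  · have h6 : Integrable fun z => ∑' j, φ z * dens L Φ (D.phi j) z := by
      refine ⟨?_, ?_⟩
      · refine Measurable.aestronglyMeasurable ?_
        exact Measurable.tsum fun j => φ.continuous.measurable.mul (ht j).meas
      · refine lt_of_le_of_lt (lintegral_mono fun z => enorm_tsum_le_tsum_enorm) ?_
        rw [lintegral_tsum (f := fun j z => ‖φ z * dens L Φ (D.phi j) z‖ₑ) fun j =>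
          (φ.continuous.measurable.mul (ht j).meas).enorm.aemeasurable]
        exact hfin
    simpa [tsum_mul_left] using h6
  · rw [h2]; exact h1
  · rw [h2]; simp [tsum_mul_left]

lemma measurable_tsum_dens {L : F →L[ℂ] ℂ} {Φ : Temp d F} (ht : ∀ j, Tame (dens L Φ (D.phi j))) :
    Measurable fun z => ∑' j, dens L Φ (D.phi j) z :=
  Measurable.tsum fun j => (ht j).meas

lemma mx_tsum_dens_le (hp : Adm p) {L : F →L[ℂ] ℂ} {Φ : Temp d F}
    (ht : ∀ j, Tame (dens L Φ (D.phi j))) :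
    mx p (fun z => ‖∑' j, dens L Φ (D.phi j) z‖ₑ) ≤
      ∑' j, mx p (fun z => ‖dens L Φ (D.phi j) z‖ₑ) :=
  (mx_mono hp fun _ => enorm_tsum_le_tsum_enorm).trans (mx_tsum_le hp fun j => (ht j).meas.enorm)

/-- A distribution with density `h` and summable blocks: the density is their sum. -/
lemma recon_fun (hp : Adm p) [CompleteSpace F] {L : F →L[ℂ] ℂ} {Φ : Temp d F} {h : Phase d → F}
    (hh : Represents h Φ) (ht : ∀ j, Tame (dens L Φ (D.phi j)))
    (hr : ∀ j φ, L (Φ (TS (D.phi j) φ)) = ∫ z, φ z * dens L Φ (D.phi j) z)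
    (hs : ∑' j, mx p (fun z => ‖dens L Φ (D.phi j) z‖ₑ) < ⊤) :
    (fun z => L (h z)) =ᵐ[volume] fun z => ∑' j, dens L Φ (D.phi j) z := by
  have h1 : LocallyIntegrable fun z => L (h z) := by
    rw [locallyIntegrable_iff]
    intro K hK
    exact L.integrable_comp (hh.locallyIntegrable.integrableOn_isCompact hK)
  have h2 : Tame fun z => ∑' j, dens L Φ (D.phi j) z :=
    Tame.of_mx hp (measurable_tsum_dens D ht) ((mx_tsum_dens_le D hp ht).trans_lt hs)
  refine ae_eq_of_test h1 h2.locallyIntegrable fun φ _ => ?_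
  rw [← (recon_dist D hp L Φ ht hr hs φ).2.2, (hh φ).2,
    ← ContinuousLinearMap.integral_comp_comm L (hh φ).1]
  simp

lemma ae_summable_of_mx (hp : Adm p) {ι : Type*} [Countable ι] {G : ι → Phase d → ℂ} (hG : ∀ j, Measurable (G j))
    (hs : ∑' j, mx p (fun z => ‖G j z‖ₑ) < ⊤) :
    ∀ᵐ z, ∑' j, ‖G j z‖ₑ < ⊤ := by
  obtain ⟨φ, hφ⟩ := exists_pos_test (d := d)
  have h1 : ∫⁻ z, (∑' j, ‖G j z‖ₑ) * ‖φ z‖ₑ < ⊤ := by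
    have hm : Measurable fun z => ∑' j, ‖G j z‖ₑ := Measurable.tsum fun j => (hG j).enorm
    refine (lintegral_mul_le_mx hp hm φ.continuous.measurable.enorm).trans_lt ?_
    exact mul_lt_top ((mx_tsum_le hp fun j => (hG j).enorm).trans_lt hs)
      (mx_schwartz_lt_top hp.conj φ)
  have hm : Measurable fun z => (∑' j, ‖G j z‖ₑ) * ‖φ z‖ₑ :=
    (Measurable.tsum fun j => (hG j).enorm).mul φ.continuous.measurable.enorm
  filter_upwards [ae_lt_top hm h1.ne] with z hz
  by_contra h
  rw [not_lt, top_le_iff] at h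
  rw [h, ENNReal.top_mul (by simpa using hφ z)] at hz
  exact lt_irrefl _ hz

/-! ### Besov norms and blocks -/

lemma blockA_apply (j : ℕ) (Φ : Temp d F) (φ : Test d) :
    blockA D.χ j Φ φ = Φ (TS (D.phi j) φ) := by
  rw [blockA, TemperedDistribution.fourierMultiplierCLM_apply_apply]
  congr 1
  rw [← D.negS_phi, TS_eq]
  congr 1
  ext ξ
  have ht : Function.HasTemperateGrowth fun η : Phase d =>
      (anisoPart D.χ j ((2 * π) • η) : ℂ) := by
    have : (fun η : Phase d => (anisoPart D.χ j ((2 * π) • η) : ℂ)) = D.phi j := by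
      funext η; rw [D.phi_eq_anisoPart]
    rw [this]; exact (D.phi j).hasTemperateGrowth
  rw [smulLeftCLM_apply_apply ht, mulS_apply, D.phi_eq_anisoPart, smul_eq_mul]

lemma blockX_blockA_apply (k j : ℕ) (Φ : Temp d F) (φ : Test d) :
    blockX D.χx k (blockA D.χ j Φ) φ = Φ (TS (D.mulX k (D.phi j)) φ) := by
  rw [blockX, TemperedDistribution.fourierMultiplierCLM_apply_apply, blockA_apply]
  congr 1
  have h1 : negS (D.mulX k (D.phi j)) = D.mulX k (D.phi j) := by rw [D.negS_mulX, D.negS_phi]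
  rw [← h1, ← D.negS_phi, TS_eq, TS_eq, fourierInv_fourier_eq, D.negS_phi]
  congr 1
  ext ξ
  have h2 := smulLeftCLM_apply_apply (D.xs_temperate k) (𝓕⁻ φ) ξ
  rw [smul_eq_mul] at h2
  rw [mulS_apply, mulS_apply, D.mulX_apply, mul_comm (D.xs k ξ), mul_assoc, ← h2]
  rfl

lemma mulS_mulX_phi_psi (k j : ℕ) : mulS (D.mulX k (D.phi j)) (D.psi j) = D.mulX k (D.phi j) := by
  rw [← D.mulX_mulS, mulS_comm, D.mulS_psi_phi]

lemma phi_supp (j : ℕ) (ξ : Phase d) (h : 2 ^ (j + 2) < gauge ξ) : D.phi j ξ = 0 :=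
  D.phi_eq_zero_of_gt (lt_of_le_of_lt (pow_le_pow_right₀ (by norm_num) (by omega)) h)

lemma sum_mulX_phi (j : ℕ) :
    ∑ k ∈ Finset.range (LP.rk j + 1), D.mulX k (D.phi j) = D.phi j :=
  D.sum_mulX (phi_supp D j)

/-- The Besov norm of a family of blocks. -/
def bnorm (p : ℝ≥0∞ × ℝ≥0∞) (γ s : ℝ) (G : ℕ → ℕ → Phase d → ℂ) : ℝ≥0∞ :=
  ⨆ (k : ℕ) (j : ℕ), pw (k * γ / 3) * pw (j * s) * mx p (fun z => ‖G k j z‖ₑ)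

lemma mx_le_bnorm {γ s : ℝ} (G : ℕ → ℕ → Phase d → ℂ) (k j : ℕ) :
    mx p (fun z => ‖G k j z‖ₑ) ≤ pw (-(k * γ / 3)) * (pw (-(j * s)) * bnorm p γ s G) := by
  refine le_pw_neg_mul (le_pw_neg_mul ?_)
  rw [← mul_assoc, mul_comm (pw (j * s))]
  exact le_iSup₂ (f := fun k j : ℕ => pw (k * γ / 3) * pw (j * s) * mx p (fun z => ‖G k j z‖ₑ)) k j

lemma besovMixed_lt_top_distNorm {γ s : ℝ} {Φ : Temp d F}
    (h : besovMixed D.χ D.χx p γ s Φ < ⊤) (k j : ℕ) :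
    distNorm p (blockX D.χx k (blockA D.χ j Φ)) < ⊤ := by
  have h1 := (le_iSup₂ (f := fun k j : ℕ => (2 : ℝ≥0∞) ^ ((k : ℝ) * γ / 3) *
    (2 : ℝ≥0∞) ^ ((j : ℝ) * s) * distNorm p (blockX D.χx k (blockA D.χ j Φ))) k j).trans_lt h
  by_contra h2
  rw [not_lt, top_le_iff] at h2
  rw [h2, ENNReal.mul_top] at h1
  · exact lt_irrefl _ h1
  · exact mul_ne_zero (pw_ne_zero _) (pw_ne_zero _)

/-- The blocks of a distribution of finite Besov norm. -/
structure BlockData (D : LP d) (p : ℝ≥0∞ × ℝ≥0∞) (L : F →L[ℂ] ℂ) (Φ : Temp d F) : Prop where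
  tame : ∀ j, Tame (dens L Φ (D.phi j))
  repr : ∀ j φ, L (Φ (TS (D.phi j) φ)) = ∫ z, φ z * dens L Φ (D.phi j) z
  tameX : ∀ k j, Tame (dens L Φ (D.mulX k (D.phi j)))

lemma negS_mulX_phi (k j : ℕ) : negS (D.mulX k (D.phi j)) = D.mulX k (D.phi j) := by
  rw [D.negS_mulX, D.negS_phi]

/-- A component of a distribution of finite Besov norm has blocks given by functions, whose norms
are controlled by the norm of the distribution. -/
lemma exists_bnorm_dens_le (hp : Adm p) : ∃ C : ℝ≥0, ∀ {F : Type} [NormedAddCommGroup F]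
    [NormedSpace ℂ F] [CompleteSpace F] {L : F →L[ℂ] ℂ} (_ : ∀ x, ‖L x‖ₑ ≤ ‖x‖ₑ) {Φ : Temp d F}
    {γ s : ℝ}, besovMixed D.χ D.χx p γ s Φ < ⊤ → BlockData D p L Φ ∧
      bnorm p γ s (fun k j => dens L Φ (D.mulX k (D.phi j))) ≤
        C * besovMixed D.χ D.χx p γ s Φ := by
  obtain ⟨C, hC⟩ := D.wiener_psi_le
  refine ⟨C, fun {F} _ _ _ {L} hL {Φ γ s} hfin => ?_⟩
  have key := fun k j => dens_of_distNorm (L := L) hp hL (negS_mulX_phi D k j) (D.negS_psi j)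
    (mulS_mulX_phi_psi D k j) (blockX_blockA_apply D k j Φ) (besovMixed_lt_top_distNorm D hfin k j)
  have e : ∀ j, dens L Φ (D.phi j) =
      fun z => ∑ k ∈ Finset.range (LP.rk j + 1), dens L Φ (D.mulX k (D.phi j)) z := fun j => by
    funext z; rw [← dens_sum, sum_mulX_phi]
  refine ⟨⟨fun j => ?_, fun j φ => ?_, fun k j => (key k j).2.1⟩, ?_⟩
  · rw [e]
    induction Finset.range (LP.rk j + 1) using Finset.induction_on with
    | empty => simpa using Tame.of_bounded (g := fun _ : Phase d => (0 : ℂ)) measurable_const (C := 0) (by simp)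
    | insert a t ha ih =>
      simp_rw [Finset.sum_insert ha]
      exact (key a j).2.1.add ih
  · rw [e]
    simp_rw [Finset.mul_sum]
    rw [integral_finsetSum _ fun k _ => (key k j).2.1.integrable_mul φ]
    conv_lhs => rw [← sum_mulX_phi D j, TS_sum, map_sum, map_sum]
    exact Finset.sum_congr rfl fun k _ => (key k j).2.2 φ
  · refine iSup₂_le fun k j => ?_
    have h1 := le_iSup₂ (f := fun k j : ℕ => (2 : ℝ≥0∞) ^ ((k : ℝ) * γ / 3) *
      (2 : ℝ≥0∞) ^ ((j : ℝ) * s) * distNorm p (blockX D.χx k (blockA D.χ j Φ))) k j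
    calc pw (k * γ / 3) * pw (j * s) * mx p (fun z => ‖dens L Φ (D.mulX k (D.phi j)) z‖ₑ)
        ≤ pw (k * γ / 3) * pw (j * s) *
          (C * distNorm p (blockX D.χx k (blockA D.χ j Φ))) := by
          gcongr
          exact (key k j).1.trans (mul_le_mul' (hC j) le_rfl)
      _ = C * (pw (k * γ / 3) * pw (j * s) * distNorm p (blockX D.χx k (blockA D.χ j Φ))) := by ring
      _ ≤ _ := by gcongr; exact h1

/-- The anisotropic blocks are controlled by the mixed Besov norm. -/
lemma mx_dens_phi_le (hp : Adm p) {L : F →L[ℂ] ℂ} {Φ : Temp d F} (h : BlockData D p L Φ) {γ s : ℝ}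
    (j : ℕ) : mx p (fun z => ‖dens L Φ (D.phi j) z‖ₑ) ≤ pw (-(j * s)) * (geo (γ / 3) *
      bnorm p γ s (fun k j => dens L Φ (D.mulX k (D.phi j)))) := by
  have e : ∀ z, ‖dens L Φ (D.phi j) z‖ₑ ≤ ∑' k, ‖dens L Φ (D.mulX k (D.phi j)) z‖ₑ := fun z => by
    conv_lhs => rw [← sum_mulX_phi D j, dens_sum]
    exact (enorm_sum_le _ _).trans
      (ENNReal.sum_le_tsum (f := fun k => ‖dens L Φ (D.mulX k (D.phi j)) z‖ₑ) _)
  refine (mx_mono hp e).trans ((mx_tsum_le hp fun k => (h.tameX k j).meas.enorm).trans ?_)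
  rw [geo, ← ENNReal.tsum_mul_right, ← ENNReal.tsum_mul_left]
  refine ENNReal.tsum_le_tsum fun k => ?_
  refine (mx_le_bnorm (γ := γ) (s := s) (fun k j => dens L Φ (D.mulX k (D.phi j))) k j).trans ?_
  rw [mul_left_comm, mul_div_assoc]

/-- The blocks of the Fourier multipliers applied to a localized distribution. -/
lemma BlockData.T_dens {L : F →L[ℂ] ℂ} {Φ : Temp d F} (h : BlockData D p L Φ) (m : Test d) (j : ℕ) :
    T m (dens L Φ (D.phi j)) = dens L Φ (mulS m (D.phi j)) := by
  funext z
  have h1 := h.repr j (reflAt (ker m) z)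
  rw [TS_reflAt, D.negS_phi, mulS_comm] at h1
  rw [dens, h1, T]
  simp

/-- The mixed Besov norm of a function is at most that of its blocks. -/
lemma besovMixed_le_bnorm (hp : Adm p) {g : Phase d → ℂ} (hg : Tame g) (γ s : ℝ) :
    ofFun (besovMixed D.χ D.χx p γ s) g ≤ bnorm p γ s (fun k j => T (D.mulX k (D.phi j)) g) := by
  rw [ofFun_eq hg.represents]
  refine iSup₂_le fun k j => ?_
  refine le_trans ?_ (le_iSup₂ (f := fun k j : ℕ => pw (k * γ / 3) * pw (j * s) *
    mx p (fun z => ‖T (D.mulX k (D.phi j)) g z‖ₑ)) k j)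
  refine mul_le_mul' le_rfl ?_
  rw [← mixedNorm_eq_mx hp]
  refine iInf₂_le (f := fun h _ => mixedNorm p h) (T (D.mulX k (D.phi j)) g)
    (represents_of_tame (hg.T _) fun φ => ?_)
  rw [blockX_blockA_apply, hg.toTemp_apply, integral_T_mul _ _ hg, negS_mulX_phi]

end

/-! ### The adjoint kinetic operator and its semigroup -/

/-- The unit vector in the direction of `x_i`. -/
def eX (i : Fin d) : Phase d := pt (EuclideanSpace.single i 1) 0

/-- `adjointOp lam` as an operator on Schwartz functions. -/
def adjS (lam : ℝ) (φ : Test d) : Test d :=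
  (∑ i : Fin d, lineDerivOp (eV i) (lineDerivOp (eV i) φ))
    - (∑ i : Fin d, smulLeftCLM ℂ (fun z : Phase d => inner ℝ z (eV i))
        (lineDerivOp (eX i) φ)) - (lam : ℂ) • φ

lemma continuous_adjS (lam : ℝ) : Continuous (adjS lam : Test d → Test d) := by
  unfold adjS
  have h : ∀ w : Phase d, Continuous fun φ : Test d => lineDerivOp w φ := fun w =>
    (lineDerivOpCLM ℂ (Test d) w).continuous
  refine ((continuous_finsetSum _ fun i _ => (h _).comp (h _)).sub
    (continuous_finsetSum _ fun i _ => ?_)).sub (continuous_const_smul _)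
  exact (smulLeftCLM ℂ (fun z : Phase d => inner ℝ z (eV i))).continuous.comp (h _)

lemma pt_zero_eq_sum (v : Vec d) : pt v 0 = ∑ i, v i • (eX i : Phase d) := by
  ext j
  rcases j with j | j <;>
  simp [pt, eX, Finset.sum_apply, Finset.sum_ite_eq]

lemma pt_zero_eq_sum' (v : Vec d) : pt 0 v = ∑ i, v i • (eV i : Phase d) := by
  ext j
  rcases j with j | j <;>
  simp [pt, eV, Finset.sum_apply, Finset.sum_ite_eq]

lemma smulLeft_inner_apply (i : Fin d) (φ : Test d) (z : Phase d) :
    smulLeftCLM ℂ (fun z : Phase d => inner ℝ z (eV i)) φ z = (velo z i : ℂ) * φ z := by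
  rw [smulLeftCLM_apply_apply (by fun_prop), inner_eV, Complex.real_smul]

lemma adjS_apply (lam : ℝ) (φ : Test d) (z : Phase d) : adjS lam φ z = adjointOp lam φ z := by
  unfold adjS adjointOp
  rw [sub_apply, sub_apply, sum_apply, sum_apply, smul_apply, smul_eq_mul,
    pt_zero_eq_sum, map_sum]
  congr 2
  refine Finset.sum_congr rfl fun i _ => ?_
  rw [smulLeft_inner_apply, map_smul, Complex.real_smul]
  rfl

lemma inner_eX (ξ : Phase d) (i : Fin d) : inner ℝ ξ (eX i) = posn ξ i := by
  rw [inner_phase]; simp [eX, PiLp.inner_apply]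

lemma fourier_lineDeriv_eX (φ : Test d) (i : Fin d) :
    𝓕 (lineDerivOp (eX i) φ) = (2 * π * Complex.I) •
      smulLeftCLM ℂ (fun z : Phase d => inner ℝ z (eX i)) (𝓕 φ) :=
  SchwartzMap.fourier_lineDerivOp_eq φ (eX i)

/-- The transport term of the adjoint operator on the Fourier side. -/
lemma fourier_transport (φ : Test d) (i : Fin d) (ξ : Phase d) :
    𝓕 (smulLeftCLM ℂ (fun z : Phase d => inner ℝ z (eV i))
      (lineDerivOp (eX i) φ)) ξ =
      -((posn ξ i : ℂ) * fderiv ℝ (𝓕 φ : Test d) ξ (eV i)) := by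
  have h1 := SchwartzMap.lineDerivOp_fourier_eq (lineDerivOp (eX i) φ) (eV i : Phase d)
  have hc : (2 * π * Complex.I : ℂ) ≠ 0 := by
    simp [Real.pi_ne_zero]
  have h2 := congrArg (fun f : Test d => f ξ) h1
  beta_reduce at h2
  rw [fourier_smul, smul_apply, smul_eq_mul,
    SchwartzMap.lineDerivOp_apply_eq_fderiv] at h2
  have h3 : ((𝓕 (lineDerivOp (eX i) φ) : Test d) : Phase d → ℂ) =
      fun η => (2 * π * Complex.I) * ((posnL η i : ℝ) * (𝓕 φ : Test d) η) := by
    funext η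
    rw [fourier_lineDeriv_eX, smul_apply, smulLeftCLM_apply_apply (by fun_prop),
      inner_eX, Complex.real_smul, smul_eq_mul]
    rfl
  have hp : HasFDerivAt (fun η : Phase d => ((posnL η i : ℝ) : ℂ))
      (Complex.ofRealCLM.comp ((EuclideanSpace.proj i).comp posnL)) ξ :=
    (Complex.ofRealCLM.comp ((EuclideanSpace.proj i).comp (posnL (d := d)))).hasFDerivAt
  have h4 : fderiv ℝ (fun η => (2 * π * Complex.I) *
      ((posnL η i : ℝ) * (𝓕 φ : Test d) η)) ξ = _ :=
    ((hp.mul (𝓕 φ : Test d).differentiableAt.hasFDerivAt).const_mul (2 * π * Complex.I)).fderiv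
  rw [h3, h4] at h2
  have h5 : posnL (eV i : Phase d) = 0 := by simp [eV]
  simp [h5] at h2
  have h6 : (2 * π * Complex.I : ℂ) * ((posn ξ i : ℂ) * fderiv ℝ (𝓕 φ : Test d) ξ (eV i)) =
    -((2 * π * Complex.I) * (𝓕 (smulLeftCLM ℂ
      (fun z : Phase d => inner ℝ z (eV i)) (lineDerivOp (eX i) φ)) : Test d) ξ) := by
    rw [← neg_mul]
    simpa using h2
  apply mul_left_cancel₀ hc
  rw [mul_neg, h6, neg_neg]

lemma fourier_adjS (lam : ℝ) (φ : Test d) (ξ : Phase d) :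
    𝓕 (adjS lam φ) ξ = (-(4 * π ^ 2 * ‖velo ξ‖ ^ 2 + lam) : ℝ) * 𝓕 φ ξ +
      fderiv ℝ (𝓕 φ : Test d) ξ (pt 0 (posn ξ)) := by
  have h : 𝓕 (adjS lam φ) =
      (∑ i : Fin d, 𝓕 (lineDerivOp (eV i) (lineDerivOp (eV i) φ)))
      - (∑ i : Fin d, 𝓕 (smulLeftCLM ℂ (fun z : Phase d => inner ℝ z (eV i))
        (lineDerivOp (eX i) φ))) - (lam : ℂ) • 𝓕 φ := by
    have := (fourierCLM ℂ (Test d))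
    unfold adjS
    rw [← fourierCLM_apply (R := ℂ) (E := Test d), map_sub, map_sub, map_sum,
      map_sum, map_smul]
    rfl
  rw [h, sub_apply, sub_apply, sum_apply, sum_apply, smul_apply, smul_eq_mul, pt_zero_eq_sum',
    map_sum]
  simp_rw [fourier_transport, fourier_lineDeriv, map_smul, Complex.real_smul]
  rw [Finset.sum_neg_distrib, sub_neg_eq_add]
  have h2 : ∑ i : Fin d, (2 * π * Complex.I * velo ξ i) *
      ((2 * π * Complex.I * velo ξ i) * 𝓕 φ ξ) =
      (-(4 * π ^ 2 * ‖velo ξ‖ ^ 2) : ℝ) * 𝓕 φ ξ := by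
    rw [EuclideanSpace.real_norm_sq_eq]
    push_cast
    rw [Finset.mul_sum, ← Finset.sum_neg_distrib, Finset.sum_mul]
    refine Finset.sum_congr rfl fun i _ => ?_
    linear_combination (4 * π ^ 2 * (velo ξ i) ^ 2 * 𝓕 φ ξ : ℂ) * Complex.I_sq
  rw [h2]
  push_cast
  ring

/-- The exponent of the symbol of the kinetic semigroup. -/
def heatE (r : ℝ) (ξ : Phase d) : ℝ :=
  -(4 * π ^ 2 * (r * ‖velo ξ‖ ^ 2 + r ^ 2 * inner ℝ (velo ξ) (posn ξ) +
      r ^ 3 * ‖posn ξ‖ ^ 2 / 3))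

lemma heatE_nonpos {r : ℝ} (hr : 0 ≤ r) (ξ : Phase d) : heatE r ξ ≤ 0 := by
  have h1 : 0 ≤ ‖velo ξ + (r / 2) • posn ξ‖ ^ 2 := by positivity
  rw [norm_add_sq_real, inner_smul_right, norm_smul, mul_pow, Real.norm_eq_abs, sq_abs] at h1
  have h2 : 0 ≤ ‖posn ξ‖ ^ 2 := by positivity
  have h3 : 0 ≤ r * ‖velo ξ‖ ^ 2 + r ^ 2 * inner ℝ (velo ξ) (posn ξ) + r ^ 3 * ‖posn ξ‖ ^ 2 / 3 := by
    have h4 := mul_nonneg hr h1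
    have h5 : 0 ≤ r ^ 3 * ‖posn ξ‖ ^ 2 := by positivity
    nlinarith
  unfold heatE
  have := mul_nonneg (show (0 : ℝ) ≤ 4 * π ^ 2 by positivity) h3
  linarith

/-- The Fourier transform of `exp(-lam r)` times the dual semigroup applied to `φ`. -/
def hsym (lam : ℝ) (φ : Test d) (r : ℝ) (ξ : Phase d) : ℂ :=
  (Real.exp (heatE r ξ - lam * r) : ℂ) * 𝓕 φ (fshear r ξ)

lemma fshear_eq_add (r : ℝ) (ξ : Phase d) : fshear r ξ = ξ + r • pt 0 (posn ξ) :=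
  phase_ext (by simp [fshear]) (by simp [fshear])

lemma hasDerivAt_comp_fshear (f : Test d) (r : ℝ) (ξ : Phase d) :
    HasDerivAt (fun s => f (fshear s ξ)) (fderiv ℝ f (fshear r ξ) (pt 0 (posn ξ))) r := by
  have h1 : HasDerivAt (fun s => fshear s ξ) (pt 0 (posn ξ)) r := by
    simp_rw [fshear_eq_add]
    simpa using ((hasDerivAt_id r).smul_const (pt 0 (posn ξ))).const_add ξ
  exact f.differentiableAt.hasFDerivAt.comp_hasDerivAt r h1

/-- The evolution equation of the dual semigroup, on the Fourier side. -/
lemma hasDerivAt_hsym (lam : ℝ) (φ : Test d) (r : ℝ) (ξ : Phase d) :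
    HasDerivAt (fun s => hsym lam φ s ξ) (hsym lam (adjS lam φ) r ξ) r := by
  have h1 := hasDerivAt_comp_fshear (𝓕 φ) r ξ
  have h2 : HasDerivAt (fun s => heatE s ξ - lam * s)
      (-(4 * π ^ 2 * ‖velo (fshear r ξ)‖ ^ 2 + lam)) r := by
    have h3 : HasDerivAt (fun s : ℝ => -(4 * π ^ 2 * (s * ‖velo ξ‖ ^ 2 +
        s ^ 2 * inner ℝ (velo ξ) (posn ξ) + s ^ 3 * ‖posn ξ‖ ^ 2 / 3)) - lam * s)
        (-(4 * π ^ 2 * (1 * ‖velo ξ‖ ^ 2 + (2 * r) * inner ℝ (velo ξ) (posn ξ) +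
          (3 * r ^ 2) * ‖posn ξ‖ ^ 2 / 3)) - lam * 1) r := by
      have e1 := (hasDerivAt_id r).mul_const (‖velo ξ‖ ^ 2)
      have e2 := (hasDerivAt_pow 2 r).mul_const (inner ℝ (velo ξ) (posn ξ))
      have e3 := ((hasDerivAt_pow 3 r).mul_const (‖posn ξ‖ ^ 2)).div_const 3
      have e4 := ((((e1.add e2).add e3).const_mul (4 * π ^ 2)).neg).sub
        ((hasDerivAt_id r).const_mul lam)
      refine e4.congr_deriv ?_
      simp
    refine h3.congr_deriv ?_
    rw [velo_fshear, norm_add_sq_real, inner_smul_right, norm_smul, mul_pow, Real.norm_eq_abs,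
      sq_abs]
    ring
  have h4 := (h2.exp.ofReal_comp).mul h1
  refine h4.congr_deriv ?_
  unfold hsym
  rw [fourier_adjS, posn_fshear]
  push_cast
  ring

/-- The dual of the kinetic semigroup, `φ ↦ E_r(D) (φ ∘ shear (-r))`, for `r > 0`. -/
def Qs (r : ℝ) (φ : Test d) : Test d := TS (heatS r) (compShear (-r) φ)

lemma fourier_compShear (r : ℝ) (φ : Test d) : 𝓕 (compShear (-r) φ) = compFshear r (𝓕 φ) := by
  ext ξ
  rw [compFshear_apply, SchwartzMap.fourier_coe, SchwartzMap.fourier_coe, Real.fourier_eq',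
    Real.fourier_eq', ← integral_comp_shear r]
  congr 1; funext w
  rw [compShear_apply, shear_shear, neg_add_cancel, shear_zero, real_inner_comm, real_inner_comm _ w,
    inner_fshear]

lemma fourier_Qs {r : ℝ} (hr : 0 < r) (lam : ℝ) (φ : Test d) (ξ : Phase d) :
    (Real.exp (-(lam * r)) : ℂ) * 𝓕 (Qs r φ) ξ = hsym lam φ r ξ := by
  rw [Qs, TS, fourier_fourierInv_eq, mulS_apply, fourier_compShear,
    compFshear_apply, heatS_apply hr, hsym, sub_eq_add_neg, Real.exp_add, heatE]
  push_cast
  ring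

lemma continuous_heatE : Continuous fun q : ℝ × Phase d => heatE q.1 q.2 := by
  have h1 : Continuous fun q : ℝ × Phase d => velo q.2 := continuous_velo.comp continuous_snd
  have h2 : Continuous fun q : ℝ × Phase d => posn q.2 := continuous_posn.comp continuous_snd
  unfold heatE
  fun_prop

lemma continuous_fshear : Continuous fun q : ℝ × Phase d => fshear q.1 q.2 := by
  have h2 : Continuous fun q : ℝ × Phase d => pt (0 : Vec d) (posn q.2) :=
    continuous_pt continuous_const (continuous_posn.comp continuous_snd)
  simp_rw [fshear_eq_add]
  exact continuous_snd.add (continuous_fst.smul h2)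

lemma continuous_hsym (lam : ℝ) (φ : Test d) :
    Continuous fun q : ℝ × Phase d => hsym lam φ q.1 q.2 := by
  unfold hsym
  have := continuous_heatE (d := d)
  refine Continuous.mul ?_ ((𝓕 φ : Test d).continuous.comp continuous_fshear)
  fun_prop

lemma norm_hsym_le {r lam : ℝ} (hr : 0 ≤ r) (hl : 0 ≤ lam) (φ : Test d) (ξ : Phase d) :
    ‖hsym lam φ r ξ‖ ≤ ‖𝓕 φ (fshear r ξ)‖ := by
  rw [hsym, norm_mul, Complex.norm_real, Real.norm_of_nonneg (Real.exp_pos _).le]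
  refine mul_le_of_le_one_left (norm_nonneg _) (Real.exp_le_one_iff.2 ?_)
  have := heatE_nonpos hr ξ
  have := mul_nonneg hl hr
  linarith

lemma integrable_hsym {r lam : ℝ} (hr : 0 ≤ r) (hl : 0 ≤ lam) (φ : Test d) :
    Integrable (hsym lam φ r) := by
  have h1 : Integrable fun ξ => 𝓕 φ (fshear r ξ) := (compFshear r (𝓕 φ)).integrable
  exact h1.mono ((continuous_hsym lam φ).comp (Continuous.prodMk_right r)).aestronglyMeasurable
    (.of_forall fun ξ => norm_hsym_le hr hl φ ξ)

lemma eq_integral_fourier (φ : Test d) (z : Phase d) :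
    φ z = ∫ ξ, Complex.exp ((2 * π * inner ℝ ξ z : ℝ) * Complex.I) • 𝓕 φ ξ := by
  rw [← ker_eq_integral, ker, fourierInv_fourier_eq]

lemma exp_mul_Qs {r : ℝ} (hr : 0 < r) (lam : ℝ) (φ : Test d) (z : Phase d) :
    (Real.exp (-(lam * r)) : ℂ) * Qs r φ z =
      ∫ ξ, Complex.exp ((2 * π * inner ℝ ξ z : ℝ) * Complex.I) • hsym lam φ r ξ := by
  rw [eq_integral_fourier, ← integral_const_mul]
  congr 1; funext ξ
  rw [← fourier_Qs hr, smul_eq_mul, smul_eq_mul]; ring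

/-- The Duhamel formula for the dual semigroup. -/
lemma Qs_duhamel {r lam : ℝ} (hr : 0 < r) (hl : 0 ≤ lam) (φ : Test d) (z : Phase d) :
    (Real.exp (-(lam * r)) : ℂ) * Qs r φ z = φ z +
      ∫ ρ in Ioc 0 r, (Real.exp (-(lam * ρ)) : ℂ) * Qs ρ (adjS lam φ) z := by
  set e : Phase d → ℂ := fun ξ => Complex.exp ((2 * π * inner ℝ ξ z : ℝ) * Complex.I) with he
  have he1 : ∀ ξ, ‖e ξ‖ = 1 := fun ξ => Complex.norm_exp_ofReal_mul_I _
  have hec : Continuous e := by rw [he]; fun_prop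
  have hi : ∀ {s : ℝ} (ψ : Test d), 0 ≤ s → Integrable fun ξ => e ξ • hsym lam ψ s ξ := fun ψ hs =>
    (integrable_hsym hs hl ψ).mono
      (hec.smul ((continuous_hsym lam ψ).comp (Continuous.prodMk_right _))).aestronglyMeasurable
      (.of_forall fun ξ => by rw [norm_smul, he1, one_mul])
  have h0 : φ z = ∫ ξ, e ξ • hsym lam φ 0 ξ := by
    rw [eq_integral_fourier φ z]
    congr 1; funext ξ
    simp [hsym, heatE, fshear_zero, he]
  have h1 : ∀ ξ, hsym lam φ r ξ - hsym lam φ 0 ξ = ∫ ρ in Ioc 0 r, hsym lam (adjS lam φ) ρ ξ := by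
    intro ξ
    have hc : Continuous fun s => hsym lam (adjS lam φ) s ξ :=
      (continuous_hsym lam (adjS lam φ)).comp (Continuous.prodMk_left ξ)
    rw [← intervalIntegral.integral_of_le hr.le, intervalIntegral.integral_eq_sub_of_hasDerivAt
      (fun s _ => hasDerivAt_hsym lam φ s ξ) (hc.intervalIntegrable _ _)]
  rw [exp_mul_Qs hr, ← sub_eq_iff_eq_add', h0, ← integral_sub (hi φ hr.le) (hi φ le_rfl)]
  have h2 : ∀ ξ, e ξ • hsym lam φ r ξ - e ξ • hsym lam φ 0 ξ =
      ∫ ρ in Ioc 0 r, e ξ • hsym lam (adjS lam φ) ρ ξ := fun ξ => by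
    rw [← smul_sub, h1, integral_smul]
  simp_rw [h2]
  rw [integral_integral_swap]
  · refine setIntegral_congr_fun measurableSet_Ioc fun ρ hρ => ?_
    exact (exp_mul_Qs hρ.1 lam _ z).symm
  · have hm : AEStronglyMeasurable (fun q : Phase d × ℝ => e q.1 • hsym lam (adjS lam φ) q.2 q.1)
        (volume.prod (volume.restrict (Ioc 0 r))) :=
      ((hec.comp continuous_fst).smul
        ((continuous_hsym lam _).comp continuous_swap)).aestronglyMeasurable
    refine (integrable_prod_iff' hm).2 ⟨?_, ?_⟩
    · filter_upwards [ae_restrict_mem measurableSet_Ioc] with ρ hρ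
      exact hi _ hρ.1.le
    · have hb : ∀ ρ ∈ Ioc 0 r, ‖∫ ξ, ‖e ξ • hsym lam (adjS lam φ) ρ ξ‖‖ ≤
          ∫ ξ, ‖𝓕 (adjS lam φ) ξ‖ := by
        intro ρ hρ
        rw [Real.norm_of_nonneg (integral_nonneg fun _ => norm_nonneg _),
          ← integral_comp_fshear ρ (fun ξ => ‖𝓕 (adjS lam φ) ξ‖)]
        refine integral_mono (hi _ hρ.1.le).norm ?_ fun ξ => ?_
        · exact (compFshear ρ (𝓕 (adjS lam φ))).integrable.norm
        · simp only [norm_smul, he1, one_mul]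
          exact norm_hsym_le hρ.1.le hl _ ξ
      refine Integrable.of_bound (C := ∫ ξ, ‖𝓕 (adjS lam φ) ξ‖) ?_ ?_
      · exact hm.norm.prod_swap.integral_prod_right'
      · filter_upwards [ae_restrict_mem measurableSet_Ioc] with ρ hρ
        exact hb ρ hρ

/-- The adjoint operator commutes with the dual semigroup. -/
lemma adjS_Qs {r : ℝ} (hr : 0 < r) (lam : ℝ) (φ : Test d) :
    adjS lam (Qs r φ) = Qs r (adjS lam φ) := by
  have hinj : ∀ {f g : Test d}, 𝓕 f = 𝓕 g → f = g := fun {f g} h => by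
    have h' : (𝓕⁻ (𝓕 f) : Test d) = 𝓕⁻ (𝓕 g) := congrArg _ h
    rwa [fourierInv_fourier_eq, fourierInv_fourier_eq] at h'
  apply hinj
  ext ξ
  have q : ∀ (ψ : Test d) η, 𝓕 (Qs r ψ) η = (Real.exp (heatE r η) : ℂ) * 𝓕 ψ (fshear r η) := by
    intro ψ η
    have := fourier_Qs hr 0 ψ η
    simpa [hsym] using this
  rw [fourier_adjS, q, q, fourier_adjS, posn_fshear]
  have h1 := hasDerivAt_comp_fshear (𝓕 (Qs r φ)) 0 ξ
  rw [fshear_zero] at h1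
  have h2 : (fun s => 𝓕 (Qs r φ) (fshear s ξ)) =
      fun s => (Real.exp (heatE r (fshear s ξ)) : ℂ) * 𝓕 φ (fshear (r + s) ξ) := by
    funext s; rw [q, fshear_fshear]
  rw [h2] at h1
  have h3 : HasDerivAt (fun s => heatE r (fshear s ξ))
      (-(4 * π ^ 2 * (2 * r * inner ℝ (velo ξ) (posn ξ) + r ^ 2 * ‖posn ξ‖ ^ 2))) 0 := by
    have e : (fun s => heatE r (fshear s ξ)) = fun s => -(4 * π ^ 2 *
        (r * (‖velo ξ‖ ^ 2 + s * (2 * inner ℝ (velo ξ) (posn ξ)) + s ^ 2 * ‖posn ξ‖ ^ 2) +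
        r ^ 2 * (inner ℝ (velo ξ) (posn ξ) + s * ‖posn ξ‖ ^ 2) + r ^ 3 * ‖posn ξ‖ ^ 2 / 3)) := by
      funext s
      rw [heatE, posn_fshear, velo_fshear, norm_add_sq_real, inner_add_left, inner_smul_right,
        inner_smul_left, norm_smul, mul_pow, Real.norm_eq_abs, sq_abs, real_inner_self_eq_norm_sq]
      simp only [RCLike.conj_to_real]
      ring
    rw [e]
    have e1 := (hasDerivAt_id (0 : ℝ)).mul_const (2 * inner ℝ (velo ξ) (posn ξ))
    have e2 := (hasDerivAt_pow 2 (0 : ℝ)).mul_const (‖posn ξ‖ ^ 2)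
    have e3 := (hasDerivAt_id (0 : ℝ)).mul_const (‖posn ξ‖ ^ 2)
    have e4 := ((((e1.const_add (‖velo ξ‖ ^ 2)).add e2).const_mul r).add
      ((e3.const_add (inner ℝ (velo ξ) (posn ξ))).const_mul (r ^ 2))).add_const
      (r ^ 3 * ‖posn ξ‖ ^ 2 / 3)
    have e5 := (e4.const_mul (4 * π ^ 2)).neg
    refine (e5.congr_deriv ?_)
    simp
    ring
  have h4 : HasDerivAt (fun s => 𝓕 φ (fshear (r + s) ξ))
      (fderiv ℝ (𝓕 φ : Test d) (fshear r ξ) (pt 0 (posn ξ))) 0 := by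
    have := hasDerivAt_comp_fshear (𝓕 φ) (r + 0) ξ
    have h5 := this.comp_const_add r 0
    simpa using h5
  have h5 := h1.unique ((h3.exp.ofReal_comp).mul h4)
  rw [h5]
  simp only [fshear_zero, add_zero]
  have h6 : ‖velo (fshear r ξ)‖ ^ 2 = ‖velo ξ‖ ^ 2 + 2 * r * inner ℝ (velo ξ) (posn ξ) +
      r ^ 2 * ‖posn ξ‖ ^ 2 := by
    rw [velo_fshear, norm_add_sq_real, inner_smul_right, norm_smul, mul_pow, Real.norm_eq_abs,
      sq_abs]
    ring
  rw [h6]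
  push_cast
  ring

/-! ### The kinetic semigroup and the Duhamel integral -/

/-- The kernel of `heatS r`, as a jointly measurable function of `r` and the point. -/
def kf (r : ℝ) (y : Phase d) : ℂ := (((√r) ^ (4 * d))⁻¹ : ℝ) • ker heat1 (dil (√r)⁻¹ y)

lemma kf_eq {r : ℝ} (hr : 0 < r) (y : Phase d) : kf r y = ker (heatS r) y :=
  (ker_compDil (Real.sqrt_pos.2 hr) _ _).symm

lemma measurable_kf : Measurable fun q : ℝ × Phase d => kf q.1 q.2 := by
  have h1 : Measurable fun q : ℝ × Phase d => (√q.1)⁻¹ :=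
    (Real.continuous_sqrt.measurable.comp measurable_fst).inv
  have h2 : Measurable fun q : ℝ × Phase d => dil (√q.1)⁻¹ q.2 :=
    measurable_pt ((h1.pow_const 3).smul (measurable_posn.comp measurable_snd))
      (h1.smul (measurable_velo.comp measurable_snd))
  exact (((Real.continuous_sqrt.measurable.comp measurable_fst).pow_const _).inv).smul
    ((ker heat1).continuous.measurable.comp h2)

/-- The kinetic semigroup `g ↦ (E_r(D) g) ∘ shear r`; it is set to zero for `r ≤ 0`. -/
def semi (r : ℝ) (g : Phase d → ℂ) (z : Phase d) : ℂ :=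
  if 0 < r then T (heatS r) g (shear r z) else 0

lemma semi_of_pos {r : ℝ} (hr : 0 < r) (g : Phase d → ℂ) (z : Phase d) :
    semi r g z = T (heatS r) g (shear r z) := if_pos hr

lemma continuous_shear : Continuous fun q : ℝ × Phase d => shear q.1 q.2 :=
  continuous_pt ((continuous_posn.comp continuous_snd).add
    (continuous_fst.smul (continuous_velo.comp continuous_snd))) (continuous_velo.comp continuous_snd)

lemma measurable_semi {h : ℝ → Phase d → ℂ} (hh : Measurable fun q : ℝ × Phase d => h q.1 q.2) :
    Measurable fun q : ℝ × ℝ × Phase d => semi q.1 (h q.2.1) q.2.2 := by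
  have h1 : Measurable fun q : (ℝ × ℝ × Phase d) × Phase d =>
      kf q.1.1 (shear q.1.1 q.1.2.2 - q.2) * h q.1.2.1 q.2 := by
    have e1 : Measurable fun q : (ℝ × ℝ × Phase d) × Phase d => shear q.1.1 q.1.2.2 :=
      continuous_shear.measurable.comp (by fun_prop :
        Measurable fun q : (ℝ × ℝ × Phase d) × Phase d => (q.1.1, q.1.2.2))
    exact (measurable_kf.comp ((by fun_prop : Measurable fun q : (ℝ × ℝ × Phase d) × Phase d =>
      q.1.1).prodMk (e1.sub measurable_snd))).mul (hh.comp (by fun_prop :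
        Measurable fun q : (ℝ × ℝ × Phase d) × Phase d => (q.1.2.1, q.2)))
  have h2 := (h1.stronglyMeasurable.integral_prod_right' (ν := volume)).measurable
  have h3 : (fun q : ℝ × ℝ × Phase d => semi q.1 (h q.2.1) q.2.2) =
      {q : ℝ × ℝ × Phase d | 0 < q.1}.indicator fun q =>
        ∫ w, kf q.1 (shear q.1 q.2.2 - w) * h q.2.1 w := by
    funext q
    by_cases hq : 0 < q.1
    · rw [indicator_of_mem (by exact hq), semi_of_pos hq, T]
      congr 1; funext w; rw [kf_eq hq]
    · rw [indicator_of_notMem (by exact hq), semi, if_neg hq]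
  rw [h3]
  exact h2.indicator (measurableSet_lt measurable_const measurable_fst)

lemma wiener_heatS {r : ℝ} (hr : 0 < r) : wiener (heatS r : Test d) = wiener (heat1 : Test d) :=
  wiener_compDil (Real.sqrt_pos.2 hr) _

lemma enorm_semi_le (r : ℝ) {g : Phase d → ℂ} {B : ℝ≥0∞} (hB : ∀ z, ‖g z‖ₑ ≤ B) (z : Phase d) :
    ‖semi r g z‖ₑ ≤ wiener (heat1 : Test d) * B := by
  unfold semi
  split_ifs with hr
  · rw [← wiener_heatS hr]; exact enorm_T_le_of_bounded _ hB _
  · simp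

/-- A jointly measurable family of functions with a uniform bound. -/
structure BddMeas (h : ℝ → Phase d → ℂ) (B : ℝ) : Prop where
  meas : Measurable fun q : ℝ × Phase d => h q.1 q.2
  bound : ∀ s z, ‖h s z‖ ≤ B

namespace BddMeas
variable {h : ℝ → Phase d → ℂ} {B : ℝ}

lemma meas_at (hh : BddMeas h B) (s : ℝ) : Measurable (h s) := hh.meas.of_uncurry_left

lemma nonneg (hh : BddMeas h B) : 0 ≤ B := (norm_nonneg _).trans (hh.bound 0 0)

lemma tame (hh : BddMeas h B) (s : ℝ) : Tame (h s) := Tame.of_bounded (hh.meas_at s) (hh.bound s)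

lemma integrableOn_pairing (hh : BddMeas h B) (φ : Test d) {s : Set ℝ} (hs : volume s ≠ ⊤) :
    IntegrableOn (fun s => ∫ z, φ z * h s z) s := by
  refine Measure.integrableOn_of_bounded (M := ∫ z, ‖φ z‖ * B) hs ?_ ?_
  · have h1 : Measurable fun q : ℝ × Phase d => φ q.2 * h q.1 q.2 :=
      (φ.continuous.measurable.comp measurable_snd).mul hh.meas
    exact (h1.stronglyMeasurable.integral_prod_right' (ν := volume)).aestronglyMeasurable
  · refine .of_forall fun s =>
      norm_integral_le_of_norm_le (φ.integrable.norm.mul_const B)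
        (.of_forall fun z => ?_)
    rw [norm_mul]
    exact mul_le_mul_of_nonneg_left (hh.bound s z) (norm_nonneg _)

lemma norm_semi_le (hh : BddMeas h B) (r s : ℝ) (z : Phase d) :
    ‖semi r (h s) z‖ ≤ (wiener (heat1 : Test d)).toReal * B := by
  have h1 := enorm_semi_le r (B := ENNReal.ofReal B) (fun z => by
    rw [← ofReal_norm]; exact ofReal_le_ofReal (hh.bound s z)) z
  rw [← ofReal_norm, ← ENNReal.ofReal_toReal (wiener_lt_top (heat1 : Test d)).ne,
    ← ENNReal.ofReal_mul ENNReal.toReal_nonneg] at h1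
  exact (ENNReal.ofReal_le_ofReal_iff (mul_nonneg ENNReal.toReal_nonneg hh.nonneg)).1 h1
end BddMeas

/-- The Duhamel integral `∫₀ᵗ exp(-lam (t - s)) P_{t-s} h_s ds` of the source `h`. -/
def duh (lam : ℝ) (h : ℝ → Phase d → ℂ) (t : ℝ) (z : Phase d) : ℂ :=
  ∫ s in Ioc 0 t, (Real.exp (-(lam * (t - s))) : ℂ) * semi (t - s) (h s) z

lemma measurable_duh_integrand (lam : ℝ) {h : ℝ → Phase d → ℂ}
    (hh : Measurable fun q : ℝ × Phase d => h q.1 q.2) :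
    Measurable fun q : (ℝ × Phase d) × ℝ =>
      (Real.exp (-(lam * (q.1.1 - q.2))) : ℂ) * semi (q.1.1 - q.2) (h q.2) q.1.2 := by
  refine Measurable.mul (by fun_prop) ?_
  exact (measurable_semi hh).comp (by fun_prop :
    Measurable fun q : (ℝ × Phase d) × ℝ => (q.1.1 - q.2, q.2, q.1.2))

lemma measurable_duh (lam : ℝ) {h : ℝ → Phase d → ℂ}
    (hh : Measurable fun q : ℝ × Phase d => h q.1 q.2) :
    Measurable fun q : ℝ × Phase d => duh lam h q.1 q.2 := by
  have h1 : Measurable fun q : (ℝ × Phase d) × ℝ =>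
      {q : (ℝ × Phase d) × ℝ | q.2 ∈ Ioc 0 q.1.1}.indicator (fun q =>
      (Real.exp (-(lam * (q.1.1 - q.2))) : ℂ) * semi (q.1.1 - q.2) (h q.2) q.1.2) q := by
    refine (measurable_duh_integrand lam hh).indicator ?_
    exact (measurableSet_lt measurable_const measurable_snd).inter
      (measurableSet_le measurable_snd (measurable_fst.comp measurable_fst))
  have h2 := (h1.stronglyMeasurable.integral_prod_right' (ν := volume)).measurable
  have h3 : (fun q : ℝ × Phase d => duh lam h q.1 q.2) = fun q : ℝ × Phase d => ∫ s,
      {q : (ℝ × Phase d) × ℝ | q.2 ∈ Ioc 0 q.1.1}.indicator (fun q =>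
      (Real.exp (-(lam * (q.1.1 - q.2))) : ℂ) * semi (q.1.1 - q.2) (h q.2) q.1.2) (q, s) := by
    funext q
    rw [duh, ← integral_indicator measurableSet_Ioc]
    rfl
  rw [h3]; exact h2

lemma exp_neg_mul_le_one {lam r : ℝ} (hl : 0 ≤ lam) (hr : 0 ≤ r) : Real.exp (-(lam * r)) ≤ 1 :=
  Real.exp_le_one_iff.2 (by have := mul_nonneg hl hr; linarith)

section
variable {lam : ℝ} {h : ℝ → Phase d → ℂ} {B : ℝ}

lemma norm_duh_integrand_le (hl : 0 ≤ lam) (hh : BddMeas h B) {t s : ℝ} (hs : s ∈ Ioc 0 t)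
    (z : Phase d) : ‖(Real.exp (-(lam * (t - s))) : ℂ) * semi (t - s) (h s) z‖ ≤
      (wiener (heat1 : Test d)).toReal * B := by
  rw [norm_mul, Complex.norm_real, Real.norm_of_nonneg (Real.exp_pos _).le]
  exact (mul_le_of_le_one_left (norm_nonneg _)
    (exp_neg_mul_le_one hl (sub_nonneg.2 hs.2))).trans (hh.norm_semi_le _ _ _)

lemma integrable_mul_duh (hl : 0 ≤ lam) (hh : BddMeas h B) (t : ℝ) {k : Phase d → ℂ}
    (hk : Integrable k) : Integrable (fun q : Phase d × ℝ => k q.1 *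
      ((Real.exp (-(lam * (t - q.2))) : ℂ) * semi (t - q.2) (h q.2) q.1))
      (volume.prod (volume.restrict (Ioc 0 t))) := by
  have h1 : Integrable (fun q : Phase d × ℝ => k q.1 * (1 : ℂ))
      (volume.prod (volume.restrict (Ioc 0 t))) := hk.mul_prod (integrable_const (1 : ℂ))
  have hm : Measurable fun q : Phase d × ℝ =>
      (Real.exp (-(lam * (t - q.2))) : ℂ) * semi (t - q.2) (h q.2) q.1 :=
    (measurable_duh_integrand lam hh.meas).comp (by fun_prop :
      Measurable fun q : Phase d × ℝ => ((t, q.1), q.2))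
  refine (h1.norm.const_mul ((wiener (heat1 : Test d)).toReal * B)).mono' ?_ ?_
  · have h2 := h1.aestronglyMeasurable
    simp only [mul_one] at h2
    exact h2.mul hm.aestronglyMeasurable
  · have : ∀ᵐ q : Phase d × ℝ ∂(volume.prod (volume.restrict (Ioc 0 t))), q.2 ∈ Ioc 0 t :=
      Measure.quasiMeasurePreserving_snd.ae (ae_restrict_mem measurableSet_Ioc)
    filter_upwards [this] with q hq
    rw [norm_mul, mul_one, mul_comm]
    exact mul_le_mul_of_nonneg_right (norm_duh_integrand_le hl hh hq _) (norm_nonneg _)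

lemma integral_mul_duh (hl : 0 ≤ lam) (hh : BddMeas h B) (t : ℝ) {k : Phase d → ℂ}
    (hk : Integrable k) : ∫ z, k z * duh lam h t z =
      ∫ s in Ioc 0 t, (Real.exp (-(lam * (t - s))) : ℂ) * ∫ z, k z * semi (t - s) (h s) z := by
  unfold duh
  simp_rw [← integral_const_mul]
  rw [integral_integral_swap (integrable_mul_duh hl hh t hk)]
  congr 1; funext s; congr 1; funext z; ring

lemma T_duh (hl : 0 ≤ lam) (hh : BddMeas h B) (t : ℝ) (m : Test d) (z : Phase d) :
    T m (duh lam h t) z =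
      ∫ s in Ioc 0 t, (Real.exp (-(lam * (t - s))) : ℂ) * T m (semi (t - s) (h s)) z :=
  integral_mul_duh hl hh t ((reflAt (ker m) z).integrable.congr
    (.of_forall fun _ => reflAt_apply _ _ _))

end

/-! ### The dual semigroup, jointly in time and space -/

/-- `exp(-lam r) Qs r φ`, as a jointly measurable function for `0 ≤ r`. -/
def qf (lam : ℝ) (φ : Test d) (r : ℝ) (z : Phase d) : ℂ :=
  ∫ ξ, Complex.exp ((2 * π * inner ℝ ξ z : ℝ) * Complex.I) • hsym lam φ r ξ

lemma qf_of_pos {r : ℝ} (hr : 0 < r) (lam : ℝ) (φ : Test d) (z : Phase d) :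
    qf lam φ r z = (Real.exp (-(lam * r)) : ℂ) * Qs r φ z := (exp_mul_Qs hr lam φ z).symm

lemma measurable_qf (lam : ℝ) (φ : Test d) : Measurable fun q : ℝ × Phase d => qf lam φ q.1 q.2 := by
  have h1 : Continuous fun q : (ℝ × Phase d) × Phase d =>
      Complex.exp ((2 * π * inner ℝ q.2 q.1.2 : ℝ) * Complex.I) • hsym lam φ q.1.1 q.2 := by
    have h0 : Continuous fun q : (ℝ × Phase d) × Phase d => (q.1.1, q.2) :=
      (continuous_fst.comp continuous_fst).prodMk continuous_snd
    have h2 := (continuous_hsym lam φ).comp h0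
    have h3 : Continuous fun q : (ℝ × Phase d) × Phase d => (inner ℝ q.2 q.1.2 : ℝ) :=
      continuous_snd.inner (continuous_snd.comp continuous_fst)
    have h4 : Continuous fun q : (ℝ × Phase d) × Phase d =>
        (((2 * π * inner ℝ q.2 q.1.2 : ℝ) : ℂ) * Complex.I) :=
      (Complex.continuous_ofReal.comp (continuous_const.mul h3)).mul continuous_const
    have h5 := Complex.continuous_exp.comp h4
    exact h5.smul h2
  exact (h1.stronglyMeasurable.integral_prod_right' (ν := volume)).measurable

lemma lintegral_qf_le {r lam : ℝ} (hr : 0 < r) (hl : 0 ≤ lam) (φ : Test d) :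
    ∫⁻ z, ‖qf lam φ r z‖ₑ ≤ wiener (heat1 : Test d) * ∫⁻ z, ‖φ z‖ₑ := by
  have h1 : ∫⁻ z, ‖qf lam φ r z‖ₑ ≤ ∫⁻ z, ‖T (heatS r) (compShear (-r) φ) z‖ₑ := by
    refine lintegral_mono fun z => ?_
    rw [qf_of_pos hr, Qs, TS_apply, ← ofReal_norm, ← ofReal_norm, norm_mul, Complex.norm_real,
      Real.norm_of_nonneg (Real.exp_pos _).le]
    exact ofReal_le_ofReal
      (mul_le_of_le_one_left (norm_nonneg _) (exp_neg_mul_le_one hl hr.le))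
  refine (h1.trans (lintegral_T_le _ (compShear (-r) φ).continuous.measurable)).trans ?_
  rw [wiener_heatS hr]
  exact mul_le_mul_right
    ((measurePreserving_shear (-r)).lintegral_comp φ.continuous.measurable.enorm).le _

/-- The pairing of `exp(-lam r) Qs r φ` with `h s`. -/
def bp (lam : ℝ) (h : ℝ → Phase d → ℂ) (φ : Test d) (s r : ℝ) : ℂ := ∫ z, qf lam φ r z * h s z

section
variable {lam : ℝ} {h : ℝ → Phase d → ℂ} {B : ℝ}

lemma measurable_bp (lam : ℝ) (hh : Measurable fun q : ℝ × Phase d => h q.1 q.2) (φ : Test d) :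
    Measurable fun q : ℝ × ℝ => bp lam h φ q.1 q.2 := by
  have h1 : Measurable fun q : (ℝ × ℝ) × Phase d => qf lam φ q.1.2 q.2 * h q.1.1 q.2 :=
    ((measurable_qf lam φ).comp (by fun_prop : Measurable fun q : (ℝ × ℝ) × Phase d =>
      (q.1.2, q.2))).mul (hh.comp (by fun_prop : Measurable fun q : (ℝ × ℝ) × Phase d =>
      (q.1.1, q.2)))
  exact (h1.stronglyMeasurable.integral_prod_right' (ν := volume)).measurable

/-- The constant bounding `bp`. -/
def bpC (φ : Test d) : ℝ := (wiener (heat1 : Test d) * ∫⁻ z, ‖φ z‖ₑ).toReal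

lemma lintegral_qf_mul_le (hl : 0 ≤ lam) (hh : BddMeas h B) (φ : Test d) (s : ℝ) {r : ℝ}
    (hr : 0 < r) : ∫⁻ z, ‖qf lam φ r z * h s z‖ₑ ≤ ENNReal.ofReal (bpC φ * B) := by
  have h1 : ∀ z, ‖qf lam φ r z * h s z‖ₑ ≤ ‖qf lam φ r z‖ₑ * ENNReal.ofReal B := fun z => by
    rw [enorm_mul]
    gcongr
    rw [← ofReal_norm]; exact ofReal_le_ofReal (hh.bound s z)
  refine (lintegral_mono h1).trans ?_
  rw [lintegral_mul_const _ ((measurable_qf lam φ).of_uncurry_left.enorm),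
    bpC, ENNReal.ofReal_mul ENNReal.toReal_nonneg, ENNReal.ofReal_toReal
    (mul_ne_top (wiener_lt_top _).ne φ.integrable.2.ne)]
  gcongr
  exact lintegral_qf_le hr hl φ

lemma norm_bp_le (hl : 0 ≤ lam) (hh : BddMeas h B) (φ : Test d) (s : ℝ) {r : ℝ} (hr : 0 < r) :
    ‖bp lam h φ s r‖ ≤ bpC φ * B := by
  have h1 := (enorm_integral_le_lintegral_enorm (fun z => qf lam φ r z * h s z)).trans
    (lintegral_qf_mul_le hl hh φ s hr)
  rw [← ofReal_norm] at h1
  exact (ENNReal.ofReal_le_ofReal_iff (mul_nonneg ENNReal.toReal_nonneg hh.nonneg)).1 h1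

lemma bp_of_pos {r : ℝ} (hr : 0 < r) (φ : Test d) (s : ℝ) :
    bp lam h φ s r = (Real.exp (-(lam * r)) : ℂ) * ∫ z, Qs r φ z * h s z := by
  rw [bp, ← integral_const_mul]
  congr 1; funext z; rw [qf_of_pos hr, mul_assoc]

lemma integral_mul_semi (φ : Test d) {r : ℝ} (hr : 0 < r) {g : Phase d → ℂ} (hg : Tame g) :
    ∫ z, φ z * semi r g z = ∫ z, Qs r φ z * g z := by
  have h1 : negS (heatS r : Test d) = heatS r := by
    ext ξ; rw [negS_apply, heatS_apply hr, heatS_apply hr]; simp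
  have h2 := integral_T_mul (heatS r) (compShear (-r) φ) hg
  rw [h1] at h2
  rw [Qs, ← h2, ← integral_comp_shear r (fun z => compShear (-r) φ z * T (heatS r) g z)]
  congr 1; funext z
  rw [semi_of_pos hr, compShear_apply, shear_shear, neg_add_cancel, shear_zero]

lemma integral_mul_duh_eq_bp (hl : 0 ≤ lam) (hh : BddMeas h B) (t : ℝ) (φ : Test d) :
    ∫ z, φ z * duh lam h t z = ∫ s in Ioo 0 t, bp lam h φ s (t - s) := by
  rw [integral_mul_duh hl hh t φ.integrable, integral_Ioc_eq_integral_Ioo]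
  refine setIntegral_congr_fun measurableSet_Ioo fun s hs => ?_
  have hr : 0 < t - s := sub_pos.2 hs.2
  rw [bp_of_pos hr, integral_mul_semi φ hr (hh.tame s)]

/-- The Duhamel formula in weak form. -/
lemma bp_duhamel (hl : 0 ≤ lam) (hh : BddMeas h B) (φ : Test d) (s : ℝ) {r : ℝ} (hr : 0 < r) :
    bp lam h φ s r = (∫ z, φ z * h s z) + ∫ ρ in Ioo 0 r, bp lam h (adjS lam φ) s ρ := by
  have h1 : ∀ z, qf lam φ r z * h s z = φ z * h s z +
      ∫ ρ in Ioo 0 r, qf lam (adjS lam φ) ρ z * h s z := fun z => by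
    rw [qf_of_pos hr, Qs_duhamel hr hl, add_mul, integral_mul_const, integral_Ioc_eq_integral_Ioo]
    congr 2
    exact setIntegral_congr_fun measurableSet_Ioo fun ρ hρ => (qf_of_pos hρ.1 _ _ _).symm
  have hm : Measurable fun q : Phase d × ℝ => qf lam (adjS lam φ) q.2 q.1 * h s q.1 :=
    ((measurable_qf lam _).comp measurable_swap).mul ((hh.meas_at s).comp measurable_fst)
  have hi : Integrable (fun q : Phase d × ℝ => qf lam (adjS lam φ) q.2 q.1 * h s q.1)
      (volume.prod (volume.restrict (Ioo 0 r))) := by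
    refine ⟨hm.aestronglyMeasurable, ?_⟩
    rw [HasFiniteIntegral, lintegral_prod_symm' _ hm.enorm]
    have h2 : ∫⁻ ρ in Ioo 0 r, ∫⁻ z, ‖qf lam (adjS lam φ) ρ z * h s z‖ₑ ≤
        ∫⁻ ρ in Ioo 0 r, ENNReal.ofReal (bpC (adjS lam φ) * B) :=
      setLIntegral_mono measurable_const fun ρ hρ => lintegral_qf_mul_le hl hh _ s hρ.1
    refine h2.trans_lt ?_
    rw [setLIntegral_const]
    exact mul_lt_top ENNReal.ofReal_lt_top (by simp)
  simp only [bp]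
  simp_rw [h1]
  rw [integral_add ((hh.tame s).integrable_mul φ) hi.integral_prod_left,
    integral_integral_swap hi]

/-- Integration over a triangle, in two orders. -/
lemma integral_triangle {g : ℝ → ℝ → ℂ} (hg : Measurable fun q : ℝ × ℝ => g q.1 q.2) {C : ℝ}
    (hC : ∀ s r, 0 < s → 0 < r → ‖g s r‖ ≤ C) (t : ℝ) :
    IntegrableOn (fun s => ∫ r in Ioo 0 (t - s), g s r) (Ioo 0 t) ∧
    ∫ s in Ioo 0 t, ∫ r in Ioo 0 (t - s), g s r = ∫ r in Ioo 0 t, ∫ s in Ioo 0 (t - r), g s r := by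
  set A : Set (ℝ × ℝ) := {q | 0 < q.1 ∧ 0 < q.2 ∧ q.1 + q.2 < t} with hA
  have hAm : MeasurableSet A :=
    (measurableSet_lt measurable_const measurable_fst).inter
      ((measurableSet_lt measurable_const measurable_snd).inter
        (measurableSet_lt (measurable_fst.add measurable_snd) measurable_const))
  set k : ℝ × ℝ → ℂ := A.indicator fun q => g q.1 q.2 with hk
  have hki : Integrable k := by
    have h1 : Integrable ((Ioo 0 t ×ˢ Ioo 0 t).indicator fun _ : ℝ × ℝ => C) := by
      rw [integrable_indicator_iff (measurableSet_Ioo.prod measurableSet_Ioo)]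
      refine integrableOn_const ?_
      rw [Measure.volume_eq_prod, Measure.prod_prod]
      exact (mul_lt_top (by simp) (by simp)).ne
    refine h1.mono' (hg.indicator hAm).aestronglyMeasurable (.of_forall fun q => ?_)
    by_cases hq : q ∈ A
    · rw [hk, indicator_of_mem hq, indicator_of_mem]
      · exact hC _ _ hq.1 hq.2.1
      · obtain ⟨h1, h2, h3⟩ := hq
        exact ⟨⟨h1, by linarith⟩, ⟨h2, by linarith⟩⟩
    · rw [hk, indicator_of_notMem hq, norm_zero]
      refine indicator_nonneg (fun x hx => ?_) _
      exact (norm_nonneg _).trans (hC 1 1 one_pos one_pos)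
  have e1 : ∀ s, (∫ r, k (s, r)) = (Ioo 0 t).indicator (fun s => ∫ r in Ioo 0 (t - s), g s r) s := by
    intro s
    by_cases hs : s ∈ Ioo 0 t
    · rw [indicator_of_mem hs, ← integral_indicator measurableSet_Ioo]
      congr 1; funext r
      simp only [hk, indicator, hA, mem_ofPred_eq, mem_Ioo, hs.1, true_and]
      simp only [lt_sub_iff_add_lt']
    · rw [indicator_of_notMem hs]
      refine integral_eq_zero_of_ae (.of_forall fun r => ?_)
      refine indicator_of_notMem (fun hq => hs ?_) _
      obtain ⟨h1, h2, h3⟩ := hq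
      exact ⟨h1, by simp only at h1 h2 h3; linarith⟩
  have e2 : ∀ r, (∫ s, k (s, r)) = (Ioo 0 t).indicator (fun r => ∫ s in Ioo 0 (t - r), g s r) r := by
    intro r
    by_cases hr : r ∈ Ioo 0 t
    · rw [indicator_of_mem hr, ← integral_indicator measurableSet_Ioo]
      congr 1; funext s
      simp only [hk, indicator, hA, mem_ofPred_eq, mem_Ioo, hr.1, true_and]
      simp only [lt_sub_iff_add_lt]
    · rw [indicator_of_notMem hr]
      refine integral_eq_zero_of_ae (.of_forall fun s => ?_)
      refine indicator_of_notMem (fun hq => hr ?_) _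
      obtain ⟨h1, h2, h3⟩ := hq
      exact ⟨h2, by simp only at h1 h2 h3; linarith⟩
  have hki' : Integrable (Function.uncurry fun s r => k (s, r)) (volume.prod volume) := hki
  constructor
  · rw [← integrable_indicator_iff measurableSet_Ioo]
    have := hki'.integral_prod_left
    simp only [Function.uncurry_apply_pair] at this
    exact this.congr (.of_forall e1)
  · rw [← integral_indicator measurableSet_Ioo, ← integral_indicator measurableSet_Ioo]
    simp_rw [← e1, ← e2]
    exact integral_integral_swap hki'

lemma integral_Ioo_sub (g : ℝ → ℂ) (t : ℝ) : ∫ s in Ioo 0 t, g (t - s) = ∫ s in Ioo 0 t, g s := by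
  rcases le_total t 0 with ht | ht
  · simp [Ioo_eq_empty (not_lt.2 ht)]
  · rw [← integral_Ioc_eq_integral_Ioo, ← integral_Ioc_eq_integral_Ioo,
      ← intervalIntegral.integral_of_le ht, ← intervalIntegral.integral_of_le ht,
      intervalIntegral.integral_comp_sub_left]
    simp

lemma integral_triangle_sub {g : ℝ → ℝ → ℂ} (hg : Measurable fun q : ℝ × ℝ => g q.1 q.2) {C : ℝ}
    (hC : ∀ s r, 0 < s → 0 < r → ‖g s r‖ ≤ C) (t : ℝ) :
    ∫ σ in Ioo 0 t, ∫ s in Ioo 0 σ, g s (σ - s) = ∫ r in Ioo 0 t, ∫ s in Ioo 0 (t - r), g s r := by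
  -- in the variables `r = σ - s` and `q = t - σ` the triangle is `0 < r, 0 < q, r + q < t`
  set C' := max C 0
  set g' : ℝ → ℝ → ℂ := fun s r => if 0 < s ∧ 0 < r then g s r else 0 with hg'
  have hgm : Measurable fun q : ℝ × ℝ => g' q.1 q.2 :=
    Measurable.ite ((measurableSet_lt measurable_const measurable_fst).inter
      (measurableSet_lt measurable_const measurable_snd)) hg measurable_const
  have hb : ∀ s r, ‖g' s r‖ ≤ C' := fun s r => by
    simp only [hg']
    split_ifs with h
    · exact (hC s r h.1 h.2).trans (le_max_left _ _)
    · simp [C']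
  have h1 : ∀ σ, ∫ s in Ioo 0 σ, g s (σ - s) = ∫ s in Ioo 0 σ, g' (σ - s) s := fun σ => by
    rw [← integral_Ioo_sub (fun s => g' (σ - s) s)]
    refine setIntegral_congr_fun measurableSet_Ioo fun s hs => ?_
    simp [hg', hs.1, hs.2]
  simp_rw [h1]
  rw [← integral_Ioo_sub]
  have h2 := (integral_triangle (g := fun r q => g' (t - q - r) r)
    (hgm.comp (by fun_prop : Measurable fun q : ℝ × ℝ => (t - q.2 - q.1, q.1)))
    (fun s r _ _ => hb _ _) t).2
  rw [← h2]
  refine setIntegral_congr_fun measurableSet_Ioo fun r hr => ?_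
  have h3 : ∀ q, t - q - r = t - r - q := fun q => by ring
  simp_rw [h3]
  rw [integral_Ioo_sub (fun s => g' s r)]
  refine setIntegral_congr_fun measurableSet_Ioo fun s hs => ?_
  simp [hg', hs.1, hr.1]

/-- The Duhamel integral solves the equation with source `h` in the weak sense. -/
lemma duh_weak (hl : 0 ≤ lam) (hh : BddMeas h B) (φ : Test d) (t : ℝ) :
    ∫ z, φ z * duh lam h t z = (∫ s in Ioo 0 t, ∫ z, φ z * h s z) +
      ∫ σ in Ioo 0 t, ∫ z, adjS lam φ z * duh lam h σ z := by
  obtain ⟨hi, he⟩ := integral_triangle (measurable_bp lam hh.meas (adjS lam φ))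
    (fun s r _ hr => norm_bp_le hl hh _ s hr) t
  have hc := hh.integrableOn_pairing φ (s := Ioo 0 t) (by simp)
  rw [integral_mul_duh_eq_bp hl hh]
  have h1 : ∫ s in Ioo 0 t, bp lam h φ s (t - s) = ∫ s in Ioo 0 t, ((∫ z, φ z * h s z) +
      ∫ r in Ioo 0 (t - s), bp lam h (adjS lam φ) s r) :=
    setIntegral_congr_fun measurableSet_Ioo fun s hs => bp_duhamel hl hh φ s (sub_pos.2 hs.2)
  rw [h1, integral_add hc hi]
  congr 1
  simp_rw [integral_mul_duh_eq_bp hl hh]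
  rw [he, integral_triangle_sub (measurable_bp lam hh.meas (adjS lam φ))
    (fun s r _ hr => norm_bp_le hl hh _ s hr) t]

end

/-! ### Block estimates for the Duhamel integral -/

/-- Interpolation between the bounds `a⁻¹` and `ν⁻¹`: the gain `a⁻¹` of two derivatives may be
traded for a power of the damping `ν`. -/
lemma integral_exp_mul_le {ν a t θ : ℝ} (hν : 0 < ν) (ha : 0 < a) (ht : 0 ≤ t)
    (hθ : θ ∈ Icc (0 : ℝ) 2) :
    ∫ r in (0 : ℝ)..t, Real.exp (-(ν * r)) * ((1 + r * a) ^ 2)⁻¹ ≤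
      a⁻¹ ^ (θ / 2) * ν⁻¹ ^ (1 - θ / 2) := by
  have hc1 : ContinuousOn (fun r => Real.exp (-(ν * r))) (uIcc 0 t) := by fun_prop
  have hpos : ∀ r ∈ uIcc 0 t, 0 < 1 + r * a := fun r hr => by
    rw [uIcc_of_le ht] at hr
    have := mul_nonneg hr.1 ha.le
    linarith
  have hc2 : ContinuousOn (fun r : ℝ => ((1 + r * a) ^ 2)⁻¹) (uIcc 0 t) :=
    ContinuousOn.inv₀ (by fun_prop) fun r hr => (pow_pos (hpos r hr) 2).ne'
  set I := ∫ r in (0 : ℝ)..t, Real.exp (-(ν * r)) * ((1 + r * a) ^ 2)⁻¹ with hI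
  have hI0 : 0 ≤ I := intervalIntegral.integral_nonneg ht fun r _ => by positivity
  have h1 : I ≤ a⁻¹ := by
    have e : ∫ r in (0 : ℝ)..t, ((1 + r * a) ^ 2)⁻¹ = -((1 + t * a)⁻¹ * a⁻¹) - -((1 + 0 * a)⁻¹ * a⁻¹) := by
      refine intervalIntegral.integral_eq_sub_of_hasDerivAt (f := fun r => -((1 + r * a)⁻¹ * a⁻¹))
        (fun r hr => ?_) hc2.intervalIntegrable
      have h2 := ((((hasDerivAt_id r).mul_const a).const_add 1).inv (hpos r hr).ne').mul_const a⁻¹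
      refine h2.neg.congr_deriv ?_
      have := hpos r hr
      simp only [id_eq]
      field_simp
    have h2 : I ≤ ∫ r in (0 : ℝ)..t, ((1 + r * a) ^ 2)⁻¹ := by
      refine intervalIntegral.integral_mono_on ht (hc1.mul hc2).intervalIntegrable
        hc2.intervalIntegrable fun r hr => ?_
      exact mul_le_of_le_one_left (by positivity) (exp_neg_mul_le_one hν.le hr.1)
    rw [e] at h2
    have h3 : 0 < 1 + t * a := hpos t right_mem_uIcc
    have h4 : 0 < (1 + t * a)⁻¹ * a⁻¹ := by positivity
    simp only [zero_mul, add_zero, inv_one, one_mul] at h2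
    linarith
  have h2 : I ≤ ν⁻¹ := by
    have e : ∫ r in (0 : ℝ)..t, Real.exp (-(ν * r)) =
        -(Real.exp (-(ν * t)) * ν⁻¹) - -(Real.exp (-(ν * 0)) * ν⁻¹) := by
      refine intervalIntegral.integral_eq_sub_of_hasDerivAt
        (f := fun r => -(Real.exp (-(ν * r)) * ν⁻¹)) (fun r hr => ?_) hc1.intervalIntegrable
      have h2 := (((hasDerivAt_id r).const_mul ν).neg.exp.mul_const ν⁻¹).neg
      refine h2.congr_deriv ?_
      simp only [id_eq]
      field_simp
      simp
    have h2 : I ≤ ∫ r in (0 : ℝ)..t, Real.exp (-(ν * r)) := by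
      refine intervalIntegral.integral_mono_on ht (hc1.mul hc2).intervalIntegrable
        hc1.intervalIntegrable fun r hr => ?_
      refine mul_le_of_le_one_right (Real.exp_pos _).le (inv_le_one_of_one_le₀ (one_le_pow₀ ?_))
      have := mul_nonneg hr.1 ha.le
      linarith
    rw [e] at h2
    have h4 : 0 < Real.exp (-(ν * t)) * ν⁻¹ := by positivity
    simp only [mul_zero, neg_zero, Real.exp_zero, one_mul] at h2
    linarith
  calc I = I ^ (θ / 2) * I ^ (1 - θ / 2) := by
        rw [← Real.rpow_add_of_nonneg hI0 (by linarith [hθ.1]) (by linarith [hθ.2])]; simp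
    _ ≤ _ := by
        gcongr
        · linarith [hθ.1]
        · linarith [hθ.2]

lemma lintegral_time_le {lam μ t θ : ℝ} (hν : 0 < lam + μ) (ht : 0 ≤ t) (hθ : θ ∈ Icc (0 : ℝ) 2)
    (l : ℕ) : ∫⁻ s in Ioc 0 t, ENNReal.ofReal (Real.exp (-(lam * (t - s))) *
      ((1 + (t - s) * 4 ^ l) ^ 2)⁻¹ * Real.exp (μ * s)) ≤
      ENNReal.ofReal (Real.exp (μ * t)) *
        (ENNReal.ofReal ((lam + μ) ^ ((θ - 2) / 2)) * pw (-(l * θ))) := by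
  set k : ℝ → ℝ := fun r => Real.exp (-((lam + μ) * r)) * ((1 + r * 4 ^ l) ^ 2)⁻¹ with hk
  have e : ∀ s, Real.exp (-(lam * (t - s))) * ((1 + (t - s) * 4 ^ l) ^ 2)⁻¹ * Real.exp (μ * s) =
      Real.exp (μ * t) * k (t - s) := fun s => by
    have : Real.exp (-(lam * (t - s))) * Real.exp (μ * s) =
        Real.exp (μ * t) * Real.exp (-((lam + μ) * (t - s))) := by
      rw [← Real.exp_add, ← Real.exp_add]; congr 1; ring
    rw [mul_right_comm, this, hk]; ring
  simp_rw [e]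
  have hi : IntegrableOn (fun s => Real.exp (μ * t) * k (t - s)) (Ioc 0 t) := by
    have h1 : ContinuousOn (fun s => Real.exp (μ * t) * k (t - s)) (Icc 0 t) := by
      refine ContinuousOn.mul (by fun_prop) (ContinuousOn.mul (by fun_prop)
        (ContinuousOn.inv₀ (by fun_prop) fun s hs => ?_))
      have : 0 ≤ (t - s) * 4 ^ l := mul_nonneg (sub_nonneg.2 hs.2) (by positivity)
      positivity
    exact h1.integrableOn_Icc.mono_set Ioc_subset_Icc_self
  rw [← ofReal_integral_eq_lintegral_ofReal hi (.of_forall fun s => by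
    simp only [hk]; positivity), ← intervalIntegral.integral_of_le ht,
    intervalIntegral.integral_const_mul, intervalIntegral.integral_comp_sub_left, sub_self,
    sub_zero, ENNReal.ofReal_mul (Real.exp_pos _).le]
  gcongr
  have h2 := integral_exp_mul_le hν (a := 4 ^ l) (by positivity) ht hθ
  refine (ofReal_le_ofReal h2).trans (le_of_eq ?_)
  rw [mul_comm, ENNReal.ofReal_mul (by positivity), pw_eq_ofReal]
  congr 2
  · rw [← Real.rpow_neg_one, ← Real.rpow_mul hν.le]; congr 1; ring
  · rw [← Real.rpow_natCast, ← Real.rpow_neg_one, ← Real.rpow_mul (by norm_num),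
      ← Real.rpow_mul (by norm_num), show (4 : ℝ) = 2 ^ (2 : ℝ) by norm_num,
      ← Real.rpow_mul (by norm_num)]
    congr 1; ring

lemma tsum_pw_dist_le (j : ℕ) : ∑' l : ℕ, pw (-(((j - l) + (l - j) : ℕ) : ℝ)) ≤ 4 := by
  have hg : ∑' n : ℕ, pw (-(n : ℝ)) = 2 := by
    have : ∀ n : ℕ, pw (-(n : ℝ)) = 2⁻¹ ^ n := fun n => by
      rw [pw, ENNReal.rpow_neg, ENNReal.rpow_natCast, ENNReal.inv_pow]
    simp_rw [this]
    rw [ENNReal.tsum_geometric]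
    rw [ENNReal.one_sub_inv_two, inv_inv]
  have h : ∀ l : ℕ, pw (-(((j - l) + (l - j) : ℕ) : ℝ)) ≤
      (if l ≤ j then pw (-((j - l : ℕ) : ℝ)) else 0) + (if j ≤ l then pw (-((l - j : ℕ) : ℝ)) else 0) := by
    intro l
    rcases le_total l j with hl | hl
    · rw [if_pos hl, Nat.sub_eq_zero_of_le hl, add_zero]; exact le_self_add
    · rw [if_pos hl, Nat.sub_eq_zero_of_le hl, zero_add]; exact le_add_self
  refine (ENNReal.tsum_le_tsum h).trans ?_
  rw [ENNReal.tsum_add]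
  have e1 : ∑' l : ℕ, (if l ≤ j then pw (-((j - l : ℕ) : ℝ)) else 0) ≤ 2 := by
    rw [tsum_eq_sum (s := Finset.range (j + 1)) fun l hl => if_neg (by simpa using hl), ← hg]
    rw [← Finset.sum_range_reflect]
    refine le_trans (Finset.sum_le_sum fun l hl => ?_)
      (ENNReal.sum_le_tsum (f := fun n : ℕ => pw (-(n : ℝ))) (Finset.range (j + 1)))
    have hl' := Finset.mem_range.1 hl
    have : j - (j + 1 - 1 - l) = l := by omega
    rw [if_pos (by omega), this]
  have e2 : ∑' l : ℕ, (if j ≤ l then pw (-((l - j : ℕ) : ℝ)) else 0) ≤ 2 := by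
    have h1 := Summable.sum_add_tsum_nat_add' (k := j) (f := fun l : ℕ =>
      if j ≤ l then pw (-((l - j : ℕ) : ℝ)) else 0) ENNReal.summable
    have h2 : ∑ l ∈ Finset.range j, (if j ≤ l then pw (-((l - j : ℕ) : ℝ)) else 0) = 0 :=
      Finset.sum_eq_zero fun l hl => if_neg (not_le.2 (Finset.mem_range.1 hl))
    rw [h2, zero_add] at h1
    rw [← h1, ← hg]
    refine ENNReal.tsum_le_tsum fun n => ?_
    rw [if_pos (Nat.le_add_left _ _), Nat.add_sub_cancel]
  calc _ ≤ (2 : ℝ≥0∞) + 2 := add_le_add e1 e2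
    _ = 4 := by norm_num

lemma tsum_block_le {N : ℕ} {s : ℝ} (hs : |s| + 1 ≤ N) (j : ℕ) :
    ∑' l : ℕ, ENNReal.ofReal ((((2 : ℝ) ^ ((j - l) + (l - j))) ^ N)⁻¹) * pw (-(l * s)) ≤
      4 * pw (-(j * s)) := by
  refine le_trans (ENNReal.tsum_le_tsum fun l => ?_)
    (le_trans (le_of_eq ENNReal.tsum_mul_right) (mul_le_mul_left (tsum_pw_dist_le j) _))
  set n := (j - l) + (l - j) with hn
  have e : ENNReal.ofReal ((((2 : ℝ) ^ n) ^ N)⁻¹) = pw (-(n * N)) := by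
    rw [pw_eq_ofReal, Real.rpow_neg (by norm_num), Real.rpow_mul (by norm_num), Real.rpow_natCast,
      Real.rpow_natCast]
  rw [e, ← pw_add, ← pw_add]
  refine pw_mono ?_
  have h1 : |(j : ℝ) - l| ≤ n := by
    rw [hn]
    rcases le_total l j with hl | hl
    · rw [Nat.sub_eq_zero_of_le hl, add_zero, Nat.cast_sub hl, abs_of_nonneg]
      exact sub_nonneg.2 (by exact_mod_cast hl)
    · rw [Nat.sub_eq_zero_of_le hl, zero_add, Nat.cast_sub hl, abs_sub_comm, abs_of_nonneg]
      exact sub_nonneg.2 (by exact_mod_cast hl)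
  have h2 : ((j : ℝ) - l) * s ≤ n * (N - 1) := by
    refine (le_abs_self _).trans ?_
    rw [abs_mul]
    gcongr
    linarith
  linarith

/-- Convolution with a symbol and a summable series. -/
lemma T_tsum {ι : Type*} [Countable ι] (m : Test d) {g : ι → Phase d → ℂ}
    (hg : ∀ i, Measurable (g i)) {z : Phase d}
    (h : ∑' i, ∫⁻ w, ‖ker m (z - w)‖ₑ * ‖g i w‖ₑ ≠ ⊤) :
    T m (fun w => ∑' i, g i w) z = ∑' i, T m (g i) z := by
  unfold T
  simp_rw [← tsum_mul_left]
  refine integral_tsum (fun i => ?_) ?_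
  · exact (((ker m).continuous.comp (continuous_const.sub continuous_id)).measurable.mul
      (hg i)).aestronglyMeasurable
  · simpa only [enorm_mul] using h

lemma lintegral_ker_mul_le (m : Test d) {g : Phase d → ℂ} {B : ℝ≥0∞} (hB : ∀ z, ‖g z‖ₑ ≤ B)
    (z : Phase d) : ∫⁻ w, ‖ker m (z - w)‖ₑ * ‖g w‖ₑ ≤ wiener m * B := by
  refine (lintegral_mono fun w => mul_le_mul_right (hB w) _).trans ?_
  have hm : Measurable fun w => ‖ker m (z - w)‖ₑ :=
    ((ker m).continuous.comp (continuous_const.sub continuous_id)).measurable.enorm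
  rw [lintegral_mul_const _ hm]
  refine mul_le_mul_left (le_of_eq ?_) _
  exact lintegral_sub_left_eq_self (fun w => ‖ker m w‖ₑ) z

lemma T_tsum_of_bounded {ι : Type*} [Countable ι] (m : Test d) {g : ι → Phase d → ℂ}
    (hg : ∀ i, Measurable (g i)) {B : ι → ℝ≥0∞} (hB : ∀ i z, ‖g i z‖ₑ ≤ B i) (hs : ∑' i, B i ≠ ⊤)
    (z : Phase d) : T m (fun w => ∑' i, g i w) z = ∑' i, T m (g i) z := by
  refine T_tsum m hg (ne_top_of_le_ne_top ?_ (ENNReal.tsum_le_tsum fun i =>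
    lintegral_ker_mul_le m (hB i) z))
  rw [ENNReal.tsum_mul_left]
  exact mul_ne_top (wiener_lt_top m).ne hs

lemma enorm_tsum_le {ι : Type*} {g : ι → ℂ} : ‖∑' i, g i‖ₑ ≤ ∑' i, ‖g i‖ₑ := by
  by_cases h : Summable g
  · exact enorm_tsum_le_tsum_enorm
  · rw [tsum_eq_zero_of_not_summable h]; simp

/-- Recovering a localized function from its position blocks. -/
lemma mx_T_le_of_mulX (D : LP d) (hp : Adm p) {m : Test d} {l : ℕ}
    (hm : ∀ ξ, 2 ^ (l + 2) < gauge ξ → m ξ = 0) {g : Phase d → ℂ} (hg : Tame g) {γ : ℝ} {A : ℝ≥0∞}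
    (hA : ∀ k : ℕ, mx p (fun z => ‖T (D.mulX k m) g z‖ₑ) ≤ pw (-(k * γ / 3)) * A) :
    mx p (fun z => ‖T m g z‖ₑ) ≤ geo (γ / 3) * A := by
  have e : ∀ z, ‖T m g z‖ₑ ≤ ∑' k, ‖T (D.mulX k m) g z‖ₑ := fun z => by
    conv_lhs => rw [← LP.sum_mulX D hm, T_sum_sym _ _ hg]
    exact (enorm_sum_le _ _).trans
      (ENNReal.sum_le_tsum (f := fun k => ‖T (D.mulX k m) g z‖ₑ) _)
  refine (mx_mono hp e).trans ((mx_tsum_le hp fun k =>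
    (measurable_T' _ hg.meas).enorm).trans ?_)
  rw [geo, ← ENNReal.tsum_mul_right]
  refine ENNReal.tsum_le_tsum fun k => (hA k).trans (le_of_eq ?_)
  rw [mul_div_assoc]

/-- A source of size `M` in the space of regularity `(γ, δ)`, given by its dyadic blocks `H l`,
with the weight `exp(μ s)` in time, and vanishing off `[0, τ]`. -/
structure Src (D : LP d) (p : ℝ≥0∞ × ℝ≥0∞) (γ δ τ μ : ℝ) (M : ℝ≥0)
    (H : ℕ → ℝ → Phase d → ℂ) : Prop where
  meas : ∀ l, Measurable fun q : ℝ × Phase d => H l q.1 q.2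
  tame : ∀ l s, Tame (H l s)
  psi : ∀ l s, T (D.psi l) (H l s) = H l s
  supp : ∀ l s, s ∉ Icc 0 τ → H l s = fun _ => 0
  bound : ∀ s, bnorm p γ δ (fun k l => T (D.mulX k (D.psi l)) (H l s)) ≤
    ENNReal.ofReal (Real.exp (μ * s)) * M

namespace Src
variable {D : LP d} {γ δ τ μ : ℝ} {M : ℝ≥0} {H : ℕ → ℝ → Phase d → ℂ}

lemma mx_block_le (h : Src D p γ δ τ μ M H) (k l : ℕ) (s : ℝ) :
    mx p (fun z => ‖T (D.mulX k (D.psi l)) (H l s) z‖ₑ) ≤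
      pw (-(k * γ / 3)) * (pw (-(l * δ)) * (ENNReal.ofReal (Real.exp (μ * s)) * M)) :=
  (mx_le_bnorm (γ := γ) (s := δ) (fun k l => T (D.mulX k (D.psi l)) (H l s)) k l).trans
    (mul_le_mul_right (mul_le_mul_right (h.bound s) _) _)

lemma mx_le (hp : Adm p) (h : Src D p γ δ τ μ M H) (l : ℕ) (s : ℝ) :
    mx p (fun z => ‖H l s z‖ₑ) ≤
      geo (γ / 3) * (pw (-(l * δ)) * (ENNReal.ofReal (Real.exp (μ * s)) * M)) := by
  conv_lhs => rw [← h.psi l s]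
  exact mx_T_le_of_mulX D hp (fun ξ hξ => D.psi_eq_zero_of_gt hξ) (h.tame l s)
    fun k => h.mx_block_le k l s

end Src

lemma Src.exists_enorm_le (D : LP d) (hp : Adm p) : ∃ C : ℝ≥0, ∀ {γ δ τ μ : ℝ} {M : ℝ≥0}
    {H : ℕ → ℝ → Phase d → ℂ}, Src D p γ δ τ μ M H → ∀ l s z, ‖H l s z‖ₑ ≤
      C * (geo (γ / 3) * (pw (l * (al d p - δ)) * (ENNReal.ofReal (Real.exp (μ * s)) * M))) := by
  obtain ⟨C, hC⟩ := D.mx_conj_ker_psi_le hp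
  refine ⟨C, fun {γ δ τ μ M H} h l s z => ?_⟩
  have h1 := enorm_T_le_mx hp (D.psi l) (h.tame l s).meas z
  rw [h.psi l s] at h1
  refine h1.trans ((mul_le_mul' (hC l) (h.mx_le hp l s)).trans (le_of_eq ?_))
  rw [mul_sub, sub_eq_add_neg, pw_add]
  ring

lemma Src.exists_bddMeas (hp : Adm p) {D : LP d} {γ δ τ μ : ℝ} (hγ : 0 < γ) (hμ : 0 ≤ μ) {M : ℝ≥0}
    {H : ℕ → ℝ → Phase d → ℂ} (h : Src D p γ δ τ μ M H) (l : ℕ) : ∃ B, BddMeas (H l) B := by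
  obtain ⟨C, hC⟩ := Src.exists_enorm_le D hp
  set B : ℝ≥0∞ := C * (geo (γ / 3) * (pw (l * (al d p - δ)) *
    (ENNReal.ofReal (Real.exp (μ * τ)) * M))) with hB
  have hBt : B ≠ ⊤ := mul_ne_top coe_ne_top (mul_ne_top
    (tsum_pw_neg_lt_top (by positivity)).ne (mul_ne_top (pw_ne_top _)
      (mul_ne_top ofReal_ne_top coe_ne_top)))
  refine ⟨B.toReal, h.meas l, fun s z => ?_⟩
  by_cases hs : s ∈ Icc 0 τ
  · have h1 : ‖H l s z‖ₑ ≤ B := by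
      refine (hC h l s z).trans ?_
      rw [hB]
      gcongr
      exact hs.2
    rw [← ofReal_norm, ← ENNReal.ofReal_toReal hBt] at h1
    exact (ENNReal.ofReal_le_ofReal_iff ENNReal.toReal_nonneg).1 h1
  · rw [h.supp l s hs]; simp

lemma enorm_T_duh_le {lam : ℝ} (hl : 0 ≤ lam) {h : ℝ → Phase d → ℂ} {B : ℝ} (hh : BddMeas h B)
    (t : ℝ) (m : Test d) (z : Phase d) : ‖T m (duh lam h t) z‖ₑ ≤
      ∫⁻ s in Ioc 0 t, ENNReal.ofReal (Real.exp (-(lam * (t - s)))) *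
        ‖T m (semi (t - s) (h s)) z‖ₑ := by
  rw [T_duh hl hh]
  refine (enorm_integral_le_lintegral_enorm _).trans (le_of_eq ?_)
  congr 1; funext s
  rw [enorm_mul, ← ofReal_norm (Real.exp (-(lam * (t - s))) : ℂ), Complex.norm_real,
    Real.norm_of_nonneg (Real.exp_pos _).le]

lemma enorm_duh_le (lam : ℝ) (h : ℝ → Phase d → ℂ) (t : ℝ) (z : Phase d) : ‖duh lam h t z‖ₑ ≤
      ∫⁻ s in Ioc 0 t, ENNReal.ofReal (Real.exp (-(lam * (t - s)))) * ‖semi (t - s) (h s) z‖ₑ := by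
  refine (enorm_integral_le_lintegral_enorm _).trans (le_of_eq ?_)
  congr 1; funext s
  rw [enorm_mul, ← ofReal_norm (Real.exp (-(lam * (t - s))) : ℂ), Complex.norm_real,
    Real.norm_of_nonneg (Real.exp_pos _).le]

/-- The blocks of the semigroup applied to a localized function. -/
lemma T_mulX_phi_semi (D : LP d) {k j l : ℕ} {r : ℝ} (hr : 0 < r) {g : Phase d → ℂ} (hg : Tame g)
    (hgl : T (D.psi l) g = g) (z : Phase d) : T (D.mulX k (D.phi j)) (semi r g) z =
      T (D.sig j l r) (T (D.mulX k (D.psi l)) g) (shear r z) := by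
  have e1 : semi r g = fun w => T (heatS r) g (shear r w) := funext fun w => semi_of_pos hr g w
  rw [e1, T_comp_shear, D.compFshear_mulX, T_T _ _ hg, T_T _ _ hg]
  conv_lhs => rw [← hgl, T_T _ _ hg]
  conv_lhs => rw [← hgl, T_T _ _ hg]
  congr 1
  ext ξ
  simp only [mulS_apply, LP.mulX_apply, LP.sig]
  ring

lemma ofReal_shuffle {a q e₁ e₂ : ℝ} (ha : 0 ≤ a) (hq : 0 ≤ q) (he : 0 ≤ e₁) {A B M : ℝ≥0∞} :
    ENNReal.ofReal e₁ * (ENNReal.ofReal (a * q) * (A * (B * (ENNReal.ofReal e₂ * M)))) =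
      ENNReal.ofReal a * (A * (B * M)) * ENNReal.ofReal (e₁ * q * e₂) := by
  rw [ENNReal.ofReal_mul ha, ENNReal.ofReal_mul (mul_nonneg he hq), ENNReal.ofReal_mul he]
  ring

/-- Smoothing by two anisotropic derivatives, at the price of a negative power of `lam`. -/
lemma Src.exists_mx_T_duh_le (D : LP d) (p : ℝ≥0∞ × ℝ≥0∞) (hp : Adm p) (N : ℕ) {τ : ℝ} (hτ : 0 ≤ τ) : ∃ C : ℝ≥0,
    ∀ {γ δ μ lam θ : ℝ} {M : ℝ≥0} {H : ℕ → ℝ → Phase d → ℂ}, Src D p γ δ τ μ M H → 0 < γ → 0 ≤ μ →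
      0 ≤ lam → 0 < lam + μ → θ ∈ Icc (0 : ℝ) 2 → ∀ t ∈ Icc 0 τ, ∀ k j l : ℕ,
      mx p (fun z => ‖T (D.mulX k (D.phi j)) (duh lam (H l) t) z‖ₑ) ≤
        C * ENNReal.ofReal ((((2 : ℝ) ^ ((j - l) + (l - j))) ^ N)⁻¹) * (pw (-(l * (δ + θ))) *
          (pw (-(k * γ / 3)) * (ENNReal.ofReal (Real.exp (μ * t)) *
            (ENNReal.ofReal ((lam + μ) ^ ((θ - 2) / 2)) * M)))) := by
  obtain ⟨C, hC0, hC⟩ := D.wiener_sig_le N hτ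
  refine ⟨C.toNNReal, fun {γ δ μ lam θ M H} h hγ hμ hl hν hθ t ht k j l => ?_⟩
  obtain ⟨B, hB⟩ := h.exists_bddMeas hp hγ hμ l
  have hm : Measurable fun q : Phase d × ℝ => ENNReal.ofReal (Real.exp (-(lam * (t - q.2)))) *
      ‖T (D.mulX k (D.phi j)) (semi (t - q.2) (H l q.2)) q.1‖ₑ := by
    have h1 : Measurable fun q : ℝ × Phase d => semi (t - q.1) (H l q.1) q.2 :=
      (measurable_semi hB.meas).comp (by fun_prop :
        Measurable fun q : ℝ × Phase d => (t - q.1, q.1, q.2))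
    have h2 := measurable_T (D.mulX k (D.phi j)) (g := fun s => semi (t - s) (H l s)) h1
    have h3 := (h2.comp (measurable_swap (α := Phase d) (β := ℝ))).enorm
    have h4 : Measurable fun q : Phase d × ℝ => ENNReal.ofReal (Real.exp (-(lam * (t - q.2)))) := by
      fun_prop
    exact h4.mul h3
  refine (mx_mono hp (enorm_T_duh_le hl hB t _)).trans ((mx_lintegral_le hp
    (F := fun z s => ENNReal.ofReal (Real.exp (-(lam * (t - s)))) *
      ‖T (D.mulX k (D.phi j)) (semi (t - s) (H l s)) z‖ₑ) hm).trans ?_)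
  set W : ℝ≥0∞ := ENNReal.ofReal (C * ((((2 : ℝ) ^ ((j - l) + (l - j))) ^ N)⁻¹)) *
    (pw (-(k * γ / 3)) * (pw (-(l * δ)) * M)) with hW
  have h3 : ∀ s ∈ Ioo 0 t, mx p (fun z => ENNReal.ofReal (Real.exp (-(lam * (t - s)))) *
      ‖T (D.mulX k (D.phi j)) (semi (t - s) (H l s)) z‖ₑ) ≤
      W * ENNReal.ofReal (Real.exp (-(lam * (t - s))) *
      ((1 + (t - s) * 4 ^ l) ^ 2)⁻¹ * Real.exp (μ * s)) := by
    intro s hs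
    have hr : 0 < t - s := sub_pos.2 hs.2
    rw [mx_const_mul hp _ ofReal_ne_top]
    simp_rw [T_mulX_phi_semi D hr (h.tame l s) (h.psi l s)]
    rw [mx_comp_shear (fun z => ‖T (D.sig j l (t - s)) (T (D.mulX k (D.psi l)) (H l s)) z‖ₑ)]
    have h4 := (mx_T_le hp (D.sig j l (t - s)) (measurable_T' (D.mulX k (D.psi l))
      (h.tame l s).meas)).trans (mul_le_mul' (hC (t - s) ⟨hr, by linarith [ht.2, hs.1]⟩ j l)
        (h.mx_block_le k l s))
    refine (mul_le_mul_right h4 _).trans (le_of_eq ?_)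
    exact ofReal_shuffle (by positivity) (by positivity) (Real.exp_pos _).le
  rw [setLIntegral_congr Ioo_ae_eq_Ioc.symm]
  refine (setLIntegral_mono' measurableSet_Ioo h3).trans ?_
  rw [setLIntegral_congr Ioo_ae_eq_Ioc, lintegral_const_mul' _ _ (by
    rw [hW]
    exact mul_ne_top ofReal_ne_top (mul_ne_top (pw_ne_top _)
      (mul_ne_top (pw_ne_top _) coe_ne_top)))]
  refine (mul_le_mul_right (lintegral_time_le hν ht.1 hθ l) W).trans (le_of_eq ?_)
  rw [hW, ENNReal.ofReal_mul hC0.le, mul_add (l : ℝ), neg_add, pw_add]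
  simp only [ENNReal.ofReal]
  ring

lemma Src.exists_enorm_duh_le (D : LP d) (hp : Adm p) {τ : ℝ} (hτ : 0 ≤ τ) : ∃ C : ℝ≥0,
    ∀ {γ δ μ lam : ℝ} {M : ℝ≥0} {H : ℕ → ℝ → Phase d → ℂ}, Src D p γ δ τ μ M H → 0 < γ → 0 ≤ μ →
      0 ≤ lam → 0 < lam + μ → ∀ t ∈ Icc 0 τ, ∀ l z, ‖duh lam (H l) t z‖ₑ ≤
        C * (geo (γ / 3) * pw (-(l * (2 + δ - al d p))) *
          (ENNReal.ofReal (Real.exp (μ * t)) * M)) := by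
  obtain ⟨C₁, hC₁⟩ := Src.exists_enorm_le D hp
  obtain ⟨C, hC0, hC⟩ := D.annular_annPsi.wiener_heat_le heat1 2 hτ D.psi_add_two
  refine ⟨C.toNNReal * C₁, fun {γ δ μ lam M H} h hγ hμ hl hν t ht l z => ?_⟩
  set W : ℝ≥0∞ := ENNReal.ofReal C * (C₁ * (geo (γ / 3) * (pw (l * (al d p - δ)) * M))) with hW
  refine (enorm_duh_le lam (H l) t z).trans ?_
  have h3 : ∀ s ∈ Ioo 0 t, ENNReal.ofReal (Real.exp (-(lam * (t - s)))) *
      ‖semi (t - s) (H l s) z‖ₑ ≤ W * ENNReal.ofReal (Real.exp (-(lam * (t - s))) *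
      ((1 + (t - s) * 4 ^ l) ^ 2)⁻¹ * Real.exp (μ * s)) := by
    intro s hs
    have hr : 0 < t - s := sub_pos.2 hs.2
    have h4 : ‖semi (t - s) (H l s) z‖ₑ ≤
        ENNReal.ofReal (C * ((1 + (t - s) * 4 ^ l) ^ 2)⁻¹) * (C₁ * (geo (γ / 3) *
          (pw (l * (al d p - δ)) * (ENNReal.ofReal (Real.exp (μ * s)) * M)))) := by
      rw [semi_of_pos hr]
      conv_lhs => rw [← h.psi l s, T_T _ _ (h.tame l s)]
      exact (enorm_T_le_of_bounded _ (hC₁ h l s) _).trans (mul_le_mul_left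
        (hC (t - s) ⟨hr, by linarith [ht.2, hs.1]⟩ l) _)
    refine (mul_le_mul_right h4 _).trans (le_of_eq ?_)
    have hp1 : 0 ≤ ((1 + (t - s) * 4 ^ l) ^ 2)⁻¹ := by positivity
    rw [hW, ENNReal.ofReal_mul (by positivity), ENNReal.ofReal_mul (by positivity),
      ENNReal.ofReal_mul (by positivity)]
    ring
  rw [setLIntegral_congr Ioo_ae_eq_Ioc.symm]
  refine (setLIntegral_mono' measurableSet_Ioo h3).trans ?_
  rw [setLIntegral_congr Ioo_ae_eq_Ioc, lintegral_const_mul' _ _ (by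
    rw [hW]
    exact mul_ne_top ofReal_ne_top (mul_ne_top coe_ne_top
      (mul_ne_top (tsum_pw_neg_lt_top (by positivity)).ne
      (mul_ne_top (pw_ne_top _) coe_ne_top))))]
  refine (mul_le_mul_right (lintegral_time_le hν ht.1 (θ := 2) ⟨by norm_num, le_rfl⟩ l) W).trans
    (le_of_eq ?_)
  have e : -((l : ℝ) * (2 + δ - al d p)) = l * (al d p - δ) + -(l * 2) := by ring
  rw [hW, e, pw_add]
  simp only [ENNReal.ofReal, sub_self, zero_div, Real.rpow_zero, Real.toNNReal_one,
    ENNReal.coe_one, one_mul, ENNReal.coe_mul]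
  ring

/-- The solution of the equation without drift, with source `∑ H l`. -/
def mild (lam : ℝ) (H : ℕ → ℝ → Phase d → ℂ) (t : ℝ) (z : Phase d) : ℂ :=
  ∑' l, duh lam (H l) t z

lemma measurable_mild (lam : ℝ) {H : ℕ → ℝ → Phase d → ℂ}
    (h : ∀ l, Measurable fun q : ℝ × Phase d => H l q.1 q.2) :
    Measurable fun q : ℝ × Phase d => mild lam H q.1 q.2 :=
  Measurable.tsum fun l => measurable_duh lam (h l)

/-- The mild solution in the scale of Besov spaces. -/
lemma Src.exists_bnorm_mild_le (D : LP d) (p : ℝ≥0∞ × ℝ≥0∞) (hp : Adm p) (δ : ℝ) {τ : ℝ}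
    (hτ : 0 ≤ τ) (hδ : 0 < 2 + δ - al d p) : ∃ C : ℝ≥0,
    ∀ {γ μ lam θ : ℝ} {M : ℝ≥0} {H : ℕ → ℝ → Phase d → ℂ}, Src D p γ δ τ μ M H → 0 < γ → 0 ≤ μ →
      0 ≤ lam → 0 < lam + μ → θ ∈ Icc (0 : ℝ) 2 → ∀ t ∈ Icc 0 τ,
      bnorm p γ (θ + δ) (fun k j => T (D.mulX k (D.phi j)) (mild lam H t)) ≤
        C * (ENNReal.ofReal ((lam + μ) ^ ((θ - 2) / 2)) *
          (ENNReal.ofReal (Real.exp (μ * t)) * M)) := by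
  obtain ⟨C, hC⟩ := Src.exists_mx_T_duh_le D p hp (⌈|δ|⌉₊ + 3) hτ
  obtain ⟨C₂, hC₂⟩ := Src.exists_enorm_duh_le D hp hτ
  refine ⟨C * 4, fun {γ μ lam θ M H} h hγ hμ hl hν hθ t ht => iSup₂_le fun k j => ?_⟩
  have hb := fun l => (h.exists_bddMeas hp hγ hμ l).choose_spec
  have hms : ∀ l, Measurable (duh lam (H l) t) := fun l => (measurable_duh lam (h.meas l)).of_uncurry_left
  have h1 : ∀ z, T (D.mulX k (D.phi j)) (mild lam H t) z =
      ∑' l, T (D.mulX k (D.phi j)) (duh lam (H l) t) z := fun z => by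
    refine T_tsum_of_bounded _ hms (fun l => hC₂ h hγ hμ hl hν t ht l) ?_ z
    rw [ENNReal.tsum_mul_left, ENNReal.tsum_mul_right, ENNReal.tsum_mul_left]
    refine mul_ne_top coe_ne_top (mul_ne_top (mul_ne_top
      (tsum_pw_neg_lt_top (by positivity)).ne (tsum_pw_neg_lt_top hδ).ne)
      (mul_ne_top ofReal_ne_top coe_ne_top))
  have h2 : mx p (fun z => ‖T (D.mulX k (D.phi j)) (mild lam H t) z‖ₑ) ≤
      ∑' l, mx p (fun z => ‖T (D.mulX k (D.phi j)) (duh lam (H l) t) z‖ₑ) := by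
    refine (mx_mono hp fun z => ?_).trans (mx_tsum_le hp fun l => (measurable_T' _ (hms l)).enorm)
    rw [h1 z]; exact enorm_tsum_le
  set W : ℝ≥0∞ := pw (-(k * γ / 3)) * (ENNReal.ofReal (Real.exp (μ * t)) *
    (ENNReal.ofReal ((lam + μ) ^ ((θ - 2) / 2)) * M)) with hW
  have h3 : ∑' l, mx p (fun z => ‖T (D.mulX k (D.phi j)) (duh lam (H l) t) z‖ₑ) ≤
      C * (4 * pw (-(j * (δ + θ)))) * W := by
    refine (ENNReal.tsum_le_tsum fun l => hC h hγ hμ hl hν hθ t ht k j l).trans ?_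
    simp_rw [← hW]
    have e : ∀ a b : ℝ≥0∞, C * a * (b * W) = C * (a * b) * W := fun a b => by ring
    simp_rw [e]
    rw [ENNReal.tsum_mul_right]
    refine mul_le_mul_left ?_ _
    rw [ENNReal.tsum_mul_left]
    refine mul_le_mul_right (tsum_block_le ?_ j) _
    have h4 : |δ + θ| ≤ |δ| + 2 := (abs_add_le _ _).trans (by
      rw [abs_of_nonneg hθ.1]; linarith [hθ.2])
    have h5 := Nat.le_ceil |δ|
    push_cast
    linarith
  refine (mul_le_mul_right (h2.trans h3) _).trans (le_of_eq ?_)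
  rw [hW, add_comm δ θ]
  have e1 := pw_mul_neg (k * γ / 3)
  have e2 := pw_mul_neg (j * (θ + δ))
  push_cast
  calc _ = (pw (k * γ / 3) * pw (-(k * γ / 3))) * (pw (j * (θ + δ)) * pw (-(j * (θ + δ)))) *
      (C * 4 * (ENNReal.ofReal ((lam + μ) ^ ((θ - 2) / 2)) *
      (ENNReal.ofReal (Real.exp (μ * t)) * M))) := by ring
    _ = _ := by rw [e1, e2]; ring

/-- The mild solution is bounded. -/
lemma Src.exists_enorm_mild_le (D : LP d) (p : ℝ≥0∞ × ℝ≥0∞) (hp : Adm p) {γ δ τ : ℝ} (hγ : 0 < γ)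
    (hτ : 0 ≤ τ) (hδ : 0 < 2 + δ - al d p) : ∃ C : ℝ≥0,
    ∀ {μ lam : ℝ} {M : ℝ≥0} {H : ℕ → ℝ → Phase d → ℂ}, Src D p γ δ τ μ M H → 0 ≤ μ →
      0 ≤ lam → 0 < lam + μ → ∀ t ∈ Icc 0 τ, ∀ z,
      ∑' l, ‖duh lam (H l) t z‖ₑ ≤ C * (ENNReal.ofReal (Real.exp (μ * t)) * M) := by
  obtain ⟨C₂, hC₂⟩ := Src.exists_enorm_duh_le D hp hτ
  have hg1 := tsum_pw_neg_lt_top (a := γ / 3) (by positivity)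
  have hg2 := tsum_pw_neg_lt_top hδ
  refine ⟨C₂ * ((geo (γ / 3)).toNNReal * (geo (2 + δ - al d p)).toNNReal),
    fun {μ lam M H} h hμ hl hν t ht z => ?_⟩
  refine (ENNReal.tsum_le_tsum fun l => hC₂ h hγ hμ hl hν t ht l z).trans (le_of_eq ?_)
  rw [ENNReal.tsum_mul_left, ENNReal.tsum_mul_right, ENNReal.tsum_mul_left]
  push_cast
  have e1 : ((geo (γ / 3)).toNNReal : ℝ≥0∞) = geo (γ / 3) := coe_toNNReal hg1.ne
  have e2 : ((geo (2 + δ - al d p)).toNNReal : ℝ≥0∞) = geo (2 + δ - al d p) :=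
    coe_toNNReal hg2.ne
  rw [e1, e2, ← geo]
  ring

/-! ### The equation without drift -/

lemma summable_of_tsum_enorm {ι : Type*} {f : ι → ℂ} (h : ∑' i, ‖f i‖ₑ ≠ ⊤) : Summable f := by
  refine Summable.of_norm ?_
  have h1 : Summable fun i => ‖f i‖₊ := ENNReal.tsum_coe_ne_top_iff_summable.1 h
  exact NNReal.summable_coe.2 h1

lemma pairing_tsum {α ι : Type*} [MeasurableSpace α] {ν : Measure α} [Countable ι] {k : α → ℂ}
    (hk : Integrable k ν) {g : ι → α → ℂ} (hg : ∀ i, Measurable (g i)) {B : ℝ≥0∞} (hB : B ≠ ⊤)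
    (h : ∀ᵐ z ∂ν, ∑' i, ‖g i z‖ₑ ≤ B) :
    ∫ z, k z * ∑' i, g i z ∂ν = ∑' i, ∫ z, k z * g i z ∂ν ∧
    ∑' i, ‖∫ z, k z * g i z ∂ν‖ₑ ≤ (∫⁻ z, ‖k z‖ₑ ∂ν) * B := by
  have hm : ∀ i, AEStronglyMeasurable (fun z => k z * g i z) ν := fun i =>
    hk.aestronglyMeasurable.mul (hg i).aestronglyMeasurable
  have h1 : ∑' i, ∫⁻ z, ‖k z * g i z‖ₑ ∂ν ≤ (∫⁻ z, ‖k z‖ₑ ∂ν) * B := by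
    rw [← lintegral_tsum fun i => (hm i).enorm, ← lintegral_mul_const' _ _ hB]
    refine lintegral_mono_ae ?_
    filter_upwards [h] with z hz
    simp_rw [enorm_mul]
    rw [ENNReal.tsum_mul_left]
    exact mul_le_mul_right hz _
  constructor
  · simp_rw [← tsum_mul_left]
    exact integral_tsum hm (ne_top_of_le_ne_top (mul_ne_top hk.2.ne hB) h1)
  · exact (ENNReal.tsum_le_tsum fun i => enorm_integral_le_lintegral_enorm _).trans h1

namespace LP
variable (D : LP d)

/-- High-frequency blocks of a Schwartz function are small: `psi (l + 2)` is a multiple of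
`2^{-6l}` times the multiplier `hom6`. -/
lemma exists_mx_TS_psi_le (hp : Adm p) (φ : Test d) : ∃ C : ℝ≥0, ∀ l : ℕ,
    mx p (fun z => ‖TS (D.psi l) φ z‖ₑ) ≤ C * pw (-(l * 6)) := by
  obtain ⟨ζ, -, hζ⟩ := D.annular_annPsi.exists_mulH
  set φ' : Test d := 𝓕⁻ (mulH (𝓕 φ)) with hφ'
  have hfin : ∀ l : ℕ, pw (l * 6) * mx p (fun z => ‖TS (D.psi l) φ z‖ₑ) ≠ ⊤ := fun l =>
    mul_ne_top (pw_ne_top _) (mx_schwartz_lt_top hp _).ne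
  set A : ℝ≥0∞ := pw 12 * (wiener ζ * mx p (fun z => ‖φ' z‖ₑ)) with hA
  obtain ⟨C, hC⟩ := exists_bound_of_two (e := 0) (A := A)
    (a := fun l : ℕ => pw (l * 6) * mx p (fun z => ‖TS (D.psi l) φ z‖ₑ)) (hfin 0) (hfin 1)
    (mul_ne_top (pw_ne_top _) (mul_ne_top (wiener_lt_top _).ne
      (mx_schwartz_lt_top hp _).ne)) le_rfl (fun l => by
    have h1 : TS (D.psi (l + 2)) φ = ((((2 : ℝ) ^ l)⁻¹ ^ 6 : ℝ) : ℂ) •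
        TS (compDil ((2 : ℝ) ^ l)⁻¹ ζ) φ' := by
      have e : mulS (D.psi (l + 2)) (𝓕 φ) = ((((2 : ℝ) ^ l)⁻¹ ^ 6 : ℝ) : ℂ) •
          mulS (compDil ((2 : ℝ) ^ l)⁻¹ ζ) (𝓕 φ') := by
        ext ξ
        rw [mulS_apply, D.psi_add_two, compDil_apply (by positivity), ← hζ, mulH_apply, hom6_dil,
          smul_apply, mulS_apply, compDil_apply (by positivity), hφ',
          fourier_fourierInv_eq, mulH_apply, smul_eq_mul]
        push_cast
        ring
      rw [TS, e, fourierInv_smul, TS]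
    have h2 : mx p (fun z => ‖TS (D.psi (l + 2)) φ z‖ₑ) ≤
        pw (-(l * 6)) * (wiener ζ * mx p (fun z => ‖φ' z‖ₑ)) := by
      have e : ∀ z, ‖TS (D.psi (l + 2)) φ z‖ₑ =
          pw (-(l * 6)) * ‖T (compDil ((2 : ℝ) ^ l)⁻¹ ζ) φ' z‖ₑ := fun z => by
        rw [h1, smul_apply, enorm_smul, TS_apply, ← ofReal_norm (_ : ℂ), Complex.norm_real,
          Real.norm_of_nonneg (by positivity), pw_eq_ofReal]
        congr 2
        rw [Real.rpow_neg (by norm_num), Real.rpow_mul (by norm_num), Real.rpow_natCast, inv_pow]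
        norm_cast
      simp_rw [e]
      rw [mx_const_mul hp _ (pw_ne_top _)]
      refine mul_le_mul_right ?_ _
      rw [← wiener_compDil (s := ((2 : ℝ) ^ l)⁻¹) (by positivity) ζ]
      exact mx_T_le hp _ φ'.continuous.measurable
    refine (mul_le_mul_right h2 _).trans (le_of_eq ?_)
    rw [hA, ← mul_assoc, ← pw_add, mul_zero, pw_zero, one_mul]
    congr 2
    push_cast; ring)
  refine ⟨C, fun l => ?_⟩
  have h3 := le_pw_neg_mul (hC l)
  rw [mul_zero, pw_zero, mul_one, mul_comm] at h3
  exact h3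

end LP

lemma Src.exists_pairing_le (D : LP d) (p : ℝ≥0∞ × ℝ≥0∞) (hp : Adm p) (φ : Test d) : ∃ C : ℝ≥0, ∀ {γ δ τ μ : ℝ} {M : ℝ≥0}
    {H : ℕ → ℝ → Phase d → ℂ}, Src D p γ δ τ μ M H → ∀ l s, ‖∫ z, φ z * H l s z‖ₑ ≤
      C * (pw (-(l * (6 + δ))) * (geo (γ / 3) * (ENNReal.ofReal (Real.exp (μ * s)) * M))) := by
  obtain ⟨C, hC⟩ := D.exists_mx_TS_psi_le hp.conj φ
  refine ⟨C, fun {γ δ τ μ M H} h l s => ?_⟩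
  have h1 : ∫ z, φ z * H l s z = ∫ z, H l s z * TS (D.psi l) φ z := by
    conv_lhs => rw [← h.psi l s, integral_T_mul _ _ (h.tame l s), D.negS_psi]
    simp_rw [mul_comm]
  rw [h1]
  refine (enorm_integral_le_lintegral_enorm _).trans ?_
  simp_rw [enorm_mul]
  refine (lintegral_mul_le_mx hp (h.tame l s).meas.enorm
    (TS (D.psi l) φ).continuous.measurable.enorm).trans
    ((mul_le_mul' (h.mx_le hp l s) (hC l)).trans (le_of_eq ?_))
  rw [mul_add (l : ℝ), neg_add, pw_add]
  ring

section
variable {D : LP d} {γ δ τ μ lam : ℝ} {M : ℝ≥0} {H : ℕ → ℝ → Phase d → ℂ}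

/-- The pairing of the sum of a source with a Schwartz function. -/
lemma Src.exists_tsum_pairing_le (hp : Adm p) (h : Src D p γ δ τ μ M H) (hγ : 0 < γ)
    (hμ : 0 ≤ μ) (hδ : 0 < 6 + δ) (φ : Test d) : ∃ B : ℝ≥0∞, B ≠ ⊤ ∧
    ∀ s, ∑' l, ‖∫ z, φ z * H l s z‖ₑ ≤ B := by
  obtain ⟨C, hC⟩ := Src.exists_pairing_le D p hp φ
  refine ⟨C * (geo (6 + δ) * (geo (γ / 3) * (ENNReal.ofReal (Real.exp (μ * τ)) * M))),
    mul_ne_top coe_ne_top (mul_ne_top (tsum_pw_neg_lt_top hδ).ne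
      (mul_ne_top (tsum_pw_neg_lt_top (by positivity)).ne
        (mul_ne_top ofReal_ne_top coe_ne_top))), fun s => ?_⟩
  by_cases hs : s ∈ Icc 0 τ
  · refine (ENNReal.tsum_le_tsum fun l => hC h l s).trans ?_
    rw [ENNReal.tsum_mul_left, ENNReal.tsum_mul_right, ← geo]
    gcongr
    exact hs.2
  · have : ∀ l, ∫ z, φ z * H l s z = 0 := fun l => by rw [h.supp l s hs]; simp
    simp [this]

lemma measurable_pairing {h : ℝ → Phase d → ℂ} (hh : Measurable fun q : ℝ × Phase d => h q.1 q.2)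
    (φ : Test d) : Measurable fun s => ∫ z, φ z * h s z := by
  have h1 : Measurable fun q : ℝ × Phase d => φ q.2 * h q.1 q.2 :=
    (φ.continuous.measurable.comp measurable_snd).mul hh
  exact (h1.stronglyMeasurable.integral_prod_right' (ν := volume)).measurable

/-- The mild solution solves the equation without drift in the weak sense. -/
lemma Src.mild_weak (hp : Adm p) (h : Src D p γ δ τ μ M H) (hγ : 0 < γ) (hμ : 0 ≤ μ)
    (hl : 0 ≤ lam) (hν : 0 < lam + μ) (hδ : 0 < 2 + δ - al d p) (φ : Test d) {t : ℝ}
    (ht : t ∈ Icc 0 τ) :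
    ∫ z, φ z * mild lam H t z = (∫ s in Ioo 0 t, ∑' l, ∫ z, φ z * H l s z) +
      ∫ σ in Ioo 0 t, ∫ z, adjS lam φ z * mild lam H σ z := by
  have hτ := ht.1.trans ht.2
  obtain ⟨C, hC⟩ := Src.exists_enorm_mild_le D p hp hγ hτ hδ
  have hb := fun l => (h.exists_bddMeas hp hγ hμ l).choose_spec
  set B : ℝ≥0∞ := C * (ENNReal.ofReal (Real.exp (μ * τ)) * M) with hB
  have hBt : B ≠ ⊤ := mul_ne_top coe_ne_top
    (mul_ne_top ofReal_ne_top coe_ne_top)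
  have hCB : ∀ σ ∈ Icc 0 τ, ∀ z, ∑' l, ‖duh lam (H l) σ z‖ₑ ≤ B := fun σ hσ z => by
    refine (hC h hμ hl hν σ hσ z).trans ?_
    rw [hB]
    gcongr
    exact hσ.2
  have hms : ∀ l σ, Measurable (duh lam (H l) σ) := fun l σ =>
    (measurable_duh lam (h.meas l)).of_uncurry_left
  have e1 := fun (ψ : Test d) (σ : ℝ) (hσ : σ ∈ Icc 0 τ) =>
    pairing_tsum (ν := volume) (k := ψ) ψ.integrable (fun l => hms l σ) hBt
      (.of_forall (hCB σ hσ))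
  have hsub : Ioo 0 t ⊆ Icc 0 τ := fun s hs => ⟨hs.1.le, hs.2.le.trans ht.2⟩
  obtain ⟨Bφ, hBφt, hBφ⟩ := h.exists_tsum_pairing_le hp hγ hμ
    (by have := al_nonneg (d := d) (p := p); linarith) φ
  have hone : Integrable (fun _ : ℝ => (1 : ℂ)) (volume.restrict (Ioo 0 t)) :=
    integrableOn_const (by simp)
  obtain ⟨e2, e2'⟩ := pairing_tsum hone (fun l => measurable_pairing (h.meas l) φ) hBφt
    (.of_forall hBφ)
  have hae : ∀ᵐ σ ∂(volume.restrict (Ioo 0 t)),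
      ∑' l, ‖∫ z, adjS lam φ z * duh lam (H l) σ z‖ₑ ≤ (∫⁻ z, ‖adjS lam φ z‖ₑ) * B := by
    filter_upwards [ae_restrict_mem measurableSet_Ioo] with σ hσ
    exact (e1 _ σ (hsub hσ)).2
  obtain ⟨e3, e3'⟩ := pairing_tsum hone
    (fun l => measurable_pairing (measurable_duh lam (h.meas l)) (adjS lam φ))
    (mul_ne_top (adjS lam φ).integrable.2.ne hBt) hae
  simp only [one_mul] at e2 e2' e3 e3'
  have hfin : ∀ {b : ℝ≥0∞}, b ≠ ⊤ → (∫⁻ _ in Ioo 0 t, ‖(1 : ℂ)‖ₑ) * b ≠ ⊤ := fun hb =>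
    mul_ne_top hone.2.ne hb
  have e4 : ∫ σ in Ioo 0 t, ∫ z, adjS lam φ z * mild lam H σ z =
      ∫ σ in Ioo 0 t, ∑' l, ∫ z, adjS lam φ z * duh lam (H l) σ z :=
    setIntegral_congr_fun measurableSet_Ioo fun σ hσ => (e1 _ σ (hsub hσ)).1
  rw [e4, e2, e3]
  refine (e1 φ t ht).1.trans ?_
  rw [← (summable_of_tsum_enorm (ne_top_of_le_ne_top (hfin hBφt) e2')).tsum_add
    (summable_of_tsum_enorm (ne_top_of_le_ne_top (hfin (mul_ne_top
      (adjS lam φ).integrable.2.ne hBt)) e3'))]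
  congr 1; funext l
  exact duh_weak hl (hb l) φ t

end

/-! ### Uniqueness of bounded solutions of the homogeneous equation -/

/-- The weak equation at time `s`, tested against the dual semigroup applied to `φ`. -/
lemma bp_eq_integral_of_weak {lam : ℝ} {v : ℝ → Phase d → ℂ} {s : ℝ}
    (hs : ∀ φ : Test d, ∫ z, φ z * v s z = ∫ σ in Ioo 0 s, ∫ z, adjS lam φ z * v σ z)
    (φ : Test d) {r : ℝ} (hr : 0 < r) :
    bp lam v φ s r = ∫ σ in Ioo 0 s, bp lam v (adjS lam φ) σ r := by
  rw [bp_of_pos hr, hs (Qs r φ), adjS_Qs hr, ← integral_const_mul]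
  congr 1; funext σ
  rw [bp_of_pos hr]

/-- Comparing two expressions of `∫₀ᵗ bp φ s (t - s) ds`, one from the Duhamel formula, the other
from the equation tested with `Qs (t - s) φ`. -/
lemma integral_pairing_eq_zero {lam B τ : ℝ} (hl : 0 ≤ lam) {v : ℝ → Phase d → ℂ} (hv : BddMeas v B)
    (h : ∀ᵐ s ∂(volume.restrict (Icc 0 τ)), ∀ φ : Test d,
      ∫ z, φ z * v s z = ∫ σ in Ioo 0 s, ∫ z, adjS lam φ z * v σ z)
    (φ : Test d) {t : ℝ} (ht : t ≤ τ) : ∫ s in Ioo 0 t, ∫ z, φ z * v s z = 0 := by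
  obtain ⟨hi, he⟩ := integral_triangle (measurable_bp lam hv.meas (adjS lam φ))
    (fun s r _ hr => norm_bp_le hl hv _ s hr) t
  have hc := hv.integrableOn_pairing φ (s := Ioo 0 t) (by simp)
  have h1 : ∫ s in Ioo 0 t, bp lam v φ s (t - s) = (∫ s in Ioo 0 t, ∫ z, φ z * v s z) +
      ∫ s in Ioo 0 t, ∫ r in Ioo 0 (t - s), bp lam v (adjS lam φ) s r := by
    rw [← integral_add hc hi]
    exact setIntegral_congr_fun measurableSet_Ioo fun s hs => bp_duhamel hl hv φ s (sub_pos.2 hs.2)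
  have h2 : ∫ s in Ioo 0 t, bp lam v φ s (t - s) =
      ∫ s in Ioo 0 t, ∫ σ in Ioo 0 s, bp lam v (adjS lam φ) σ (t - s) := by
    have h' := ae_restrict_of_ae_restrict_of_subset
      (show Ioo 0 t ⊆ Icc 0 τ from fun s hs => ⟨hs.1.le, hs.2.le.trans ht⟩) h
    refine integral_congr_ae ?_
    filter_upwards [h', ae_restrict_mem measurableSet_Ioo] with s hs hst
    exact bp_eq_integral_of_weak hs φ (sub_pos.2 hst.2)
  have h3 : ∫ s in Ioo 0 t, ∫ σ in Ioo 0 s, bp lam v (adjS lam φ) σ (t - s) =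
      ∫ r in Ioo 0 t, ∫ σ in Ioo 0 (t - r), bp lam v (adjS lam φ) σ r := by
    rw [← integral_Ioo_sub]
    simp_rw [sub_sub_cancel]
  rw [h2, h3, ← he] at h1
  simpa using h1

/-- The weak equation for compactly supported test functions implies that for Schwartz ones. -/
lemma weak_of_compactSupport (D : LP d) {lam B s : ℝ} {v : ℝ → Phase d → ℂ} (hv : BddMeas v B)
    (h : ∀ φ : Test d, HasCompactSupport φ →
      ∫ z, φ z * v s z = ∫ σ in Ioo 0 s, ∫ z, adjS lam φ z * v σ z) (φ : Test d) :
    ∫ z, φ z * v s z = ∫ σ in Ioo 0 s, ∫ z, adjS lam φ z * v σ z := by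
  set w : Phase d → ℂ := fun z => ∫ σ in Ioo 0 s, v σ z with hw
  have hwm : Measurable w := by
    have h1 := (hv.meas.comp (measurable_swap (α := Phase d) (β := ℝ))).stronglyMeasurable
    exact (h1.integral_prod_right' (ν := volume.restrict (Ioo 0 s))).measurable
  have hwt : Tame w := by
    refine Tame.of_bounded hwm (C := B * (volume (Ioo 0 s)).toReal) fun z => ?_
    exact norm_setIntegral_le_of_norm_le_const (by simp) fun σ _ => hv.bound σ z
  have e : ∀ ψ : Test d, ∫ σ in Ioo 0 s, ∫ z, ψ z * v σ z = hwt.toTemp ψ := fun ψ => by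
    rw [hwt.toTemp_apply, hw, integral_integral_swap]
    · simp_rw [integral_const_mul]
    · have h1 : Integrable (fun q : ℝ × Phase d => (1 : ℂ) * ψ q.2)
          ((volume.restrict (Ioo 0 s)).prod volume) :=
        (show Integrable (fun _ : ℝ => (1 : ℂ)) (volume.restrict (Ioo 0 s)) from
          integrableOn_const (by simp)).mul_prod ψ.integrable
      simp only [one_mul] at h1
      refine (h1.norm.mul_const B).mono' (((ψ.continuous.measurable.comp measurable_snd).mul
        hv.meas).aestronglyMeasurable) (.of_forall fun q => ?_)
      simp only [Function.uncurry]
      rw [norm_mul]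
      exact mul_le_mul_of_nonneg_left (hv.bound _ _) (norm_nonneg _)
  have hlim := D.tendsto_mulS_cut φ
  have h1 := ((hv.tame s).toTemp.continuous.tendsto φ).comp hlim
  have h2 := ((hwt.toTemp.continuous.comp (continuous_adjS lam)).tendsto φ).comp hlim
  rw [e]
  refine tendsto_nhds_unique h1 (h2.congr fun n => ?_)
  have h3 : HasCompactSupport (mulS (D.cut n) φ : Test d) :=
    hasCompactSupport_of_gauge (2 ^ (n + 1)) fun ξ hξ => by
      rw [mulS_apply, D.cut_eq_zero hξ, zero_mul]
  simp only [Function.comp_apply]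
  exact ((e _).symm.trans (h _ h3).symm).trans (Tame.toTemp_apply (hv.tame s) _).symm

/-! ### Products of localized functions -/

/-- The character of frequency `ξ`. -/
def chr (ξ w : Phase d) : ℂ := Complex.exp ((2 * π * inner ℝ ξ w : ℝ) * Complex.I)

lemma norm_chr (ξ w : Phase d) : ‖chr ξ w‖ = 1 := Complex.norm_exp_ofReal_mul_I _

lemma continuous_chr : Continuous fun q : Phase d × Phase d => chr q.1 q.2 := by
  have h3 : Continuous fun q : Phase d × Phase d => (inner ℝ q.1 q.2 : ℝ) :=
    continuous_fst.inner continuous_snd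
  exact Complex.continuous_exp.comp
    ((Complex.continuous_ofReal.comp (continuous_const.mul h3)).mul continuous_const)

lemma integral_ker_mul_chr (m : Test d) (ξ z : Phase d) :
    ∫ w, ker m (z - w) * chr ξ w = chr ξ z * m ξ := by
  unfold chr
  have h1 : m ξ = ∫ w, Complex.exp ((-2 * π * inner ℝ w ξ : ℝ) * Complex.I) • ker m w := by
    rw [← Real.fourier_eq', ← SchwartzMap.fourier_coe, ker,
      fourier_fourierInv_eq]
  rw [h1, ← integral_const_mul, ← integral_sub_left_eq_self _ volume z]
  congr 1; funext w
  rw [sub_sub_cancel, inner_sub_right, smul_eq_mul, ← mul_assoc, ← Complex.exp_add, mul_comm,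
    real_inner_comm w ξ]
  congr 2
  push_cast
  ring

/-- By Fourier inversion, the product of the characters of frequencies `ξ` and `ζ` is multiplied by
`m (ξ + ζ)`. -/
lemma integral_ker_mul_ker_eq_zero {m m₁ m₂ : Test d} (h : ∀ ξ ζ, m (ξ + ζ) * (m₁ ξ * m₂ ζ) = 0)
    (z y y' : Phase d) : ∫ w, ker m (z - w) * (ker m₁ (w - y) * ker m₂ (w - y')) = 0 := by
  have e1 : ∀ w, ker m (z - w) * (ker m₁ (w - y) * ker m₂ (w - y')) =
      ∫ q : Phase d × Phase d, ker m (z - w) * ((chr q.1 (w - y) * m₁ q.1) * (chr q.2 (w - y') * m₂ q.2))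
        ∂(volume.prod volume) := fun w => by
    rw [integral_const_mul, integral_prod_mul (fun ξ => chr ξ (w - y) * m₁ ξ)
      (fun ξ => chr ξ (w - y') * m₂ ξ), ker_eq_integral m₁, ker_eq_integral m₂]
    rfl
  simp_rw [e1]
  have hmk : Integrable fun w => ker m (z - w) := (ker m).integrable.comp_sub_left z
  rw [integral_integral_swap]
  · refine integral_eq_zero_of_ae (.of_forall fun q => ?_)
    have e2 : ∀ w, ker m (z - w) * ((chr q.1 (w - y) * m₁ q.1) * (chr q.2 (w - y') * m₂ q.2)) =
        (chr q.1 (-y) * chr q.2 (-y') * (m₁ q.1 * m₂ q.2)) * (ker m (z - w) * chr (q.1 + q.2) w) := by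
      intro w
      have a1 : chr q.1 (w - y) = chr q.1 w * chr q.1 (-y) := by
        simp only [chr]
        rw [← Complex.exp_add, sub_eq_add_neg, inner_add_right]
        congr 1; push_cast; ring
      have a2 : chr q.2 (w - y') = chr q.2 w * chr q.2 (-y') := by
        simp only [chr]
        rw [← Complex.exp_add, sub_eq_add_neg, inner_add_right]
        congr 1; push_cast; ring
      have a3 : chr (q.1 + q.2) w = chr q.1 w * chr q.2 w := by
        simp only [chr]
        rw [← Complex.exp_add, inner_add_left]
        congr 1; push_cast; ring
      rw [a1, a2, a3]; ring
    simp only [Pi.zero_apply]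
    simp_rw [e2]
    rw [integral_const_mul, integral_ker_mul_chr]
    linear_combination (chr q.1 (-y) * chr q.2 (-y') * chr (q.1 + q.2) z) * h q.1 q.2
  · have h1 : Integrable (fun q : Phase d × Phase d × Phase d =>
        ker m (z - q.1) * (m₁ q.2.1 * m₂ q.2.2)) (volume.prod (volume.prod volume)) :=
      hmk.mul_prod (m₁.integrable.mul_prod m₂.integrable)
    refine h1.norm.mono' ?_ (.of_forall fun q => ?_)
    · have c1 := continuous_chr.comp (((continuous_fst (X := Phase d) (Y := Phase d)).comp
        (continuous_snd (X := Phase d))).prodMk (continuous_fst.sub (continuous_const (y := y))))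
      have c2 := continuous_chr.comp (((continuous_snd (X := Phase d) (Y := Phase d)).comp
        (continuous_snd (X := Phase d))).prodMk (continuous_fst.sub (continuous_const (y := y'))))
      have c3 := (ker m).continuous.comp ((continuous_const (y := z)).sub
        (continuous_fst (X := Phase d) (Y := Phase d × Phase d)))
      have c4 := m₁.continuous.comp ((continuous_fst (X := Phase d) (Y := Phase d)).comp
        (continuous_snd (X := Phase d)))
      have c5 := m₂.continuous.comp ((continuous_snd (X := Phase d) (Y := Phase d)).comp
        (continuous_snd (X := Phase d)))
      have c := c3.mul ((c1.mul c4).mul (c2.mul c5))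
      exact c.aestronglyMeasurable
    · simp only [Function.uncurry, norm_mul, norm_chr, one_mul]
      exact le_rfl

/-- The block `m` of a product vanishes if `m` vanishes on the sum of the supports of the symbols of
the factors. -/
lemma T_mul_eq_zero {m m₁ m₂ : Test d} (h : ∀ ξ ζ, m (ξ + ζ) * (m₁ ξ * m₂ ζ) = 0)
    {g g' : Phase d → ℂ} (hg : Tame g) (hg' : Tame g') {B : ℝ} (hB : ∀ z, ‖T m₂ g' z‖ ≤ B)
    (z : Phase d) : T m (fun w => T m₁ g w * T m₂ g' w) z = 0 := by
  have hm2 := (continuous_T m₂ hg').measurable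
  -- the second factor is integrated first, against the Schwartz function of the first kernel
  have h1 : ∀ y, ∫ w, ker m (z - w) * T m₂ g' w * ker m₁ (w - y) = 0 := fun y => by
    set φ : Test d := mulS (reflAt (ker m) z) (SchwartzMap.compSubConstCLM ℂ y (ker m₁)) with hφ
    have e : ∀ w, φ w = ker m (z - w) * ker m₁ (w - y) := fun w => by
      rw [hφ, mulS_apply, reflAt_apply]; rfl
    have h2 := integral_mul_conv φ (ker m₂) hg'
    have h3 : ∀ w, ∫ x, φ x * ker m₂ (x - w) = 0 := fun w => by
      simp_rw [e, mul_assoc]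
      exact integral_ker_mul_ker_eq_zero h z y w
    simp_rw [h3, zero_mul, integral_zero, e] at h2
    rw [← h2]
    congr 1; funext w
    rw [T]; ring
  have hint : Integrable (fun q : Phase d × Phase d =>
      (ker m (z - q.1) * T m₂ g' q.1) * (ker m₁ (q.1 - q.2) * g q.2)) (volume.prod volume) := by
    have h2 := (integrable_mul_conv (reflAt (ker m) z) (ker m₁) hg).bdd_mul
      (hm2.comp measurable_fst).aestronglyMeasurable
      (.of_forall fun q : Phase d × Phase d => hB q.1)
    refine h2.congr (.of_forall fun q => ?_)
    simp only [Function.comp_apply, reflAt_apply]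
    ring
  rw [T]
  have e : ∀ w, ker m (z - w) * (T m₁ g w * T m₂ g' w) =
      ∫ y, (ker m (z - w) * T m₂ g' w) * (ker m₁ (w - y) * g y) := fun w => by
    rw [integral_const_mul]
    simp only [T]
    ring
  simp_rw [e]
  rw [integral_integral_swap hint]
  simp_rw [← mul_assoc, integral_mul_const, h1, zero_mul, integral_zero]

namespace LP
variable (D : LP d)

lemma phi_mul_eq_zero {j j₁ j₂ : ℕ} (h₁ : j₁ + 4 ≤ j) (h₂ : j₂ + 4 ≤ j) {ξ ζ : Phase d}
    (hξ : gauge ξ ≤ 2 ^ (j₁ + 1)) (hζ : gauge ζ ≤ 2 ^ (j₂ + 1)) : D.phi j (ξ + ζ) = 0 := by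
  obtain ⟨n, rfl⟩ : ∃ n, j = n + 1 := ⟨j - 1, by omega⟩
  refine D.phi_succ_eq_zero_of_le ((gauge_add_le ξ ζ).trans ?_)
  have e1 : (2 : ℝ) ^ (j₁ + 1) ≤ 2 ^ (n - 1) := pow_le_pow_right₀ (by norm_num) (by omega)
  have e2 : (2 : ℝ) ^ (j₂ + 1) ≤ 2 ^ (n - 1) := pow_le_pow_right₀ (by norm_num) (by omega)
  have e3 : (2 : ℝ) ^ n = 2 ^ (n - 1) + 2 ^ (n - 1) := by
    obtain ⟨k, rfl⟩ : ∃ k, n = k + 1 := ⟨n - 1, by omega⟩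
    rw [Nat.add_sub_cancel, pow_succ]; ring
  linarith

/-- The interaction of frequencies in the product of a function and a derivative. -/
lemma symbols_mul_eq_zero {k k₁ k₂ j j₁ j₂ : ℕ} (i : Fin d)
    (h : ¬(k ≤ max k₁ k₂ + 3 ∧ j ≤ max j₁ j₂ + 3)) (ξ ζ : Phase d) :
    D.mulX k (D.phi j) (ξ + ζ) * (D.mulX k₁ (D.phi j₁) ξ * D.mulX k₂ (gradS i (D.phi j₂)) ζ) = 0 := by
  simp only [mulX_apply, gradS_apply]
  by_cases hk : k ≤ max k₁ k₂ + 3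
  · have hj : ¬ j ≤ max j₁ j₂ + 3 := fun hj => h ⟨hk, hj⟩
    have h1 : j₁ + 4 ≤ j := by have := le_max_left j₁ j₂; omega
    have h2 : j₂ + 4 ≤ j := by have := le_max_right j₁ j₂; omega
    by_cases hξ : gauge ξ ≤ 2 ^ (j₁ + 1)
    · by_cases hζ : gauge ζ ≤ 2 ^ (j₂ + 1)
      · rw [D.phi_mul_eq_zero h1 h2 hξ hζ]; ring
      · rw [D.phi_eq_zero_of_gt (not_le.1 hζ)]; ring
    · rw [D.phi_eq_zero_of_gt (not_le.1 hξ)]; ring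
  · have h1 : k₁ + 4 ≤ k := by have := le_max_left k₁ k₂; omega
    have h2 : k₂ + 4 ≤ k := by have := le_max_right k₁ k₂; omega
    have h3 := D.xs_add_mul_mul h1 h2 ξ ζ
    linear_combination (D.phi j (ξ + ζ) * D.phi j₁ ξ *
      ((2 * π * Complex.I * velo ζ i) * D.phi j₂ ζ)) * h3

end LP

/-! ### Functions with finite Besov norm -/

/-- The mixed Besov norm of a function, in terms of its blocks. -/
def bn (D : LP d) (p : ℝ≥0∞ × ℝ≥0∞) (γ s : ℝ) (g : Phase d → ℂ) : ℝ≥0∞ :=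
  bnorm p γ s fun k j => T (D.mulX k (D.phi j)) g

section
variable (D : LP d) {γ s : ℝ} {g : Phase d → ℂ}

lemma mx_T_mulX_phi_le (k j : ℕ) : mx p (fun z => ‖T (D.mulX k (D.phi j)) g z‖ₑ) ≤
    pw (-(k * γ / 3)) * (pw (-(j * s)) * bn D p γ s g) :=
  mx_le_bnorm (γ := γ) (s := s) (fun k j => T (D.mulX k (D.phi j)) g) k j

lemma mx_T_phi_le (hp : Adm p) (hg : Tame g) (j : ℕ) : mx p (fun z => ‖T (D.phi j) g z‖ₑ) ≤
    geo (γ / 3) * (pw (-(j * s)) * bn D p γ s g) :=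
  mx_T_le_of_mulX D hp (phi_supp D j) hg fun k => mx_T_mulX_phi_le D k j

lemma tsum_mx_T_phi_lt_top (hp : Adm p) (hg : Tame g) (hγ : 0 < γ) (hs : 0 < s)
    (hb : bn D p γ s g < ⊤) : ∑' j, mx p (fun z => ‖T (D.phi j) g z‖ₑ) < ⊤ := by
  refine (ENNReal.tsum_le_tsum fun j => mx_T_phi_le D (γ := γ) (s := s) hp hg j).trans_lt ?_
  rw [ENNReal.tsum_mul_left, ENNReal.tsum_mul_right]
  exact mul_lt_top (tsum_pw_neg_lt_top (by positivity))
    (mul_lt_top (tsum_pw_neg_lt_top hs) hb)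

/-- A function of positive regularity is the sum of its blocks. -/
lemma ae_eq_tsum_T_phi (hp : Adm p) (hg : Tame g) (hγ : 0 < γ) (hs : 0 < s)
    (hb : bn D p γ s g < ⊤) : g =ᵐ[volume] fun z => ∑' j, T (D.phi j) g z := by
  have h1 : ∀ j, dens (ContinuousLinearMap.id ℂ ℂ) hg.toTemp (D.phi j) = T (D.phi j) g :=
    fun j => hg.dens _
  have h2 := recon_fun D (L := ContinuousLinearMap.id ℂ ℂ) hp hg.represents
    (fun j => by rw [h1]; exact hg.T _) (fun j φ => by
      rw [h1, ContinuousLinearMap.id_apply, Tame.toTemp_apply, integral_T_mul _ _ hg, D.negS_phi])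
    (by simp_rw [h1]; exact tsum_mx_T_phi_lt_top D hp hg hγ hs hb)
  simp_rw [h1] at h2
  exact h2

lemma ae_eq_tsum_blocks (hp : Adm p) (hg : Tame g) (hγ : 0 < γ) (hs : 0 < s)
    (hb : bn D p γ s g < ⊤) : ∀ᵐ z, ∑' q : ℕ × ℕ, ‖T (D.mulX q.2 (D.phi q.1)) g z‖ₑ < ⊤ ∧
      g z = ∑' q : ℕ × ℕ, T (D.mulX q.2 (D.phi q.1)) g z := by
  have h1 : ∑' q : ℕ × ℕ, mx p (fun z => ‖T (D.mulX q.2 (D.phi q.1)) g z‖ₑ) < ⊤ := by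
    refine (ENNReal.tsum_le_tsum fun q : ℕ × ℕ =>
      mx_T_mulX_phi_le D (γ := γ) (s := s) q.2 q.1).trans_lt ?_
    rw [ENNReal.tsum_prod']
    simp_rw [ENNReal.tsum_mul_right, ENNReal.tsum_mul_left, ENNReal.tsum_mul_right, mul_div_assoc]
    exact mul_lt_top (tsum_pw_neg_lt_top (by positivity))
      (mul_lt_top (tsum_pw_neg_lt_top hs) hb)
  filter_upwards [ae_summable_of_mx hp (fun q : ℕ × ℕ => measurable_T' _ hg.meas) h1,
    ae_eq_tsum_T_phi D hp hg hγ hs hb] with z hz1 hz2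
  refine ⟨hz1, hz2.trans ?_⟩
  rw [(summable_of_tsum_enorm hz1.ne).tsum_prod]
  congr 1; funext j
  conv_lhs => rw [← sum_mulX_phi D j, T_sum_sym _ _ hg]
  refine (tsum_eq_sum fun k hk => ?_).symm
  rw [LP.mulX_eq_zero D (by simpa using hk) (phi_supp D j), T_zero_sym]

/-- The gradient in the velocity, component `i`, of a function of regularity greater than
`1 + a · d / p`. -/
def gradF (i : Fin d) (g : Phase d → ℂ) (z : Phase d) : ℂ := ∑' j, T (gradS i (D.phi j)) g z

lemma mulX_gradS (k : ℕ) (i : Fin d) (m : Test d) : D.mulX k (gradS i m) = gradS i (D.mulX k m) := by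
  ext ξ
  simp only [LP.mulX_apply, gradS_apply]
  ring

/-- Bernstein's inequality for the blocks of the gradient. -/
lemma exists_enorm_T_gradS_le (hp : Adm p) (i : Fin d) : ∃ C : ℝ≥0, ∀ {γ s : ℝ} {g : Phase d → ℂ},
    Tame g → ∀ k j z, ‖T (D.mulX k (gradS i (D.phi j))) g z‖ₑ ≤
      C * (pw (-(k * γ / 3)) * (pw (-(j * (s - 1 - al d p))) * bn D p γ s g)) := by
  obtain ⟨C, hC⟩ := D.mx_conj_ker_gradS_psi_le hp i
  refine ⟨C, fun {γ s g} hg k j z => ?_⟩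
  have e : D.mulX k (gradS i (D.phi j)) = mulS (gradS i (D.psi j)) (D.mulX k (D.phi j)) := by
    rw [mulX_gradS, ← gradS_mulS, mulS_comm, mulS_mulX_phi_psi]
  rw [e, ← T_T _ _ hg]
  refine (enorm_T_le_mx hp _ (measurable_T' _ hg.meas) z).trans
    ((mul_le_mul' (hC j) (mx_T_mulX_phi_le D (γ := γ) (s := s) k j)).trans (le_of_eq ?_))
  have e2 : -((j : ℝ) * (s - 1 - al d p)) = j * (1 + al d p) + -(j * s) := by ring
  rw [e2, pw_add]
  ring

lemma tsum_T_mulX_gradS (i : Fin d) (hg : Tame g) (j : ℕ) (z : Phase d) :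
    ∑' k, T (D.mulX k (gradS i (D.phi j))) g z = T (gradS i (D.phi j)) g z := by
  have hs : ∀ ξ, 2 ^ (j + 2) < gauge ξ → gradS i (D.phi j) ξ = 0 := fun ξ hξ => by
    rw [gradS_apply, phi_supp D j ξ hξ, mul_zero]
  conv_rhs => rw [← LP.sum_mulX D hs, T_sum_sym _ _ hg]
  refine tsum_eq_sum fun k hk => ?_
  rw [LP.mulX_eq_zero D (by simpa using hk) hs, T_zero_sym]

lemma enorm_T_gradS_le_tsum (i : Fin d) (hg : Tame g) (j : ℕ) (z : Phase d) :
    ‖T (gradS i (D.phi j)) g z‖ₑ ≤ ∑' k, ‖T (D.mulX k (gradS i (D.phi j))) g z‖ₑ := by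
  rw [← tsum_T_mulX_gradS D i hg]
  exact enorm_tsum_le

lemma exists_tsum_gradS_le (hp : Adm p) (i : Fin d) (hγ : 0 < γ) (hs : 0 < s - 1 - al d p) :
    ∃ C : ℝ≥0, ∀ {g : Phase d → ℂ}, Tame g → ∀ z,
      ∑' q : ℕ × ℕ, ‖T (D.mulX q.2 (gradS i (D.phi q.1))) g z‖ₑ ≤ C * bn D p γ s g := by
  obtain ⟨C, hC⟩ := exists_enorm_T_gradS_le D hp i
  have hg1 := tsum_pw_neg_lt_top (a := γ / 3) (by positivity)
  have hg2 := tsum_pw_neg_lt_top hs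
  refine ⟨C * ((geo (γ / 3)).toNNReal * (geo (s - 1 - al d p)).toNNReal), fun {g} hg z => ?_⟩
  refine (ENNReal.tsum_le_tsum fun q : ℕ × ℕ => hC (γ := γ) (s := s) hg q.2 q.1 z).trans
    (le_of_eq ?_)
  rw [ENNReal.tsum_prod']
  simp_rw [ENNReal.tsum_mul_left, ENNReal.tsum_mul_right, ENNReal.tsum_mul_left,
    ENNReal.tsum_mul_right, mul_div_assoc]
  have e1 : ((geo (γ / 3)).toNNReal : ℝ≥0∞) = geo (γ / 3) := coe_toNNReal hg1.ne
  have e2 : ((geo (s - 1 - al d p)).toNNReal : ℝ≥0∞) = geo (s - 1 - al d p) :=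
    coe_toNNReal hg2.ne
  push_cast
  rw [e1, e2, geo, geo]
  ring

lemma measurable_gradF (i : Fin d) {α : Type*} [MeasurableSpace α] {g : α → Phase d → ℂ}
    (hg : Measurable (Function.uncurry g)) :
    Measurable fun q : α × Phase d => gradF D i (g q.1) q.2 :=
  Measurable.tsum fun _ => measurable_T _ hg

lemma tsum_T_gradS_le_blocks (i : Fin d) (hg : Tame g) (z : Phase d) :
    ∑' j, ‖T (gradS i (D.phi j)) g z‖ₑ ≤
      ∑' q : ℕ × ℕ, ‖T (D.mulX q.2 (gradS i (D.phi q.1))) g z‖ₑ := by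
  rw [ENNReal.tsum_prod']
  exact ENNReal.tsum_le_tsum fun j => enorm_T_gradS_le_tsum D i hg j z

lemma enorm_gradF_le_blocks (i : Fin d) (hg : Tame g) (z : Phase d) : ‖gradF D i g z‖ₑ ≤
    ∑' q : ℕ × ℕ, ‖T (D.mulX q.2 (gradS i (D.phi q.1))) g z‖ₑ :=
  enorm_tsum_le.trans (tsum_T_gradS_le_blocks D i hg z)

lemma gradF_eq_tsum_blocks (hp : Adm p) (i : Fin d) (hγ : 0 < γ) (hs : 0 < s - 1 - al d p)
    (hg : Tame g) (hb : bn D p γ s g < ⊤) (z : Phase d) :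
    gradF D i g z = ∑' q : ℕ × ℕ, T (D.mulX q.2 (gradS i (D.phi q.1))) g z := by
  obtain ⟨C, hC⟩ := exists_tsum_gradS_le D hp i hγ hs
  have h1 := ne_top_of_le_ne_top (mul_ne_top coe_ne_top hb.ne) (hC hg z)
  rw [(summable_of_tsum_enorm h1).tsum_prod]
  simp_rw [tsum_T_mulX_gradS D i hg]
  rfl

lemma exists_tsum_T_phi_le (hp : Adm p) (hγ : 0 < γ) (hs : 0 < s - al d p) :
    ∃ C : ℝ≥0, ∀ {g : Phase d → ℂ}, Tame g → ∀ z, ∑' j, ‖T (D.phi j) g z‖ₑ ≤ C * bn D p γ s g := by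
  obtain ⟨C, hC⟩ := D.mx_conj_ker_psi_le hp
  have hg1 := tsum_pw_neg_lt_top (a := γ / 3) (by positivity)
  have hg2 := tsum_pw_neg_lt_top hs
  refine ⟨C * ((geo (γ / 3)).toNNReal * (geo (s - al d p)).toNNReal), fun {g} hg z => ?_⟩
  have h1 : ∀ j : ℕ, ‖T (D.phi j) g z‖ₑ ≤
      C * geo (γ / 3) * (pw (-(j * (s - al d p))) * bn D p γ s g) := fun j => by
    have h2 := enorm_T_le_mx hp (D.psi j) (measurable_T' (D.phi j) hg.meas) z
    rw [T_T _ _ hg, D.mulS_psi_phi] at h2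
    refine h2.trans ((mul_le_mul' (hC j) (mx_T_phi_le D (γ := γ) (s := s) hp hg j)).trans
      (le_of_eq ?_))
    have e2 : -((j : ℝ) * (s - al d p)) = j * al d p + -(j * s) := by ring
    rw [e2, pw_add]
    ring
  refine (ENNReal.tsum_le_tsum h1).trans (le_of_eq ?_)
  simp_rw [ENNReal.tsum_mul_left, ENNReal.tsum_mul_right]
  have e1 : ((geo (γ / 3)).toNNReal : ℝ≥0∞) = geo (γ / 3) := coe_toNNReal hg1.ne
  have e2 : ((geo (s - al d p)).toNNReal : ℝ≥0∞) = geo (s - al d p) :=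
    coe_toNNReal hg2.ne
  push_cast
  rw [e1, e2, geo, geo]
  ring

/-- Functions of regularity greater than `a · d / p` are essentially bounded. -/
lemma exists_ae_enorm_le (hp : Adm p) (hγ : 0 < γ) (hs : 0 < s - al d p) :
    ∃ C : ℝ≥0, ∀ {g : Phase d → ℂ}, Tame g → bn D p γ s g < ⊤ →
      ∀ᵐ z, ‖g z‖ₑ ≤ C * bn D p γ s g := by
  obtain ⟨C, hC⟩ := exists_tsum_T_phi_le D hp hγ hs
  refine ⟨C, fun {g} hg hb => ?_⟩
  have := al_nonneg (d := d) (p := p)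
  filter_upwards [ae_eq_tsum_T_phi D hp hg hγ (by linarith) hb] with z hz
  rw [hz]
  exact enorm_tsum_le.trans (hC hg z)

/-- `gradF` is the weak gradient. -/
lemma integral_lineDeriv_mul_eq_neg (hp : Adm p) (i : Fin d) (hγ : 0 < γ)
    (hs : 0 < s - 1 - al d p) (hg : Tame g) (hb : bn D p γ s g < ⊤) (φ : Test d) :
    ∫ z, lineDerivOp (eV i) φ z * g z = -∫ z, φ z * gradF D i g z := by
  have ha := al_nonneg (d := d) (p := p)
  obtain ⟨C, hC⟩ := exists_tsum_T_phi_le D hp (s := s) hγ (by linarith)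
  obtain ⟨C', hC'⟩ := exists_tsum_gradS_le D hp i hγ hs
  have h1 : ∫ z, lineDerivOp (eV i) φ z * g z =
      ∫ z, lineDerivOp (eV i) φ z * ∑' j, T (D.phi j) g z := by
    refine integral_congr_ae ?_
    filter_upwards [ae_eq_tsum_T_phi D hp hg hγ (by linarith) hb] with z hz
    rw [← hz]
  rw [h1, (pairing_tsum (lineDerivOp (eV i) φ).integrable
    (fun j => measurable_T' (D.phi j) hg.meas) (mul_ne_top coe_ne_top hb.ne)
    (.of_forall fun z => hC hg z)).1]
  unfold gradF
  rw [(pairing_tsum φ.integrable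
    (fun j => measurable_T' (gradS i (D.phi j)) hg.meas) (mul_ne_top coe_ne_top hb.ne)
    (.of_forall fun z =>
      (tsum_T_gradS_le_blocks D i hg z).trans (hC' hg z))).1, ← tsum_neg]
  congr 1; funext j
  exact integral_T_lineDeriv _ φ i hg

end

/-! ### The product estimate -/

lemma tsum_tail_le {a : ℝ} (ha : 0 < a) (n : ℕ) :
    ∑' m : ℕ, (if n ≤ m + 3 then pw (-(m * a)) else 0) ≤ pw (3 * a) * geo a * pw (-(n * a)) := by
  have h1 := Summable.sum_add_tsum_nat_add' (k := n - 3) (f := fun m : ℕ =>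
      if n ≤ m + 3 then pw (-(m * a)) else 0) ENNReal.summable
  have h2 : ∑ m ∈ Finset.range (n - 3), (if n ≤ m + 3 then pw (-(m * a)) else 0) = 0 :=
    Finset.sum_eq_zero fun m hm => if_neg (by have := Finset.mem_range.1 hm; omega)
  rw [h2, zero_add] at h1
  rw [← h1, geo, ← ENNReal.tsum_mul_left, ← ENNReal.tsum_mul_right]
  refine ENNReal.tsum_le_tsum fun m => ?_
  rw [if_pos (by omega), ← pw_add, ← pw_add]
  refine pw_mono ?_
  have h3 : (n : ℝ) ≤ ((m + (n - 3) : ℕ) : ℝ) - m + 3 := by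
    have : n ≤ (n - 3) + 3 := by omega
    have h4 : (n : ℝ) ≤ ((n - 3 : ℕ) : ℝ) + 3 := by exact_mod_cast this
    push_cast
    linarith
  nlinarith

/-- The weights of the pairs of frequencies contributing to the block `n` of a product. -/
def maxW (a b : ℝ) (n n₁ n₂ : ℕ) : ℝ≥0∞ :=
  if n ≤ max n₁ n₂ + 3 then pw (-(n₁ * a)) * pw (-(n₂ * b)) else 0

/-- The exponents `a`, `b` are those of the two factors, and `s ≤ min a b` is that of the product:
the larger of the two frequencies pays for the output frequency `n`, the other one is summed by
positivity of its exponent. -/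
lemma exists_tsum_maxW_le {a b s : ℝ} (ha : 0 < a) (hb : 0 < b) (hsa : s ≤ a) (hsb : s ≤ b) :
    ∃ C : ℝ≥0, ∀ n : ℕ, ∑' n₁, ∑' n₂, maxW a b n n₁ n₂ ≤ C * pw (-(n * s)) := by
  have hga := tsum_pw_neg_lt_top ha
  have hgb := tsum_pw_neg_lt_top hb
  set Z : ℝ≥0∞ := pw (3 * a) * geo a * geo b + geo a * (pw (3 * b) * geo b) with hZ
  have hZt : Z ≠ ⊤ := ENNReal.add_ne_top.2
    ⟨mul_ne_top (mul_ne_top (pw_ne_top _) hga.ne) hgb.ne,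
      mul_ne_top hga.ne (mul_ne_top (pw_ne_top _) hgb.ne)⟩
  refine ⟨Z.toNNReal, fun n => ?_⟩
  rw [coe_toNNReal hZt]
  have h1 : ∀ n₁ n₂ : ℕ, maxW a b n n₁ n₂ ≤
      (if n ≤ n₁ + 3 then pw (-(n₁ * a)) else 0) * pw (-(n₂ * b)) +
      pw (-(n₁ * a)) * (if n ≤ n₂ + 3 then pw (-(n₂ * b)) else 0) := by
    intro n₁ n₂
    unfold maxW
    split_ifs with h h1 h2 h2
    · exact le_self_add
    · exact le_self_add
    · exact le_add_self
    · exfalso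
      rcases le_total n₁ n₂ with h' | h'
      · rw [max_eq_right h'] at h; omega
      · rw [max_eq_left h'] at h; omega
    all_goals exact zero_le
  refine (ENNReal.tsum_le_tsum fun n₁ => ENNReal.tsum_le_tsum fun n₂ => h1 n₁ n₂).trans ?_
  have eg : ∀ a : ℝ, ∑' k : ℕ, pw (-(k * a)) = geo a := fun _ => rfl
  simp_rw [ENNReal.tsum_add, ENNReal.tsum_mul_left, ENNReal.tsum_mul_right, eg]
  rw [hZ, add_mul]
  have e1 : pw (-(n * a)) ≤ pw (-(n * s)) := pw_mono (by gcongr)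
  have e2 : pw (-(n * b)) ≤ pw (-(n * s)) := pw_mono (by gcongr)
  refine add_le_add ?_ ?_
  · refine (mul_le_mul_left (tsum_tail_le ha n) _).trans ?_
    rw [mul_right_comm]
    gcongr
  · rw [mul_assoc]
    refine mul_le_mul_right ((tsum_tail_le hb n).trans ?_) _
    gcongr

/-- The product of a function of regularity `β > 0` and of a velocity derivative of a function of
regularity `s > 1 + a · d / p`. Only the pairs of blocks in which one frequency is at least
comparable to the output frequency contribute. -/
lemma exists_bn_mul_gradF_le (D : LP d) (hp : Adm p) {γ β δ s : ℝ} (hγ : 0 < γ) (hβ : 0 < β)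
    (hδβ : δ ≤ β) (hs : 0 < s - 1 - al d p) (hδs : δ ≤ s - 1 - al d p) (i : Fin d) :
    ∃ C : ℝ≥0, ∀ {g u : Phase d → ℂ}, Tame g → Tame u → bn D p γ β g < ⊤ → bn D p γ s u < ⊤ →
      Tame (fun z => g z * gradF D i u z) ∧
      bn D p γ δ (fun z => g z * gradF D i u z) ≤ C * (bn D p γ β g * bn D p γ s u) := by
  obtain ⟨Cg, hCg⟩ := exists_enorm_T_gradS_le D hp i
  obtain ⟨Cs, hCs⟩ := exists_tsum_gradS_le D hp i hγ hs
  obtain ⟨Cw, hCw⟩ := D.wiener_mulX_phi_le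
  obtain ⟨C₁, hC₁⟩ := exists_tsum_maxW_le (a := γ / 3) (b := γ / 3) (s := γ / 3) (by positivity)
    (by positivity) le_rfl le_rfl
  obtain ⟨C₂, hC₂⟩ := exists_tsum_maxW_le hβ hs hδβ hδs
  refine ⟨Cw * Cg * (C₁ * C₂), fun {g u} hg hu hgb hub => ?_⟩
  set A : ℕ × ℕ → Phase d → ℂ := fun q => T (D.mulX q.2 (D.phi q.1)) g with hA
  set W : ℕ × ℕ → Phase d → ℂ := fun q => T (D.mulX q.2 (gradS i (D.phi q.1))) u with hW
  have hAm : ∀ q, Measurable (A q) := fun q => measurable_T' _ hg.meas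
  have hWm : ∀ q, Measurable (W q) := fun q => measurable_T' _ hu.meas
  have hgm : Measurable (gradF D i u) := Measurable.tsum fun _ => measurable_T' _ hu.meas
  have hWs : ∀ z, ∑' q, ‖W q z‖ₑ ≤ Cs * bn D p γ s u := fun z => hCs hu z
  have hft : Cs * bn D p γ s u ≠ ⊤ := mul_ne_top coe_ne_top hub.ne
  have hbd : ∀ q z, ‖W q z‖ₑ ≤ Cs * bn D p γ s u := fun q z =>
    (ENNReal.le_tsum q).trans (hWs z)
  have htm : Tame (fun z => g z * gradF D i u z) := by
    refine hg.mul_bounded hgm (C := (Cs * bn D p γ s u).toReal) fun z => ?_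
    have h1 := (enorm_gradF_le_blocks D i hu z).trans (hWs z)
    rw [← ofReal_norm] at h1
    exact (ENNReal.ofReal_le_iff_le_toReal hft).1 h1
  refine ⟨htm, iSup₂_le fun k j => ?_⟩
  beta_reduce
  set m := D.mulX k (D.phi j) with hm
  have hae : (fun z => g z * gradF D i u z) =ᵐ[volume]
      fun z => ∑' q : (ℕ × ℕ) × (ℕ × ℕ), A q.1 z * W q.2 z := by
    filter_upwards [ae_eq_tsum_blocks D hp hg hγ hβ hgb] with z hz
    have h1 : Summable fun q => ‖A q z‖ := (summable_of_tsum_enorm hz.1.ne).norm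
    have h2 : Summable fun q => ‖W q z‖ :=
      (summable_of_tsum_enorm (ne_top_of_le_ne_top hft (hWs z))).norm
    rw [hz.2, gradF_eq_tsum_blocks D hp i hγ hs hu hub]
    exact tsum_mul_tsum_of_summable_norm h1 h2
  set K : ℝ≥0∞ := Cw * Cg * (bn D p γ β g * bn D p γ s u) with hK
  have hAW : ∀ q : (ℕ × ℕ) × (ℕ × ℕ), mx p (fun z => ‖A q.1 z * W q.2 z‖ₑ) ≤
      (pw (-(q.1.2 * γ / 3)) * (pw (-(q.1.1 * β)) * bn D p γ β g)) * (Cg * (pw (-(q.2.2 * γ / 3)) *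
        (pw (-(q.2.1 * (s - 1 - al d p))) * bn D p γ s u))) := by
    intro q
    have h1 : ∀ z, ‖A q.1 z * W q.2 z‖ₑ ≤ (Cg * (pw (-(q.2.2 * γ / 3)) *
        (pw (-(q.2.1 * (s - 1 - al d p))) * bn D p γ s u))) * ‖A q.1 z‖ₑ := fun z => by
      rw [enorm_mul, mul_comm]
      exact mul_le_mul_left (hCg hu _ _ z) _
    refine (mx_mono hp h1).trans ?_
    rw [mx_const_mul hp _ (mul_ne_top coe_ne_top (mul_ne_top (pw_ne_top _)
      (mul_ne_top (pw_ne_top _) hub.ne))), mul_comm]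
    exact mul_le_mul_left (mx_T_mulX_phi_le D _ _) _
  have hterm : ∀ q : (ℕ × ℕ) × (ℕ × ℕ), mx p (fun z => ‖T m (fun w => A q.1 w * W q.2 w) z‖ₑ) ≤
      K * (maxW (γ / 3) (γ / 3) k q.1.2 q.2.2 * maxW β (s - 1 - al d p) j q.1.1 q.2.1) := by
    intro q
    by_cases h : k ≤ max q.1.2 q.2.2 + 3 ∧ j ≤ max q.1.1 q.2.1 + 3
    · refine (mx_T_le hp m ((hAm q.1).mul (hWm q.2))).trans
        ((mul_le_mul' (hCw k j) (hAW q)).trans (le_of_eq ?_))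
      rw [maxW, maxW, if_pos h.1, if_pos h.2, hK, mul_div_assoc, mul_div_assoc]
      ring
    · have h1 : ∀ z, T m (fun w => A q.1 w * W q.2 w) z = 0 := fun z =>
        T_mul_eq_zero (fun ξ ζ => D.symbols_mul_eq_zero i h ξ ζ) hg hu
          (B := (Cs * bn D p γ s u).toReal) (fun z => by
            have h2 := hbd q.2 z
            rw [← ofReal_norm] at h2
            exact (ENNReal.ofReal_le_iff_le_toReal hft).1 h2) z
      simp_rw [h1, enorm_zero, mx_zero hp]
      exact zero_le
  have hsum : ∑' q : (ℕ × ℕ) × (ℕ × ℕ),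
      maxW (γ / 3) (γ / 3) k q.1.2 q.2.2 * maxW β (s - 1 - al d p) j q.1.1 q.2.1 ≤
      (C₁ * pw (-(k * (γ / 3)))) * (C₂ * pw (-(j * δ))) := by
    refine le_trans (le_of_eq ?_) (mul_le_mul' (hC₁ k) (hC₂ j))
    rw [ENNReal.tsum_prod']
    simp_rw [ENNReal.tsum_prod', ENNReal.tsum_mul_right, ENNReal.tsum_mul_left,
      ENNReal.tsum_mul_right, ENNReal.tsum_mul_left]
  have hPm : ∀ q : (ℕ × ℕ) × (ℕ × ℕ), Measurable fun z => A q.1 z * W q.2 z := fun q =>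
    (hAm q.1).mul (hWm q.2)
  clear_value A W m
  set P : (ℕ × ℕ) × (ℕ × ℕ) → Phase d → ℂ := fun q z => A q.1 z * W q.2 z with hP
  have hTs : ∀ z, T m (fun z => g z * gradF D i u z) z =
      ∑' q : (ℕ × ℕ) × (ℕ × ℕ), T m (fun w => A q.1 w * W q.2 w) z := fun z => by
    rw [T_congr_ae m hae]
    refine T_tsum m (fun q : (ℕ × ℕ) × (ℕ × ℕ) => (hAm q.1).mul (hWm q.2)) ?_
    have h1 : ∀ q : (ℕ × ℕ) × (ℕ × ℕ), ∫⁻ w, ‖ker m (z - w)‖ₑ * ‖A q.1 w * W q.2 w‖ₑ ≤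
        mx p (fun z => ‖A q.1 z * W q.2 z‖ₑ) * mx (conjPair p) (fun w => ‖reflAt (ker m) z w‖ₑ) := by
      intro q
      have h2 : Measurable fun w => ‖A q.1 w * W q.2 w‖ₑ := ((hAm q.1).mul (hWm q.2)).enorm
      have h3 : Measurable fun w => ‖reflAt (ker m) z w‖ₑ :=
        (reflAt (ker m) z).continuous.measurable.enorm
      refine le_trans (le_of_eq ?_) (lintegral_mul_le_mx hp h2 h3)
      refine lintegral_congr fun w => ?_
      rw [mul_comm, reflAt_apply]
    refine ne_top_of_le_ne_top ?_ (ENNReal.tsum_le_tsum fun q => (h1 q).trans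
      (mul_le_mul_left (hAW q) _))
    rw [ENNReal.tsum_mul_right]
    refine mul_ne_top ?_ (mx_schwartz_lt_top hp.conj _).ne
    rw [ENNReal.tsum_prod']
    simp_rw [ENNReal.tsum_mul_left, ENNReal.tsum_mul_right]
    refine mul_ne_top ?_ (mul_ne_top coe_ne_top ?_)
    · rw [ENNReal.tsum_prod']
      simp_rw [ENNReal.tsum_mul_right, ENNReal.tsum_mul_left, ENNReal.tsum_mul_right, mul_div_assoc]
      exact mul_ne_top (tsum_pw_neg_lt_top (by positivity)).ne
        (mul_ne_top (tsum_pw_neg_lt_top hβ).ne hgb.ne)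
    · rw [ENNReal.tsum_prod']
      simp_rw [ENNReal.tsum_mul_right, ENNReal.tsum_mul_left, ENNReal.tsum_mul_right, mul_div_assoc]
      exact mul_ne_top (tsum_pw_neg_lt_top (by positivity)).ne
        (mul_ne_top (tsum_pw_neg_lt_top hs).ne hub.ne)
  have hfin : mx p (fun z => ‖T m (fun z => g z * gradF D i u z) z‖ₑ) ≤
      K * ((C₁ * pw (-(k * (γ / 3)))) * (C₂ * pw (-(j * δ)))) := by
    have hmq : ∀ q : (ℕ × ℕ) × (ℕ × ℕ), Measurable fun z => ‖T m (P q) z‖ₑ := fun q =>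
      (measurable_T' m (hPm q)).enorm
    have b1 := mx_tsum_le hp hmq
    have b2 : mx p (fun z => ‖T m (fun z => g z * gradF D i u z) z‖ₑ) ≤
        mx p (fun z => ∑' q, ‖T m (P q) z‖ₑ) :=
      mx_mono hp fun z => (by rw [hTs z]; exact enorm_tsum_le)
    refine b2.trans (b1.trans ((ENNReal.tsum_le_tsum hterm).trans ?_))
    rw [ENNReal.tsum_mul_left]
    exact mul_le_mul_right hsum _
  refine (mul_le_mul_right hfin _).trans (le_of_eq ?_)
  have e1 := pw_mul_neg (k * (γ / 3))
  have e2 := pw_mul_neg (j * δ)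
  rw [hK, mul_div_assoc]
  push_cast
  calc _ = (pw (k * (γ / 3)) * pw (-(k * (γ / 3)))) * (pw (j * δ) * pw (-(j * δ))) *
      (Cw * Cg * (C₁ * C₂) * (bn D p γ β g * bn D p γ s u)) := by ring
    _ = _ := by rw [e1, e2]; ring

/-! ### Sums, real parts and trivial position blocks -/

lemma T_zero_fun (m : Test d) : T m (fun _ => 0) = fun _ => 0 := by
  funext z; simp [T]

lemma tame_zero : Tame (fun _ : Phase d => (0 : ℂ)) :=
  Tame.of_bounded measurable_const (C := 0) fun _ => by simp

lemma Tame.sum {ι : Type*} (s : Finset ι) {g : ι → Phase d → ℂ} (hg : ∀ i, Tame (g i)) :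
    Tame fun z => ∑ i ∈ s, g i z := by
  classical
  induction s using Finset.induction_on with
  | empty => simpa using tame_zero
  | insert a s ha ih =>
    simp_rw [Finset.sum_insert ha]
    exact (hg a).add ih

section
variable (D : LP d) {γ s : ℝ}

lemma bn_zero (hp : Adm p) : bn D p γ s (fun _ => 0) = 0 := by
  refine le_antisymm (iSup₂_le fun k j => ?_) zero_le
  simp [T_zero_fun, mx_zero hp]

lemma bn_congr_ae {g h : Phase d → ℂ} (e : g =ᵐ[volume] h) : bn D p γ s g = bn D p γ s h := by
  unfold bn
  congr 1; funext k j
  exact T_congr_ae _ e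

lemma bn_mono_exponent {s' : ℝ} (h : s ≤ s') (g : Phase d → ℂ) :
    bn D p γ s g ≤ bn D p γ s' g := by
  refine iSup₂_mono fun k j => ?_
  refine mul_le_mul_left (mul_le_mul_right (pw_mono ?_) _) _
  exact mul_le_mul_of_nonneg_left h (Nat.cast_nonneg j)

lemma le_bn (g : Phase d → ℂ) (k j : ℕ) :
    pw (k * γ / 3) * pw (j * s) * mx p (fun z => ‖T (D.mulX k (D.phi j)) g z‖ₑ) ≤ bn D p γ s g :=
  le_iSup₂ (f := fun k j : ℕ => pw (k * γ / 3) * pw (j * s) *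
    mx p (fun z => ‖T (D.mulX k (D.phi j)) g z‖ₑ)) k j

lemma bn_add_le (hp : Adm p) {g h : Phase d → ℂ} (hg : Tame g) (hh : Tame h) :
    bn D p γ s (fun z => g z + h z) ≤ bn D p γ s g + bn D p γ s h := by
  refine iSup₂_le fun k j => ?_
  have h1 : mx p (fun z => ‖T (D.mulX k (D.phi j)) (fun z => g z + h z) z‖ₑ) ≤
      mx p (fun z => ‖T (D.mulX k (D.phi j)) g z‖ₑ) +
        mx p (fun z => ‖T (D.mulX k (D.phi j)) h z‖ₑ) := by
    refine (mx_mono hp fun z => ?_).trans (mx_add_le hp (measurable_T' _ hg.meas).enorm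
      (measurable_T' _ hh.meas).enorm)
    rw [T_add_fun _ hg hh]
    exact enorm_add_le _ _
  refine (mul_le_mul_right h1 _).trans ?_
  rw [mul_add]
  exact add_le_add (le_bn D g k j) (le_bn D h k j)

lemma bn_sum_le (hp : Adm p) {ι : Type*} (S : Finset ι) {g : ι → Phase d → ℂ}
    (hg : ∀ i, Tame (g i)) : bn D p γ s (fun z => ∑ i ∈ S, g i z) ≤ ∑ i ∈ S, bn D p γ s (g i) := by
  classical
  induction S using Finset.induction_on with
  | empty => simp [bn_zero D hp]
  | insert a S ha ih =>
    simp_rw [Finset.sum_insert ha]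
    exact (bn_add_le D hp (hg a) (Tame.sum S hg)).trans (add_le_add le_rfl ih)

lemma bn_tsum_le (hp : Adm p) {ι : Type*} [Countable ι] {g : ι → Phase d → ℂ}
    (hg : ∀ i, Measurable (g i)) {B : ι → ℝ≥0∞} (hB : ∀ i z, ‖g i z‖ₑ ≤ B i)
    (hs : ∑' i, B i ≠ ⊤) : bn D p γ s (fun z => ∑' i, g i z) ≤ ∑' i, bn D p γ s (g i) := by
  refine iSup₂_le fun k j => ?_
  have h1 : mx p (fun z => ‖T (D.mulX k (D.phi j)) (fun z => ∑' i, g i z) z‖ₑ) ≤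
      ∑' i, mx p (fun z => ‖T (D.mulX k (D.phi j)) (g i) z‖ₑ) := by
    refine (mx_mono hp fun z => ?_).trans (mx_tsum_le hp fun i => (measurable_T' _ (hg i)).enorm)
    rw [T_tsum_of_bounded _ hg hB hs]
    exact enorm_tsum_le
  refine (mul_le_mul_right h1 _).trans ?_
  rw [← ENNReal.tsum_mul_left]
  exact ENNReal.tsum_le_tsum fun i => le_bn D (g i) k j

lemma exists_mx_le (hp : Adm p) (hγ : 0 < γ) (hs : 0 < s) : ∃ C : ℝ≥0, ∀ {g : Phase d → ℂ},
    Tame g → bn D p γ s g < ⊤ → mx p (fun z => ‖g z‖ₑ) ≤ C * bn D p γ s g := by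
  have h1 : geo (γ / 3) < ⊤ := tsum_pw_neg_lt_top (by positivity)
  have h2 : geo s < ⊤ := tsum_pw_neg_lt_top hs
  refine ⟨(geo (γ / 3) * geo s).toNNReal, fun {g} hg hb => ?_⟩
  rw [coe_toNNReal (mul_ne_top h1.ne h2.ne)]
  have e : (fun z => ‖g z‖ₑ) =ᵐ[volume] fun z => ‖∑' j, T (D.phi j) g z‖ₑ := by
    filter_upwards [ae_eq_tsum_T_phi D hp hg hγ hs hb] with z hz
    rw [hz]
  rw [mx_congr_ae e]
  refine (mx_mono hp fun z => enorm_tsum_le).trans ((mx_tsum_le hp fun j =>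
    (measurable_T' _ hg.meas).enorm).trans ((ENNReal.tsum_le_tsum fun j =>
      mx_T_phi_le D (γ := γ) (s := s) hp hg j).trans (le_of_eq ?_)))
  rw [ENNReal.tsum_mul_left, ENNReal.tsum_mul_right, mul_assoc]
  rfl

lemma gradF_congr_ae (i : Fin d) {g h : Phase d → ℂ} (e : g =ᵐ[volume] h) :
    gradF D i g = gradF D i h := by
  funext z
  unfold gradF
  congr 1; funext j
  rw [T_congr_ae _ e]

lemma gradF_zero (i : Fin d) : gradF D i (fun _ => 0) = fun _ => 0 := by
  funext z
  simp [gradF, T_zero_fun]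

lemma exists_enorm_gradF_le (hp : Adm p) (hγ : 0 < γ) (hs : 0 < s - 1 - al d p) :
    ∃ C : ℝ≥0, ∀ (i : Fin d) {g : Phase d → ℂ}, Tame g → ∀ z,
      ∑' j, ‖T (gradS i (D.phi j)) g z‖ₑ ≤ C * bn D p γ s g ∧
        ‖gradF D i g z‖ₑ ≤ C * bn D p γ s g := by
  choose C hC using fun i => exists_tsum_gradS_le D hp i hγ hs
  refine ⟨∑ i, C i, fun i g hg z => ?_⟩
  have h1 : ∑' j, ‖T (gradS i (D.phi j)) g z‖ₑ ≤ (∑ i, C i : ℝ≥0) * bn D p γ s g :=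
    (tsum_T_gradS_le_blocks D i hg z).trans ((hC i hg z).trans (mul_le_mul_left
      (ENNReal.coe_le_coe.2 (Finset.single_le_sum (f := C) (fun _ _ => zero_le)
        (Finset.mem_univ i))) _))
  exact ⟨h1, enorm_tsum_le.trans h1⟩

lemma gradF_tsum (hp : Adm p) (hγ : 0 < γ) (hs : 0 < s - 1 - al d p) (i : Fin d)
    {g : ℕ → Phase d → ℂ} (hg : ∀ n, Measurable (g n)) {B : ℕ → ℝ≥0∞}
    (hB : ∀ n z, ‖g n z‖ₑ ≤ B n) (hBs : ∑' n, B n ≠ ⊤) (hb : ∑' n, bn D p γ s (g n) ≠ ⊤)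
    (z : Phase d) : gradF D i (fun z => ∑' n, g n z) z = ∑' n, gradF D i (g n) z := by
  obtain ⟨C, hC⟩ := exists_enorm_gradF_le D hp hγ hs
  have ht : ∀ n, Tame (g n) := fun n => by
    have h1 : B n ≠ ⊤ := ENNReal.ne_top_of_tsum_ne_top hBs n
    refine Tame.of_bounded (hg n) (C := (B n).toReal) fun z => ?_
    have h2 := hB n z
    rw [← ofReal_norm] at h2
    exact (ENNReal.ofReal_le_iff_le_toReal h1).1 h2
  unfold gradF
  simp_rw [T_tsum_of_bounded _ hg hB hBs]
  refine Summable.tsum_comm (f := fun n j => T (gradS i (D.phi j)) (g n) z) ?_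
  refine summable_of_tsum_enorm ?_
  rw [ENNReal.tsum_prod']
  refine ne_top_of_le_ne_top ?_ (ENNReal.tsum_le_tsum fun n => (hC i (ht n) z).1)
  rw [ENNReal.tsum_mul_left]
  exact mul_ne_top coe_ne_top hb

end

lemma im_tsum_eq_zero {ι : Type*} {f : ι → ℂ} (h : ∀ i, (f i).im = 0) : (∑' i, f i).im = 0 := by
  have e : f = fun i => ((f i).re : ℂ) := funext fun i => Complex.ext rfl (by simpa using h i)
  rw [e, ← Complex.ofReal_tsum, Complex.ofReal_im]

lemma im_integral_eq_zero {α : Type*} [MeasurableSpace α] {μ : Measure α} {f : α → ℂ}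
    (h : ∀ i, (f i).im = 0) : (∫ i, f i ∂μ).im = 0 := by
  have e : f = fun i => ((f i).re : ℂ) := funext fun i => Complex.ext rfl (by simpa using h i)
  rw [e]
  exact (congrArg Complex.im integral_ofReal).trans (Complex.ofReal_im _)

lemma im_gradF (D : LP d) (i : Fin d) {g : Phase d → ℂ} (hg : ∀ z, (g z).im = 0) (z : Phase d) :
    (gradF D i g z).im = 0 :=
  im_tsum_eq_zero fun j => ((D.herm_phi j).gradS i).T_im hg z

lemma im_semi (r : ℝ) {g : Phase d → ℂ} (hg : ∀ z, (g z).im = 0) (z : Phase d) :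
    (semi r g z).im = 0 := by
  unfold semi
  split_ifs with h
  · exact (herm_heatS h).T_im hg _
  · rfl

lemma im_duh (lam : ℝ) {h : ℝ → Phase d → ℂ} (hh : ∀ s z, (h s z).im = 0) (t : ℝ) (z : Phase d) :
    (duh lam h t z).im = 0 :=
  im_integral_eq_zero fun s => by
    rw [Complex.im_ofReal_mul, im_semi _ (hh s), mul_zero]

lemma im_mild (lam : ℝ) {H : ℕ → ℝ → Phase d → ℂ} (hH : ∀ l s z, (H l s z).im = 0) (t : ℝ)
    (z : Phase d) : (mild lam H t z).im = 0 :=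
  im_tsum_eq_zero fun l => im_duh lam (hH l) t z

/-- The Littlewood-Paley data with the same anisotropic cutoff and the trivial partition of unity
`1 = 1 + 0 + 0 + ⋯` in the position variable; its mixed Besov norms are the anisotropic ones. -/
def LP.triv (D : LP d) : LP d where
  χ := D.χ
  hχ := D.hχ
  χx := fun _ => 1
  smooth := contDiff_const
  even := fun _ => rfl
  eq_one := fun _ _ => rfl
  supp := Or.inr fun _ => rfl

namespace LP
variable (D : LP d)

lemma triv_phi (j : ℕ) : D.triv.phi j = D.phi j := by cases j <;> rfl

lemma triv_mulX_zero (m : Test d) : D.triv.mulX 0 m = m := by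
  ext ξ
  rw [mulX_apply]
  have : D.triv.xs 0 ξ = 1 := by simp [xs, isoPart, triv]
  rw [this]; simp

lemma triv_mulX_succ (k : ℕ) (m : Test d) : D.triv.mulX (k + 1) m = 0 := by
  ext ξ
  rw [mulX_apply]
  have : D.triv.xs (k + 1) ξ = 0 := by simp [xs, isoPart, triv]
  rw [this]; simp

end LP

section
variable (D : LP d)

lemma bn_triv_le (hp : Adm p) {γ γ' s : ℝ} {g : Phase d → ℂ} (hg : Tame g) :
    bn D.triv p γ' s g ≤ geo (γ / 3) * bn D p γ s g := by
  refine iSup₂_le fun k j => ?_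
  beta_reduce
  cases k with
  | zero =>
    rw [D.triv_mulX_zero, D.triv_phi]
    simp only [Nat.cast_zero, zero_mul, zero_div, pw_zero, one_mul]
    refine pw_mul_le ((mx_T_phi_le D (γ := γ) (s := s) hp hg j).trans (le_of_eq ?_))
    ring
  | succ k =>
    rw [D.triv_mulX_succ]
    simp [T_zero_sym, mx_zero hp]

lemma distNorm_zero (hp : Adm p) : distNorm p (0 : Temp d F) = 0 := by
  refine le_antisymm ((iInf₂_le (f := fun (g : Phase d → F) (_ : Represents g 0) => mixedNorm p g)
    (fun _ => 0) fun φ => ⟨by simp, by simp⟩).trans ?_) zero_le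
  rw [mixedNorm_eq_mx hp]
  simp [mx_zero hp]

lemma besovMixed_triv (hp : Adm p) (γ s : ℝ) (Φ : Temp d F) :
    besovMixed D.triv.χ D.triv.χx p γ s Φ = besov D.χ p s Φ := by
  have h0 : ∀ j, blockX D.triv.χx 0 (blockA D.triv.χ j Φ) = blockA D.χ j Φ := fun j => by
    ext φ
    rw [blockX_blockA_apply, D.triv_mulX_zero, D.triv_phi, blockA_apply]
  have h1 : ∀ k j, blockX D.triv.χx (k + 1) (blockA D.triv.χ j Φ) = 0 := fun k j => by
    ext φ
    rw [blockX_blockA_apply, D.triv_mulX_succ]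
    have : TS (0 : Test d) φ = 0 := by
      ext z
      rw [TS_apply, T_zero_sym]; rfl
    rw [this, map_zero]; rfl
  refine le_antisymm (iSup₂_le fun k j => ?_) (iSup_le fun j => ?_)
  · cases k with
    | zero =>
      rw [h0]
      simp only [Nat.cast_zero, zero_mul, zero_div, ENNReal.rpow_zero, one_mul]
      exact le_iSup (f := fun j : ℕ => (2 : ℝ≥0∞) ^ ((j : ℝ) * s) *
        distNorm p (blockA D.χ j Φ)) j
    | succ k => rw [h1, distNorm_zero hp, mul_zero]; exact zero_le
  · refine le_trans (le_of_eq ?_) (le_iSup₂ (f := fun k j : ℕ =>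
      (2 : ℝ≥0∞) ^ ((k : ℝ) * γ / 3) * (2 : ℝ≥0∞) ^ ((j : ℝ) * s) *
        distNorm p (blockX D.triv.χx k (blockA D.triv.χ j Φ))) 0 j)
    rw [h0]
    simp

end

/-- A tempered distribution is the sum of its blocks. -/
lemma tsum_TS_phi (D : LP d) (Φ : Temp d ℂ) (φ : Test d)
    (h : Summable fun l => Φ (TS (D.phi l) φ)) : ∑' l, Φ (TS (D.phi l) φ) = Φ φ := by
  have h1 := (h.hasSum.tendsto_sum_nat).comp (tendsto_add_atTop_nat 1)
  have h2 : Tendsto (fun n => Φ (TS (D.cut n) φ)) atTop (nhds (Φ φ)) :=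
    (Φ.continuous.tendsto φ).comp (D.tendsto_TS_cut φ)
  refine tendsto_nhds_unique h1 (h2.congr fun n => ?_)
  simp only [Function.comp]
  rw [← map_sum, ← TS_sum, D.sum_phi]

lemma tsum_integral_T_phi (D : LP d) {g : Phase d → ℂ} (hg : Tame g) (φ : Test d)
    (h : Summable fun l => ∫ z, φ z * T (D.phi l) g z) :
    ∑' l, ∫ z, φ z * T (D.phi l) g z = ∫ z, φ z * g z := by
  have e : ∀ l, ∫ z, φ z * T (D.phi l) g z = hg.toTemp (TS (D.phi l) φ) := fun l => by
    rw [integral_T_mul _ _ hg, D.negS_phi]; rfl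
  simp_rw [e] at h ⊢
  exact tsum_TS_phi D hg.toTemp φ h

/-! ### The transport term and its Neumann series -/

/-- The admissible parameters: `γ`, `β`, `δ` are the regularity exponents, `τ` is the final time,
and `κ + δ`, with `κ < 2`, is the regularity of the solution used to control `b · ∇_v u`. -/
structure Par (d : ℕ) (p : ℝ≥0∞ × ℝ≥0∞) (γ β δ κ τ : ℝ) : Prop where
  adm : Adm p
  hγ : 0 < γ
  hβ : 0 < β
  hδβ : δ ≤ β
  hτ : 0 ≤ τ
  hκ : κ < 2
  grad : 0 < κ + δ - 1 - al d p
  prod : δ ≤ κ + δ - 1 - al d p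

/-- The components of a drift that is bounded in time, with values in the mixed Besov space, and
extended by zero outside `[0, τ]`. -/
structure Drift (D : LP d) (p : ℝ≥0∞ × ℝ≥0∞) (γ β τ : ℝ) (K : ℝ≥0)
    (b : Fin d → ℝ → Phase d → ℂ) : Prop where
  meas : ∀ i, Measurable fun q : ℝ × Phase d => b i q.1 q.2
  tame : ∀ i s, Tame (b i s)
  supp : ∀ i s, s ∉ Icc 0 τ → b i s = fun _ => 0
  bound : ∀ i s, bn D p γ β (b i s) ≤ K

/-- A measurable evolution whose Besov norm of order `σ` at time `s` is at most `exp (μ s) M`. -/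
structure Evol (D : LP d) (p : ℝ≥0∞ × ℝ≥0∞) (γ σ τ μ : ℝ) (M : ℝ≥0)
    (u : ℝ → Phase d → ℂ) : Prop where
  meas : Measurable fun q : ℝ × Phase d => u q.1 q.2
  tame : ∀ s ∈ Icc 0 τ, Tame (u s)
  bound : ∀ s ∈ Icc 0 τ, bn D p γ σ (u s) ≤ ENNReal.ofReal (Real.exp (μ * s)) * M

/-- The transport term `b · ∇_v u`. -/
def tr (D : LP d) (b : Fin d → ℝ → Phase d → ℂ) (u : ℝ → Phase d → ℂ) (s : ℝ) (z : Phase d) : ℂ :=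
  ∑ i, b i s z * gradF D i (u s) z

/-- The dyadic blocks of the transport term. -/
def trS (D : LP d) (b : Fin d → ℝ → Phase d → ℂ) (u : ℝ → Phase d → ℂ) (l : ℕ) (s : ℝ) :
    Phase d → ℂ := T (D.phi l) (tr D b u s)

lemma Evol.lt_top {D : LP d} {γ σ τ μ : ℝ} {M : ℝ≥0} {u : ℝ → Phase d → ℂ}
    (h : Evol D p γ σ τ μ M u) {s : ℝ} (hs : s ∈ Icc 0 τ) : bn D p γ σ (u s) < ⊤ :=
  (h.bound s hs).trans_lt (mul_lt_top ENNReal.ofReal_lt_top coe_lt_top)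

lemma measurable_tr (D : LP d) {b : Fin d → ℝ → Phase d → ℂ} {u : ℝ → Phase d → ℂ}
    (hb : ∀ i, Measurable fun q : ℝ × Phase d => b i q.1 q.2)
    (hu : Measurable fun q : ℝ × Phase d => u q.1 q.2) :
    Measurable fun q : ℝ × Phase d => tr D b u q.1 q.2 :=
  Finset.measurable_fun_sum _ fun i _ => (hb i).mul (measurable_gradF D i (g := u) hu)

lemma Drift.tr_eq_zero {D : LP d} {γ β τ : ℝ} {K : ℝ≥0} {b : Fin d → ℝ → Phase d → ℂ}
    (hb : Drift D p γ β τ K b) (u : ℝ → Phase d → ℂ) {s : ℝ} (hs : s ∉ Icc 0 τ) :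
    tr D b u s = fun _ => 0 := by
  funext z
  simp [tr, hb.supp _ s hs]

section
variable {D : LP d} {γ β δ κ τ : ℝ}

lemma Par.exists_tr_le (h : Par d p γ β δ κ τ) (D : LP d) : ∃ C : ℝ≥0, ∀ {K : ℝ≥0}
    {b : Fin d → ℝ → Phase d → ℂ} {u : ℝ → Phase d → ℂ}, Drift D p γ β τ K b →
    ∀ s, Tame (u s) → bn D p γ (κ + δ) (u s) < ⊤ →
      Tame (tr D b u s) ∧ bn D p γ δ (tr D b u s) ≤ C * (K * bn D p γ (κ + δ) (u s)) := by
  choose C hC using fun i : Fin d =>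
    exists_bn_mul_gradF_le D h.adm h.hγ h.hβ h.hδβ h.grad h.prod i
  refine ⟨∑ i, C i, fun {K b u} hb s hu hbu => ?_⟩
  have h1 := fun i => hC i (hb.tame i s) hu ((hb.bound i s).trans_lt coe_lt_top) hbu
  refine ⟨Tame.sum _ fun i => (h1 i).1, (bn_sum_le D h.adm _ fun i => (h1 i).1).trans ?_⟩
  push_cast
  rw [Finset.sum_mul]
  exact Finset.sum_le_sum fun i _ => (h1 i).2.trans
    (mul_le_mul_right (mul_le_mul_left (hb.bound i s) _) _)

lemma bnorm_psi_T_phi {γ s : ℝ} {g : Phase d → ℂ} (hg : Tame g) :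
    bnorm p γ s (fun k l => T (D.mulX k (D.psi l)) (T (D.phi l) g)) = bn D p γ s g := by
  unfold bn
  congr 1; funext k l
  rw [T_T _ _ hg, ← D.mulX_mulS, D.mulS_psi_phi]

/-- The transport term maps regularity `κ + δ` to `δ`, with the bound `K` of the drift as a factor. -/
lemma Par.exists_src_trS (h : Par d p γ β δ κ τ) (D : LP d) : ∃ C : ℝ≥0, ∀ {K M : ℝ≥0} {μ : ℝ}
    {b : Fin d → ℝ → Phase d → ℂ} {u : ℝ → Phase d → ℂ}, Drift D p γ β τ K b →
    Evol D p γ (κ + δ) τ μ M u → Src D p γ δ τ μ (C * K * M) (trS D b u) := by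
  obtain ⟨C, hC⟩ := h.exists_tr_le D
  refine ⟨C, fun {K M μ b u} hb hu => ?_⟩
  have hz : ∀ l s, s ∉ Icc 0 τ → trS D b u l s = fun _ => 0 := fun l s hs => by
    rw [trS, hb.tr_eq_zero u hs, T_zero_fun]
  have ht : ∀ s, Tame (tr D b u s) := fun s => by
    by_cases hs : s ∈ Icc 0 τ
    · exact (hC hb s (hu.tame s hs) (hu.lt_top hs)).1
    · rw [hb.tr_eq_zero u hs]; exact tame_zero
  refine ⟨fun l => measurable_T (D.phi l) (g := fun s => tr D b u s)
    (measurable_tr D hb.meas hu.meas), fun l s => (ht s).T _, fun l s => ?_, hz, fun s => ?_⟩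
  · rw [trS, T_T _ _ (ht s), D.mulS_psi_phi]
  · simp only [trS]
    rw [bnorm_psi_T_phi (ht s)]
    by_cases hs : s ∈ Icc 0 τ
    · refine (hC hb s (hu.tame s hs) (hu.lt_top hs)).2.trans
        ((mul_le_mul_right (mul_le_mul_right (hu.bound s hs) _) _).trans (le_of_eq ?_))
      push_cast
      ring
    · rw [hb.tr_eq_zero u hs, bn_zero D h.adm]; exact zero_le

lemma Par.two_add_pos (h : Par d p γ β δ κ τ) : 0 < 2 + δ - al d p := by
  have := h.grad; have := h.hκ; linarith

lemma Par.κ_mem (h : Par d p γ β δ κ τ) : κ ∈ Icc (0 : ℝ) 2 :=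
  ⟨by have := h.prod; have := al_nonneg (d := d) (p := p); linarith, h.hκ.le⟩

lemma Src.norm_mild_bound (hp : Adm p) (hγ : 0 < γ) (hτ : 0 ≤ τ) (hδ : 0 < 2 + δ - al d p)
    (D : LP d) : ∃ C : ℝ≥0, ∀ {μ lam : ℝ} {M : ℝ≥0} {H : ℕ → ℝ → Phase d → ℂ},
      Src D p γ δ τ μ M H → 0 ≤ μ → 0 ≤ lam → 0 < lam + μ → ∀ t ∈ Icc 0 τ, ∀ z,
        ‖mild lam H t z‖ₑ ≤ C * (ENNReal.ofReal (Real.exp (μ * τ)) * M) := by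
  obtain ⟨C, hC⟩ := Src.exists_enorm_mild_le D p hp hγ hτ hδ
  refine ⟨C, fun h hμ hl hν t ht z => enorm_tsum_le.trans ((hC h hμ hl hν t ht z).trans ?_)⟩
  gcongr
  exact ht.2

lemma tame_of_enorm_le {g : Phase d → ℂ} (hg : Measurable g) {B : ℝ≥0∞} (hB : B ≠ ⊤)
    (h : ∀ z, ‖g z‖ₑ ≤ B) : Tame g := by
  refine Tame.of_bounded hg (C := B.toReal) fun z => ?_
  have h2 := h z
  rw [← ofReal_norm] at h2
  exact (ENNReal.ofReal_le_iff_le_toReal hB).1 h2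

lemma Par.exists_evol_mild (h : Par d p γ β δ κ τ) (D : LP d) : ∃ C : ℝ≥0, ∀ {M : ℝ≥0}
    {μ lam θ : ℝ} {H : ℕ → ℝ → Phase d → ℂ}, Src D p γ δ τ μ M H → 0 ≤ μ → 0 ≤ lam →
    0 < lam + μ → θ ∈ Icc (0 : ℝ) 2 →
    Evol D p γ (θ + δ) τ μ (C * ((lam + μ) ^ ((θ - 2) / 2)).toNNReal * M) (mild lam H) := by
  obtain ⟨C, hC⟩ := Src.exists_bnorm_mild_le D p h.adm δ h.hτ h.two_add_pos
  obtain ⟨C', hC'⟩ := Src.norm_mild_bound h.adm h.hγ h.hτ h.two_add_pos D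
  refine ⟨C, fun {M μ lam θ H} hH hμ hl hν hθ => ⟨measurable_mild lam hH.meas, fun s hs => ?_,
    fun s hs => (hC hH h.hγ hμ hl hν hθ s hs).trans (le_of_eq ?_)⟩⟩
  · exact tame_of_enorm_le (measurable_mild lam hH.meas).of_uncurry_left
      (mul_ne_top coe_ne_top (mul_ne_top ofReal_ne_top
        coe_ne_top)) (hC' hH hμ hl hν s hs)
  · rw [ENNReal.ofReal]
    push_cast
    ring

lemma Src.mono {μ : ℝ} {M M' : ℝ≥0} {H : ℕ → ℝ → Phase d → ℂ} (h : Src D p γ δ τ μ M H)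
    (hM : M ≤ M') : Src D p γ δ τ μ M' H :=
  ⟨h.meas, h.tame, h.psi, h.supp, fun s => (h.bound s).trans (by gcongr)⟩

lemma Evol.mono {σ μ : ℝ} {M M' : ℝ≥0} {u : ℝ → Phase d → ℂ} (h : Evol D p γ σ τ μ M u)
    (hM : M ≤ M') : Evol D p γ σ τ μ M' u :=
  ⟨h.meas, h.tame, fun s hs => (h.bound s hs).trans (by gcongr)⟩

/-- A source bounded in time is bounded with respect to every exponential weight. -/
lemma Src.of_zero (hp : Adm p) {μ : ℝ} (hμ : 0 ≤ μ) {M : ℝ≥0} {H : ℕ → ℝ → Phase d → ℂ}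
    (h : Src D p γ δ τ 0 M H) : Src D p γ δ τ μ M H := by
  refine ⟨h.meas, h.tame, h.psi, h.supp, fun s => ?_⟩
  by_cases hs : s ∈ Icc 0 τ
  · refine (h.bound s).trans ?_
    gcongr
    exact hs.1
  · have e : ∀ k l, T (D.mulX k (D.psi l)) (H l s) = fun _ => 0 := fun k l => by
      rw [h.supp l s hs, T_zero_fun]
    simp_rw [bnorm, e]
    simp [mx_zero hp]

/-- For a large exponential weight, depending on the drift only through its norm, the map
`u ↦ ∫ e^{-lam (t - s)} P_{t - s} (b · ∇_v u_s) ds` halves the norms. -/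
lemma Par.exists_contraction (h : Par d p γ β δ κ τ) (D : LP d) (K : ℝ≥0) :
    ∃ μ : ℝ, 1 ≤ μ ∧ ∀ {lam : ℝ}, 0 ≤ lam → ∀ {b : Fin d → ℝ → Phase d → ℂ} {M : ℝ≥0},
      Drift D p γ β τ K b →
      (∀ {H}, Src D p γ δ τ μ M H → Src D p γ δ τ μ (M / 2) (trS D b (mild lam H))) ∧
      ∀ {u}, Evol D p γ (κ + δ) τ μ M u → (∃ M', Src D p γ δ τ μ M' (trS D b u)) ∧
        Evol D p γ (κ + δ) τ μ (M / 2) (mild lam (trS D b u)) := by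
  obtain ⟨C₁, h₁⟩ := h.exists_evol_mild D
  obtain ⟨C₂, h₂⟩ := h.exists_src_trS D
  have he : 0 < (2 - κ) / 2 := by have := h.hκ; linarith
  -- since `κ < 2`, the factor `(lam + μ) ^ ((κ - 2) / 2)` is small for large `μ`
  have ht := (tendsto_rpow_neg_atTop he).const_mul ((C₂ * K * C₁ : ℝ≥0) : ℝ)
  rw [mul_zero] at ht
  obtain ⟨μ, hμ, hμ1⟩ := ((ht.eventually (gt_mem_nhds (show (0 : ℝ) < 1 / 2 by norm_num))).and
    (eventually_ge_atTop 1)).exists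
  refine ⟨μ, hμ1, fun {lam} hl {b M} hb => ?_⟩
  have hμ0 : 0 ≤ μ := zero_le_one.trans hμ1
  have hν : 0 < lam + μ := by linarith
  have hf : C₂ * K * C₁ * ((lam + μ) ^ ((κ - 2) / 2)).toNNReal ≤ 1 / 2 := by
    rw [← NNReal.coe_le_coe, NNReal.coe_mul, Real.coe_toNNReal _ (by positivity)]
    refine le_trans ?_ (le_trans hμ.le (by norm_num))
    refine mul_le_mul_of_nonneg_left ?_ (NNReal.coe_nonneg _)
    rw [show (κ - 2) / 2 = -((2 - κ) / 2) by ring]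
    exact Real.rpow_le_rpow_of_nonpos (by linarith) (by linarith) (by linarith)
  have hM : ∀ x : ℝ≥0, x ≤ 1 / 2 → x * M ≤ M / 2 := fun x hx =>
    (mul_le_mul_left hx M).trans (le_of_eq (by rw [div_eq_mul_inv, one_mul, mul_comm,
      div_eq_mul_inv]))
  refine ⟨fun {H} hH => ?_, fun {u} hu => ⟨⟨_, h₂ hb hu⟩, ?_⟩⟩
  · refine (h₂ hb (h₁ hH hμ0 hl hν h.κ_mem)).mono (le_trans (le_of_eq ?_) (hM _ hf))
    ring
  · refine (h₁ (h₂ hb hu) hμ0 hl hν h.κ_mem).mono (le_trans (le_of_eq ?_) (hM _ hf))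
    ring

end

/-- The sources of the terms of the Neumann series: the given source, then the transport terms of
the preceding solutions. -/
def iter (D : LP d) (b : Fin d → ℝ → Phase d → ℂ) (lam : ℝ) (H : ℕ → ℝ → Phase d → ℂ) :
    ℕ → ℕ → ℝ → Phase d → ℂ
  | 0 => H
  | n + 1 => trS D b (mild lam (iter D b lam H n))

/-- The sum of the Neumann series. -/
def sol (D : LP d) (b : Fin d → ℝ → Phase d → ℂ) (lam : ℝ) (H : ℕ → ℝ → Phase d → ℂ)
    (t : ℝ) (z : Phase d) : ℂ := ∑' n, mild lam (iter D b lam H n) t z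

/-- `H` is a source for which all the terms of the Neumann series decay geometrically. -/
structure Geom (D : LP d) (p : ℝ≥0∞ × ℝ≥0∞) (γ δ τ μ lam : ℝ) (b : Fin d → ℝ → Phase d → ℂ)
    (M : ℝ≥0) (H : ℕ → ℝ → Phase d → ℂ) : Prop where
  hμ : 1 ≤ μ
  hl : 0 ≤ lam
  src : ∀ n, Src D p γ δ τ μ (M / 2 ^ n) (iter D b lam H n)

lemma tsum_div_two_pow (M : ℝ≥0) : ∑' n : ℕ, ((M / 2 ^ n : ℝ≥0) : ℝ≥0∞) = 2 * M := by
  have h : ∀ n : ℕ, ((M / 2 ^ n : ℝ≥0) : ℝ≥0∞) = M * (2⁻¹ : ℝ≥0∞) ^ n := fun n => by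
    rw [div_eq_mul_inv, ENNReal.coe_mul, ENNReal.coe_inv (by positivity)]
    push_cast
    rw [ENNReal.inv_pow]
  simp_rw [h]
  rw [ENNReal.tsum_mul_left, ENNReal.tsum_geometric, ENNReal.one_sub_inv_two, inv_inv, mul_comm]

section
variable {D : LP d} {γ β δ κ τ : ℝ}

lemma Par.exists_geom (h : Par d p γ β δ κ τ) (D : LP d) (K : ℝ≥0) :
    ∃ μ : ℝ, 1 ≤ μ ∧ ∀ {lam : ℝ}, 0 ≤ lam → ∀ {b : Fin d → ℝ → Phase d → ℂ} {M : ℝ≥0}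
      {H : ℕ → ℝ → Phase d → ℂ}, Drift D p γ β τ K b → Src D p γ δ τ 0 M H →
      Geom D p γ δ τ μ lam b M H := by
  obtain ⟨μ, hμ, hc⟩ := h.exists_contraction D K
  refine ⟨μ, hμ, fun {lam} hl {b M H} hb hH => ⟨hμ, hl, fun n => ?_⟩⟩
  induction n with
  | zero => simpa [iter] using hH.of_zero h.adm (zero_le_one.trans hμ)
  | succ n ih =>
    refine ((hc hl hb).1 ih).mono (le_of_eq ?_)
    rw [div_div, pow_succ]

namespace Geom
variable {μ lam : ℝ} {b : Fin d → ℝ → Phase d → ℂ} {M : ℝ≥0} {H : ℕ → ℝ → Phase d → ℂ}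

lemma hμ0 (g : Geom D p γ δ τ μ lam b M H) : 0 ≤ μ := zero_le_one.trans g.hμ

lemma hν (g : Geom D p γ δ τ μ lam b M H) : 0 < lam + μ := by
  have := g.hμ; have := g.hl; linarith

lemma measurable_term (g : Geom D p γ δ τ μ lam b M H) (n : ℕ) :
    Measurable fun q : ℝ × Phase d => mild lam (iter D b lam H n) q.1 q.2 :=
  measurable_mild lam (g.src n).meas

lemma measurable_sol (g : Geom D p γ δ τ μ lam b M H) :
    Measurable fun q : ℝ × Phase d => sol D b lam H q.1 q.2 :=
  Measurable.tsum fun n => g.measurable_term n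

end Geom

/-- The uniform bounds on the terms of the Neumann series. -/
lemma Par.exists_term_le (h : Par d p γ β δ κ τ) (D : LP d) (μ : ℝ) : ∃ C : ℝ≥0,
    ∀ {lam : ℝ} {b : Fin d → ℝ → Phase d → ℂ} {M : ℝ≥0} {H : ℕ → ℝ → Phase d → ℂ},
      Geom D p γ δ τ μ lam b M H → ∀ t ∈ Icc 0 τ, ∀ n z,
        ‖mild lam (iter D b lam H n) t z‖ₑ ≤ C * (M / 2 ^ n : ℝ≥0) := by
  obtain ⟨C, hC⟩ := Src.norm_mild_bound h.adm h.hγ h.hτ h.two_add_pos D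
  refine ⟨C * (Real.exp (μ * τ)).toNNReal, fun g t ht n z => (hC (g.src n) g.hμ0 g.hl g.hν t ht
    z).trans (le_of_eq ?_)⟩
  rw [ENNReal.ofReal]
  push_cast
  ring

lemma tsum_mul_div_two_pow_ne_top (C M : ℝ≥0) :
    ∑' n : ℕ, (C : ℝ≥0∞) * (M / 2 ^ n : ℝ≥0) ≠ ⊤ := by
  rw [ENNReal.tsum_mul_left, tsum_div_two_pow]
  exact mul_ne_top coe_ne_top (mul_ne_top (by norm_num)
    coe_ne_top)

lemma Par.exists_sol_le (h : Par d p γ β δ κ τ) (D : LP d) (μ : ℝ) : ∃ C : ℝ≥0,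
    ∀ {lam : ℝ} {b : Fin d → ℝ → Phase d → ℂ} {M : ℝ≥0} {H : ℕ → ℝ → Phase d → ℂ},
      Geom D p γ δ τ μ lam b M H → ∀ t ∈ Icc 0 τ,
        (∀ z, ∑' n, ‖mild lam (iter D b lam H n) t z‖ₑ ≤ C * M) ∧ Tame (sol D b lam H t) ∧
        ∀ z, ‖sol D b lam H t z‖ₑ ≤ C * M := by
  obtain ⟨C, hC⟩ := h.exists_term_le D μ
  refine ⟨C * 2, fun {lam b M H} g t ht => ?_⟩
  have h1 : ∀ z, ∑' n, ‖mild lam (iter D b lam H n) t z‖ₑ ≤ (C * 2 : ℝ≥0) * M := fun z => by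
    refine (ENNReal.tsum_le_tsum fun n => hC g t ht n z).trans (le_of_eq ?_)
    rw [ENNReal.tsum_mul_left, tsum_div_two_pow]
    push_cast
    ring
  have h2 : ∀ z, ‖sol D b lam H t z‖ₑ ≤ (C * 2 : ℝ≥0) * M := fun z => enorm_tsum_le.trans (h1 z)
  exact ⟨h1, tame_of_enorm_le g.measurable_sol.of_uncurry_left
    (mul_ne_top coe_ne_top coe_ne_top) h2, h2⟩

lemma Par.exists_bn_term_le (h : Par d p γ β δ κ τ) (D : LP d) : ∃ C : ℝ≥0,
    ∀ {μ lam θ : ℝ} {b : Fin d → ℝ → Phase d → ℂ} {M : ℝ≥0} {H : ℕ → ℝ → Phase d → ℂ},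
      Geom D p γ δ τ μ lam b M H → θ ∈ Icc (0 : ℝ) 2 → ∀ t ∈ Icc 0 τ,
        ∑' n, bn D p γ (θ + δ) (mild lam (iter D b lam H n) t) ≤
          C * (ENNReal.ofReal ((lam + μ) ^ ((θ - 2) / 2)) *
            (ENNReal.ofReal (Real.exp (μ * τ)) * M)) := by
  obtain ⟨C, hC⟩ := h.exists_evol_mild D
  refine ⟨C * 2, fun {μ lam θ b M H} g hθ t ht => ?_⟩
  have hμτ : ENNReal.ofReal (Real.exp (μ * t)) ≤ ENNReal.ofReal (Real.exp (μ * τ)) := by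
    have := g.hμ0
    gcongr
    exact ht.2
  refine (ENNReal.tsum_le_tsum fun n => ((hC (g.src n) g.hμ0 g.hl g.hν hθ).bound t ht).trans
    (mul_le_mul_left hμτ _)).trans (le_of_eq ?_)
  simp_rw [ENNReal.coe_mul]
  rw [ENNReal.tsum_mul_left, ENNReal.tsum_mul_left, tsum_div_two_pow, ENNReal.ofReal,
    ENNReal.ofReal]
  push_cast
  ring

/-- The smoothing estimate for the solution. -/
lemma Par.exists_bn_sol_le (h : Par d p γ β δ κ τ) (D : LP d) : ∃ C : ℝ≥0,
    ∀ {μ lam θ : ℝ} {b : Fin d → ℝ → Phase d → ℂ} {M : ℝ≥0} {H : ℕ → ℝ → Phase d → ℂ},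
      Geom D p γ δ τ μ lam b M H → θ ∈ Icc (0 : ℝ) 2 → ∀ t ∈ Icc 0 τ,
        bn D p γ (θ + δ) (sol D b lam H t) ≤
          C * (ENNReal.ofReal ((lam + μ) ^ ((θ - 2) / 2)) *
            (ENNReal.ofReal (Real.exp (μ * τ)) * M)) := by
  obtain ⟨C, hC⟩ := h.exists_bn_term_le D
  refine ⟨C, fun {μ lam θ b M H} g hθ t ht => ?_⟩
  obtain ⟨C', hC'⟩ := h.exists_term_le D μ
  exact (bn_tsum_le D h.adm (fun n => (g.measurable_term n).of_uncurry_left) (hC' g t ht)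
    (tsum_mul_div_two_pow_ne_top C' M)).trans (hC g hθ t ht)

lemma Par.gradF_sol (h : Par d p γ β δ κ τ) {μ lam : ℝ} {b : Fin d → ℝ → Phase d → ℂ} {M : ℝ≥0}
    {H : ℕ → ℝ → Phase d → ℂ} (g : Geom D p γ δ τ μ lam b M H) {t : ℝ} (ht : t ∈ Icc 0 τ)
    (i : Fin d) (z : Phase d) :
    gradF D i (sol D b lam H t) z = ∑' n, gradF D i (mild lam (iter D b lam H n) t) z := by
  obtain ⟨C, hC⟩ := h.exists_bn_term_le D
  obtain ⟨C', hC'⟩ := h.exists_term_le D μ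
  refine gradF_tsum D h.adm h.hγ h.grad i (fun n => (g.measurable_term n).of_uncurry_left)
    (hC' g t ht) (tsum_mul_div_two_pow_ne_top C' M) (ne_top_of_le_ne_top ?_ (hC g h.κ_mem t ht)) z
  exact mul_ne_top coe_ne_top (mul_ne_top ofReal_ne_top
    (mul_ne_top ofReal_ne_top coe_ne_top))

lemma Par.integral_tr_sol (h : Par d p γ β δ κ τ) {K : ℝ≥0} {μ lam : ℝ}
    {b : Fin d → ℝ → Phase d → ℂ} {M : ℝ≥0} {H : ℕ → ℝ → Phase d → ℂ}
    (hb : Drift D p γ β τ K b) (g : Geom D p γ δ τ μ lam b M H) {t : ℝ} (ht : t ∈ Icc 0 τ)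
    (φ : Test d) : ∫ z, φ z * tr D b (sol D b lam H) t z =
      ∑' n, ∫ z, φ z * tr D b (mild lam (iter D b lam H n)) t z := by
  obtain ⟨C, hC⟩ := h.exists_bn_term_le D
  obtain ⟨C', hC'⟩ := h.exists_term_le D μ
  obtain ⟨Cg, hCg⟩ := exists_enorm_gradF_le D h.adm h.hγ h.grad
  have hfin : ∑' n, bn D p γ (κ + δ) (mild lam (iter D b lam H n) t) ≠ ⊤ :=
    ne_top_of_le_ne_top (mul_ne_top coe_ne_top (mul_ne_top
      ofReal_ne_top (mul_ne_top ofReal_ne_top coe_ne_top)))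
      (hC g h.κ_mem t ht)
  have hm : ∀ n, Measurable (mild lam (iter D b lam H n) t) := fun n =>
    (g.measurable_term n).of_uncurry_left
  have htm : ∀ n, Tame (mild lam (iter D b lam H n) t) := fun n =>
    tame_of_enorm_le (hm n) (mul_ne_top coe_ne_top coe_ne_top)
      (hC' g t ht n)
  have hgm : ∀ n i, Measurable (gradF D i (mild lam (iter D b lam H n) t)) := fun n i =>
    Measurable.tsum fun _ => measurable_T' _ (hm n)
  have hB : Cg * ∑' n, bn D p γ (κ + δ) (mild lam (iter D b lam H n) t) ≠ ⊤ :=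
    mul_ne_top coe_ne_top hfin
  have hsum : ∀ i z, ∑' n, ‖gradF D i (mild lam (iter D b lam H n) t) z‖ₑ ≤
      Cg * ∑' n, bn D p γ (κ + δ) (mild lam (iter D b lam H n) t) := fun i z => by
    rw [← ENNReal.tsum_mul_left]
    exact ENNReal.tsum_le_tsum fun n => (hCg i (htm n) z).2
  have hk : ∀ i, Integrable fun z => φ z * b i t z := fun i => (hb.tame i t).integrable_mul φ
  have key := fun i => pairing_tsum (hk i) (fun n => hgm n i) hB
    (.of_forall (hsum i))
  have hint : ∀ i, ∀ {w : Phase d → ℂ} {B : ℝ≥0∞}, Measurable w → B ≠ ⊤ → (∀ z, ‖w z‖ₑ ≤ B) →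
      Integrable fun z => φ z * b i t z * w z := fun i w B hw hB hwB => by
    refine (hk i).mul_bdd (c := B.toReal) hw.aestronglyMeasurable
      (.of_forall fun z => ?_)
    have h2 := hwB z
    rw [← ofReal_norm] at h2
    exact (ENNReal.ofReal_le_iff_le_toReal hB).1 h2
  have e1 : ∀ z, φ z * tr D b (sol D b lam H) t z =
      ∑ i, φ z * b i t z * ∑' n, gradF D i (mild lam (iter D b lam H n) t) z := fun z => by
    rw [tr, Finset.mul_sum]
    exact Finset.sum_congr rfl fun i _ => by rw [h.gradF_sol g ht]; ring
  have e2 : ∀ n, ∫ z, φ z * tr D b (mild lam (iter D b lam H n)) t z =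
      ∑ i, ∫ z, φ z * b i t z * gradF D i (mild lam (iter D b lam H n) t) z := fun n => by
    rw [← integral_finsetSum _ fun i _ => hint i (hgm n i) hB fun z =>
      (ENNReal.le_tsum n).trans (hsum i z)]
    congr 1; funext z
    rw [tr, Finset.mul_sum]
    exact Finset.sum_congr rfl fun i _ => by ring
  simp_rw [e1, e2]
  rw [integral_finsetSum _ fun i _ => hint i (Measurable.tsum fun n => hgm n i) hB fun z =>
    enorm_tsum_le.trans (hsum i z), Summable.tsum_finsetSum fun i _ => summable_of_tsum_enorm
      (ne_top_of_le_ne_top (mul_ne_top (hk i).2.ne hB) (key i).2)]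
  exact Finset.sum_congr rfl fun i _ => (key i).1

/-- The pairing of the blocks of the transport term sums to the pairing of the transport term. -/
lemma Par.tsum_pairing_trS (h : Par d p γ β δ κ τ) {K : ℝ≥0} {μ : ℝ} (hμ : 0 ≤ μ)
    {b : Fin d → ℝ → Phase d → ℂ} {M : ℝ≥0} {u : ℝ → Phase d → ℂ}
    (hb : Drift D p γ β τ K b) (hu : Evol D p γ (κ + δ) τ μ M u) {s : ℝ} (hs : s ∈ Icc 0 τ)
    (φ : Test d) : ∑' l, ∫ z, φ z * trS D b u l s z = ∫ z, φ z * tr D b u s z := by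
  obtain ⟨C, hC⟩ := h.exists_tr_le D
  obtain ⟨C', hC'⟩ := h.exists_src_trS D
  obtain ⟨B, hB, hB'⟩ := (hC' hb hu).exists_tsum_pairing_le h.adm h.hγ hμ (by
    have := h.two_add_pos; have := al_nonneg (d := d) (p := p); linarith) φ
  exact tsum_integral_T_phi D (hC hb s (hu.tame s hs) (hu.lt_top hs)).1 φ
    (summable_of_tsum_enorm (ne_top_of_le_ne_top hB (hB' s)))

lemma Src.exists_tsum_pairing_bound (D : LP d) (hp : Adm p) (hγ : 0 < γ) (hδ : 0 < 6 + δ)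
    {μ : ℝ} (hμ : 0 ≤ μ) (φ : Test d) : ∃ C : ℝ≥0, ∀ {M : ℝ≥0} {H : ℕ → ℝ → Phase d → ℂ},
      Src D p γ δ τ μ M H → ∀ s ∈ Icc 0 τ, ∑' l, ‖∫ z, φ z * H l s z‖ₑ ≤ C * M := by
  obtain ⟨C, hC⟩ := Src.exists_pairing_le D p hp φ
  have h1 : geo (γ / 3) < ⊤ := tsum_pw_neg_lt_top (by positivity)
  have h2 : geo (6 + δ) < ⊤ := tsum_pw_neg_lt_top hδ
  refine ⟨C * ((geo (6 + δ)).toNNReal * ((geo (γ / 3)).toNNReal *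
    (Real.exp (μ * τ)).toNNReal)), fun {M H} hH s hs => ?_⟩
  have h3 : ENNReal.ofReal (Real.exp (μ * s)) ≤ ENNReal.ofReal (Real.exp (μ * τ)) := by
    gcongr
    exact hs.2
  refine (ENNReal.tsum_le_tsum fun l => hC hH l s).trans ?_
  rw [ENNReal.tsum_mul_left, ENNReal.tsum_mul_right]
  push_cast
  rw [coe_toNNReal h1.ne, coe_toNNReal h2.ne, ← ENNReal.ofReal]
  simp only [mul_assoc]
  refine mul_le_mul_right (mul_le_mul_right (mul_le_mul_right (mul_le_mul_left h3 _) _) _) _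

/-- The weak formulation satisfied by the sum of the Neumann series. -/
lemma Par.sol_weak (h : Par d p γ β δ κ τ) {K : ℝ≥0} {μ lam : ℝ}
    {b : Fin d → ℝ → Phase d → ℂ} {M : ℝ≥0} {H : ℕ → ℝ → Phase d → ℂ}
    (hb : Drift D p γ β τ K b) (g : Geom D p γ δ τ μ lam b M H) (φ : Test d) {t : ℝ}
    (ht : t ∈ Icc 0 τ) : ∫ z, φ z * sol D b lam H t z =
      ∫ s in Ioo 0 t, (((∑' l, ∫ z, φ z * H l s z) + ∫ z, φ z * tr D b (sol D b lam H) s z)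
        + ∫ z, adjS lam φ z * sol D b lam H s z) := by
  set u : ℕ → ℝ → Phase d → ℂ := fun n => mild lam (iter D b lam H n) with hu
  set q : ℕ → ℝ → ℂ := fun n s => ∑' l, ∫ z, φ z * iter D b lam H n l s z with hq
  obtain ⟨Cu, hCu⟩ := h.exists_term_le D μ
  have hδ6 : 0 < 6 + δ := by
    have := h.two_add_pos; have := al_nonneg (d := d) (p := p); linarith
  obtain ⟨Cq, hCq⟩ := Src.exists_tsum_pairing_bound (τ := τ) D h.adm h.hγ hδ6 g.hμ0 φ
  have hIcc : ∀ s ∈ Ioo 0 t, s ∈ Icc 0 τ := fun s hs => ⟨hs.1.le, hs.2.le.trans ht.2⟩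
  have hum : ∀ n s, Measurable (u n s) := fun n s => (g.measurable_term n).of_uncurry_left
  have hqm : ∀ n, Measurable (q n) := fun n => Measurable.tsum fun l =>
    measurable_pairing ((g.src n).meas l) φ
  have ham : ∀ n, Measurable fun s => ∫ z, adjS lam φ z * u n s z := fun n =>
    measurable_pairing (g.measurable_term n) _
  have hqb : ∀ n, ∀ s ∈ Icc 0 τ, ‖q n s‖ₑ ≤ Cq * (M / 2 ^ n : ℝ≥0) := fun n s hs =>
    enorm_tsum_le.trans (hCq (g.src n) s hs)
  set A : ℝ≥0 := (∫⁻ z, ‖adjS lam φ z‖ₑ).toNNReal with hA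
  have hA' : (A : ℝ≥0∞) = ∫⁻ z, ‖adjS lam φ z‖ₑ :=
    coe_toNNReal (adjS lam φ).integrable.2.ne
  have hab : ∀ n, ∀ s ∈ Icc 0 τ, ‖∫ z, adjS lam φ z * u n s z‖ₑ ≤
      (A * Cu : ℝ≥0) * (M / 2 ^ n : ℝ≥0) := fun n s hs => by
    refine (enorm_integral_le_lintegral_enorm _).trans ?_
    rw [ENNReal.coe_mul, hA', mul_assoc, ← lintegral_mul_const' _ _ (mul_ne_top
      coe_ne_top coe_ne_top)]
    refine lintegral_mono fun z => ?_
    rw [enorm_mul]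
    exact mul_le_mul_right (hCu g s hs n z) _
  have hbdd : ∀ {f : ℝ → ℂ} {B : ℝ≥0}, Measurable f → (∀ s ∈ Icc 0 τ, ‖f s‖ₑ ≤ B) →
      IntegrableOn f (Ioo 0 t) := fun {f B} hf hB => by
    refine Measure.integrableOn_of_bounded (M := B) (by simp) hf.aestronglyMeasurable
      ((ae_restrict_iff' measurableSet_Ioo).2 (.of_forall fun s hs => ?_))
    have := hB s (hIcc s hs)
    rwa [enorm_le_coe] at this
  have hterm : ∀ n, ∫ z, φ z * u n t z =
      ∫ s in Ioo 0 t, (q n s + ∫ z, adjS lam φ z * u n s z) := fun n => by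
    rw [integral_add (hbdd (hqm n) (B := Cq * (M / 2 ^ n)) (by simpa using hqb n))
      (hbdd (ham n) (B := A * Cu * (M / 2 ^ n)) (by simpa using hab n))]
    exact (g.src n).mild_weak h.adm h.hγ g.hμ0 g.hl g.hν h.two_add_pos φ ht
  have hsol : ∀ (ψ : Test d), ∀ s ∈ Icc 0 τ, ∫ z, ψ z * sol D b lam H s z =
      ∑' n, ∫ z, ψ z * u n s z := fun ψ s hs =>
    (pairing_tsum ψ.integrable (fun n => hum n s) (tsum_mul_div_two_pow_ne_top Cu M)
      (.of_forall fun z => ENNReal.tsum_le_tsum fun n => hCu g s hs n z)).1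
  rw [hsol φ t ht]
  simp_rw [hterm]
  have hsw := (pairing_tsum (ν := volume.restrict (Ioo 0 t)) (k := fun _ => (1 : ℂ))
    (integrable_const _) (g := fun n s => q n s + ∫ z, adjS lam φ z * u n s z)
    (fun n => (hqm n).add (ham n)) (tsum_mul_div_two_pow_ne_top (Cq + A * Cu) M)
    ((ae_restrict_iff' measurableSet_Ioo).2 (.of_forall fun s hs =>
      ENNReal.tsum_le_tsum fun n => (enorm_add_le _ _).trans ((add_le_add
        (hqb n s (hIcc s hs)) (hab n s (hIcc s hs))).trans (le_of_eq (by
          push_cast; ring)))))).1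
  simp only [one_mul] at hsw
  rw [← hsw]
  refine setIntegral_congr_fun measurableSet_Ioo fun s hs => ?_
  have hs' := hIcc s hs
  have hqs : Summable fun n => q n s := summable_of_tsum_enorm (ne_top_of_le_ne_top
    (tsum_mul_div_two_pow_ne_top Cq M) (ENNReal.tsum_le_tsum fun n => hqb n s hs'))
  have has : Summable fun n => ∫ z, adjS lam φ z * u n s z := summable_of_tsum_enorm
    (ne_top_of_le_ne_top (tsum_mul_div_two_pow_ne_top (A * Cu) M)
      (ENNReal.tsum_le_tsum fun n => hab n s hs'))
  rw [hqs.tsum_add has, ← hsol _ s hs', hqs.tsum_eq_zero_add, h.integral_tr_sol hb g hs' φ]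
  obtain ⟨Ce, hCe⟩ := h.exists_evol_mild D
  congr 2
  refine tsum_congr fun n => ?_
  exact h.tsum_pairing_trS g.hμ0 hb (hCe (g.src n) g.hμ0 g.hl g.hν h.κ_mem) hs' φ

end

/-! ### Drifts and sources at almost every time -/

lemma exists_good_times {τ : ℝ} {P : ℝ → Prop} (h : ∀ᵐ s ∂(volume.restrict (Icc 0 τ)), P s) :
    ∃ S : Set ℝ, MeasurableSet S ∧ S ⊆ Icc 0 τ ∧ (∀ s ∈ S, P s) ∧
      ∀ᵐ s ∂(volume.restrict (Icc 0 τ)), s ∈ S := by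
  obtain ⟨S, hS, hSm, hSP⟩ := h.exists_measurable_mem
  refine ⟨S ∩ Icc 0 τ, hSm.inter measurableSet_Icc, inter_subset_right, fun s hs => hSP s hs.1, ?_⟩
  filter_upwards [hS, ae_restrict_mem measurableSet_Icc] with s h1 h2 using ⟨h1, h2⟩

lemma ae_le_of_supT_le {τ : ℝ} {n : ℝ → ℝ≥0∞} {K : ℝ≥0∞} (h : supT τ n ≤ K) :
    ∀ᵐ s ∂(volume.restrict (Icc 0 τ)), n s ≤ K := by
  filter_upwards [ENNReal.ae_le_essSup n] with s hs using hs.trans h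

section
variable (D : LP d) {γ s : ℝ}

/-- A component of a function in a Besov space of positive order is bounded in the norm of the
densities of the blocks. -/
lemma exists_bn_le_ofFun (hp : Adm p) (hγ : 0 < γ) (hs : 0 < s) : ∃ C : ℝ≥0, ∀ {F : Type}
    [NormedAddCommGroup F] [NormedSpace ℂ F] [CompleteSpace F] {L : F →L[ℂ] ℂ}
    (_ : ∀ x, ‖L x‖ₑ ≤ ‖x‖ₑ) {g : Phase d → F}, Measurable (fun z => L (g z)) →
    ofFun (besovMixed D.χ D.χx p γ s) g < ⊤ → Tame (fun z => L (g z)) ∧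
      bn D p γ s (fun z => L (g z)) ≤ C * ofFun (besovMixed D.χ D.χx p γ s) g := by
  obtain ⟨C, hC⟩ := exists_bnorm_dens_le D hp
  refine ⟨C, fun {F} _ _ _ {L} hL {g} hg hfin => ?_⟩
  obtain ⟨Φ, hΦ, e⟩ := exists_represents_of_ofFun_lt hfin
  rw [e] at hfin ⊢
  obtain ⟨hbd, hle⟩ := hC hL hfin
  have h1 : geo (γ / 3) < ⊤ := tsum_pw_neg_lt_top (by positivity)
  have hb : bnorm p γ s (fun k j => dens L Φ (D.mulX k (D.phi j))) < ⊤ :=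
    hle.trans_lt (mul_lt_top coe_lt_top hfin)
  have hsum : ∑' j, mx p (fun z => ‖dens L Φ (D.phi j) z‖ₑ) < ⊤ := by
    refine (ENNReal.tsum_le_tsum fun j => mx_dens_phi_le D hp hbd (γ := γ) (s := s) j).trans_lt ?_
    rw [ENNReal.tsum_mul_right]
    exact mul_lt_top (tsum_pw_neg_lt_top hs) (mul_lt_top h1 hb)
  have hae := recon_fun D hp hΦ hbd.tame hbd.repr hsum
  refine ⟨Tame.of_mx hp hg ?_, ?_⟩
  · rw [mx_congr_ae (H := fun z => ‖∑' j, dens L Φ (D.phi j) z‖ₑ) (by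
      filter_upwards [hae] with z hz
      rw [hz])]
    exact (mx_tsum_dens_le D hp hbd.tame).trans_lt hsum
  · unfold bn
    simp_rw [hΦ.T_eq L]
    exact hle

/-- A drift in `L^∞_T` of the mixed Besov space agrees at almost every time with a family for which
the bounds hold at every time. -/
lemma exists_drift (hp : Adm p) (hγ : 0 < γ) (hs : 0 < s) : ∃ C : ℝ≥0, ∀ {τ : ℝ} {K : ℝ≥0}
    {b : ℝ → Phase d → Vec d}, Measurable (fun q : ℝ × Phase d => b q.1 q.2) →
    supT τ (fun t => ofFun (besovMixed D.χ D.χx p γ s) (cplxVec (b t))) ≤ K →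
    ∃ bI : Fin d → ℝ → Phase d → ℂ, Drift D p γ s τ (C * K) bI ∧
      (∀ i s z, (bI i s z).im = 0) ∧
      ∀ᵐ s ∂(volume.restrict (Icc 0 τ)), ∀ i z, bI i s z = (b s z i : ℂ) := by
  classical
  obtain ⟨C, hC⟩ := exists_bn_le_ofFun D hp hγ hs
  refine ⟨C, fun {τ K b} hb hK => ?_⟩
  obtain ⟨S, hSm, hSI, hSP, hSae⟩ := exists_good_times (ae_le_of_supT_le hK)
  have hbm : ∀ i, Measurable fun q : ℝ × Phase d => (b q.1 q.2 i : ℂ) := fun i =>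
    Complex.measurable_ofReal.comp ((EuclideanSpace.proj (𝕜 := ℝ) i).continuous.measurable.comp hb)
  have key : ∀ i, ∀ s' ∈ S, Tame (fun z => (b s' z i : ℂ)) ∧
      bn D p γ s (fun z => (b s' z i : ℂ)) ≤ (C * K : ℝ≥0) := fun i s' hs' => by
    have h1 := hC (L := (EuclideanSpace.proj i : EuclideanSpace ℂ (Fin d) →L[ℂ] ℂ))
      (fun x => by
        rw [← ofReal_norm, ← ofReal_norm]
        exact ofReal_le_ofReal (PiLp.norm_apply_le x i))
      (g := cplxVec (b s')) ((hbm i).comp measurable_prodMk_left)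
      ((hSP s' hs').trans_lt coe_lt_top)
    refine ⟨h1.1, h1.2.trans ?_⟩
    rw [ENNReal.coe_mul]
    exact mul_le_mul_right (hSP s' hs') _
  refine ⟨fun i s' z => if s' ∈ S then (b s' z i : ℂ) else 0, ⟨fun i => ?_, fun i s' => ?_,
    fun i s' hs' => ?_, fun i s' => ?_⟩, fun i s' z => ?_, ?_⟩
  · exact Measurable.ite (measurable_fst hSm) (hbm i) measurable_const
  · by_cases h : s' ∈ S
    · simpa only [h, if_true] using (key i s' h).1
    · simpa only [h, if_false] using tame_zero
  · funext z
    exact if_neg fun h => hs' (hSI h)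
  · by_cases h : s' ∈ S
    · simpa only [h, if_true] using (key i s' h).2
    · simp only [h, if_false]
      rw [bn_zero D hp]; exact zero_le
  · by_cases h : s' ∈ S <;> simp [h]
  · filter_upwards [hSae] with s' hs' i z using if_pos hs'

/-- The blocks of a forcing in `L^∞_T` of the mixed Besov space. -/
lemma exists_source (hp : Adm p) {δ : ℝ} : ∃ C : ℝ≥0, ∀ {τ : ℝ} {M : ℝ≥0}
    {f : ℝ → Temp d ℂ}, IsForcing τ f →
    supT τ (fun t => besovMixed D.χ D.χx p γ δ (f t)) ≤ M →
    ∃ H : ℕ → ℝ → Phase d → ℂ, Src D p γ δ τ 0 (C * M) H ∧ (∀ l s z, (H l s z).im = 0) ∧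
      ∀ᵐ s ∂(volume.restrict (Icc 0 τ)), ∀ l φ, ∫ z, φ z * H l s z = f s (TS (D.phi l) φ) := by
  classical
  obtain ⟨C, hC⟩ := exists_bnorm_dens_le D hp
  refine ⟨C, fun {τ M f} hf hM => ?_⟩
  set L := ContinuousLinearMap.id ℂ ℂ with hL
  set w : ℕ → Phase d := TopologicalSpace.denseSeq (Phase d) with hw
  -- measurable versions of the blocks, at a dense sequence of points
  have hgw : ∀ l n, AEMeasurable (fun s => f s (reflAt (ker (D.phi l)) (w n)))
      (volume.restrict (Icc 0 τ)) := fun l n => hf.1 _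
  have hall : ∀ᵐ s ∂(volume.restrict (Icc 0 τ)), (besovMixed D.χ D.χx p γ δ (f s) ≤ M ∧
      IsRealDist (f s)) ∧ ∀ l n, f s (reflAt (ker (D.phi l)) (w n)) = (hgw l n).mk _ s := by
    filter_upwards [ae_le_of_supT_le hM, hf.2, ae_all_iff.2 fun l => ae_all_iff.2 fun n =>
      (hgw l n).ae_eq_mk] with s h1 h2 h3 using ⟨⟨h1, h2⟩, h3⟩
  obtain ⟨S, hSm, hSI, hSP, hSae⟩ := exists_good_times hall
  have hbd : ∀ s ∈ S, BlockData D p L (f s) ∧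
      bnorm p γ δ (fun k j => dens L (f s) (D.mulX k (D.phi j))) ≤ (C * M : ℝ≥0) := fun s hs => by
    have h1 := hC (L := L) (fun x => le_rfl) (Φ := f s) (γ := γ) (s := δ)
      ((hSP s hs).1.1.trans_lt coe_lt_top)
    refine ⟨h1.1, h1.2.trans ?_⟩
    rw [ENNReal.coe_mul]
    exact mul_le_mul_right (hSP s hs).1.1 _
  set H : ℕ → ℝ → Phase d → ℂ := fun l s z => if s ∈ S then dens L (f s) (D.phi l) z else 0 with hH
  have hHS : ∀ l, ∀ s ∈ S, H l s = dens L (f s) (D.phi l) := fun l s hs => by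
    funext z; exact if_pos hs
  have hH0 : ∀ l, ∀ s ∉ S, H l s = fun _ => 0 := fun l s hs => by
    funext z; exact if_neg hs
  have htame : ∀ l s, Tame (H l s) := fun l s => by
    by_cases h : s ∈ S
    · rw [hHS l s h]; exact (hbd s h).1.tame l
    · rw [hH0 l s h]; exact tame_zero
  have hpsi : ∀ l s, T (D.psi l) (H l s) = H l s := fun l s => by
    by_cases h : s ∈ S
    · rw [hHS l s h, (hbd s h).1.T_dens, D.mulS_psi_phi]
    · rw [hH0 l s h, T_zero_fun]
  have hcont : ∀ l s, Continuous (H l s) := fun l s => by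
    rw [← hpsi l s]; exact continuous_T _ (htame l s)
  have hmw : ∀ l n, Measurable fun s => H l s (w n) := fun l n => by
    have e : (fun s => H l s (w n)) = fun s => if s ∈ S then (hgw l n).mk _ s else 0 := by
      funext s
      by_cases h : s ∈ S
      · simp only [hH, h, if_true]
        exact (hSP s h).2 l n
      · simp only [hH, h, if_false]
    rw [e]
    exact Measurable.ite hSm (hgw l n).measurable_mk measurable_const
  have hmz : ∀ l z, Measurable fun s => H l s z := fun l z => by
    obtain ⟨x, hx, hxz⟩ := mem_closure_iff_seq_limit.1
      ((TopologicalSpace.denseRange_denseSeq (Phase d)).closure_range ▸ mem_univ z)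
    refine measurable_of_tendsto_metrizable (f := fun n s => H l s (x n)) (fun n => ?_)
      (tendsto_pi_nhds.2 fun s => ((hcont l s).tendsto z).comp hxz)
    obtain ⟨k, hk⟩ := hx n
    rw [← hk]
    exact hmw l k
  refine ⟨H, ⟨fun l => ?_, htame, hpsi, fun l s hs => hH0 l s fun h => hs (hSI h), fun s => ?_⟩,
    fun l s z => ?_, ?_⟩
  · exact (measurable_uncurry_of_continuous_of_measurable (u := fun z s => H l s z)
      (fun s => hcont l s) (hmz l)).comp measurable_swap
  · by_cases h : s ∈ S
    · have e : (fun k l => T (D.mulX k (D.psi l)) (H l s)) =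
          fun k j => dens L (f s) (D.mulX k (D.phi j)) := by
        funext k l
        rw [hHS l s h, (hbd s h).1.T_dens, ← D.mulX_mulS, D.mulS_psi_phi]
      rw [e]
      simpa using (hbd s h).2
    · have e : ∀ k l, T (D.mulX k (D.psi l)) (H l s) = fun _ => 0 := fun k l => by
        rw [hH0 l s h, T_zero_fun]
      simp_rw [bnorm, e]
      simp [mx_zero hp]
  · by_cases h : s ∈ S
    · rw [hHS l s h]
      exact (hSP s h).1.2 _ fun y => by
        rw [reflAt_apply]; exact (D.herm_phi l).ker_im _
    · rw [hH0 l s h]; rfl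
  · filter_upwards [hSae] with s hs l φ
    rw [hHS l s hs]
    exact ((hbd s hs).1.repr l φ).symm

end

/-! ### The Neumann series is a weak solution -/

lemma im_tr (D : LP d) {b : Fin d → ℝ → Phase d → ℂ} (hb : ∀ i s z, (b i s z).im = 0)
    {u : ℝ → Phase d → ℂ} (hu : ∀ s z, (u s z).im = 0) (s : ℝ) (z : Phase d) :
    (tr D b u s z).im = 0 := by
  rw [tr, Complex.im_sum]
  refine Finset.sum_eq_zero fun i _ => ?_
  rw [Complex.mul_im, hb, im_gradF D i (hu s)]
  simp

lemma im_iter (D : LP d) {b : Fin d → ℝ → Phase d → ℂ} (hb : ∀ i s z, (b i s z).im = 0) (lam : ℝ)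
    {H : ℕ → ℝ → Phase d → ℂ} (hH : ∀ l s z, (H l s z).im = 0) (n l : ℕ) (s : ℝ) (z : Phase d) :
    (iter D b lam H n l s z).im = 0 := by
  induction n generalizing l s z with
  | zero => exact hH l s z
  | succ n ih =>
    exact (D.herm_phi l).T_im (fun w => im_tr D hb (im_mild lam ih) s w) z

lemma im_sol (D : LP d) {b : Fin d → ℝ → Phase d → ℂ} (hb : ∀ i s z, (b i s z).im = 0) (lam : ℝ)
    {H : ℕ → ℝ → Phase d → ℂ} (hH : ∀ l s z, (H l s z).im = 0) (t : ℝ) (z : Phase d) :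
    (sol D b lam H t z).im = 0 :=
  im_tsum_eq_zero fun n => im_mild lam (im_iter D hb lam hH n) t z

lemma ae_Ioo_of_ae_Icc {τ t : ℝ} (ht : t ≤ τ) {P : ℝ → Prop}
    (h : ∀ᵐ s ∂(volume.restrict (Icc 0 τ)), P s) : ∀ᵐ s ∂(volume.restrict (Ioo 0 t)), P s :=
  ae_mono (Measure.restrict_mono (Ioo_subset_Icc_self.trans (Icc_subset_Icc_right ht)) le_rfl) h

lemma measurable_inner_vec : Measurable fun q : Vec d × Vec d => (inner ℝ q.1 q.2 : ℝ) :=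
  (continuous_fst.inner continuous_snd).measurable

section
variable {D : LP d} {γ β δ κ τ : ℝ}

lemma Par.evol_sol (h : Par d p γ β δ κ τ) {μ lam : ℝ} {b : Fin d → ℝ → Phase d → ℂ} {M : ℝ≥0}
    {H : ℕ → ℝ → Phase d → ℂ} (g : Geom D p γ δ τ μ lam b M H) :
    ∃ M', Evol D p γ (κ + δ) τ 0 M' (sol D b lam H) := by
  obtain ⟨C, hC⟩ := h.exists_bn_sol_le D
  obtain ⟨C', hC'⟩ := h.exists_sol_le D μ
  refine ⟨C * (((lam + μ) ^ ((κ - 2) / 2)).toNNReal * ((Real.exp (μ * τ)).toNNReal * M)),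
    g.measurable_sol, fun s hs => (hC' g s hs).2.1, fun s hs => (hC g h.κ_mem s hs).trans
      (le_of_eq ?_)⟩
  rw [zero_mul, Real.exp_zero, ENNReal.ofReal_one, one_mul, ENNReal.ofReal, ENNReal.ofReal]
  push_cast
  rfl

/-- The transport term is integrable against Schwartz functions, uniformly in time. -/
lemma Par.exists_lintegral_tr_le (h : Par d p γ β δ κ τ) {K M : ℝ≥0} {μ : ℝ} (hμ : 0 ≤ μ)
    {b : Fin d → ℝ → Phase d → ℂ} {u : ℝ → Phase d → ℂ} (hb : Drift D p γ β τ K b)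
    (hu : Evol D p γ (κ + δ) τ μ M u) (φ : Test d) :
    ∃ B : ℝ≥0, ∀ s ∈ Icc 0 τ, ∫⁻ z, ‖φ z * tr D b u s z‖ₑ ≤ B := by
  obtain ⟨Cg, hCg⟩ := exists_enorm_gradF_le D h.adm h.hγ h.grad
  obtain ⟨Cm, hCm⟩ := exists_mx_le D (p := p) h.adm h.hγ h.hβ
  have hφ : mx (conjPair p) (fun z => ‖φ z‖ₑ) < ⊤ := mx_schwartz_lt_top h.adm.conj φ
  set E : ℝ≥0 := Cg * ((Real.exp (μ * τ)).toNNReal * M) with hE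
  refine ⟨d * (E * (Cm * K * (mx (conjPair p) (fun z => ‖φ z‖ₑ)).toNNReal)), fun s hs => ?_⟩
  have hG : ∀ i z, ‖gradF D i (u s) z‖ₑ ≤ E := fun i z => by
    refine (hCg i (hu.tame s hs) z).2.trans ((mul_le_mul_right (hu.bound s hs) _).trans ?_)
    rw [hE, ENNReal.ofReal]
    push_cast
    gcongr
    exact hs.2
  have h1 : ∀ z, ‖φ z * tr D b u s z‖ₑ ≤ ∑ i, E * (‖b i s z‖ₑ * ‖φ z‖ₑ) := fun z => by
    rw [tr, Finset.mul_sum]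
    refine (enorm_sum_le _ _).trans (Finset.sum_le_sum fun i _ => ?_)
    rw [enorm_mul, enorm_mul]
    calc _ = ‖gradF D i (u s) z‖ₑ * (‖b i s z‖ₑ * ‖φ z‖ₑ) := by ring
      _ ≤ _ := mul_le_mul_left (hG i z) _
  refine (lintegral_mono h1).trans ?_
  have hbm : ∀ i, Measurable fun z => ‖b i s z‖ₑ * ‖φ z‖ₑ := fun i =>
    (hb.tame i s).meas.enorm.mul φ.continuous.measurable.enorm
  rw [lintegral_finsetSum _ fun i _ => (hbm i).const_mul _]
  have h2 : ∀ i, ∫⁻ z, E * (‖b i s z‖ₑ * ‖φ z‖ₑ) ≤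
      E * (Cm * K * mx (conjPair p) (fun z => ‖φ z‖ₑ)) := fun i => by
    rw [lintegral_const_mul _ (hbm i)]
    refine mul_le_mul_right ((lintegral_mul_le_mx h.adm (hb.tame i s).meas.enorm
      φ.continuous.measurable.enorm).trans (mul_le_mul_left ?_ _)) _
    exact (hCm (hb.tame i s) ((hb.bound i s).trans_lt coe_lt_top)).trans
      (mul_le_mul_right (hb.bound i s) _)
  refine (Finset.sum_le_sum fun i _ => h2 i).trans (le_of_eq ?_)
  rw [Finset.sum_const, Finset.card_univ, Fintype.card_fin, nsmul_eq_mul]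
  push_cast
  rw [coe_toNNReal hφ.ne]

/-- The gradient of the solution as a real vector field. -/
def gradV (D : LP d) (u : ℝ → Phase d → ℂ) (s : ℝ) (z : Phase d) : Vec d :=
  WithLp.toLp 2 fun i => (gradF D i (u s) z).re

lemma measurable_gradV {u : ℝ → Phase d → ℂ} (hu : Measurable fun q : ℝ × Phase d => u q.1 q.2) :
    Measurable fun q : ℝ × Phase d => gradV D u q.1 q.2 := by
  refine (PiLp.continuous_toLp 2 (fun _ : Fin d => ℝ)).measurable.comp (measurable_pi_lambda _
    fun i => Complex.measurable_re.comp (measurable_gradF D i (g := u) hu))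

lemma coe_gradV {u : ℝ → Phase d → ℂ} (hu : ∀ s z, (u s z).im = 0) (s : ℝ) (z : Phase d)
    (i : Fin d) : (gradV D u s z i : ℂ) = gradF D i (u s) z :=
  Complex.ext rfl (by simp [im_gradF D i (hu s)])

lemma coe_inner_gradV {b : Vec d} {bI : Fin d → ℝ → Phase d → ℂ} {u : ℝ → Phase d → ℂ}
    (hu : ∀ s z, (u s z).im = 0) {s : ℝ} {z : Phase d} (hb : ∀ i, bI i s z = (b i : ℂ)) :
    ((inner ℝ b (gradV D u s z) : ℝ) : ℂ) = tr D bI u s z := by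
  rw [tr, PiLp.inner_apply, Complex.ofReal_sum]
  refine Finset.sum_congr rfl fun i _ => ?_
  rw [hb, ← coe_gradV hu]
  simp [mul_comm]

lemma Par.isWeakGradV (h : Par d p γ β δ κ τ) {M : ℝ≥0} {μ : ℝ} {u : ℝ → Phase d → ℂ}
    (hu : Evol D p γ (κ + δ) τ μ M u) (hur : ∀ s z, (u s z).im = 0) {s : ℝ} (hs : s ∈ Icc 0 τ) :
    IsWeakGradV (fun z => (u s z).re) (gradV D u s) := by
  have ht := hu.tame s hs
  obtain ⟨C, hC⟩ := exists_enorm_gradF_le D h.adm h.hγ h.grad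
  have hfin : C * bn D p γ (κ + δ) (u s) ≠ ⊤ :=
    mul_ne_top coe_ne_top (hu.lt_top hs).ne
  refine ⟨ht.locallyIntegrable.mono (Complex.measurable_re.comp ht.meas).aestronglyMeasurable
    (.of_forall fun z => Complex.abs_re_le_norm _), ?_, fun φ _ i => ?_⟩
  · refine (locallyIntegrable_const (d * (C * bn D p γ (κ + δ) (u s)).toReal)).mono
      ((measurable_gradV hu.meas).of_uncurry_left).aestronglyMeasurable
      (.of_forall fun z => ?_)
    rw [Real.norm_of_nonneg (by positivity), EuclideanSpace.norm_eq]
    have h1 : ∀ i, ‖gradV D u s z i‖ ≤ (C * bn D p γ (κ + δ) (u s)).toReal := fun i => by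
      have h2 := (hC i ht z).2
      rw [← ofReal_norm] at h2
      exact (Complex.abs_re_le_norm _).trans ((ENNReal.ofReal_le_iff_le_toReal hfin).1 h2)
    refine Real.sqrt_le_iff.2 ⟨by positivity, ?_⟩
    refine (Finset.sum_le_sum fun i _ => pow_le_pow_left₀ (norm_nonneg _) (h1 i) 2).trans ?_
    rw [Finset.sum_const, Finset.card_univ, Fintype.card_fin, nsmul_eq_mul, mul_pow]
    refine mul_le_mul_of_nonneg_right ?_ (by positivity)
    have : d ≤ d ^ 2 := Nat.le_self_pow two_ne_zero d
    exact_mod_cast this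
  · have h1 := integral_lineDeriv_mul_eq_neg D h.adm i h.hγ h.grad ht (hu.lt_top hs) φ
    have e1 : ∀ z, ((u s z).re : ℂ) = u s z := fun z => Complex.ext rfl (by simp [hur s z])
    simp_rw [e1, coe_gradV hur]
    simp_rw [mul_comm (u s _), mul_comm (gradF D i (u s) _)]
    exact h1

/-- The real part of the sum of the Neumann series is a weak solution. -/
lemma Par.isWeakSolution_sol (h : Par d p γ β δ κ τ) {K : ℝ≥0} {μ lam : ℝ}
    {bI : Fin d → ℝ → Phase d → ℂ} {M : ℝ≥0} {H : ℕ → ℝ → Phase d → ℂ}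
    (hb : Drift D p γ β τ K bI) (g : Geom D p γ δ τ μ lam bI M H)
    (hbr : ∀ i s z, (bI i s z).im = 0) (hHr : ∀ l s z, (H l s z).im = 0)
    {b : ℝ → Phase d → Vec d} (hbm : Measurable fun q : ℝ × Phase d => b q.1 q.2)
    (hbe : ∀ᵐ s ∂(volume.restrict (Icc 0 τ)), ∀ i z, bI i s z = (b s z i : ℂ))
    {f : ℝ → Temp d ℂ} (hf : IsForcing τ f)
    (hHe : ∀ᵐ s ∂(volume.restrict (Icc 0 τ)), ∀ l φ,
      ∫ z, φ z * H l s z = f s (TS (D.phi l) φ)) :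
    IsWeakSolution τ lam b f (fun t z => (sol D bI lam H t z).re) := by
  set u := sol D bI lam H with hu
  have hur : ∀ s z, (u s z).im = 0 := im_sol D hbr lam hHr
  have hue : ∀ s z, ((u s z).re : ℂ) = u s z := fun s z => Complex.ext rfl (by simp [hur s z])
  obtain ⟨M', hev⟩ := h.evol_sol g
  obtain ⟨Cs, hCs⟩ := h.exists_sol_le D μ
  have hum : Measurable fun q : ℝ × Phase d => u q.1 q.2 := hev.meas
  have hδ6 : 0 < 6 + δ := by
    have := h.two_add_pos; have := al_nonneg (d := d) (p := p); linarith
  -- the forcing is the sum of its blocks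
  have hfe : ∀ φ : Test d, ∃ B : ℝ≥0, ∀ᵐ s ∂(volume.restrict (Icc 0 τ)),
      ∑' l, ∫ z, φ z * H l s z = f s φ ∧ ‖f s φ‖ₑ ≤ B := fun φ => by
    obtain ⟨B, hB, hB'⟩ := (g.src 0).exists_tsum_pairing_le h.adm h.hγ g.hμ0 hδ6 φ
    refine ⟨B.toNNReal, ?_⟩
    filter_upwards [hHe] with s hs
    have h1 : ∑' l, ∫ z, φ z * H l s z = f s φ := by
      simp_rw [hs]
      refine tsum_TS_phi D (f s) φ (summable_of_tsum_enorm (ne_top_of_le_ne_top hB ?_))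
      simp_rw [← hs]
      exact hB' s
    refine ⟨h1, ?_⟩
    rw [← h1, coe_toNNReal hB]
    exact enorm_tsum_le.trans (hB' s)
  refine ⟨Complex.measurable_re.comp hum, gradV D u, measurable_gradV hum, ?_, fun φ hφ =>
    ⟨?_, ?_, ?_, fun t ht => ⟨?_, ?_⟩⟩⟩
  · filter_upwards [ae_restrict_mem measurableSet_Icc] with s hs
    exact h.isWeakGradV hev hur hs
  · simp_rw [hue]
    have h1 : Integrable (fun q : ℝ × Phase d => (1 : ℂ) * adjS lam φ q.2)
        ((volume.restrict (Icc 0 τ)).prod volume) :=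
      (integrable_const (1 : ℂ)).mul_prod (adjS lam φ).integrable
    have hae : ∀ᵐ q : ℝ × Phase d ∂((volume.restrict (Icc 0 τ)).prod volume), q.1 ∈ Icc 0 τ :=
      Measure.quasiMeasurePreserving_fst.ae (ae_restrict_mem measurableSet_Icc)
    refine (h1.bdd_mul (c := (Cs * M : ℝ≥0)) hum.aestronglyMeasurable ?_).congr ?_
    · filter_upwards [hae] with q hq
      have := (hCs g q.1 hq).2.2 q.2
      rwa [← ENNReal.coe_mul, enorm_le_coe] at this
    · refine .of_forall fun q => ?_
      simp only [one_mul, adjS_apply]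
  · have hm : Measurable fun q : ℝ × Phase d =>
        ((inner ℝ (b q.1 q.2) (gradV D u q.1 q.2) : ℝ) : ℂ) * φ q.2 :=
      (Complex.measurable_ofReal.comp (measurable_inner_vec.comp
        (hbm.prodMk (measurable_gradV hum)))).mul (φ.continuous.measurable.comp measurable_snd)
    obtain ⟨B, hB⟩ := h.exists_lintegral_tr_le le_rfl hb hev φ
    refine ⟨hm.aestronglyMeasurable, ?_⟩
    rw [hasFiniteIntegral_iff_enorm, lintegral_prod _ hm.enorm.aemeasurable]
    have h1 : ∀ᵐ s ∂(volume.restrict (Icc 0 τ)),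
        ∫⁻ z, ‖((inner ℝ (b s z) (gradV D u s z) : ℝ) : ℂ) * φ z‖ₑ ≤ B := by
      filter_upwards [hbe, ae_restrict_mem measurableSet_Icc] with s hs hs'
      refine le_trans (le_of_eq (lintegral_congr fun z => ?_)) (hB s hs')
      rw [coe_inner_gradV hur fun i => hs i z, mul_comm]
    refine (lintegral_mono_ae h1).trans_lt ?_
    rw [lintegral_const]
    refine mul_lt_top coe_lt_top ?_
    simp
  · obtain ⟨B, hB⟩ := hfe φ
    rw [intervalIntegrable_iff_integrableOn_Icc_of_le h.hτ]
    refine ⟨(hf.1 φ).aestronglyMeasurable, HasFiniteIntegral.of_bounded (C := B) ?_⟩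
    filter_upwards [hB] with s hs
    have := hs.2
    rwa [enorm_le_coe] at this
  · simp_rw [hue, mul_comm (u t _)]
    exact (hev.tame t ht).integrable_mul φ
  · obtain ⟨B, hB⟩ := hfe φ
    simp_rw [hue]
    rw [intervalIntegral.integral_of_le ht.1, integral_Ioc_eq_integral_Ioo]
    simp_rw [mul_comm (u t _)]
    rw [h.sol_weak hb g φ ht]
    refine integral_congr_ae ?_
    filter_upwards [ae_Ioo_of_ae_Icc ht.2 hB, ae_Ioo_of_ae_Icc ht.2 hbe] with s hs hbs
    rw [hs.1]
    have e1 : ∀ z, ((inner ℝ (b s z) (gradV D u s z) : ℝ) : ℂ) * φ z = φ z * tr D bI u s z :=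
      fun z => by rw [coe_inner_gradV hur fun i => hbs i z, mul_comm]
    have e2 : ∀ z, u s z * adjointOp lam φ z = adjS lam φ z * u s z := fun z => by
      rw [adjS_apply, mul_comm]
    simp_rw [e1, e2]
    ring

end

/-! ### Uniqueness of weak solutions -/

lemma locallyIntegrable_of_test (D : LP d) {g : Phase d → ℂ}
    (h : ∀ φ : Test d, HasCompactSupport φ → Integrable fun z => g z * φ z) :
    LocallyIntegrable g := fun x => by
  obtain ⟨n, hn⟩ := pow_unbounded_of_one_lt (gauge x) (one_lt_two : (1 : ℝ) < 2)
  have hc : HasCompactSupport (D.cut n : Phase d → ℂ) :=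
    hasCompactSupport_of_gauge (2 ^ (n + 1)) fun ξ hξ => D.cut_eq_zero hξ
  have ho : IsOpen {z : Phase d | gauge z < 2 ^ n} := isOpen_lt continuous_gauge continuous_const
  refine ⟨_, ho.mem_nhds hn, ((h _ hc).integrableOn).congr_fun (fun z hz => ?_) ho.measurableSet⟩
  simp only
  rw [D.cut_eq_one (le_of_lt hz), mul_one]

lemma integrable_ofReal_mul {g : Phase d → ℝ} (hg : LocallyIntegrable g) {φ : Phase d → ℂ}
    (hφ : Continuous φ) (hc : HasCompactSupport φ) : Integrable fun z => (g z : ℂ) * φ z := by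
  simpa only [Complex.real_smul] using hg.integrable_smul_right_of_hasCompactSupport hφ hc

lemma hasCompactSupport_lineDeriv {φ : Test d} (hφ : HasCompactSupport φ) (i : Fin d) :
    HasCompactSupport (lineDerivOp (eV i) φ : Test d) := by
  have e : ((lineDerivOp (eV i) φ : Test d) : Phase d → ℂ) =
      fun z => fderiv ℝ φ z (eV i) := funext fun z => SchwartzMap.lineDerivOp_apply_eq_fderiv _ _ _
  rw [e]
  exact hφ.fderiv_apply (𝕜 := ℝ) (eV i)

lemma locallyIntegrable_component {G : Phase d → Vec d} (hG : LocallyIntegrable G) (i : Fin d) :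
    LocallyIntegrable fun z => G z i :=
  hG.mono ((EuclideanSpace.proj (𝕜 := ℝ) i).continuous.comp_aestronglyMeasurable
    hG.aestronglyMeasurable) (.of_forall fun z => PiLp.norm_apply_le (G z) i)

lemma IsWeakGradV.sub {u₁ u₂ : Phase d → ℝ} {G₁ G₂ : Phase d → Vec d} (h₁ : IsWeakGradV u₁ G₁)
    (h₂ : IsWeakGradV u₂ G₂) : IsWeakGradV (fun z => u₁ z - u₂ z) (fun z => G₁ z - G₂ z) := by
  refine ⟨h₁.1.sub h₂.1, h₁.2.1.sub h₂.2.1, fun φ hφ i => ?_⟩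
  set ψ : Test d := lineDerivOp (eV i) φ with hψ
  have hψc : HasCompactSupport ψ := hasCompactSupport_lineDeriv hφ i
  have a₁ := integrable_ofReal_mul h₁.1 ψ.continuous hψc
  have a₂ := integrable_ofReal_mul h₂.1 ψ.continuous hψc
  have b₁ := integrable_ofReal_mul (locallyIntegrable_component h₁.2.1 i) φ.continuous hφ
  have b₂ := integrable_ofReal_mul (locallyIntegrable_component h₂.2.1 i) φ.continuous hφ
  have e1 : ∀ z, ((u₁ z - u₂ z : ℝ) : ℂ) * ψ z = (u₁ z : ℂ) * ψ z - (u₂ z : ℂ) * ψ z := fun z => by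
    rw [Complex.ofReal_sub, sub_mul]
  have e2 : ∀ z, (((G₁ z - G₂ z) i : ℝ) : ℂ) * φ z = (G₁ z i : ℂ) * φ z - (G₂ z i : ℂ) * φ z :=
    fun z => by rw [PiLp.sub_apply, Complex.ofReal_sub, sub_mul]
  have h3 := h₁.2.2 φ hφ i
  have h4 := h₂.2.2 φ hφ i
  rw [← hψ] at h3 h4
  clear_value ψ
  simp only [e1, e2]
  rw [integral_sub a₁ a₂, integral_sub b₁ b₂, h3, h4]
  ring

/-- The equation for the difference of two weak solutions. -/
lemma IsWeakSolution.exists_sub {τ lam : ℝ} {b : ℝ → Phase d → Vec d} {f : ℝ → Temp d ℂ}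
    {u₁ u₂ : ℝ → Phase d → ℝ} (h₁ : IsWeakSolution τ lam b f u₁)
    (h₂ : IsWeakSolution τ lam b f u₂) : ∃ G : ℝ → Phase d → Vec d,
      (∀ᵐ s ∂(volume.restrict (Icc 0 τ)), IsWeakGradV (fun z => u₁ s z - u₂ s z) (G s)) ∧
      ∀ φ : Test d, HasCompactSupport φ → ∀ t ∈ Icc 0 τ,
        Integrable (fun z => ((u₁ t z - u₂ t z : ℝ) : ℂ) * φ z) ∧
        ∫ z, ((u₁ t z - u₂ t z : ℝ) : ℂ) * φ z =
          ∫ s in Ioo 0 t, ((∫ z, ((u₁ s z - u₂ s z : ℝ) : ℂ) * adjointOp lam φ z) +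
            ∫ z, ((inner ℝ (b s z) (G s z) : ℝ) : ℂ) * φ z) := by
  obtain ⟨-, G₁, -, hG₁, H₁⟩ := h₁
  obtain ⟨-, G₂, -, hG₂, H₂⟩ := h₂
  refine ⟨fun s z => G₁ s z - G₂ s z, ?_, fun φ hφ t ht => ?_⟩
  · filter_upwards [hG₁, hG₂] with s a b using a.sub b
  obtain ⟨a₁, b₁, c₁, e₁⟩ := H₁ φ hφ
  obtain ⟨a₂, b₂, c₂, e₂⟩ := H₂ φ hφ
  have hI : ∀ z, ((u₁ t z - u₂ t z : ℝ) : ℂ) * φ z =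
      (u₁ t z : ℂ) * φ z - (u₂ t z : ℂ) * φ z := fun z => by push_cast; ring
  simp_rw [hI]
  refine ⟨(e₁ t ht).1.sub (e₂ t ht).1, ?_⟩
  rw [integral_sub (e₁ t ht).1 (e₂ t ht).1, (e₁ t ht).2, (e₂ t ht).2]
  have hτ : 0 ≤ τ := ht.1.trans ht.2
  have hsub : Ioo 0 t ⊆ Icc 0 τ := Ioo_subset_Icc_self.trans (Icc_subset_Icc_right ht.2)
  have hi : ∀ {A B : ℝ × Phase d → ℂ} {c : ℝ → ℂ},
      Integrable A ((volume.restrict (Icc 0 τ)).prod volume) →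
      Integrable B ((volume.restrict (Icc 0 τ)).prod volume) → IntervalIntegrable c volume 0 τ →
      IntegrableOn (fun s => ((∫ z, A (s, z)) + ∫ z, B (s, z)) + c s) (Ioo 0 t) :=
    fun {A B c} hA hB hc => by
      have h3 := (intervalIntegrable_iff_integrableOn_Icc_of_le hτ).1 hc
      have h4 : IntegrableOn (fun s => ((∫ z, A (s, z)) + ∫ z, B (s, z)) + c s) (Icc 0 τ) :=
        (hA.integral_prod_left.add hB.integral_prod_left).add h3
      exact h4.mono_set hsub
  rw [intervalIntegral.integral_of_le ht.1, intervalIntegral.integral_of_le ht.1,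
    integral_Ioc_eq_integral_Ioo, integral_Ioc_eq_integral_Ioo,
    ← integral_sub (hi a₁ b₁ c₁) (hi a₂ b₂ c₂)]
  refine integral_congr_ae (ae_Ioo_of_ae_Icc ht.2 ?_)
  filter_upwards [a₁.prod_right_ae, b₁.prod_right_ae, a₂.prod_right_ae, b₂.prod_right_ae] with
    s a₁ b₁ a₂ b₂
  have f1 : ∀ z, ((u₁ s z - u₂ s z : ℝ) : ℂ) * adjointOp lam φ z =
      (u₁ s z : ℂ) * adjointOp lam φ z - (u₂ s z : ℂ) * adjointOp lam φ z :=
    fun z => by push_cast; ring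
  have f2 : ∀ z, ((inner ℝ (b s z) (G₁ s z - G₂ s z) : ℝ) : ℂ) * φ z =
      ((inner ℝ (b s z) (G₁ s z) : ℝ) : ℂ) * φ z - ((inner ℝ (b s z) (G₂ s z) : ℝ) : ℂ) * φ z :=
    fun z => by rw [inner_sub_right]; push_cast; ring
  simp_rw [f1, f2]
  rw [integral_sub a₁ a₂, integral_sub b₁ b₂]
  ring

section
variable {D : LP d} {γ β δ κ τ : ℝ}

lemma bn_neg (D : LP d) {s : ℝ} (g : Phase d → ℂ) :
    bn D p γ s (fun z => -g z) = bn D p γ s g := by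
  have e : ∀ m z, T m (fun z => -g z) z = -T m g z := fun m z => by
    simpa using T_const_mul m (-1) g z
  simp [bn, bnorm, e]

/-- A bounded evolution `w` that solves the equation with vanishing forcing is the mild solution
with the transport term of `w` as source. -/
lemma Par.ae_eq_mild (h : Par d p γ β δ κ τ) {K M M' : ℝ≥0} {μ lam B : ℝ} (hμ : 0 < μ)
    (hl : 0 ≤ lam) {b : Fin d → ℝ → Phase d → ℂ} (hb : Drift D p γ β τ K b)
    {w : ℝ → Phase d → ℂ} (hw : BddMeas w B) (hev : Evol D p γ (κ + δ) τ μ M w)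
    (hsrc : Src D p γ δ τ μ M' (trS D b w))
    (hweak : ∀ᵐ s ∂(volume.restrict (Icc 0 τ)), ∀ φ : Test d, HasCompactSupport φ →
      ∫ z, φ z * w s z = ∫ σ in Ioo 0 s, ((∫ z, adjS lam φ z * w σ z) +
        ∫ z, φ z * tr D b w σ z)) :
    ∀ᵐ s ∂(volume.restrict (Icc 0 τ)), w s =ᵐ[volume] mild lam (trS D b w) s := by
  classical
  set m := mild lam (trS D b w) with hm
  have hν : 0 < lam + μ := by linarith
  obtain ⟨Cm, hCm⟩ := Src.norm_mild_bound (γ := γ) h.adm h.hγ h.hτ h.two_add_pos D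
  have hmb := hCm hsrc hμ.le hl hν
  set Bm : ℝ≥0 := Cm * ((Real.exp (μ * τ)).toNNReal * M') with hBm
  have hmb' : ∀ t ∈ Icc 0 τ, ∀ z, ‖m t z‖ ≤ Bm := fun t ht z => by
    have h1 : ‖m t z‖ₑ ≤ Bm := (hmb t ht z).trans (le_of_eq (by
      rw [hBm, ENNReal.ofReal]; push_cast; rfl))
    rwa [enorm_le_coe] at h1
  have hmm : Measurable fun q : ℝ × Phase d => m q.1 q.2 := measurable_mild lam hsrc.meas
  set m₀ : ℝ → Phase d → ℂ := fun s z => if s ∈ Icc 0 τ then m s z else 0 with hm₀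
  have hm₀e : ∀ s ∈ Icc 0 τ, m₀ s = m s := fun s hs => by funext z; exact if_pos hs
  have hm₀b : BddMeas m₀ Bm := by
    refine ⟨Measurable.ite (measurable_fst measurableSet_Icc) hmm measurable_const,
      fun s z => ?_⟩
    by_cases hs : s ∈ Icc 0 τ
    · rw [hm₀e s hs]; exact hmb' s hs z
    · simp only [hm₀, hs, if_false, norm_zero]; exact Bm.2
  set v : ℝ → Phase d → ℂ := fun s z => w s z - m₀ s z with hv
  have hvb : BddMeas v (B + Bm) := ⟨hw.meas.sub hm₀b.meas, fun s z =>
    (norm_sub_le _ _).trans (add_le_add (hw.bound s z) (hm₀b.bound s z))⟩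
  have hsplit : ∀ (φ : Test d) s, ∫ z, φ z * v s z = (∫ z, φ z * w s z) - ∫ z, φ z * m₀ s z :=
    fun φ s => by
      rw [← integral_sub ((hw.tame s).integrable_mul φ) ((hm₀b.tame s).integrable_mul φ)]
      congr 1; funext z
      rw [hv]; ring
  have hI : ∀ {s : ℝ}, s ∈ Icc 0 τ → ∀ σ ∈ Ioo 0 s, σ ∈ Icc 0 τ := fun hs σ hσ =>
    ⟨hσ.1.le, hσ.2.le.trans hs.2⟩
  have hvweak : ∀ᵐ s ∂(volume.restrict (Icc 0 τ)), ∀ φ : Test d,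
      ∫ z, φ z * v s z = ∫ σ in Ioo 0 s, ∫ z, adjS lam φ z * v σ z := by
    filter_upwards [hweak, ae_restrict_mem measurableSet_Icc] with s hs hsI
    refine weak_of_compactSupport D hvb fun φ hφ => ?_
    obtain ⟨Bt, hBt⟩ := h.exists_lintegral_tr_le hμ.le hb hev φ
    have i1 : IntegrableOn (fun σ => ∫ z, φ z * tr D b w σ z) (Ioo 0 s) := by
      refine Measure.integrableOn_of_bounded (M := Bt) (by simp)
        (measurable_pairing (measurable_tr D hb.meas hw.meas) φ).aestronglyMeasurable
        ((ae_restrict_iff' measurableSet_Ioo).2 (.of_forall fun σ hσ => ?_))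
      have h1 := (enorm_integral_le_lintegral_enorm _).trans (hBt σ (hI hsI σ hσ))
      rwa [enorm_le_coe] at h1
    have i2 : IntegrableOn (fun σ => ∫ z, adjS lam φ z * w σ z) (Ioo 0 s) :=
      hw.integrableOn_pairing _ (by simp)
    have i3 : IntegrableOn (fun σ => ∫ z, adjS lam φ z * m₀ σ z) (Ioo 0 s) :=
      hm₀b.integrableOn_pairing _ (by simp)
    have e1 := hsrc.mild_weak h.adm h.hγ hμ.le hl hν h.two_add_pos φ hsI
    rw [setIntegral_congr_fun measurableSet_Ioo (fun σ hσ =>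
      h.tsum_pairing_trS hμ.le hb hev (hI hsI σ hσ) φ)] at e1
    have e2 : ∫ σ in Ioo 0 s, ∫ z, adjS lam φ z * m₀ σ z =
        ∫ σ in Ioo 0 s, ∫ z, adjS lam φ z * m σ z :=
      setIntegral_congr_fun measurableSet_Ioo fun σ hσ => by
        simp only [hm₀e σ (hI hsI σ hσ)]
    rw [hsplit, hs φ hφ, hm₀e s hsI, e1, integral_add i2 i1]
    simp_rw [hsplit]
    rw [integral_sub i2 i3, e2]
    ring
  filter_upwards [hvweak, ae_restrict_mem measurableSet_Icc] with s hs hsI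
  have h0 : v s =ᵐ[volume] fun _ => 0 := by
    refine ae_eq_of_test (hvb.tame s).locallyIntegrable tame_zero.locallyIntegrable
      fun φ _ => ?_
    rw [hs φ, integral_pairing_eq_zero hl hvb hvweak (adjS lam φ) hsI.2]
    simp
  filter_upwards [h0] with z hz
  have : w s z - m₀ s z = 0 := hz
  rw [hm₀e s hsI] at this
  exact sub_eq_zero.1 this

lemma mild_congr {lam : ℝ} {H H' : ℕ → ℝ → Phase d → ℂ} (h : ∀ᵐ s, ∀ l, H l s = H' l s) :
    mild lam H = mild lam H' := by
  funext t z
  unfold mild duh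
  congr 1; funext l
  refine integral_congr_ae (ae_restrict_of_ae ?_)
  filter_upwards [h] with s hs
  rw [hs l]

/-- The only bounded solution with vanishing forcing is zero. -/
lemma Par.ae_eq_zero (h : Par d p γ β δ κ τ) {K M : ℝ≥0} {lam B : ℝ}
    (hl : 0 ≤ lam) {b : Fin d → ℝ → Phase d → ℂ} (hb : Drift D p γ β τ K b)
    {w : ℝ → Phase d → ℂ} (hw : BddMeas w B) (hwt : ∀ s ∈ Icc 0 τ, bn D p γ (κ + δ) (w s) ≤ M)
    (hweak : ∀ᵐ s ∂(volume.restrict (Icc 0 τ)), ∀ φ : Test d, HasCompactSupport φ →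
      ∫ z, φ z * w s z = ∫ σ in Ioo 0 s, ((∫ z, adjS lam φ z * w σ z) +
        ∫ z, φ z * tr D b w σ z)) :
    ∀ᵐ s ∂(volume.restrict (Icc 0 τ)), w s =ᵐ[volume] fun _ => 0 := by
  obtain ⟨μ, hμ, hc⟩ := h.exists_contraction D K
  have hμ0 : 0 < μ := zero_lt_one.trans_le hμ
  have hev : Evol D p γ (κ + δ) τ μ M w := ⟨hw.meas, fun s _ => hw.tame s, fun s hs =>
    (hwt s hs).trans (le_mul_of_one_le_left zero_le (ENNReal.one_le_ofReal.2
      (Real.one_le_exp (mul_nonneg hμ0.le hs.1))))⟩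
  obtain ⟨⟨M', hsrc⟩, hev1⟩ := (hc hl (M := M) hb).2 hev
  have hae := h.ae_eq_mild hμ0 hl hb hw hev hsrc hweak
  set m := mild lam (trS D b w) with hm
  have hfix : m = mild lam (trS D b m) := by
    refine mild_congr ?_
    have h1 := (ae_restrict_iff' measurableSet_Icc).1 hae
    filter_upwards [h1] with s hs l
    by_cases hsI : s ∈ Icc 0 τ
    · unfold trS
      congr 1; funext z
      unfold tr
      refine Finset.sum_congr rfl fun i _ => ?_
      rw [gradF_congr_ae D i (hs hsI)]
    · rw [trS, trS, hb.tr_eq_zero w hsI, hb.tr_eq_zero m hsI]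
  have hev2 : ∀ n : ℕ, Evol D p γ (κ + δ) τ μ (M / 2 ^ n) m := fun n => by
    induction n with
    | zero => exact hev1.mono (by rw [pow_zero, div_one]; exact half_le_self zero_le)
    | succ n ih =>
      have h2 := ((hc hl (M := M / 2 ^ n) hb).2 ih).2
      rw [← hfix] at h2
      exact h2.mono (le_of_eq (by rw [div_div, pow_succ]))
  obtain ⟨C, hC⟩ := exists_ae_enorm_le D (p := p) (γ := γ) (s := κ + δ) h.adm h.hγ
    (by have := h.grad; linarith)
  filter_upwards [hae, ae_restrict_mem measurableSet_Icc] with s hs hsI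
  have hz : bn D p γ (κ + δ) (m s) = 0 := by
    have h3 : Tendsto (fun n : ℕ => ENNReal.ofReal (Real.exp (μ * s)) *
        ((M / 2 ^ n : ℝ≥0) : ℝ≥0∞)) atTop (nhds (ENNReal.ofReal (Real.exp (μ * s)) * 0)) := by
      refine ENNReal.Tendsto.const_mul ?_ (Or.inr ofReal_ne_top)
      rw [← ENNReal.coe_zero, ENNReal.tendsto_coe]
      have h4 := (NNReal.tendsto_pow_atTop_nhds_zero_of_lt_one
        (r := 1 / 2) (by rw [← NNReal.coe_lt_coe]; norm_num)).const_mul M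
      rw [mul_zero] at h4
      refine h4.congr fun n => ?_
      rw [one_div, inv_pow, div_eq_mul_inv]
    rw [mul_zero] at h3
    exact le_antisymm (ge_of_tendsto' h3 fun n => (hev2 n).bound s hsI) zero_le
  filter_upwards [hs, hC ((hev2 0).tame s hsI) ((hev2 0).lt_top hsI)] with z h5 h6
  rw [hz, mul_zero] at h6
  rw [h5]
  simpa using h6

end

/-! ### Well-posedness -/

section
variable {D : LP d} {γ β δ κ τ : ℝ}

/-- Two weak solutions in the class `L^∞_T(B^{2+δ})` agree at every time. -/
lemma Par.unique (h : Par d p γ β δ κ τ) {K M : ℝ≥0} {lam : ℝ} (hl : 0 ≤ lam)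
    {bI : Fin d → ℝ → Phase d → ℂ} (hb : Drift D p γ β τ K bI) {b : ℝ → Phase d → Vec d}
    (hbe : ∀ᵐ s ∂(volume.restrict (Icc 0 τ)), ∀ i z, bI i s z = (b s z i : ℂ))
    {f : ℝ → Temp d ℂ} {u₁ u₂ : ℝ → Phase d → ℝ}
    (h₁ : IsWeakSolution τ lam b f u₁) (h₂ : IsWeakSolution τ lam b f u₂)
    (hr₁ : supT τ (fun t => ofFun (besovMixed D.χ D.χx p γ (2 + δ)) (cplx (u₁ t))) ≤ M)
    (hr₂ : supT τ (fun t => ofFun (besovMixed D.χ D.χx p γ (2 + δ)) (cplx (u₂ t))) ≤ M) :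
    ∀ t ∈ Icc 0 τ, u₁ t =ᵐ[volume] u₂ t := by
  classical
  obtain ⟨G, hG, heq⟩ := h₁.exists_sub h₂
  have hal := al_nonneg (d := d) (p := p)
  have h2δ := h.two_add_pos
  obtain ⟨C, hC⟩ := exists_bn_le_ofFun D (s := 2 + δ) h.adm h.hγ (by linarith)
  obtain ⟨CB, hCB⟩ := exists_ae_enorm_le D (p := p) (γ := γ) (s := 2 + δ) h.adm h.hγ h2δ
  obtain ⟨Cg, hCg⟩ := exists_enorm_gradF_le D (p := p) (γ := γ) (s := κ + δ) h.adm h.hγ h.grad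
  set W : ℝ → Phase d → ℂ := fun s z => ((u₁ s z - u₂ s z : ℝ) : ℂ) with hW
  have hWm : Measurable fun q : ℝ × Phase d => W q.1 q.2 :=
    Complex.measurable_ofReal.comp (h₁.1.sub h₂.1)
  obtain ⟨S, hSm, hSI, hSP, hSae⟩ := exists_good_times
    (hG.and (hbe.and ((ae_le_of_supT_le hr₁).and (ae_le_of_supT_le hr₂))))
  set N : ℝ≥0 := C * M + C * M with hN
  have hu : ∀ {u : ℝ → Phase d → ℝ} (_ : Measurable fun q : ℝ × Phase d => u q.1 q.2) {s : ℝ}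
      (_ : ofFun (besovMixed D.χ D.χx p γ (2 + δ)) (cplx (u s)) ≤ M),
      Tame (cplx (u s)) ∧ bn D p γ (2 + δ) (cplx (u s)) ≤ (C * M : ℝ≥0) := fun {u} hu {s} hs => by
    have h1 := hC (L := ContinuousLinearMap.id ℂ ℂ) (fun x => le_rfl) (g := cplx (u s))
      (Complex.measurable_ofReal.comp (hu.comp measurable_prodMk_left))
      (hs.trans_lt coe_lt_top)
    refine ⟨h1.1, h1.2.trans ?_⟩
    rw [ENNReal.coe_mul]
    exact mul_le_mul_right hs _
  have hWS : ∀ s ∈ S, Tame (W s) ∧ bn D p γ (2 + δ) (W s) ≤ N := fun s hs => by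
    have a₁ := hu h₁.1 (hSP s hs).2.2.1
    have a₂ := hu h₂.1 (hSP s hs).2.2.2
    have a₃ : Tame fun z => -cplx (u₂ s) z := by
      have := a₂.1.mul_bounded (h := fun _ => (-1 : ℂ)) measurable_const (C := 1)
        fun z => by simp
      simpa using this
    have e : W s = fun z => cplx (u₁ s) z + -cplx (u₂ s) z := by
      funext z
      simp only [hW, cplx]
      push_cast
      ring
    rw [e]
    refine ⟨a₁.1.add a₃, (bn_add_le D h.adm a₁.1 a₃).trans ?_⟩
    rw [bn_neg, hN, ENNReal.coe_add]
    exact add_le_add a₁.2 a₂.2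
  -- `w` agrees with the difference at almost every time, and it is bounded everywhere
  set w : ℝ → Phase d → ℂ := fun s z => if s ∈ S ∧ ‖W s z‖ ≤ (CB * N : ℝ≥0) then W s z else 0
    with hw
  have hwb : BddMeas w (CB * N : ℝ≥0) := by
    refine ⟨Measurable.ite ((measurable_fst hSm).inter
      (measurableSet_le hWm.norm measurable_const)) hWm measurable_const, fun s z => ?_⟩
    simp only [hw]
    split_ifs with hs
    · exact hs.2
    · simp only [norm_zero]; exact NNReal.coe_nonneg _
  have hwW : ∀ s ∈ S, w s =ᵐ[volume] W s := fun s hs => by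
    filter_upwards [hCB (hWS s hs).1 ((hWS s hs).2.trans_lt coe_lt_top)] with z hz
    have h3 : ‖W s z‖ₑ ≤ (CB * N : ℝ≥0) := by
      rw [ENNReal.coe_mul]
      exact hz.trans (mul_le_mul_right (hWS s hs).2 _)
    rw [enorm_le_coe] at h3
    exact if_pos ⟨hs, h3⟩
  have hbW : ∀ s ∈ S, bn D p γ (κ + δ) (W s) ≤ N := fun s hs =>
    (bn_mono_exponent D (by have := h.hκ; linarith) _).trans (hWS s hs).2
  have hwt : ∀ s ∈ Icc 0 τ, bn D p γ (κ + δ) (w s) ≤ N := fun s _ => by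
    by_cases hs : s ∈ S
    · rw [bn_congr_ae D (hwW s hs)]; exact hbW s hs
    · have e : w s = fun _ => 0 := by
        funext z; exact if_neg fun h => hs h.1
      rw [e, bn_zero D h.adm]; exact zero_le
  -- the weak gradient of the difference is the sum of the gradients of its blocks
  have htr : ∀ s ∈ S, ∀ᵐ z, ((inner ℝ (b s z) (G s z) : ℝ) : ℂ) = tr D bI w s z := fun s hs => by
    obtain ⟨⟨-, hGl, hGw⟩, hbs, -⟩ := hSP s hs
    have hWt := (hWS s hs).1
    have hfin : bn D p γ (κ + δ) (W s) < ⊤ := (hbW s hs).trans_lt coe_lt_top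
    have hi : ∀ i, (fun z => ((G s z i : ℝ) : ℂ)) =ᵐ[volume] gradF D i (W s) := fun i => by
      have hl := locallyIntegrable_component hGl i
      refine ae_eq_of_test (hl.mono (Complex.continuous_ofReal.comp_aestronglyMeasurable
        hl.aestronglyMeasurable) (.of_forall fun z => by simp)) ?_ fun φ hφ => ?_
      · exact (tame_of_enorm_le (Measurable.tsum fun _ => measurable_T' _ hWt.meas)
          (mul_ne_top coe_ne_top hfin.ne)
          fun z => (hCg i hWt z).2).locallyIntegrable
      · have e1 := integral_lineDeriv_mul_eq_neg D h.adm i h.hγ h.grad hWt hfin φ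
        have e2 := hGw φ hφ i
        have e3 : ∀ z, lineDerivOp (eV i) φ z * W s z =
            ((u₁ s z - u₂ s z : ℝ) : ℂ) * lineDerivOp (eV i) φ z :=
          fun z => mul_comm _ _
        simp_rw [e3] at e1
        rw [e2, neg_inj] at e1
        rw [← e1]
        congr 1; funext z
        rw [mul_comm]
    filter_upwards [ae_all_iff.2 hi] with z hz
    rw [tr, PiLp.inner_apply, Complex.ofReal_sum]
    refine Finset.sum_congr rfl fun i _ => ?_
    rw [gradF_congr_ae D i (hwW s hs), hbs, ← hz]
    simp [mul_comm]
  have hweakW : ∀ t ∈ Icc 0 τ, ∀ φ : Test d, HasCompactSupport φ → ∫ z, φ z * W t z =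
      ∫ σ in Ioo 0 t, ((∫ z, adjS lam φ z * w σ z) + ∫ z, φ z * tr D bI w σ z) := by
    intro t ht φ hφ
    have e := (heq φ hφ t ht).2
    have e3 : ∀ z, φ z * W t z = ((u₁ t z - u₂ t z : ℝ) : ℂ) * φ z := fun z => mul_comm _ _
    simp_rw [e3]
    rw [e]
    refine integral_congr_ae (ae_Ioo_of_ae_Icc ht.2 ?_)
    filter_upwards [hSae] with s hs
    congr 1
    · refine integral_congr_ae ?_
      filter_upwards [hwW s hs] with z hz
      rw [hz, adjS_apply, mul_comm]
    · refine integral_congr_ae ?_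
      filter_upwards [htr s hs] with z hz
      rw [hz, mul_comm]
  have hzero := h.ae_eq_zero hl hb hwb hwt (by
    filter_upwards [hSae] with s hs φ hφ
    rw [← hweakW s (hSI hs) φ hφ]
    refine integral_congr_ae ?_
    filter_upwards [hwW s hs] with z hz
    rw [hz])
  intro t ht
  have hW0 : W t =ᵐ[volume] fun _ => 0 := by
    refine ae_eq_of_test (locallyIntegrable_of_test D fun φ hφ => (heq φ hφ t ht).1)
      tame_zero.locallyIntegrable fun φ hφ => ?_
    rw [hweakW t ht φ hφ]
    simp only [mul_zero, integral_zero]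
    refine integral_eq_zero_of_ae (ae_Ioo_of_ae_Icc ht.2 ?_)
    filter_upwards [hzero] with s hs
    have e1 : ∫ z, adjS lam φ z * w s z = 0 := by
      refine integral_eq_zero_of_ae ?_
      filter_upwards [hs] with z hz
      rw [hz, mul_zero]; rfl
    have e2 : ∀ z, tr D bI w s z = 0 := fun z => by
      refine Finset.sum_eq_zero fun i _ => ?_
      rw [gradF_congr_ae D i hs, gradF_zero, mul_zero]
    simp [e1, e2]
  filter_upwards [hW0] with z hz
  exact sub_eq_zero.1 (Complex.ofReal_eq_zero.1 hz)

lemma Drift.triv {K : ℝ≥0} {bI : Fin d → ℝ → Phase d → ℂ} (hp : Adm p) (hγ : 0 < γ)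
    (hb : Drift D p γ β τ K bI) :
    Drift D.triv p 1 β τ ((geo (γ / 3)).toNNReal * K) bI :=
  ⟨hb.meas, hb.tame, hb.supp, fun i s => by
    have h1 : geo (γ / 3) < ⊤ := tsum_pw_neg_lt_top (by positivity)
    rw [ENNReal.coe_mul, coe_toNNReal h1.ne]
    exact (bn_triv_le D hp (hb.tame i s)).trans (mul_le_mul_right (hb.bound i s) _)⟩

lemma ofFun_congr_ae {g h : Phase d → F} (e : g =ᵐ[volume] h) (N : Temp d F → ℝ≥0∞) :
    ofFun N g = ofFun N h := by
  have key : ∀ {g h : Phase d → F}, g =ᵐ[volume] h → ∀ Φ, Represents g Φ → Represents h Φ :=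
    fun {g h} e Φ H φ => by
      have e1 : (fun z => φ z • g z) =ᵐ[volume] fun z => φ z • h z := by
        filter_upwards [e] with z hz
        rw [hz]
      exact ⟨(H φ).1.congr e1, (H φ).2.trans (integral_congr_ae e1)⟩
  unfold ofFun
  refine iInf_congr fun Φ => ?_
  exact iInf_congr_Prop ⟨key e Φ, key e.symm Φ⟩ fun _ => rfl

/-- Existence, with the smoothing estimate. The weight `μ` and the constant `A` depend on the drift
only through the bound `K`, and they do not depend on `lam`. -/
lemma Par.exists_solution (h : Par d p γ β δ κ τ) (D : LP d) (K : ℝ≥0) :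
    ∃ (μ : ℝ) (A K' : ℝ≥0), 0 ≤ μ ∧ ∀ (b : ℝ → Phase d → Vec d) (f : ℝ → Temp d ℂ) (M : ℝ≥0),
      Measurable (fun q : ℝ × Phase d => b q.1 q.2) → IsForcing τ f →
      supT τ (fun t => ofFun (besovMixed D.χ D.χx p γ β) (cplxVec (b t))) ≤ K →
      supT τ (fun t => besovMixed D.χ D.χx p γ δ (f t)) ≤ M →
      ∃ bI, Drift D p γ β τ K' bI ∧
        (∀ᵐ s ∂(volume.restrict (Icc 0 τ)), ∀ i z, bI i s z = (b s z i : ℂ)) ∧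
        ∀ lam : ℝ, 0 ≤ lam → ∃ u : ℝ → Phase d → ℝ, IsWeakSolution τ lam b f u ∧
          ∀ t ∈ Icc 0 τ, Tame (cplx (u t)) ∧ ∀ θ ∈ Icc (0 : ℝ) 2,
            bn D p γ (θ + δ) (cplx (u t)) ≤
              A * ENNReal.ofReal ((lam + μ) ^ ((θ - 2) / 2)) * M := by
  obtain ⟨Cb, hCb⟩ := exists_drift D (p := p) h.adm h.hγ h.hβ
  obtain ⟨Cf, hCf⟩ := exists_source D (p := p) (γ := γ) h.adm (δ := δ)
  obtain ⟨μ, hμ, hgeom⟩ := h.exists_geom D (Cb * K)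
  obtain ⟨C, hC⟩ := h.exists_bn_sol_le D
  obtain ⟨C', hC'⟩ := h.exists_sol_le D μ
  refine ⟨μ, C * (Real.exp (μ * τ)).toNNReal * Cf, Cb * K, zero_le_one.trans hμ,
    fun b f M hb hf hK hM => ?_⟩
  obtain ⟨bI, hD, hbr, hbe⟩ := hCb hb hK
  obtain ⟨H, hH, hHr, hHe⟩ := hCf hf hM
  refine ⟨bI, hD, hbe, fun lam hl => ?_⟩
  have g := hgeom hl hD hH
  have e : ∀ t, cplx (fun z => (sol D bI lam H t z).re) = sol D bI lam H t := fun t => by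
    funext z
    exact Complex.ext rfl (by simp [cplx, im_sol D hbr lam hHr])
  refine ⟨fun t z => (sol D bI lam H t z).re, h.isWeakSolution_sol hD g hbr hHr hb hbe hf hHe,
    fun t ht => ?_⟩
  rw [e]
  refine ⟨(hC' g t ht).2.1, fun θ hθ => (hC g hθ t ht).trans (le_of_eq ?_)⟩
  rw [show ENNReal.ofReal (Real.exp (μ * τ)) = ((Real.exp (μ * τ)).toNNReal : ℝ≥0∞) from rfl]
  push_cast
  ring

/-- The conditions on `κ` other than `κ < 2` say that `κ` exceeds `1 + a · d / p - δ` and is at least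
`1 + a · d / p`; since both numbers are less than `2`, a midpoint is admissible. -/
lemma exists_par (hp : Adm p) (hγ : 0 < γ) (hβ : 0 < β) (hδβ : δ ≤ β) (hτ : 0 ≤ τ)
    (ha : al d p < 1) (hδ : -1 + al d p < δ) : ∃ κ, Par d p γ β δ κ τ := by
  have h1 := le_max_left (1 + al d p) (1 + al d p - δ)
  have h2 := le_max_right (1 + al d p) (1 + al d p - δ)
  have h3 : max (1 + al d p) (1 + al d p - δ) < 2 := max_lt (by linarith) (by linarith)
  exact ⟨(2 + max (1 + al d p) (1 + al d p - δ)) / 2, hp, hγ, hβ, hδβ, hτ, by linarith,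
    by linarith, by linarith⟩

lemma besovMixed_triv_eq (D : LP d) (hp : Adm p) (γ s : ℝ) :
    (besovMixed D.triv.χ D.triv.χx p γ s : Temp d F → ℝ≥0∞) = besov D.χ p s :=
  funext fun Φ => besovMixed_triv D hp γ s Φ

/-- Existence, uniqueness and the smoothing estimate in the mixed Besov spaces of the given
Littlewood-Paley data. -/
lemma Par.wellPosed (h : Par d p γ β δ κ τ) (D : LP d) :
    (∀ (b : ℝ → Phase d → Vec d) (f : ℝ → Temp d ℂ),
        Measurable (fun q : ℝ × Phase d => b q.1 q.2) → IsForcing τ f →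
        supT τ (fun t => ofFun (besovMixed D.χ D.χx p γ β) (cplxVec (b t))) < ⊤ →
        supT τ (fun t => besovMixed D.χ D.χx p γ δ (f t)) < ⊤ →
        ∀ lam : ℝ, 0 ≤ lam → UniquelySolvable D.χ p δ τ lam b f) ∧
      ∀ θ ∈ Icc (0 : ℝ) 2, ∀ K : ℝ≥0, ∃ C : ℝ, 0 < C ∧
        ∀ (b : ℝ → Phase d → Vec d) (f : ℝ → Temp d ℂ),
        Measurable (fun q : ℝ × Phase d => b q.1 q.2) → IsForcing τ f →
        supT τ (fun t => ofFun (besovMixed D.χ D.χx p γ β) (cplxVec (b t))) ≤ K →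
        supT τ (fun t => besovMixed D.χ D.χx p γ δ (f t)) < ⊤ →
        ∀ lam : ℝ, 1 ≤ lam → ∀ u, IsRegularSolution D.χ p δ τ lam b f u →
          ⨆ t ∈ Icc 0 τ, ofFun (besovMixed D.χ D.χx p γ (θ + δ)) (cplx (u t)) ≤
            ENNReal.ofReal (C * lam ^ ((θ - 2) / 2)) *
              supT τ (fun t => besovMixed D.χ D.χx p γ δ (f t)) := by
  have h' : Par d p 1 β δ κ τ :=
    ⟨h.adm, one_pos, h.hβ, h.hδβ, h.hτ, h.hκ, h.grad, h.prod⟩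
  have hgeo : geo (γ / 3) < ⊤ := tsum_pw_neg_lt_top (by have := h.hγ; positivity)
  -- uniqueness takes place in the anisotropic spaces
  have huniq : ∀ {K : ℝ≥0} {bI : Fin d → ℝ → Phase d → ℂ} {b : ℝ → Phase d → Vec d}
      {f : ℝ → Temp d ℂ} {lam : ℝ} {u₁ u₂ : ℝ → Phase d → ℝ}, Drift D p γ β τ K bI →
      (∀ᵐ s ∂(volume.restrict (Icc 0 τ)), ∀ i z, bI i s z = (b s z i : ℂ)) → 0 ≤ lam →
      IsRegularSolution D.χ p δ τ lam b f u₁ → IsRegularSolution D.χ p δ τ lam b f u₂ →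
      ∀ t ∈ Icc 0 τ, u₁ t =ᵐ[volume] u₂ t := fun {K bI b f lam u₁ u₂} hD hbe hl h₁ h₂ => by
    refine h'.unique (D := D.triv) (M := max
      (supT τ fun t => ofFun (besov D.χ p (2 + δ)) (cplx (u₁ t))).toNNReal
      (supT τ fun t => ofFun (besov D.χ p (2 + δ)) (cplx (u₂ t))).toNNReal)
      hl (hD.triv h.adm h.hγ) hbe h₁.1 h₂.1 ?_ ?_
    · rw [besovMixed_triv_eq D h.adm, ENNReal.coe_max, coe_toNNReal h₁.2.ne]
      exact le_max_left _ _
    · rw [besovMixed_triv_eq D h.adm, ENNReal.coe_max, coe_toNNReal h₂.2.ne]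
      exact le_max_right _ _
  -- the solution of `Par.exists_solution` belongs to the regularity class
  have hreg : ∀ {b : ℝ → Phase d → Vec d} {f : ℝ → Temp d ℂ} {lam : ℝ} {u : ℝ → Phase d → ℝ}
      {B : ℝ≥0∞}, B ≠ ⊤ → IsWeakSolution τ lam b f u →
      (∀ t ∈ Icc 0 τ, Tame (cplx (u t)) ∧ bn D p γ (2 + δ) (cplx (u t)) ≤ B) →
      IsRegularSolution D.χ p δ τ lam b f u := fun {b f lam u B} hB hu hub => by
    refine ⟨hu, (essSup_le_of_ae_le (geo (γ / 3) * B) ?_).trans_lt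
      (mul_lt_top hgeo hB.lt_top)⟩
    filter_upwards [ae_restrict_mem measurableSet_Icc] with t ht
    rw [← besovMixed_triv_eq D h.adm 1]
    exact (besovMixed_le_bnorm D.triv h.adm (hub t ht).1 1 (2 + δ)).trans
      ((bn_triv_le D h.adm (hub t ht).1).trans (mul_le_mul_right (hub t ht).2 _))
  have hfinite : ∀ (A M : ℝ≥0) (x : ℝ), A * ENNReal.ofReal x * M ≠ ⊤ := fun A M x =>
    mul_ne_top (mul_ne_top coe_ne_top ofReal_ne_top)
      coe_ne_top
  have h2 : (2 : ℝ) ∈ Icc (0 : ℝ) 2 := ⟨zero_le_two, le_rfl⟩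
  refine ⟨fun b f hb hf hbK hfM lam hl => ?_, fun θ hθ K => ?_⟩
  · obtain ⟨μ, A, K', hμ, hsol⟩ := h.exists_solution D
      (supT τ (fun t => ofFun (besovMixed D.χ D.χx p γ β) (cplxVec (b t)))).toNNReal
    obtain ⟨bI, hD, hbe, hex⟩ := hsol b f
      (supT τ (fun t => besovMixed D.χ D.χx p γ δ (f t))).toNNReal hb hf
      (coe_toNNReal hbK.ne).ge (coe_toNNReal hfM.ne).ge
    obtain ⟨u, hu, hub⟩ := hex lam hl
    have hr := hreg (hfinite _ _ _) hu fun t ht => ⟨(hub t ht).1, (hub t ht).2 2 h2⟩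
    exact ⟨u, hr, fun u₁ h₁ => huniq hD hbe hl h₁ hr⟩
  · obtain ⟨μ, A, K', hμ, hsol⟩ := h.exists_solution D K
    refine ⟨A + 1, by positivity, fun b f hb hf hbK hfM lam hl u₁ h₁ => ?_⟩
    set M := (supT τ (fun t => besovMixed D.χ D.χx p γ δ (f t))).toNNReal with hM
    have hMe : (M : ℝ≥0∞) = supT τ (fun t => besovMixed D.χ D.χx p γ δ (f t)) :=
      coe_toNNReal hfM.ne
    obtain ⟨bI, hD, hbe, hex⟩ := hsol b f M hb hf hbK hMe.ge
    have hl0 : 0 ≤ lam := zero_le_one.trans hl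
    obtain ⟨u, hu, hub⟩ := hex lam hl0
    have hr := hreg (hfinite _ _ _) hu fun t ht => ⟨(hub t ht).1, (hub t ht).2 2 h2⟩
    refine iSup₂_le fun t ht => ?_
    have hae : cplx (u₁ t) =ᵐ[volume] cplx (u t) := by
      filter_upwards [huniq hD hbe hl0 h₁ hr t ht] with z hz
      simp only [cplx, hz]
    rw [ofFun_congr_ae hae, ← hMe]
    refine (besovMixed_le_bnorm D h.adm (hub t ht).1 γ (θ + δ)).trans
      (((hub t ht).2 θ hθ).trans (mul_le_mul_left ?_ _))
    rw [ENNReal.ofReal_mul (by positivity)]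
    refine mul_le_mul' ?_ (ofReal_le_ofReal ?_)
    · rw [← ENNReal.ofReal_coe_nnreal]
      exact ofReal_le_ofReal (by linarith)
    · exact Real.rpow_le_rpow_of_nonpos (by linarith) (by linarith)
        (by have := hθ.2; linarith)

end

end Kinetic

end

theorem mainTheorem4 (d : ℕ) (hd : 1 ≤ d)
    (χ : Phase d → ℝ) (hχ : IsCutoff anisoNorm χ)
    (χx : Vec d → ℝ) (hχx : IsCutoff (fun ξ : Vec d => ‖ξ‖) χx)
    (T β δ : ℝ) (hT : 0 < T) (hβ : 0 < β) (p : ℝ≥0∞ × ℝ≥0∞)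
    (hpx : 1 < p.1 ∧ p.1 < ⊤) (hpv : 1 < p.2 ∧ p.2 < ⊤)
    (hp : 3 * (d / p.1.toReal) + d / p.2.toReal < 1)
    (hδ : -1 + (3 * (d / p.1.toReal) + d / p.2.toReal) < δ) (hδβ : δ ≤ β) :
    -- part (i): well-posedness and estimate in the anisotropic spaces
    ((∀ (b : ℝ → Phase d → Vec d) (f : ℝ → Temp d ℂ),
        Measurable (fun q : ℝ × Phase d => b q.1 q.2) → IsForcing T f →
        supT T (fun t => ofFun (besov χ p β) (cplxVec (b t))) < ⊤ →
        supT T (fun t => besov χ p δ (f t)) < ⊤ →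
        ∀ lam : ℝ, 0 ≤ lam → UniquelySolvable χ p δ T lam b f) ∧
      ∀ θ ∈ Icc (0 : ℝ) 2, ∀ K : ℝ≥0, ∃ C : ℝ, 0 < C ∧
        ∀ (b : ℝ → Phase d → Vec d) (f : ℝ → Temp d ℂ),
        Measurable (fun q : ℝ × Phase d => b q.1 q.2) → IsForcing T f →
        supT T (fun t => ofFun (besov χ p β) (cplxVec (b t))) ≤ K →
        supT T (fun t => besov χ p δ (f t)) < ⊤ →
        ∀ lam : ℝ, 1 ≤ lam → ∀ u, IsRegularSolution χ p δ T lam b f u →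
          ⨆ t ∈ Icc 0 T, ofFun (besov χ p (θ + δ)) (cplx (u t)) ≤
            ENNReal.ofReal (C * lam ^ ((θ - 2) / 2)) * supT T (fun t => besov χ p δ (f t))) ∧
    -- part (ii): well-posedness and estimate in the mixed spaces
    (∀ γ : ℝ, 0 < γ →
      (∀ (b : ℝ → Phase d → Vec d) (f : ℝ → Temp d ℂ),
        Measurable (fun q : ℝ × Phase d => b q.1 q.2) → IsForcing T f →
        supT T (fun t => ofFun (besovMixed χ χx p γ β) (cplxVec (b t))) < ⊤ →
        supT T (fun t => besovMixed χ χx p γ δ (f t)) < ⊤ →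
        ∀ lam : ℝ, 0 ≤ lam → UniquelySolvable χ p δ T lam b f) ∧
      ∀ θ ∈ Icc (0 : ℝ) 2, ∀ K : ℝ≥0, ∃ C : ℝ, 0 < C ∧
        ∀ (b : ℝ → Phase d → Vec d) (f : ℝ → Temp d ℂ),
        Measurable (fun q : ℝ × Phase d => b q.1 q.2) → IsForcing T f →
        supT T (fun t => ofFun (besovMixed χ χx p γ β) (cplxVec (b t))) ≤ K →
        supT T (fun t => besovMixed χ χx p γ δ (f t)) < ⊤ →
        ∀ lam : ℝ, 1 ≤ lam → ∀ u, IsRegularSolution χ p δ T lam b f u →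
          ⨆ t ∈ Icc 0 T, ofFun (besovMixed χ χx p γ (θ + δ)) (cplx (u t)) ≤
            ENNReal.ofReal (C * lam ^ ((θ - 2) / 2)) *
              supT T (fun t => besovMixed χ χx p γ δ (f t))) := by
  have hAdm : Adm p := ⟨hpx.1, hpx.2, hpv.1, hpv.2⟩
  let D : LP d := ⟨χ, hχ, χx, hχx.smooth, hχx.even, hχx.eq_one, Or.inl hχx.eq_zero⟩
  refine ⟨?_, fun γ hγ => ?_⟩
  · obtain ⟨κ, h⟩ := exists_par (d := d) hAdm one_pos hβ hδβ hT.le hp hδ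
    have key := h.wellPosed D.triv
    simp only [besovMixed_triv_eq D hAdm] at key
    exact key
  · obtain ⟨κ, h⟩ := exists_par (d := d) hAdm hγ hβ hδβ hT.le hp hδ
    exact h.wellPosed D
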